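/- Let $z(w)=\frac{w^2-1/3}{w(w^2-1)}$, let $\omega=e^{2\pi i/24}$, and let $z_1=3^{-1/4}\omega^{7}$, $z_2=3^{-1/4}\omega^{17}$, $z_3=3^{-1/4}\omega^{19}$, $z_4=3^{-1/4}\omega^{5}$ be its finite critical values. A *sheet structure* consists of a simple analytic arc $\Gamma_P$ from $z_1$ to $z_2$ in the open left half-plane, a simple analytic arc $\Gamma_R$ from $z_3$ to $z_4$ in the open right half-plane, and three inverse mappings $\psi_P,\psi_Q,\psi_R$ of $z(w)$ (that is, $z(\psi_j(z))=z$) such that * $\psi_P$ is analytic on $\mathbb C\setminus\Gamma_P$, $\psi_R$ is analytic on $\mathbb C\setminus\Gamma_R$, and $\psi_Q$ is analytic on $\mathbb C\setminus(\Gamma_P\cup\Gamma_R\cup\{0\})$ with $\psi_Q(z)\to\infty$ as $z\to0$; * $\psi_P(z)\to-1$, $\psi_Q(z)\to0$, $\psi_R(z)\to1$ as $z\to\infty$; * $\frac{3}{2\pi i}\int_{z_1}^z(\psi_Q-\psi_P)_+(s)\,ds\in\mathbb R$ for $z\in\Gamma_P$ and $\frac{3}{2\pi i}\int_{z_3}^z(\psi_Q-\psi_R)_+(s)\,ds\in\mathbb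 R$ for $z\in\Gamma_R$, where the integration is along the cut and $+$ denotes the boundary value from the left of the cut. Analytic arcs and curves are regular (non-vanishing derivative) and simple, and contain their finite endpoints. **Proposition.** A sheet structure exists. There is a real number $y^*$ with $0.621028\le y^*<0.621029$ such that the following holds for every sheet structure. In (a) and (b) the integrals are taken along $C^1$ paths which lie, except possibly for their endpoints, in $\mathbb C\setminus(\Gamma_P\cup\Gamma_R\cup\{0\})$. Each $z\neq0$ can be reached by such a path from $z_1$ and from $z_3$, the integrals exist, and whether their values are real does not depend on the path. (a) There are an analytic arc $\Gamma_P^*$ from $z_2$ to $z_1$ that intersects the positive real axis, and unbounded analytic curves $\Gamma_{E,1}$ from $z_1$ to infinity and $\Gamma_{E,2}$ from $z_2$ to infinity, both in the open left half-plane. The four curves $\Gamma_P,\Gamma_P^*,\Gamma_{E,1},\Gamma_{E,2}$ do not contain $0$ and meet each other only at their common endpoints $z_1,z_2$. For $z\ne0$, the number $\frac{3}{2\pi i}\int_{z_1}^z(\psi_Q-\psi_P)(s)\,ds$ is real if and only if $z\in\Gamma_P\cup\Gamma_P^*\cup\Gamma_{E,1}\cup\Gamma_{E,2}$. (b) There are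 an analytic arc $\Gamma_R^*$ from $z_4$ to $z_3$ that intersects the negative real axis, and unbounded analytic curves $\Gamma_{E,3}$ from $z_3$ to infinity and $\Gamma_{E,4}$ from $z_4$ to infinity, both in the open right half-plane. The four curves $\Gamma_R,\Gamma_R^*,\Gamma_{E,3},\Gamma_{E,4}$ do not contain $0$ and meet each other only at their common endpoints $z_3,z_4$. For $z\ne0$, the number $\frac{3}{2\pi i}\int_{z_3}^z(\psi_Q-\psi_R)(s)\,ds$ is real if and only if $z\in\Gamma_R\cup\Gamma_R^*\cup\Gamma_{E,3}\cup\Gamma_{E,4}$. (c) $\Gamma_P^*\cap\Gamma_R=\emptyset$. (d) $\Gamma_R^*\cap\Gamma_P=\emptyset$. (e) $\Gamma_P^*\cap\Gamma_R^*=\{iy^*,-iy^*\}$. -/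

import Mathlib

open Set Filter Topology MeasureTheory

noncomputable section

namespace HermitePade

/-- The rational function `z(w) = (w² - 1/3) / (w (w² - 1))`, for `w ≠ 0, 1, -1`. -/
def zMap (w : ℂ) : ℂ := (w ^ 2 - 1 / 3) / (w * (w ^ 2 - 1))

/-- `w` is a preimage of the finite point `z` under the rational function `zMap`. -/
def IsPreimage (w z : ℂ) : Prop := w ≠ 0 ∧ w ≠ 1 ∧ w ≠ -1 ∧ zMap w = z

/-- The primitive 24th root of unity `e^{2πi/24}`. -/
def omega24 : ℂ := Complex.exp (2 * Real.pi * Complex.I / 24)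

/-- The branch points `z₁, z₂, z₃, z₄`, the critical values of `zMap`. -/
def z₁ : ℂ := (((3 : ℝ) ^ (-(1 / 4) : ℝ) : ℝ) : ℂ) * omega24 ^ 7

/-- A branch point, see `z₁`. -/
def z₂ : ℂ := (((3 : ℝ) ^ (-(1 / 4) : ℝ) : ℝ) : ℂ) * omega24 ^ 17

/-- A branch point, see `z₁`. -/
def z₃ : ℂ := (((3 : ℝ) ^ (-(1 / 4) : ℝ) : ℝ) : ℂ) * omega24 ^ 19

/-- A branch point, see `z₁`. -/
def z₄ : ℂ := (((3 : ℝ) ^ (-(1 / 4) : ℝ) : ℝ) : ℂ) * omega24 ^ 5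

/-- `γ`, restricted to `[0, 1]`, is a simple regular real-analytic arc from `a` to `b`. -/
structure IsAnalyticArc (γ : ℝ → ℂ) (a b : ℂ) : Prop where
  analytic : AnalyticOnNhd ℝ γ (Icc 0 1)
  regular : ∀ t ∈ Icc (0 : ℝ) 1, deriv γ t ≠ 0
  injOn : InjOn γ (Icc 0 1)
  source : γ 0 = a
  target : γ 1 = b

/-- The set of points of an arc. -/
def arcSet (γ : ℝ → ℂ) : Set ℂ := γ '' Icc 0 1

/-- `γ`, restricted to `[0, ∞)`, is a simple regular real-analytic curve from `a` to infinity. -/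
structure IsAnalyticRay (γ : ℝ → ℂ) (a : ℂ) : Prop where
  analytic : AnalyticOnNhd ℝ γ (Ici 0)
  regular : ∀ t ∈ Ici (0 : ℝ), deriv γ t ≠ 0
  injOn : InjOn γ (Ici 0)
  source : γ 0 = a
  target : Tendsto γ atTop (Bornology.cobounded ℂ)

/-- The set of points of an unbounded curve. -/
def raySet (γ : ℝ → ℂ) : Set ℂ := γ '' Ici 0

/-- A complex number is real. -/
def IsReal (c : ℂ) : Prop := c.im = 0

/-- `(3 / 2πi) ∫ g₊(s) ds`, taken along the initial parts of the arc `γ`, is real. Here `g₊` is the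
boundary value of `g` from the `+`side, which is the side on the left (the direction `i γ'(t)`)
while traversing the arc. -/
def RealPlusIntegrals (γ : ℝ → ℂ) (g : ℂ → ℂ) : Prop :=
  ∃ gp : ℝ → ℂ,
    (∀ t ∈ Ioo (0 : ℝ) 1, Tendsto (fun ε : ℝ => g (γ t + ε * (Complex.I * deriv γ t)))
      (𝓝[>] 0) (𝓝 (gp t))) ∧
    IntervalIntegrable (fun t => gp t * deriv γ t) volume 0 1 ∧
    ∀ t ∈ Icc (0 : ℝ) 1,
      IsReal (3 / (2 * Real.pi * Complex.I) * ∫ s in (0 : ℝ)..t, gp s * deriv γ s)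

/-- The sheet structure of the Riemann surface of `zMap`: an analytic arc `Γ_P` from `z₁` to `z₂` in
the left half-plane, an analytic arc `Γ_R` from `z₃` to `z₄` in the right half-plane, and three
inverse mappings `ψ_P`, `ψ_Q`, `ψ_R` of `zMap`, analytic off the cuts (`ψ_Q` as a map to the sphere,
with `ψ_Q(0) = ∞`), with the values `-1`, `0`, `1` at infinity, and with real integrals along the
cuts. The values of the `ψ`'s on their cuts, and of `ψ_Q` at `0`, are irrelevant. -/
structure IsSheetStructure (γP γR : ℝ → ℂ) (ψP ψQ ψR : ℂ → ℂ) : Prop where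
  arcP : IsAnalyticArc γP z₁ z₂
  arcP_left : ∀ z ∈ arcSet γP, z.re < 0
  arcR : IsAnalyticArc γR z₃ z₄
  arcR_right : ∀ z ∈ arcSet γR, 0 < z.re
  invP : ∀ z, z ∉ arcSet γP → IsPreimage (ψP z) z
  invQ : ∀ z, z ∉ arcSet γP ∪ arcSet γR ∪ {0} → IsPreimage (ψQ z) z
  invR : ∀ z, z ∉ arcSet γR → IsPreimage (ψR z) z
  analyticP : DifferentiableOn ℂ ψP (arcSet γP)ᶜ
  analyticQ : DifferentiableOn ℂ ψQ (arcSet γP ∪ arcSet γR ∪ {0})ᶜ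
  poleQ : Tendsto ψQ (𝓝[≠] 0) (Bornology.cobounded ℂ)
  analyticR : DifferentiableOn ℂ ψR (arcSet γR)ᶜ
  inftyP : Tendsto ψP (Bornology.cobounded ℂ) (𝓝 (-1))
  inftyQ : Tendsto ψQ (Bornology.cobounded ℂ) (𝓝 0)
  inftyR : Tendsto ψR (Bornology.cobounded ℂ) (𝓝 1)
  realP : RealPlusIntegrals γP (fun z => ψQ z - ψP z)
  realR : RealPlusIntegrals γR (fun z => ψQ z - ψR z)

/-- `γ`, restricted to `[0, 1]`, is a `C¹` path from `a` to `z`, lying in `Ω` except possibly for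
its two endpoints. -/
structure IsPathIn (Ω : Set ℂ) (a z : ℂ) (γ : ℝ → ℂ) : Prop where
  contDiffOn : ContDiffOn ℝ 1 γ (Icc 0 1)
  source : γ 0 = a
  target : γ 1 = z
  mem : ∀ t ∈ Ioo (0 : ℝ) 1, γ t ∈ Ω

/-- The set of points `z ≠ 0` where `(3 / 2πi) ∫_a^z g(s) ds` is real is exactly the set `C`.
The paths of integration are the paths in `Ω`; the endpoint `z` may also lie on the boundary of `Ω`
(on a cut). Every `z ≠ 0` can be reached, the integrals exist, and whether their value is real
does not depend on the path. -/
def RealIntegralExactlyOn (Ω : Set ℂ) (g : ℂ → ℂ) (a : ℂ) (C : Set ℂ) : Prop :=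
  0 ∉ C ∧ ∀ z : ℂ, z ≠ 0 →
    (∃ γ, IsPathIn Ω a z γ) ∧
    ∀ γ, IsPathIn Ω a z γ →
      IntervalIntegrable (fun t => g (γ t) * deriv γ t) volume 0 1 ∧
      (IsReal (3 / (2 * Real.pi * Complex.I) * ∫ t in (0 : ℝ)..1, g (γ t) * deriv γ t) ↔ z ∈ C)

end HermitePade

end

noncomputable section

namespace HermitePade

/-! ### Preimages as roots of a cubic -/

/-! Since `3z = 1/w + 1/(w-1) + 1/(w+1)`, a primitive of `3w dz` is `2/(w²-1) - log(w³-w)`, and its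
real part `hw` is single valued. The factor `3/(2πi)` is purely imaginary, so the integral of `ψ_Q -
ψ_P` from `z₁` gives a real value exactly where `pot = hw ψ_Q - hw ψ_P` vanishes. The theorem
therefore describes the zero set of `pot`, which is harmonic off the cuts and `0`.

In the left half-plane exactly one preimage, `rt z`, has positive real part (`Roots.prod_re`). With
`q = z * rt z`, the difference `δ` of the other two satisfies `δ² = dq = 1 + 1/(3q²)`. Along a
horizontal line the difference of potentials has derivative `3 Re δ`, so the question is the sign of
`Re δ`. It is governed by the curve `Re q = 0`, which every horizontal line off the real axis meets
once, and along which the coordinates are monotone in `|q|²` (`CurveEq.mono`). The roots `dp` and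
`dt` jump on complementary parts of this curve, separated by the branch points. Monotonicity then
gives one zero with `x ≤ Re z₁` at each height in the strip `|Im z| ≤ Im z₁` (`fP`), one zero at
each height outside its interior (`fE`), and one more zero to the right of the cut inside the strip
(`fS`). These graphs are `Γ_P`, `Γ_E` and `Γ_P^*`. They are analytic by local inversion. At `z₁` the
square of the complex difference of potentials has a zero of order three (`branchSq_order`), so
three analytic level curves leave `z₁` at angles of 120 degrees.

Existence of a sheet structure: cut along `fP` and exchange the two left branches across it.
Uniqueness: in any sheet structure the reality condition forces `dq γ'² ≤ 0` along `Γ_P`, so the arc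
lies in the zero set, and a topological argument leaves only the graph of `fP` (`arcSet_P`). The
branches are then identified from infinity (`eq_std`), using that an analytic arc does not
disconnect the region. Since the branches exchanged on a cut have equal `hw` there, `pot` is
continuous across the cuts, and the fundamental theorem of calculus covers all admissible paths
(`integral_re`).

Part (c) holds because `pot` is positive on `Γ_R` off its endpoints, by a comparison with the third
potential (`hw_rt_lt`). Parts (b) and (d) follow by the half-turn `z ↦ -z`. For (e), `pot` is
explicit on the imaginary axis (`imag_axis`) and vanishes there only at heights `±y*`. The numbers
`fS y` and `fS (-y)` have the same sign, whereas a common point of `Γ_P^*` and `-Γ_P^*` needs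
opposite signs, so it lies on the axis. -/

theorem isPreimage_iff {w z : ℂ} : IsPreimage w z ↔ z * (w ^ 3 - w) = w ^ 2 - 1 / 3 := by
  unfold IsPreimage zMap
  constructor
  · rintro ⟨h0, h1, h2, rfl⟩
    have h3 : w ^ 2 - 1 ≠ 0 := by
      have : w ^ 2 - 1 = (w - 1) * (w + 1) := by ring
      rw [this]
      exact mul_ne_zero (sub_ne_zero.2 h1) (by rwa [← sub_neg_eq_add, sub_ne_zero])
    field_simp
    try ring
  · intro h
    -- The excluded values are automatic: at `0, ±1` the left side vanishes and `w² - 1/3` does not.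
    have h0 : w ≠ 0 := by rintro rfl; norm_num at h
    have h1 : w ≠ 1 := by rintro rfl; norm_num at h
    have h2 : w ≠ -1 := by rintro rfl; norm_num at h
    have h3 : w ^ 2 - 1 ≠ 0 := by
      have : w ^ 2 - 1 = (w - 1) * (w + 1) := by ring
      rw [this]
      exact mul_ne_zero (sub_ne_zero.2 h1) (by rwa [← sub_neg_eq_add, sub_ne_zero])
    refine ⟨h0, h1, h2, ?_⟩
    rw [← h]
    field_simp

/-- `a, b, c` are the three preimages of `z`, with multiplicity. -/
structure Roots (z a b c : ℂ) : Prop where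
  sum : z * (a + b + c) = 1
  pair : a * b + b * c + c * a = -1
  prod : 3 * z * (a * b * c) = -1

namespace Roots

variable {z a b c w : ℂ}

theorem ne_zero (h : Roots z a b c) : z ≠ 0 := by
  rintro rfl; simpa using h.sum

theorem rot (h : Roots z a b c) : Roots z b c a :=
  ⟨by rw [← h.sum]; ring, by rw [← h.pair]; ring, by rw [← h.prod]; ring⟩

theorem swap (h : Roots z a b c) : Roots z b a c :=
  ⟨by rw [← h.sum]; ring, by rw [← h.pair]; ring, by rw [← h.prod]; ring⟩

theorem factor (h : Roots z a b c) (w : ℂ) :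
    z * (w ^ 3 - w) - (w ^ 2 - 1 / 3) = z * ((w - a) * (w - b) * (w - c)) := by
  linear_combination w ^ 2 * h.sum - z * w * h.pair + (1 / 3 : ℂ) * h.prod

theorem eqn (h : Roots z a b c) : z * (c ^ 3 - c) = c ^ 2 - 1 / 3 := by
  have := h.factor c
  rw [sub_self, mul_zero, mul_zero] at this
  exact sub_eq_zero.1 this

theorem mem (h : Roots z a b c) (hw : z * (w ^ 3 - w) = w ^ 2 - 1 / 3) :
    w = a ∨ w = b ∨ w = c := by
  have h1 := h.factor w
  rw [hw, sub_self] at h1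
  have h2 := (mul_eq_zero.1 h1.symm).resolve_left h.ne_zero
  rcases mul_eq_zero.1 h2 with h3 | h3
  · rcases mul_eq_zero.1 h3 with h4 | h4
    · exact Or.inl (sub_eq_zero.1 h4)
    · exact Or.inr (Or.inl (sub_eq_zero.1 h4))
  · exact Or.inr (Or.inr (sub_eq_zero.1 h3))

theorem neg (h : Roots z a b c) : Roots (-z) (-a) (-b) (-c) :=
  ⟨by rw [← h.sum]; ring, by rw [← h.pair]; ring, by rw [← h.prod]; ring⟩

end Roots

theorem cube_sub_ne_zero {z w : ℂ} (h : z * (w ^ 3 - w) = w ^ 2 - 1 / 3) : w ^ 3 - w ≠ 0 := by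
  obtain ⟨h0, h1, h2, -⟩ := isPreimage_iff.2 h
  have : w ^ 3 - w = w * (w - 1) * (w + 1) := by ring
  rw [this]
  exact mul_ne_zero (mul_ne_zero h0 (sub_ne_zero.2 h1)) (by rwa [← sub_neg_eq_add, sub_ne_zero])

theorem sq_sub_one_ne_zero {z w : ℂ} (h : z * (w ^ 3 - w) = w ^ 2 - 1 / 3) : w ^ 2 - 1 ≠ 0 := by
  intro h1
  apply cube_sub_ne_zero h
  linear_combination w * h1

theorem root_ne_zero {z w : ℂ} (h : z * (w ^ 3 - w) = w ^ 2 - 1 / 3) : w ≠ 0 :=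
  (isPreimage_iff.2 h).1

theorem root_eq_zMap {z w : ℂ} (h : z * (w ^ 3 - w) = w ^ 2 - 1 / 3) : z = zMap w :=
  (isPreimage_iff.2 h).2.2.2.symm

/-- The two other preimages, in terms of one preimage `r` and a square root. -/
theorem roots_of_root {z r s : ℂ} (hz : z ≠ 0) (hr : z * (r ^ 3 - r) = r ^ 2 - 1 / 3)
    (hs : s ^ 2 = 1 + 1 / (3 * (z * r) ^ 2)) :
    Roots z ((1 / z - r + s) / 2) ((1 / z - r - s) / 2) r := by
  have hr0 := root_ne_zero hr
  have h1 : s ^ 2 * (3 * (z * r) ^ 2) = 3 * (z * r) ^ 2 + 1 := by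
    rw [hs]; field_simp
  have key : (1 / z - r) ^ 2 + 4 / (3 * z * r) = s ^ 2 := by
    have h2 : ((1 / z - r) ^ 2 + 4 / (3 * z * r)) * (3 * (z * r) ^ 2)
        = 3 * (z * r) ^ 2 + 1 := by
      field_simp
      linear_combination (3 * z * r - 3) * hr
    have h3 : (3 * (z * r) ^ 2) ≠ 0 :=
      mul_ne_zero three_ne_zero (pow_ne_zero _ (mul_ne_zero hz hr0))
    exact mul_right_cancel₀ h3 (h2.trans h1.symm)
  have hp : ((1 / z - r + s) / 2) * ((1 / z - r - s) / 2) = -1 / (3 * z * r) := by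
    have : ((1 / z - r + s) / 2) * ((1 / z - r - s) / 2) = ((1 / z - r) ^ 2 - s ^ 2) / 4 := by ring
    rw [this, ← key]; field_simp; ring
  refine ⟨by field_simp; ring, ?_, ?_⟩
  · have : ((1 / z - r + s) / 2) * ((1 / z - r - s) / 2) + ((1 / z - r - s) / 2) * r
        + r * ((1 / z - r + s) / 2)
        = ((1 / z - r + s) / 2) * ((1 / z - r - s) / 2) + (1 / z - r) * r := by ring
    rw [this, hp]
    field_simp
    linear_combination (-3 : ℂ) * hr
  · rw [hp]; field_simp

theorem exists_csqrt (w : ℂ) : ∃ s : ℂ, s ^ 2 = w :=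
  ⟨w ^ (((2 : ℕ) : ℂ)⁻¹), Complex.cpow_nat_inv_pow w two_ne_zero⟩

/-- This is the discriminant of the quadratic left after splitting off `c`. The equation of `c`
turns it into a function of the product `z * c` alone, which is why `q = z * rt z` is the coordinate
used below. -/
theorem Roots.sq_sub {z a b c : ℂ} (h : Roots z a b c) :
    (a - b) ^ 2 = 1 + 1 / (3 * (z * c) ^ 2) := by
  have hz := h.ne_zero
  have hc := root_ne_zero h.eqn
  obtain ⟨s, hs⟩ := exists_csqrt (1 + 1 / (3 * (z * c) ^ 2))
  have h2 := roots_of_root hz h.eqn hs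
  have e1 : a + b = 1 / z - c := by
    have := h.sum; field_simp; linear_combination this
  have e2 : a * b = -1 / (3 * z * c) := by
    have := h.prod; field_simp; linear_combination this
  have e3 := h2.prod
  have e4 : ((1 / z - c + s) / 2) * ((1 / z - c - s) / 2) = -1 / (3 * z * c) := by
    field_simp at e3 ⊢; linear_combination e3
  rw [← hs]
  have : (a - b) ^ 2 = (a + b) ^ 2 - 4 * (a * b) := by ring
  rw [this, e1, e2, ← e4]; ring

theorem exists_roots_of_root {z r : ℂ} (hz : z ≠ 0) (hr : z * (r ^ 3 - r) = r ^ 2 - 1 / 3) :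
    ∃ a b, Roots z a b r := by
  obtain ⟨s, hs⟩ := exists_csqrt (1 + 1 / (3 * (z * r) ^ 2))
  exact ⟨_, _, roots_of_root hz hr hs⟩

theorem exists_roots {z : ℂ} (hz : z ≠ 0) : ∃ a b c, Roots z a b c := by
  open Polynomial in
  have hd : (C z * X ^ 3 + C (-1) * X ^ 2 + C (-z) * X + C (1 / 3) : ℂ[X]).degree = 3 :=
    degree_cubic hz
  obtain ⟨r, hr⟩ := IsAlgClosed.exists_root _ (by rw [hd]; norm_num :
    (Polynomial.C z * Polynomial.X ^ 3 + Polynomial.C (-1) * Polynomial.X ^ 2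
      + Polynomial.C (-z) * Polynomial.X + Polynomial.C (1 / 3) : Polynomial ℂ).degree ≠ 0)
  have hr' : z * (r ^ 3 - r) = r ^ 2 - 1 / 3 := by
    simp [Polynomial.IsRoot] at hr
    linear_combination hr
  obtain ⟨a, b, h⟩ := exists_roots_of_root hz hr'
  exact ⟨a, b, r, h⟩

/-! ### The signs of the real parts of the preimages -/

/-- By the pair relation `c = -(1 + ab)/(a + b)`, and the real part of `(1 + ab)` times the
conjugate of `a + b` is `Re (a + b) + |a|² Re b + |b|² Re a`. -/
theorem Roots.third_re_neg {z a b c : ℂ} (h : Roots z a b c) (ha : 0 < a.re) (hb : 0 < b.re) :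
    c.re < 0 := by
  have hab : a + b ≠ 0 := fun h0 => by
    have := congrArg Complex.re h0; simp at this; linarith
  have hc : c = -((1 + a * b) / (a + b)) := by
    field_simp; linear_combination h.pair
  rw [hc, Complex.neg_re, neg_neg_iff_pos, Complex.div_re, ← add_div]
  apply div_pos _ (Complex.normSq_pos.2 hab)
  simp only [Complex.add_re, Complex.add_im, Complex.mul_re, Complex.mul_im, Complex.one_re,
    Complex.one_im]
  nlinarith [mul_nonneg ha.le (sq_nonneg b.re), mul_nonneg hb.le (sq_nonneg a.re),
    mul_nonneg ha.le (sq_nonneg b.im), mul_nonneg hb.le (sq_nonneg a.im)]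

/-- Subtracting the conjugated equation of `a` from the factored cubic at `-ā`, the mirror image of
`a` in the imaginary axis, isolates `Re a` against `Re z`. -/
theorem Roots.re_identity {z a b c : ℂ} (h : Roots z a b c) :
    z * (2 * a.re : ℝ) * ((starRingEnd ℂ a + b) * (starRingEnd ℂ a + c))
      = (2 * z.re : ℝ) * starRingEnd ℂ (a ^ 3 - a) := by
  have h1 := h.factor (-starRingEnd ℂ a)
  have h2 : starRingEnd ℂ z * starRingEnd ℂ (a ^ 3 - a) = (starRingEnd ℂ a) ^ 2 - 1 / 3 := by
    have := congrArg (starRingEnd ℂ) h.rot.eqn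
    simpa [map_ofNat] using this
  have e1 : ((2 * a.re : ℝ) : ℂ) = a + starRingEnd ℂ a := (Complex.add_conj a).symm
  have e2 : ((2 * z.re : ℝ) : ℂ) = z + starRingEnd ℂ z := (Complex.add_conj z).symm
  rw [e1, e2]
  simp only [map_sub, map_pow] at h2 ⊢
  linear_combination h1 - h2

/-- Since `w³ - w = w(w-1)(w+1)`, the product over the roots is read off from the values of the
cubic at `0`, `1` and `-1`. -/
theorem Roots.prod_cube {z a b c : ℂ} (h : Roots z a b c) :
    27 * z ^ 3 * ((a ^ 3 - a) * (b ^ 3 - b) * (c ^ 3 - c)) = -4 := by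
  have f1 := h.factor 1
  have f2 := h.factor (-1)
  have e : 27 * z ^ 3 * ((a ^ 3 - a) * (b ^ 3 - b) * (c ^ 3 - c))
      = 9 * (3 * z * (a * b * c)) * (-(z * ((1 - a) * (1 - b) * (1 - c))))
        * (-(z * ((-1 - a) * (-1 - b) * (-1 - c)))) := by ring
  rw [e, ← f1, ← f2, h.prod]; norm_num

/-- Multiply `re_identity` over the three roots: each factor `ā + b` meets its conjugate and becomes
a squared norm. The sign of the product of the real parts is thus controlled by that of `Re z`. -/
theorem Roots.prod_re {z a b c : ℂ} (h : Roots z a b c) :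
    27 * ‖z‖ ^ 6 * (a.re * b.re * c.re) *
      (‖starRingEnd ℂ a + b‖ ^ 2 * ‖starRingEnd ℂ b + c‖ ^ 2 * ‖starRingEnd ℂ c + a‖ ^ 2)
      = -4 * z.re ^ 3 := by
  have ha := h.re_identity
  have hb := h.rot.re_identity
  have hc := h.rot.rot.re_identity
  have hM := h.prod_cube
  have hM' := congrArg (starRingEnd ℂ) hM
  simp only [map_mul, map_pow, map_ofNat, map_neg] at hM'
  have n1 : ∀ w : ℂ, ((‖w‖ ^ 2 : ℝ) : ℂ) = w * starRingEnd ℂ w := fun w => by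
    rw [Complex.mul_conj, Complex.normSq_eq_norm_sq]
  have n6 : ((‖z‖ ^ 6 : ℝ) : ℂ) = (z * starRingEnd ℂ z) ^ 3 := by
    rw [← n1]; push_cast; ring
  apply Complex.ofReal_injective
  push_cast at ha hb hc n6 ⊢
  have n1' : ∀ w : ℂ, ((‖w‖ : ℝ) : ℂ) ^ 2 = w * starRingEnd ℂ w := fun w => by
    rw [← n1]; push_cast; rfl
  rw [n6, n1', n1', n1']
  simp only [map_add, Complex.conj_conj]
  have hprod := congrArg₂ (· * ·) (congrArg₂ (· * ·) ha hb) hc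
  linear_combination (27 / 8 * (starRingEnd ℂ z) ^ 3) * hprod + (z.re : ℂ) ^ 3 * hM'

theorem Roots.prod_re_pos {z a b c : ℂ} (h : Roots z a b c) (hz : z.re < 0) :
    0 < a.re * b.re * c.re := by
  have h1 := h.prod_re
  have h2 : 0 < -4 * z.re ^ 3 := by nlinarith [pow_pos (neg_pos.2 hz) 3]
  rw [← h1] at h2
  by_contra h3
  push Not at h3
  have : 27 * ‖z‖ ^ 6 * (a.re * b.re * c.re) *
      (‖starRingEnd ℂ a + b‖ ^ 2 * ‖starRingEnd ℂ b + c‖ ^ 2 * ‖starRingEnd ℂ c + a‖ ^ 2) ≤ 0 := by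
    apply mul_nonpos_of_nonpos_of_nonneg _ (by positivity)
    exact mul_nonpos_of_nonneg_of_nonpos (by positivity) h3
  linarith

/-- If `z` is in the left half-plane, and one preimage in the right half-plane, then the other two
are in the left half-plane. -/
theorem Roots.re_neg_of_re_pos {z a b c : ℂ} (h : Roots z a b c) (hz : z.re < 0) (hc : 0 < c.re) :
    a.re < 0 ∧ b.re < 0 := by
  have h1 := h.prod_re_pos hz
  have h2 : 0 < a.re * b.re := by
    by_contra h3
    push Not at h3
    nlinarith [mul_nonneg (neg_nonneg.2 h3) hc.le]
  rcases pos_and_pos_or_neg_and_neg_of_mul_pos h2 with ⟨ha, hb⟩ | h3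
  · exact absurd (h.third_re_neg ha hb) (not_lt.2 hc.le)
  · exact h3

theorem exists_left_roots {z : ℂ} (hz : z.re < 0) :
    ∃ a b c, Roots z a b c ∧ a.re < 0 ∧ b.re < 0 ∧ 0 < c.re := by
  have hz0 : z ≠ 0 := by rintro rfl; simp at hz
  obtain ⟨a, b, c, h⟩ := exists_roots hz0
  have h1 := h.prod_re_pos hz
  have key : 0 < a.re ∨ 0 < b.re ∨ 0 < c.re := by
    by_contra hn
    push Not at hn
    obtain ⟨h2, h3, h4⟩ := hn
    nlinarith [mul_nonneg_of_nonpos_of_nonpos h2 h3,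
      mul_nonneg (mul_nonneg_of_nonpos_of_nonpos h2 h3) (neg_nonneg.2 h4)]
  rcases key with h2 | h2 | h2
  · exact ⟨b, c, a, h.rot, (h.rot.re_neg_of_re_pos hz h2).1, (h.rot.re_neg_of_re_pos hz h2).2, h2⟩
  · exact ⟨c, a, b, h.rot.rot, (h.rot.rot.re_neg_of_re_pos hz h2).1,
      (h.rot.rot.re_neg_of_re_pos hz h2).2, h2⟩
  · exact ⟨a, b, c, h, (h.re_neg_of_re_pos hz h2).1, (h.re_neg_of_re_pos hz h2).2, h2⟩

/-- For `z = iy` and `w = it` the equation becomes a real cubic in `t`. Its value is `-2/3` at `t =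
-1/y` and `1/3` at `t = 0`. -/
theorem exists_imag_root {y : ℝ} (hy : y ≠ 0) :
    ∃ t : ℝ, t ≠ 0 ∧ y * (t ^ 3 + t) + t ^ 2 + 1 / 3 = 0 := by
  have hc : ContinuousOn (fun t : ℝ => y * (t ^ 3 + t) + t ^ 2 + 1 / 3) (uIcc (-1 / y) 0) := by
    fun_prop
  have h1 := intermediate_value_uIcc hc
  have h2 : (0 : ℝ) ∈ uIcc ((fun t : ℝ => y * (t ^ 3 + t) + t ^ 2 + 1 / 3) (-1 / y))
      ((fun t : ℝ => y * (t ^ 3 + t) + t ^ 2 + 1 / 3) 0) := by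
    have e1 : (fun t : ℝ => y * (t ^ 3 + t) + t ^ 2 + 1 / 3) (-1 / y) = -2 / 3 := by
      simp only; field_simp; ring
    rw [e1]
    simp only
    rw [mem_uIcc]; left; constructor <;> norm_num
  obtain ⟨t, -, ht⟩ := h1 h2
  refine ⟨t, ?_, ht⟩
  rintro rfl; norm_num at ht

/-- The preimages of the points of the imaginary axis. -/
theorem imag_roots {y t : ℝ} (hy : y ≠ 0) (h : y * (t ^ 3 + t) + t ^ 2 + 1 / 3 = 0) :
    ∃ s : ℝ, 0 < s ∧ s ^ 2 = 1 + 1 / (3 * (y * t) ^ 2) ∧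
      Roots (Complex.I * y) ((-Complex.I * (1 / y + t : ℝ) + s) / 2)
        ((-Complex.I * (1 / y + t : ℝ) - s) / 2) (Complex.I * t) := by
  have ht : t ≠ 0 := by rintro rfl; norm_num at h
  refine ⟨√(1 + 1 / (3 * (y * t) ^ 2)), by positivity, Real.sq_sqrt (by positivity), ?_⟩
  set s := √(1 + 1 / (3 * (y * t) ^ 2))
  have hs : s ^ 2 = 1 + 1 / (3 * (y * t) ^ 2) := Real.sq_sqrt (by positivity)
  have hz : Complex.I * (y : ℂ) ≠ 0 := mul_ne_zero Complex.I_ne_zero (by exact_mod_cast hy)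
  have e : (1 : ℂ) / (Complex.I * y) - Complex.I * t = -Complex.I * (1 / y + t : ℝ) := by
    have hy' : (y : ℂ) ≠ 0 := by exact_mod_cast hy
    push_cast
    field_simp
    linear_combination Complex.I_sq
  have hI3 : Complex.I ^ 4 = 1 := Complex.I_pow_four
  have := roots_of_root (s := (s : ℂ)) (r := Complex.I * t) hz (by
    have hC : (y : ℂ) * (t ^ 3 + t) + t ^ 2 + 1 / 3 = 0 := by
      have := congrArg (fun x : ℝ => (x : ℂ)) h
      push_cast at this; exact this
    linear_combination hC + (y : ℂ) * t ^ 3 * hI3 - (y * t + t ^ 2 : ℂ) * Complex.I_sq) (by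
    have hsC : (s : ℂ) ^ 2 = 1 + 1 / (3 * (y * t) ^ 2) := by exact_mod_cast hs
    rw [hsC]
    have : (Complex.I * y * (Complex.I * t)) ^ 2 = (y * t : ℂ) ^ 2 := by
      linear_combination (y * t : ℂ) ^ 2 * hI3
    rw [this])
  rwa [e] at this

/-- On the closed left half-plane without `0` there is exactly one preimage with positive real
part. -/
theorem exists_closed_left_roots {z : ℂ} (hz : z.re ≤ 0) (hz0 : z ≠ 0) :
    ∃ a b c, Roots z a b c ∧ a.re < 0 ∧ b.re ≤ 0 ∧ 0 < c.re := by
  rcases hz.lt_or_eq with h | h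
  · obtain ⟨a, b, c, h1, h2, h3, h4⟩ := exists_left_roots h
    exact ⟨a, b, c, h1, h2, h3.le, h4⟩
  · have hy : z.im ≠ 0 := fun h' => hz0 (Complex.ext h h')
    have hz' : z = Complex.I * (z.im : ℝ) := by
      apply Complex.ext <;> simp [h]
    obtain ⟨t, -, ht⟩ := exists_imag_root hy
    obtain ⟨s, hs, -, hR⟩ := imag_roots hy ht
    rw [← hz'] at hR
    refine ⟨_, _, _, hR.rot, ?_, ?_, ?_⟩
    · simp; linarith
    · simp
    · simp; linarith

/-- The preimage in the right half-plane. -/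
def rt (z : ℂ) : ℂ := Classical.epsilon fun w => z * (w ^ 3 - w) = w ^ 2 - 1 / 3 ∧ 0 < w.re

theorem rt_spec {z : ℂ} (hz : z.re ≤ 0) :
    z * ((rt z) ^ 3 - rt z) = (rt z) ^ 2 - 1 / 3 ∧ 0 < (rt z).re := by
  apply Classical.epsilon_spec (p := fun w => z * (w ^ 3 - w) = w ^ 2 - 1 / 3 ∧ 0 < w.re)
  by_cases h0 : z = 0
  · refine ⟨((1 / √3 : ℝ) : ℂ), ?_, by rw [Complex.ofReal_re]; positivity⟩
    have : (1 / √3 : ℝ) ^ 2 = 1 / 3 := by rw [div_pow, Real.sq_sqrt (by norm_num)]; norm_num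
    rw [h0, zero_mul, ← Complex.ofReal_pow, this]; push_cast; ring
  · obtain ⟨a, b, c, h, -, -, hc⟩ := exists_closed_left_roots hz h0
    exact ⟨c, h.eqn, hc⟩

theorem rt_eqn {z : ℂ} (hz : z.re ≤ 0) : z * ((rt z) ^ 3 - rt z) = (rt z) ^ 2 - 1 / 3 :=
  (rt_spec hz).1

theorem rt_re_pos {z : ℂ} (hz : z.re ≤ 0) : 0 < (rt z).re := (rt_spec hz).2

theorem rt_ne_zero {z : ℂ} (hz : z.re ≤ 0) : rt z ≠ 0 := root_ne_zero (rt_eqn hz)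

theorem rt_zero : rt 0 = ((1 / √3 : ℝ) : ℂ) := by
  obtain ⟨h1, h2⟩ := rt_spec (z := 0) (by simp)
  have : (1 / √3 : ℝ) ^ 2 = 1 / 3 := by rw [div_pow, Real.sq_sqrt (by norm_num)]; norm_num
  have h3 : (rt 0) ^ 2 = ((1 / √3 : ℝ) : ℂ) ^ 2 := by
    rw [← Complex.ofReal_pow, this]; push_cast; linear_combination (-1 : ℂ) * h1
  rcases sq_eq_sq_iff_eq_or_eq_neg.1 h3 with h4 | h4
  · exact h4
  · rw [h4, Complex.neg_re, Complex.ofReal_re] at h2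
    have : 0 < 1 / √3 := by positivity
    linarith

theorem rt_unique {z w : ℂ} (hz : z.re ≤ 0) (hw : z * (w ^ 3 - w) = w ^ 2 - 1 / 3)
    (hw' : 0 < w.re) : w = rt z := by
  obtain ⟨h1, h2⟩ := rt_spec hz
  -- At `z = 0` the cubic degenerates to `w² = 1/3`, so `Roots` is not available.
  by_cases h0 : z = 0
  · subst h0
    have h3 : w ^ 2 = (rt 0) ^ 2 := by linear_combination h1 - hw
    rcases sq_eq_sq_iff_eq_or_eq_neg.1 h3 with h4 | h4
    · exact h4
    · rw [h4, Complex.neg_re] at hw'; linarith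
  · obtain ⟨a, b, c, h, ha, hb, -⟩ := exists_closed_left_roots hz h0
    have e1 : w = c := by
      rcases h.mem hw with e | e | e
      · rw [e] at hw'; linarith
      · rw [e] at hw'; linarith
      · exact e
    rcases h.mem h1 with e | e | e
    · rw [e] at h2; linarith
    · rw [e] at h2; linarith
    · rw [e1, e]

theorem rt_conj {z : ℂ} (hz : z.re ≤ 0) : rt (starRingEnd ℂ z) = starRingEnd ℂ (rt z) := by
  symm
  apply rt_unique (by simpa using hz)
  · have := congrArg (starRingEnd ℂ) (rt_eqn hz)
    have h3 : (starRingEnd ℂ) 3 = 3 := map_ofNat _ 3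
    simpa [h3] using this
  · simpa using rt_re_pos hz

/-- With `rt z` as third preimage, the first two are in the closed left half-plane. -/
theorem Roots.left {z a b : ℂ} (h : Roots z a b (rt z)) (hz : z.re < 0) : a.re < 0 ∧ b.re < 0 :=
  h.re_neg_of_re_pos hz (rt_re_pos hz.le)

/-- A preimage on the imaginary axis makes the left side of `prod_re` zero. Hence the sign of the
real part of a continuous branch cannot change inside a half-plane. -/
theorem root_re_ne_zero {z w : ℂ} (h : z * (w ^ 3 - w) = w ^ 2 - 1 / 3) (hz : z.re ≠ 0) :
    w.re ≠ 0 := by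
  have hz0 : z ≠ 0 := by rintro rfl; simp at hz
  obtain ⟨a, b, hR⟩ := exists_roots_of_root hz0 h
  intro h0
  have := hR.prod_re
  rw [h0] at this
  simp at this
  exact hz this

/-! ### The imaginary parts of the preimages -/

theorem zMap_partial {w : ℂ} (h0 : w ≠ 0) (h1 : w ≠ 1) (h2 : w ≠ -1) :
    zMap w = (1 / 3 : ℝ) * (w⁻¹ + (w - 1)⁻¹ + (w + 1)⁻¹) := by
  have h3 : w - 1 ≠ 0 := sub_ne_zero.2 h1
  have h4 : w + 1 ≠ 0 := by rwa [← sub_neg_eq_add, sub_ne_zero]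
  have h5 : w ^ 2 - 1 ≠ 0 := by
    have : w ^ 2 - 1 = (w - 1) * (w + 1) := by ring
    rw [this]; exact mul_ne_zero h3 h4
  unfold zMap
  push_cast
  field_simp
  ring

/-- All three residues in the partial fractions are positive, so every term has imaginary part
opposite in sign to `Im w`. -/
theorem root_im {z w : ℂ} (h : z * (w ^ 3 - w) = w ^ 2 - 1 / 3) :
    ∃ k : ℝ, 0 < k ∧ z.im = -(k * w.im) := by
  obtain ⟨h0, h1, h2, rfl⟩ := isPreimage_iff.2 h
  have h3 : w - 1 ≠ 0 := sub_ne_zero.2 h1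
  have h4 : w + 1 ≠ 0 := by rwa [← sub_neg_eq_add, sub_ne_zero]
  refine ⟨1 / 3 * (1 / Complex.normSq w + 1 / Complex.normSq (w - 1)
    + 1 / Complex.normSq (w + 1)), ?_, ?_⟩
  · have := Complex.normSq_pos.2 h0
    have := Complex.normSq_pos.2 h3
    have := Complex.normSq_pos.2 h4
    positivity
  · rw [zMap_partial h0 h1 h2, Complex.im_ofReal_mul]
    simp only [Complex.add_im, Complex.inv_im, Complex.sub_im, Complex.one_im]
    ring

theorem root_im_neg {z w : ℂ} (h : z * (w ^ 3 - w) = w ^ 2 - 1 / 3) (hz : 0 < z.im) :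
    w.im < 0 := by
  obtain ⟨k, hk, e⟩ := root_im h
  by_contra h1
  push Not at h1
  nlinarith [mul_nonneg hk.le h1]

theorem root_im_zero {z w : ℂ} (h : z * (w ^ 3 - w) = w ^ 2 - 1 / 3) (hz : z.im = 0) :
    w.im = 0 := by
  obtain ⟨k, hk, e⟩ := root_im h
  rw [hz] at e
  have : k * w.im = 0 := by linarith
  exact (mul_eq_zero.1 this).resolve_left hk.ne'

/-! ### Local inverses of `zMap` -/

/-- The critical points of `zMap` are the solutions of `c⁴ = -1/3`: the identity `z(c-a)(c-b)(c³-c)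
= c⁴ + 1/3` shows that simple preimages avoid them. -/
theorem Roots.pow_four_ne {z a b c : ℂ} (h : Roots z a b c) (ha : c ≠ a) (hb : c ≠ b) :
    c ^ 4 ≠ -1 / 3 := by
  intro h4
  have h1 : z * ((c - a) * (c - b)) * (c ^ 3 - c) = c ^ 4 + 1 / 3 := by
    have e : z * ((c - a) * (c - b)) = z * (3 * c ^ 2 - 1) - 2 * c := by
      linear_combination z * h.pair - 2 * c * h.sum
    rw [e]
    linear_combination (3 * c ^ 2 - 1) * h.eqn
  rw [h4] at h1
  have h2 : z * ((c - a) * (c - b)) * (c ^ 3 - c) = 0 := by rw [h1]; ring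
  exact mul_ne_zero (mul_ne_zero h.ne_zero (mul_ne_zero (sub_ne_zero.2 ha) (sub_ne_zero.2 hb)))
    (cube_sub_ne_zero h.eqn) h2

theorem hasDerivAt_zMap {w : ℂ} (hw : w ^ 3 - w ≠ 0) :
    HasDerivAt zMap (-(w ^ 4 + 1 / 3) / (w ^ 3 - w) ^ 2) w := by
  have e : w * (w ^ 2 - 1) = w ^ 3 - w := by ring
  have h1 : HasDerivAt (fun w : ℂ => (w ^ 2 - 1 / 3) / (w * (w ^ 2 - 1)))
      (((2 * w) * (w * (w ^ 2 - 1)) - (w ^ 2 - 1 / 3) * (1 * (w ^ 2 - 1) + w * (2 * w)))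
        / (w * (w ^ 2 - 1)) ^ 2) w := by
    apply HasDerivAt.div
    · simpa using (hasDerivAt_pow 2 w).sub_const (1 / 3 : ℂ)
    · apply HasDerivAt.mul (hasDerivAt_id w)
      simpa using (hasDerivAt_pow 2 w).sub_const (1 : ℂ)
    · rwa [e]
  convert! h1 using 1
  rw [e]
  congr 1
  ring

theorem analyticAt_zMap {w : ℂ} (hw : w ^ 3 - w ≠ 0) : AnalyticAt ℂ zMap w := by
  unfold zMap
  apply AnalyticAt.div (by fun_prop) (by fun_prop)
  convert! hw using 1
  ring

/-- `zMap` has a local inverse near a simple preimage. -/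
theorem exists_local_inverse {z₀ w₀ : ℂ} (h : z₀ * (w₀ ^ 3 - w₀) = w₀ ^ 2 - 1 / 3)
    (hc : w₀ ^ 4 ≠ -1 / 3) :
    ∃ g : ℂ → ℂ, AnalyticAt ℂ g z₀ ∧ g z₀ = w₀ ∧
      (∀ᶠ z in 𝓝 z₀, z * (g z ^ 3 - g z) = g z ^ 2 - 1 / 3) ∧
      ∀ᶠ w in 𝓝 w₀, ∀ z, z * (w ^ 3 - w) = w ^ 2 - 1 / 3 → g z = w := by
  have hM := cube_sub_ne_zero h
  have hz : z₀ = zMap w₀ := root_eq_zMap h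
  have ha := analyticAt_zMap hM
  have hd : deriv zMap w₀ ≠ 0 := by
    rw [(hasDerivAt_zMap hM).deriv]
    apply div_ne_zero _ (pow_ne_zero _ hM)
    intro h0
    apply hc
    linear_combination -h0
  have hg := ha.analyticAt_localInverse hd
  have hl := ha.hasStrictDerivAt.eventually_left_inverse hd
  have hr := ha.hasStrictDerivAt.eventually_right_inverse hd
  have he : ha.hasStrictDerivAt.localInverse _ _ _ hd (zMap w₀) = w₀ := hl.self_of_nhds
  refine ⟨_, hz ▸ hg, by rw [hz]; exact he, ?_, ?_⟩
  · rw [hz]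
    have hne : ∀ᶠ z in 𝓝 (zMap w₀),
        (ha.hasStrictDerivAt.localInverse _ _ _ hd z) ^ 3 -
          ha.hasStrictDerivAt.localInverse _ _ _ hd z ≠ 0 := by
      have hcont : ContinuousAt (fun z => (ha.hasStrictDerivAt.localInverse _ _ _ hd z) ^ 3 -
          ha.hasStrictDerivAt.localInverse _ _ _ hd z) (zMap w₀) :=
        (hg.continuousAt.pow 3).sub hg.continuousAt
      apply hcont.eventually_ne
      rwa [he]
    filter_upwards [hr, hne] with z h1 h2
    apply isPreimage_iff.1
    refine ⟨?_, ?_, ?_, h1⟩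
    · intro h0; rw [h0] at h2; norm_num at h2
    · intro h0; rw [h0] at h2; norm_num at h2
    · intro h0; rw [h0] at h2; norm_num at h2
  · filter_upwards [hl] with w hw z hz'
    rw [root_eq_zMap hz']
    exact hw

/-- A continuous choice of simple preimages is analytic. -/
theorem analyticAt_of_continuousAt {ψ : ℂ → ℂ} {z₀ : ℂ} (hψ : ContinuousAt ψ z₀)
    (h : ∀ᶠ z in 𝓝 z₀, z * (ψ z ^ 3 - ψ z) = ψ z ^ 2 - 1 / 3) (hc : ψ z₀ ^ 4 ≠ -1 / 3) :
    AnalyticAt ℂ ψ z₀ := by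
  obtain ⟨g, hg, -, -, h2⟩ := exists_local_inverse h.self_of_nhds hc
  apply hg.congr
  filter_upwards [h, hψ.eventually h2] with z h3 h4
  exact h4 z h3

theorem rt_pow_four_ne {z : ℂ} (hz : z.re ≤ 0) : rt z ^ 4 ≠ -1 / 3 := by
  by_cases h0 : z = 0
  · rw [h0]
    have h1 := rt_eqn (z := 0) (by simp)
    have h2 : rt 0 ^ 2 = 1 / 3 := by linear_combination -h1
    intro h3
    have : (rt 0 ^ 2) ^ 2 = -1 / 3 := by rw [← h3]; ring
    rw [h2] at this
    norm_num at this
  · obtain ⟨a, b, c, h, ha, hb, hc⟩ := exists_closed_left_roots hz h0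
    have : c = rt z := rt_unique hz h.eqn hc
    rw [← this]
    apply h.pow_four_ne
    · rintro rfl; linarith
    · rintro rfl; linarith

/-- Near each point of the closed left half-plane, `rt` is the restriction of an analytic choice of
preimages. -/
theorem rt_local {z₀ : ℂ} (hz : z₀.re ≤ 0) :
    ∃ g : ℂ → ℂ, AnalyticAt ℂ g z₀ ∧ g z₀ = rt z₀ ∧
      (∀ᶠ z in 𝓝 z₀, z * (g z ^ 3 - g z) = g z ^ 2 - 1 / 3) ∧
      (∀ᶠ z in 𝓝 z₀, z.re ≤ 0 → rt z = g z) ∧ ∀ᶠ z in 𝓝 z₀, 0 < (g z).re := by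
  obtain ⟨g, hg, h0, h1, -⟩ := exists_local_inverse (rt_eqn hz) (rt_pow_four_ne hz)
  have h2 : ∀ᶠ z in 𝓝 z₀, 0 < (g z).re := by
    have : ContinuousAt (fun z => (g z).re) z₀ :=
      Complex.continuous_re.continuousAt.comp hg.continuousAt
    exact this.eventually (lt_mem_nhds (by simp only [h0]; exact rt_re_pos hz))
  refine ⟨g, hg, h0, h1, ?_, h2⟩
  filter_upwards [h1, h2] with z h3 h4 h5
  exact (rt_unique h5 h3 h4).symm

theorem rt_continuousWithinAt {z : ℂ} (hz : z.re ≤ 0) :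
    ContinuousWithinAt rt {z | z.re ≤ 0} z := by
  obtain ⟨g, hg, h0, -, h1, -⟩ := rt_local hz
  refine (hg.continuousAt.continuousWithinAt).congr_of_eventuallyEq ?_ h0.symm
  exact (eventually_nhdsWithin_iff.2 h1)

theorem isOpen_left : IsOpen {z : ℂ | z.re < 0} := isOpen_lt Complex.continuous_re continuous_const

theorem left_mem_nhds {z : ℂ} (hz : z.re < 0) : ∀ᶠ z' in 𝓝 z, z'.re < 0 :=
  isOpen_left.mem_nhds hz

theorem rt_analyticAt {z : ℂ} (hz : z.re < 0) : AnalyticAt ℂ rt z := by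
  obtain ⟨g, hg, -, -, h1, -⟩ := rt_local hz.le
  apply hg.congr
  filter_upwards [h1, left_mem_nhds hz] with z' h2 h3
  exact (h2 h3.le).symm

/-! ### The potential -/

/-- The real part of `3 ∫ w dz`. -/
def hw (w : ℂ) : ℝ := (2 / (w ^ 2 - 1)).re - Real.log ‖w ^ 3 - w‖

theorem hw_neg (w : ℂ) : hw (-w) = hw w := by
  unfold hw
  have : (-w) ^ 3 - -w = -(w ^ 3 - w) := by ring
  rw [this, norm_neg, neg_sq]

theorem hw_conj (w : ℂ) : hw (starRingEnd ℂ w) = hw w := by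
  unfold hw
  have h1 : (starRingEnd ℂ w) ^ 3 - starRingEnd ℂ w = starRingEnd ℂ (w ^ 3 - w) := by simp
  have h3 : (starRingEnd ℂ) 2 = 2 := map_ofNat _ 2
  have h2 : 2 / ((starRingEnd ℂ w) ^ 2 - 1) = starRingEnd ℂ (2 / (w ^ 2 - 1)) := by simp [h3]
  rw [h1, h2, Complex.norm_conj, Complex.conj_re]

theorem continuousAt_hw {w : ℂ} (h : w ^ 3 - w ≠ 0) : ContinuousAt hw w := by
  unfold hw
  have h2 : w ^ 2 - 1 ≠ 0 := fun h0 => h (by linear_combination w * h0)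
  apply ContinuousAt.sub
  · apply Complex.continuous_re.continuousAt.comp
    exact ContinuousAt.div continuousAt_const (by fun_prop) h2
  · apply ContinuousAt.log (by fun_prop)
    rwa [norm_ne_zero_iff]

/-- A local holomorphic function whose real part is `hw`, up to a constant. -/
def prim (c w : ℂ) : ℂ := 2 / (w ^ 2 - 1) - Complex.log ((w ^ 3 - w) / c)

theorem prim_re {c w : ℂ} (hc : c ≠ 0) (hM : w ^ 3 - w ≠ 0) :
    (prim c w).re = hw w + Real.log ‖c‖ := by
  simp only [prim, Complex.sub_re, Complex.log_re, norm_div, hw]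
  rw [Real.log_div (norm_ne_zero_iff.2 hM) (norm_ne_zero_iff.2 hc)]
  ring

theorem hasDerivAt_prim_comp {ψ : ℂ → ℂ} {c z : ℂ} (hψ : AnalyticAt ℂ ψ z)
    (h : ∀ᶠ z in 𝓝 z, z * (ψ z ^ 3 - ψ z) = ψ z ^ 2 - 1 / 3) (hc : c ≠ 0)
    (hs : (ψ z ^ 3 - ψ z) / c ∈ Complex.slitPlane) :
    HasDerivAt (fun z => prim c (ψ z)) (3 * ψ z) z := by
  have h2 := h.self_of_nhds
  have hd := hψ.differentiableAt.hasDerivAt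
  set w := ψ z
  set w' := deriv ψ z
  have hM := cube_sub_ne_zero h2
  have hN := sq_sub_one_ne_zero h2
  have e1 : HasDerivAt (fun z => z * (ψ z ^ 3 - ψ z) - (ψ z ^ 2 - 1 / 3))
      ((1 * (w ^ 3 - w) + z * ((3 : ℕ) * w ^ 2 * w' - w')) - ((2 : ℕ) * w ^ 1 * w')) z :=
    ((hasDerivAt_id z).mul ((hd.pow 3).sub hd)).sub ((hd.pow 2).sub_const _)
  have e2 : (1 * (w ^ 3 - w) + z * ((3 : ℕ) * w ^ 2 * w' - w')) - ((2 : ℕ) * w ^ 1 * w') = 0 := by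
    rw [← e1.deriv]
    have : (fun z => z * (ψ z ^ 3 - ψ z) - (ψ z ^ 2 - 1 / 3)) =ᶠ[𝓝 z] fun _ => 0 := by
      filter_upwards [h] with x hx
      rw [hx, sub_self]
    rw [this.deriv_eq]; simp
  -- Implicit differentiation, with `z` eliminated by means of the equation itself.
  have e3 : (w ^ 3 - w) ^ 2 + (w ^ 4 + 1 / 3) * w' = 0 := by
    push_cast at e2
    linear_combination (w ^ 3 - w) * e2 - (3 * w ^ 2 - 1) * w' * h2
  have e4 : HasDerivAt (fun z => prim c (ψ z))
      ((0 * (w ^ 2 - 1) - 2 * ((2 : ℕ) * w ^ 1 * w')) / (w ^ 2 - 1) ^ 2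
        - (((3 : ℕ) * w ^ 2 * w' - w') / c) / ((w ^ 3 - w) / c)) z :=
    ((hasDerivAt_const z (2 : ℂ)).div ((hd.pow 2).sub_const 1) hN).sub
      ((((hd.pow 3).sub hd).div_const c).clog hs)
  convert! e4 using 1
  have e5 : w ^ 3 - w = w * (w ^ 2 - 1) := by ring
  have hw0 : w ≠ 0 := root_ne_zero h2
  rw [e5] at e3 ⊢
  push_cast
  field_simp
  linear_combination 3 * e3

theorem prim_continuousAt {c w : ℂ} (hM : w ^ 3 - w ≠ 0) (hs : (w ^ 3 - w) / c ∈ Complex.slitPlane) :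
    ContinuousAt (prim c) w := by
  unfold prim
  have h2 : w ^ 2 - 1 ≠ 0 := fun h0 => hM (by linear_combination w * h0)
  apply ContinuousAt.sub
  · exact ContinuousAt.div continuousAt_const (by fun_prop) h2
  · exact ContinuousAt.clog (by fun_prop) hs

/-- A local holomorphic function with real part `hw ∘ ψ`. -/
theorem exists_primitive {ψ : ℂ → ℂ} {z₀ : ℂ} (hψ : AnalyticAt ℂ ψ z₀)
    (h : ∀ᶠ z in 𝓝 z₀, z * (ψ z ^ 3 - ψ z) = ψ z ^ 2 - 1 / 3) :
    ∃ F : ℂ → ℂ, AnalyticAt ℂ F z₀ ∧ (∀ᶠ z in 𝓝 z₀, HasDerivAt F (3 * ψ z) z) ∧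
      ∀ᶠ z in 𝓝 z₀, (F z).re = hw (ψ z) := by
  -- Dividing by the value at the base point keeps the argument of the logarithm near `1`. The shift
  -- `log ‖c‖` of the real part is subtracted again.
  set c := ψ z₀ ^ 3 - ψ z₀ with hc
  have hc0 : c ≠ 0 := cube_sub_ne_zero h.self_of_nhds
  have hcont : ContinuousAt (fun z => (ψ z ^ 3 - ψ z) / c) z₀ :=
    ((hψ.continuousAt.pow 3).sub hψ.continuousAt).div_const c
  have hslit : ∀ᶠ z in 𝓝 z₀, (ψ z ^ 3 - ψ z) / c ∈ Complex.slitPlane := by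
    apply hcont.eventually_mem
    apply Complex.isOpen_slitPlane.mem_nhds
    rw [← hc, div_self hc0]
    exact Complex.one_mem_slitPlane
  have hd : ∀ᶠ z in 𝓝 z₀, HasDerivAt (fun z => prim c (ψ z) - (Real.log ‖c‖ : ℝ)) (3 * ψ z) z := by
    filter_upwards [hslit, h.eventually_nhds, hψ.eventually_analyticAt] with z h1 h3 h4
    exact (hasDerivAt_prim_comp h4 h3 hc0 h1).sub_const _
  refine ⟨_, ?_, hd, ?_⟩
  · rw [Complex.analyticAt_iff_eventually_differentiableAt]
    exact hd.mono fun z h => h.differentiableAt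
  · filter_upwards [h] with z h1
    rw [Complex.sub_re, prim_re hc0 (cube_sub_ne_zero h1), Complex.ofReal_re, add_sub_cancel_right]

/-- The derivative of `hw ∘ ψ` along a curve. -/
theorem hasDerivAt_hw_comp {ψ : ℂ → ℂ} {γ : ℝ → ℂ} {t : ℝ} {γ' : ℂ}
    (hψ : AnalyticAt ℂ ψ (γ t))
    (h : ∀ᶠ z in 𝓝 (γ t), z * (ψ z ^ 3 - ψ z) = ψ z ^ 2 - 1 / 3) (hγ : HasDerivAt γ γ' t) :
    HasDerivAt (fun s => hw (ψ (γ s))) ((3 * ψ (γ t) * γ').re) t := by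
  obtain ⟨F, -, h1, h2⟩ := exists_primitive hψ h
  have h3 : HasDerivAt (fun s => F (γ s)) (3 * ψ (γ t) * γ') t :=
    h1.self_of_nhds.comp_of_eq t hγ rfl
  have h4 : HasDerivAt (fun s => (F (γ s)).re) ((3 * ψ (γ t) * γ').re) t := by
    have := Complex.reCLM.hasFDerivAt.comp_hasDerivAt t h3
    simpa using! this
  apply h4.congr_of_eventuallyEq
  filter_upwards [hγ.continuousAt.eventually h2] with s hs
  exact hs.symm

/-! ### The principal square root -/

/-- The principal square root. -/
def csq (w : ℂ) : ℂ := w ^ (((2 : ℕ) : ℂ)⁻¹)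

theorem csq_sq (w : ℂ) : csq w ^ 2 = w := Complex.cpow_nat_inv_pow w two_ne_zero

theorem csq_analyticAt {w : ℂ} (hw : w ∈ Complex.slitPlane) : AnalyticAt ℂ csq w :=
  analyticAt_id.cpow analyticAt_const hw

theorem csq_norm (w : ℂ) : ‖csq w‖ = √‖w‖ := by
  rw [eq_comm, Real.sqrt_eq_iff_mul_self_eq (norm_nonneg _) (norm_nonneg _), ← norm_mul, ← sq,
    csq_sq]

theorem csq_zero : csq 0 = 0 := by
  have := csq_sq 0
  simpa using this

theorem csq_continuousAt_zero : ContinuousAt csq 0 := by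
  rw [ContinuousAt, csq_zero, tendsto_zero_iff_norm_tendsto_zero]
  simp only [csq_norm]
  have : ContinuousAt (fun w : ℂ => √‖w‖) 0 := by fun_prop
  simpa [ContinuousAt] using this

theorem csq_re {w : ℂ} (hw : w ≠ 0) :
    (csq w).re = Real.exp (Real.log ‖w‖ / 2) * Real.cos (w.arg / 2) := by
  unfold csq
  rw [Complex.cpow_def_of_ne_zero hw, Complex.exp_re]
  have e : Complex.log w * (((2 : ℕ) : ℂ)⁻¹) = Complex.log w / (2 : ℝ) := by
    push_cast; rw [div_eq_mul_inv]
  rw [e, Complex.div_ofReal_re, Complex.div_ofReal_im, Complex.log_re, Complex.log_im]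

theorem csq_re_nonneg (w : ℂ) : 0 ≤ (csq w).re := by
  by_cases hw : w = 0
  · rw [hw, csq_zero]; simp
  · rw [csq_re hw]
    apply mul_nonneg (Real.exp_nonneg _)
    apply Real.cos_nonneg_of_mem_Icc
    have h1 := Complex.neg_pi_lt_arg w
    have h2 := Complex.arg_le_pi w
    constructor <;> linarith

theorem csq_re_pos {w : ℂ} (hw : w ∈ Complex.slitPlane) : 0 < (csq w).re := by
  rw [csq_re (Complex.slitPlane_ne_zero hw)]
  apply mul_pos (Real.exp_pos _)
  apply Real.cos_pos_of_mem_Ioo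
  have h1 := Complex.neg_pi_lt_arg w
  have h2 := (Complex.arg_le_pi w).lt_of_ne (Complex.mem_slitPlane_iff_arg.1 hw).1
  constructor <;> linarith

/-- A square root which is continuous at a given point. -/
theorem exists_continuous_sqrt (w₀ : ℂ) :
    ∃ s : ℂ → ℂ, ContinuousAt s w₀ ∧ ∀ w, s w ^ 2 = w := by
  by_cases h0 : w₀ = 0
  · exact ⟨csq, h0 ▸ csq_continuousAt_zero, csq_sq⟩
  · obtain ⟨ζ, hζ⟩ := exists_csqrt w₀
    have hζ0 : ζ ^ 2 ≠ 0 := by rwa [hζ]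
    have hζ1 : ζ ≠ 0 := fun h => hζ0 (by rw [h]; ring)
    refine ⟨fun w => ζ * csq (w / ζ ^ 2), ?_, fun w => ?_⟩
    · apply continuousAt_const.mul
      apply ContinuousAt.comp (g := csq)
      · apply (csq_analyticAt _).continuousAt
        rw [hζ, div_self h0]; exact Complex.one_mem_slitPlane
      · exact continuousAt_id.div_const _
    · rw [mul_pow, csq_sq]; field_simp

/-! ### The branch points -/

theorem z₁_eq : z₁ = (((3 : ℝ) ^ (-(1 / 4) : ℝ) : ℝ) : ℂ) * Complex.exp ((7 * Real.pi / 12 : ℝ) * Complex.I) := by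
  rw [z₁, omega24, ← Complex.exp_nat_mul]
  congr 2; push_cast; ring

theorem z₂_eq : z₂ = starRingEnd ℂ z₁ := by
  rw [z₁_eq, map_mul, Complex.conj_ofReal, ← Complex.exp_conj, z₂, omega24, ← Complex.exp_nat_mul]
  congr 1
  simp only [map_mul, Complex.conj_ofReal, Complex.conj_I]
  rw [Complex.exp_eq_exp_iff_exists_int]
  exact ⟨1, by push_cast; ring⟩

theorem z₃_eq : z₃ = -z₁ := by
  have h : Complex.exp (2 * Real.pi * Complex.I / 24) ^ 12 = -1 := by
    rw [← Complex.exp_nat_mul, ← Complex.exp_pi_mul_I]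
    congr 1; push_cast; ring
  rw [z₃, z₁, omega24]
  linear_combination (((3 : ℝ) ^ (-(1 / 4) : ℝ) : ℝ) : ℂ) * (Complex.exp (2 * Real.pi * Complex.I / 24)) ^ 7 * h

theorem z₄_eq : z₄ = -z₂ := by
  have h : Complex.exp (2 * Real.pi * Complex.I / 24) ^ 12 = -1 := by
    rw [← Complex.exp_nat_mul, ← Complex.exp_pi_mul_I]
    congr 1; push_cast; ring
  rw [z₂, z₄, omega24]
  linear_combination (((3 : ℝ) ^ (-(1 / 4) : ℝ) : ℝ) : ℂ) * (Complex.exp (2 * Real.pi * Complex.I / 24)) ^ 5 * h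

theorem third_root_pos : 0 < (3 : ℝ) ^ (-(1 / 4) : ℝ) := by positivity

theorem z₁_re : z₁.re = (3 : ℝ) ^ (-(1 / 4) : ℝ) * Real.cos (7 * Real.pi / 12) := by
  rw [z₁_eq, Complex.re_ofReal_mul, Complex.exp_ofReal_mul_I_re]

theorem z₁_im : z₁.im = (3 : ℝ) ^ (-(1 / 4) : ℝ) * Real.sin (7 * Real.pi / 12) := by
  rw [z₁_eq, Complex.im_ofReal_mul, Complex.exp_ofReal_mul_I_im]

theorem z₁_re_neg : z₁.re < 0 := by
  rw [z₁_re]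
  apply mul_neg_of_pos_of_neg third_root_pos
  apply Real.cos_neg_of_pi_div_two_lt_of_lt <;> linarith [Real.pi_pos]

theorem z₁_im_pos : 0 < z₁.im := by
  rw [z₁_im]
  apply mul_pos third_root_pos
  apply Real.sin_pos_of_pos_of_lt_pi <;> linarith [Real.pi_pos]

theorem third_root_sq : ((3 : ℝ) ^ (-(1 / 4) : ℝ)) ^ 2 = 1 / √3 := by
  rw [← Real.rpow_natCast, ← Real.rpow_mul (by norm_num), Real.sqrt_eq_rpow, one_div ((3 : ℝ) ^ _),
    ← Real.rpow_neg (by norm_num)]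
  norm_num

theorem z₁_normSq : z₁.re ^ 2 + z₁.im ^ 2 = 1 / √3 := by
  rw [z₁_re, z₁_im, ← third_root_sq]
  linear_combination ((3 : ℝ) ^ (-(1 / 4) : ℝ)) ^ 2 * Real.sin_sq_add_cos_sq (7 * Real.pi / 12)

theorem z₁_sq_re : z₁.re ^ 2 - z₁.im ^ 2 = -(1 / 2) := by
  have h : Real.cos (2 * (7 * Real.pi / 12)) = -(√3 / 2) := by
    have : 2 * (7 * Real.pi / 12) = Real.pi / 6 + Real.pi := by ring
    rw [this, Real.cos_add_pi, Real.cos_pi_div_six]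
  rw [z₁_re, z₁_im]
  have e : ((3 : ℝ) ^ (-(1 / 4) : ℝ) * Real.cos (7 * Real.pi / 12)) ^ 2
      - ((3 : ℝ) ^ (-(1 / 4) : ℝ) * Real.sin (7 * Real.pi / 12)) ^ 2
      = ((3 : ℝ) ^ (-(1 / 4) : ℝ)) ^ 2 * Real.cos (2 * (7 * Real.pi / 12)) := by
    rw [Real.cos_two_mul]
    linear_combination -((3 : ℝ) ^ (-(1 / 4) : ℝ)) ^ 2 * Real.sin_sq_add_cos_sq (7 * Real.pi / 12)
  rw [e, h, third_root_sq]
  field_simp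

/-! ### The coordinate `q` -/

/-- The product of `z` and its preimage in the right half-plane. -/
def qz (z : ℂ) : ℂ := z * rt z

theorem qz_ne_zero {z : ℂ} (hz : z.re ≤ 0) (h0 : z ≠ 0) : qz z ≠ 0 := mul_ne_zero h0 (rt_ne_zero hz)

theorem qz_sq {z : ℂ} (hz : z.re ≤ 0) :
    z ^ 2 * (3 * qz z - 1) = 3 * qz z ^ 2 * (qz z - 1) := by
  have h := rt_eqn hz
  unfold qz
  linear_combination (-3 : ℂ) * z ^ 2 * h

theorem qz_im_pos {z : ℂ} (hz : z.re < 0) (hy : 0 < z.im) : 0 < (qz z).im := by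
  have h1 := root_im_neg (rt_eqn hz.le) hy
  have h2 := rt_re_pos hz.le
  rw [qz, Complex.mul_im]
  nlinarith [mul_pos_of_neg_of_neg hz h1, mul_pos hy h2]

theorem qz_conj {z : ℂ} (hz : z.re ≤ 0) : qz (starRingEnd ℂ z) = starRingEnd ℂ (qz z) := by
  rw [qz, qz, rt_conj hz, map_mul]

theorem qz_real {z : ℂ} (hz : z.re < 0) (hy : z.im = 0) : (qz z).re < 0 ∧ (qz z).im = 0 := by
  have h1 := root_im_zero (rt_eqn hz.le) hy
  have h2 := rt_re_pos hz.le
  rw [qz, Complex.mul_im, Complex.mul_re, h1, hy]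
  constructor
  · nlinarith [mul_pos_of_neg_of_neg hz (neg_lt_zero.2 h2)]
  · ring

/-- The equations satisfied by the squares `P, R` of the coordinates of the points where `q² = -s`. -/
structure CurveEq (s P R : ℝ) : Prop where
  s_pos : 0 < s
  P_nonneg : 0 ≤ P
  R_nonneg : 0 ≤ R
  diff : (P - R) * (1 + 9 * s) = -(3 * s * (1 + 3 * s))
  sum : (P + R) ^ 2 * (1 + 9 * s) = 9 * s ^ 2 * (1 + s)

theorem CurveEq.prod {s P R : ℝ} (h : CurveEq s P R) : P * R * (1 + 9 * s) ^ 2 = 9 * s ^ 3 := by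
  linear_combination ((1 + 9 * s) / 4) * h.sum
    - (1 / 4 : ℝ) * ((P - R) * (1 + 9 * s) - 3 * s * (1 + 3 * s)) * h.diff

/-- Both `R - P` and `R + P` are explicit increasing functions of `s`, hence so is `R`. For `P`:
both quotients by `s` decrease, so `R/s` decreases, while `PR/s = 9(s/(1+9s))²` increases. -/
theorem CurveEq.mono {s P R s' P' R' : ℝ} (h : CurveEq s P R) (h' : CurveEq s' P' R')
    (hs : s < s') : P < P' ∧ R < R' := by
  have p := h.s_pos
  have p' := h'.s_pos
  have k : 0 < 1 + 9 * s := by linarith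
  have k' : 0 < 1 + 9 * s' := by linarith
  have hP := h.P_nonneg
  have hP' := h'.P_nonneg
  have hR := h.R_nonneg
  have hR' := h'.R_nonneg
  have hd : 0 < s' - s := by linarith
  have pp : 0 < s * s' := mul_pos p p'
  have A : R - P = 3 * s * (1 + 3 * s) / (1 + 9 * s) := by
    rw [eq_div_iff k.ne']; linear_combination -h.diff
  have A' : R' - P' = 3 * s' * (1 + 3 * s') / (1 + 9 * s') := by
    rw [eq_div_iff k'.ne']; linear_combination -h'.diff
  have B : (P + R) ^ 2 = 9 * s ^ 2 * (1 + s) / (1 + 9 * s) := by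
    rw [eq_div_iff k.ne']; exact h.sum
  have B' : (P' + R') ^ 2 = 9 * s' ^ 2 * (1 + s') / (1 + 9 * s') := by
    rw [eq_div_iff k'.ne']; exact h'.sum
  have hA : R - P < R' - P' := by
    rw [A, A', div_lt_div_iff₀ k k']
    nlinarith [mul_pos hd p, mul_pos hd p', mul_pos hd pp]
  have hB : P + R < P' + R' := by
    apply lt_of_pow_lt_pow_left₀ 2 (by linarith)
    rw [B, B', div_lt_div_iff₀ k k']
    nlinarith [mul_pos hd p, mul_pos hd p', mul_pos hd pp, mul_pos (mul_pos hd p) p,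
      mul_pos (mul_pos hd p) p', mul_pos (mul_pos hd p') p', mul_pos (mul_pos hd pp) p,
      mul_pos (mul_pos hd pp) p']
  have hRR : R < R' := by linarith
  refine ⟨?_, hRR⟩
  have hA2 : (R' - P') * s < (R - P) * s' := by
    rw [A, A', div_mul_eq_mul_div, div_mul_eq_mul_div, div_lt_div_iff₀ k' k]
    nlinarith [mul_pos hd pp]
  have hB2 : (P' + R') * s < (P + R) * s' := by
    apply lt_of_pow_lt_pow_left₀ 2 (mul_nonneg (by linarith) p'.le)
    rw [mul_pow, mul_pow, B, B', div_mul_eq_mul_div, div_mul_eq_mul_div, div_lt_div_iff₀ k' k]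
    nlinarith [mul_pos (mul_pos hd pp) pp]
  have hRs : R' * s < R * s' := by linarith
  have e : P * R / s = 9 * (s / (1 + 9 * s)) ^ 2 := by
    have := h.prod
    field_simp
    linear_combination this
  have e' : P' * R' / s' = 9 * (s' / (1 + 9 * s')) ^ 2 := by
    have := h'.prod
    field_simp
    linear_combination this
  have hσ : s / (1 + 9 * s) < s' / (1 + 9 * s') := by
    rw [div_lt_div_iff₀ k k']; nlinarith
  have hlt : P * R / s < P' * R' / s' := by
    rw [e, e']
    have : 0 < s / (1 + 9 * s) := by positivity
    nlinarith
  by_contra hc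
  push Not at hc
  rw [div_lt_div_iff₀ p p'] at hlt
  have h1 : P' * R' * s ≤ P' * (R * s') := by
    rw [mul_assoc]; exact mul_le_mul_of_nonneg_left hRs.le hP'
  have h2 : P' * (R * s') ≤ P * (R * s') :=
    mul_le_mul_of_nonneg_right hc (mul_nonneg hR p'.le)
  nlinarith

/-- Put `q = iτ` in `qz_sq`: real and imaginary parts give `x² - y²` and `2xy`, and the squares of
these two add up to `(x² + y²)²`. -/
theorem curveEq_of_qz {z : ℂ} (hz : z.re ≤ 0) (h0 : z ≠ 0) (hq : (qz z).re = 0) :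
    CurveEq ((qz z).im ^ 2) (z.re ^ 2) (z.im ^ 2) := by
  have hq0 := qz_ne_zero hz h0
  set τ := (qz z).im with hτ
  have hτ0 : τ ≠ 0 := fun h => hq0 (Complex.ext hq h)
  have hqe : qz z = Complex.I * τ := by apply Complex.ext <;> simp [hq, hτ]
  have h := qz_sq hz
  rw [hqe] at h
  have h1 := congrArg Complex.re h
  have h2 := congrArg Complex.im h
  simp [pow_two] at h1 h2
  set x := z.re
  set y := z.im
  have e1 : (x ^ 2 - y ^ 2) * (1 + 9 * τ ^ 2) = -(3 * τ ^ 2 * (1 + 3 * τ ^ 2)) := by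
    linear_combination (-1 : ℝ) * h1 + 3 * τ * h2
  have e2 : 2 * (x * y) * (1 + 9 * τ ^ 2) = -6 * τ ^ 3 := by
    linear_combination (-1 : ℝ) * h2 - 3 * τ * h1
  have hk : (1 + 9 * τ ^ 2) ≠ 0 := by positivity
  refine ⟨by positivity, by positivity, by positivity, e1, ?_⟩
  apply mul_right_cancel₀ hk
  linear_combination ((x ^ 2 - y ^ 2) * (1 + 9 * τ ^ 2) - (3 * τ ^ 2 * (1 + 3 * τ ^ 2))) * e1
    + (2 * (x * y) * (1 + 9 * τ ^ 2) - 6 * τ ^ 3) * e2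

/-- This uses only the explicit value of `z₁`. That `z₁` lies on the curve `Re q = 0` is deduced in
`qz_z₁` from uniqueness on its horizontal line. -/
theorem curveEq_z₁ : CurveEq (1 / 3) (z₁.re ^ 2) (z₁.im ^ 2) := by
  refine ⟨by norm_num, by positivity, by positivity, ?_, ?_⟩
  · rw [z₁_sq_re]; norm_num
  · rw [z₁_normSq, div_pow, Real.sq_sqrt (by norm_num)]; norm_num

/-- By `CurveEq.mono`, height and `|q|²` are equivalent parameters on the curve `Re q = 0`. The
height of `z₁` thus separates `|q|² < 1/3` from `|q|² > 1/3`, which decides whether `dt` or `dp` is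
analytic there. -/
theorem qz_curve_lt {z : ℂ} (hz : z.re < 0) (hq : (qz z).re = 0) :
    (z.im ^ 2 < z₁.im ^ 2 → z₁.re < z.re ∧ (qz z).im ^ 2 < 1 / 3) ∧
    (z.im ^ 2 = z₁.im ^ 2 → z.re = z₁.re ∧ (qz z).im ^ 2 = 1 / 3) ∧
    (z₁.im ^ 2 < z.im ^ 2 → 1 / 3 < (qz z).im ^ 2) := by
  have h0 : z ≠ 0 := by rintro rfl; simp at hz
  have h := curveEq_of_qz hz.le h0 hq
  have h1 := curveEq_z₁
  have hn := z₁_re_neg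
  rcases lt_trichotomy ((qz z).im ^ 2) (1 / 3) with hs | hs | hs
  · obtain ⟨a, b⟩ := h.mono h1 hs
    refine ⟨fun _ => ⟨by nlinarith, hs⟩, fun e => by linarith, fun e => by linarith⟩
  · rw [hs] at h
    have d1 := h.diff
    have d2 := h1.diff
    have s1 := h.sum
    have s2 := h1.sum
    have e1 : z.re ^ 2 + z.im ^ 2 = z₁.re ^ 2 + z₁.im ^ 2 := by
      rw [← sq_eq_sq₀ (by positivity) (by positivity)]; linarith
    refine ⟨fun e => by nlinarith, fun _ => ⟨?_, hs⟩, fun e => by nlinarith⟩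
    nlinarith
  · obtain ⟨a, b⟩ := h1.mono h hs
    exact ⟨fun e => by linarith, fun e => by linarith, fun _ => hs⟩

theorem qz_curve_inj {z z' : ℂ} (hz : z.re < 0) (hz' : z'.re < 0) (hq : (qz z).re = 0)
    (hq' : (qz z').re = 0) (h : z.im = z'.im) : z.re = z'.re := by
  have h0 : z ≠ 0 := by rintro rfl; simp at hz
  have h0' : z' ≠ 0 := by rintro rfl; simp at hz'
  have c := curveEq_of_qz hz.le h0 hq
  have c' := curveEq_of_qz hz'.le h0' hq'
  rw [← h] at c'
  have hs : (qz z).im ^ 2 = (qz z').im ^ 2 := by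
    rcases lt_trichotomy ((qz z).im ^ 2) ((qz z').im ^ 2) with hs | hs | hs
    · exact absurd (c.mono c' hs).2 (lt_irrefl _)
    · exact hs
    · exact absurd (c'.mono c hs).2 (lt_irrefl _)
  have d := c.diff
  have d' := c'.diff
  rw [hs] at d
  have hk : 0 < 1 + 9 * (qz z').im ^ 2 := by positivity
  have : z.re ^ 2 = z'.re ^ 2 := by
    have : z.re ^ 2 - z.im ^ 2 = z'.re ^ 2 - z.im ^ 2 :=
      mul_right_cancel₀ hk.ne' (d.trans d'.symm)
    linarith
  nlinarith

/-! ### Behaviour at infinity -/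

theorem root_bound {z w : ℂ} (h : z * (w ^ 3 - w) = w ^ 2 - 1 / 3) (hz : 1 ≤ ‖z‖) : ‖w‖ ≤ 2 := by
  by_contra hw
  push Not at hw
  have h1 : ‖z‖ * ‖w ^ 3 - w‖ = ‖w ^ 2 - 1 / 3‖ := by rw [← norm_mul, h]
  have h2 : ‖w ^ 2 - 1 / 3‖ ≤ ‖w‖ ^ 2 + 1 / 3 := by
    refine (norm_sub_le _ _).trans ?_
    rw [norm_pow]; norm_num
  have h3 : ‖w‖ ^ 3 - ‖w‖ ≤ ‖w ^ 3 - w‖ := by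
    have := norm_sub_norm_le (w ^ 3) w
    rwa [norm_pow] at this
  nlinarith [norm_nonneg (w ^ 3 - w), mul_le_mul_of_nonneg_right hz (norm_nonneg (w ^ 3 - w)),
    mul_pos (sub_pos.2 hw) (sub_pos.2 hw), mul_pos (mul_pos (sub_pos.2 hw) (sub_pos.2 hw)) (sub_pos.2 hw)]

theorem root_near {z w : ℂ} (h : z * (w ^ 3 - w) = w ^ 2 - 1 / 3) (hz : 1 ≤ ‖z‖) :
    ‖w‖ * ‖w - 1‖ * ‖w + 1‖ ≤ 5 / ‖z‖ := by
  have hw := root_bound h hz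
  rw [← norm_mul, ← norm_mul, le_div_iff₀ (by linarith), mul_comm, ← norm_mul]
  have : z * (w * (w - 1) * (w + 1)) = w ^ 2 - 1 / 3 := by rw [← h]; ring
  rw [this]
  refine (norm_sub_le _ _).trans ?_
  rw [norm_pow]
  norm_num
  nlinarith [norm_nonneg w]

/-- For large `z` each preimage is near `0`, `1` or `-1`. If `rt z` is not near `1`, positivity of
its real part puts it near `0`. The pair relation then makes `ab` close to `-1`, so neither `a` nor
`b` is small. Both are therefore near `-1`, and `ab` is close to `1`, a contradiction. -/
theorem rt_near_one {z : ℂ} (hz : z.re ≤ 0) {ε : ℝ} (hε : 0 < ε) (hε1 : ε ≤ 1)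
    (hM : 100 / ε < ‖z‖) : ‖rt z - 1‖ < ε := by
  have hz1 : 100 < ‖z‖ := by
    refine lt_of_le_of_lt ?_ hM
    rw [le_div_iff₀ hε]; linarith
  have h0 : z ≠ 0 := by rintro rfl; norm_num at hz1
  obtain ⟨a, b, c, hR, ha, hb, hc⟩ := exists_closed_left_roots hz h0
  have hcr : c = rt z := rt_unique hz hR.eqn hc
  rw [← hcr]
  by_contra hcon
  push Not at hcon
  have hε2 : 5 / ‖z‖ < ε / 20 := by
    rw [div_lt_iff₀ (by linarith)]
    rw [div_lt_iff₀ hε] at hM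
    linarith
  have e1 := root_near hR.eqn (by linarith)
  have e2 := root_near hR.rot.eqn (by linarith)
  have e3 := root_near hR.rot.rot.eqn (by linarith)
  have ba := root_bound hR.rot.eqn (by linarith)
  have bb := root_bound hR.rot.rot.eqn (by linarith)
  have d1 : 1 ≤ ‖c + 1‖ := by
    have := Complex.re_le_norm (c + 1)
    rw [Complex.add_re, Complex.one_re] at this; linarith
  have da : 1 ≤ ‖a - 1‖ := by
    have := Complex.re_le_norm (1 - a)
    rw [Complex.sub_re, Complex.one_re, norm_sub_rev] at this; linarith
  have db : 1 ≤ ‖b - 1‖ := by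
    have := Complex.re_le_norm (1 - b)
    rw [Complex.sub_re, Complex.one_re, norm_sub_rev] at this; linarith
  have hc1 : ‖c‖ * ε ≤ 5 / ‖z‖ := by
    refine le_trans ?_ e1
    calc ‖c‖ * ε ≤ ‖c‖ * ‖c - 1‖ := mul_le_mul_of_nonneg_left hcon (norm_nonneg _)
      _ ≤ ‖c‖ * ‖c - 1‖ * ‖c + 1‖ := le_mul_of_one_le_right (by positivity) d1
  have hc2 : ‖c‖ ≤ 1 / 20 := by
    by_contra h; push Not at h
    nlinarith
  have haa : ‖a‖ * ‖a + 1‖ ≤ 1 / 20 := by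
    refine le_trans ?_ (e2.trans (hε2.le.trans (by linarith)))
    calc ‖a‖ * ‖a + 1‖ ≤ ‖a‖ * ‖a + 1‖ * ‖a - 1‖ := le_mul_of_one_le_right (by positivity) da
      _ = _ := by ring
  have hbb : ‖b‖ * ‖b + 1‖ ≤ 1 / 20 := by
    refine le_trans ?_ (e3.trans (hε2.le.trans (by linarith)))
    calc ‖b‖ * ‖b + 1‖ ≤ ‖b‖ * ‖b + 1‖ * ‖b - 1‖ := le_mul_of_one_le_right (by positivity) db
      _ = _ := by ring
  have hpair : ‖a * b + 1‖ ≤ 1 / 5 := by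
    have : a * b + 1 = -(c * (a + b)) := by linear_combination hR.pair
    rw [this, norm_neg, norm_mul]
    have := norm_add_le a b
    nlinarith [norm_nonneg c, norm_nonneg (a + b)]
  have hab : 4 / 5 ≤ ‖a‖ * ‖b‖ := by
    have h1 : ‖(1 : ℂ)‖ ≤ ‖a * b + 1‖ + ‖a * b‖ := by
      have : (1 : ℂ) = (a * b + 1) - a * b := by ring
      rw [this]
      simpa using norm_sub_le (a * b + 1) (a * b)
    rw [norm_one, norm_mul] at h1
    linarith
  have hap : 2 / 5 ≤ ‖a‖ := by nlinarith [norm_nonneg a, norm_nonneg b]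
  have hbp : 2 / 5 ≤ ‖b‖ := by nlinarith [norm_nonneg a, norm_nonneg b]
  have ha1 : ‖a + 1‖ ≤ 1 / 8 := by nlinarith [norm_nonneg (a + 1)]
  have hb1 : ‖b + 1‖ ≤ 1 / 8 := by nlinarith [norm_nonneg (b + 1)]
  have hfin : (2 : ℝ) ≤ ‖a * b + 1‖ + ‖a + 1‖ * ‖b‖ + ‖b + 1‖ := by
    have : (2 : ℂ) = (a * b + 1) - (a + 1) * b + (b + 1) := by ring
    calc (2 : ℝ) = ‖(2 : ℂ)‖ := by simp
      _ = ‖(a * b + 1) - (a + 1) * b + (b + 1)‖ := by rw [← this]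
      _ ≤ ‖(a * b + 1) - (a + 1) * b‖ + ‖b + 1‖ := norm_add_le _ _
      _ ≤ _ := by
        have := norm_sub_le (a * b + 1) ((a + 1) * b)
        rw [norm_mul (a + 1)] at this; linarith
  nlinarith [norm_nonneg (a + 1)]

theorem tendsto_rt : Tendsto rt (Bornology.cobounded ℂ ⊓ 𝓟 {z | z.re ≤ 0}) (𝓝 1) := by
  rw [Metric.tendsto_nhds]
  intro ε hε
  have h1 : ∀ᶠ z : ℂ in Bornology.cobounded ℂ, 100 / min ε 1 < ‖z‖ :=
    tendsto_norm_cobounded_atTop.eventually (eventually_gt_atTop _)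
  rw [eventually_inf_principal]
  filter_upwards [h1] with z hz hz'
  rw [dist_eq_norm]
  exact (rt_near_one hz' (by positivity) (min_le_right _ _) hz).trans_le (min_le_left _ _)

/-! ### Cartesian coordinates and limits along horizontal lines -/

/-- The point with given coordinates. -/
def pt (x y : ℝ) : ℂ := ⟨x, y⟩

@[simp] theorem pt_re (x y : ℝ) : (pt x y).re = x := rfl
@[simp] theorem pt_im (x y : ℝ) : (pt x y).im = y := rfl

theorem pt_eq (x y : ℝ) : pt x y = x + y * Complex.I := Complex.mk_eq_add_mul_I x y

theorem pt_re_im (z : ℂ) : pt z.re z.im = z := rfl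

theorem pt_conj (x y : ℝ) : starRingEnd ℂ (pt x y) = pt x (-y) := rfl

theorem hasDerivAt_pt_left (x y : ℝ) : HasDerivAt (fun x => pt x y) 1 x := by
  simp only [pt_eq]
  exact (Complex.ofRealCLM.hasDerivAt (x := x)).add_const _

theorem hasDerivAt_pt_right (x y : ℝ) : HasDerivAt (fun y => pt x y) Complex.I y := by
  simp only [pt_eq]
  simpa using! ((Complex.ofRealCLM.hasDerivAt (x := y)).mul_const Complex.I).const_add (x : ℂ)

theorem continuous_pt : Continuous fun p : ℝ × ℝ => pt p.1 p.2 := by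
  simp only [pt_eq]; fun_prop

theorem continuous_pt_left (y : ℝ) : Continuous fun x => pt x y :=
  continuous_pt.comp (by fun_prop : Continuous fun x : ℝ => (x, y))

theorem continuous_pt_right (x : ℝ) : Continuous fun y => pt x y :=
  continuous_pt.comp (by fun_prop : Continuous fun y : ℝ => (x, y))

theorem tendsto_pt_atBot (y : ℝ) : Tendsto (fun x => pt x y) atBot (Bornology.cobounded ℂ) := by
  rw [← tendsto_norm_atTop_iff_cobounded]
  apply tendsto_atTop_mono (f := fun x : ℝ => -x) _ tendsto_neg_atBot_atTop
  intro x
  exact (neg_le_abs x).trans (Complex.abs_re_le_norm (pt x y))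

theorem tendsto_pt_atTop (y : ℝ) : Tendsto (fun x => pt x y) atTop (Bornology.cobounded ℂ) := by
  rw [← tendsto_norm_atTop_iff_cobounded]
  apply tendsto_atTop_mono (f := fun x : ℝ => x) _ tendsto_id
  intro x
  exact (le_abs_self x).trans (Complex.abs_re_le_norm (pt x y))

theorem tendsto_rt_line (y : ℝ) : Tendsto (fun x => rt (pt x y)) atBot (𝓝 1) := by
  apply tendsto_rt.comp
  rw [tendsto_inf]
  refine ⟨tendsto_pt_atBot y, tendsto_principal.2 ?_⟩
  filter_upwards [eventually_le_atBot 0] with x hx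
  exact hx

theorem tendsto_qz_re (y : ℝ) : Tendsto (fun x => (qz (pt x y)).re) atBot atBot := by
  have h1 : Tendsto (fun x => (rt (pt x y)).re) atBot (𝓝 1) := by
    simpa using! (Complex.continuous_re.tendsto 1).comp (tendsto_rt_line y)
  have h2 : Tendsto (fun x => (rt (pt x y)).im) atBot (𝓝 0) := by
    simpa using! (Complex.continuous_im.tendsto 1).comp (tendsto_rt_line y)
  have h3 : Tendsto (fun x => x * (rt (pt x y)).re) atBot atBot :=
    tendsto_id.atBot_mul_pos one_pos h1
  have h4 : Tendsto (fun x => -(y * (rt (pt x y)).im)) atBot (𝓝 0) := by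
    simpa using (h2.const_mul y).neg
  refine (h3.atBot_add h4).congr fun x => ?_
  rw [qz, Complex.mul_re]; simp [sub_eq_add_neg]

/-! ### The difference of the two left preimages -/

/-- The square of the difference of the two other preimages. -/
def dq (z : ℂ) : ℂ := 1 + 1 / (3 * qz z ^ 2)

/-- The principal square root of `dq`. -/
def dp (z : ℂ) : ℂ := csq (dq z)

/-- The square root of `dq` with positive real part where `qz z` has negative real part. -/
def dt (z : ℂ) : ℂ := -(csq (1 + 3 * qz z ^ 2) / (√3 * qz z))

/-- The difference of the potentials of the two other preimages, given their difference. -/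
def potDiff (z δ : ℂ) : ℝ := hw ((1 / z - rt z + δ) / 2) - hw ((1 / z - rt z - δ) / 2)

theorem potDiff_neg (z δ : ℂ) : potDiff z (-δ) = -potDiff z δ := by
  unfold potDiff
  rw [← sub_eq_add_neg, sub_neg_eq_add, neg_sub]

theorem potDiff_zero (z : ℂ) : potDiff z 0 = 0 := by simp [potDiff]

theorem dp_sq (z : ℂ) : dp z ^ 2 = dq z := csq_sq _

theorem sqrt3_sq : ((√3 : ℝ) : ℂ) ^ 2 = 3 := by
  rw [← Complex.ofReal_pow, Real.sq_sqrt (by norm_num)]; norm_num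

theorem dt_sq {z : ℂ} (hz : z.re ≤ 0) (h0 : z ≠ 0) : dt z ^ 2 = dq z := by
  have hq := qz_ne_zero hz h0
  rw [dt, neg_sq, div_pow, csq_sq, mul_pow, sqrt3_sq, dq]
  field_simp
  ring

theorem roots_of_sq {z δ : ℂ} (hz : z.re ≤ 0) (h0 : z ≠ 0) (hδ : δ ^ 2 = dq z) :
    Roots z ((1 / z - rt z + δ) / 2) ((1 / z - rt z - δ) / 2) (rt z) :=
  roots_of_root h0 (rt_eqn hz) hδ

theorem Roots.eq_of_rt {z a b : ℂ} (h : Roots z a b (rt z)) :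
    (a - b) ^ 2 = dq z ∧ a = (1 / z - rt z + (a - b)) / 2 ∧ b = (1 / z - rt z - (a - b)) / 2 := by
  have e1 : a + b = 1 / z - rt z := by
    have h0 := h.ne_zero
    have := h.sum; field_simp; linear_combination this
  refine ⟨h.sq_sub, ?_, ?_⟩
  · rw [← e1]; ring
  · rw [← e1]; ring

theorem Roots.potDiff {z a b : ℂ} (h : Roots z a b (rt z)) :
    hw a - hw b = potDiff z (a - b) := by
  obtain ⟨-, h1, h2⟩ := h.eq_of_rt
  rw [HermitePade.potDiff, ← h1, ← h2]

theorem sq_eq_dq {z δ δ' : ℂ} (h : δ ^ 2 = dq z) (h' : δ' ^ 2 = dq z) : δ = δ' ∨ δ = -δ' :=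
  sq_eq_sq_iff_eq_or_eq_neg.1 (h.trans h'.symm)

theorem potDiff_sq {z δ δ' : ℂ} (h : δ ^ 2 = dq z) (h' : δ' ^ 2 = dq z) :
    potDiff z δ ^ 2 = potDiff z δ' ^ 2 := by
  rcases sq_eq_dq h h' with e | e
  · rw [e]
  · rw [e, potDiff_neg, neg_sq]

/-- The zero set of the differences of potentials of the two left preimages. -/
def IsLevel (z : ℂ) : Prop := potDiff z (dp z) = 0

theorem isLevel_iff {z δ : ℂ} (h : δ ^ 2 = dq z) : IsLevel z ↔ potDiff z δ = 0 := by
  have := potDiff_sq h (dp_sq z)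
  rw [IsLevel, ← sq_eq_zero_iff (a := potDiff z δ), this, sq_eq_zero_iff]

theorem Roots.isLevel {z a b : ℂ} (h : Roots z a b (rt z)) : IsLevel z ↔ hw a = hw b := by
  rw [isLevel_iff h.eq_of_rt.1, ← h.potDiff, sub_eq_zero]

theorem qz_analyticAt {z : ℂ} (hz : z.re < 0) : AnalyticAt ℂ qz z :=
  analyticAt_id.mul (rt_analyticAt hz)

theorem left_ne_zero {z : ℂ} (hz : z.re < 0) : z ≠ 0 := by rintro rfl; simp at hz

theorem dq_analyticAt {z : ℂ} (hz : z.re < 0) : AnalyticAt ℂ dq z := by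
  unfold dq
  apply analyticAt_const.add
  exact analyticAt_const.div (analyticAt_const.mul ((qz_analyticAt hz).pow 2))
    (mul_ne_zero three_ne_zero (pow_ne_zero _ (qz_ne_zero hz.le (left_ne_zero hz))))

/-- `dq z` is real and at most `0` exactly when `q²` lies in `[-1/3, 0)`, that is, when `q` is
imaginary with `|q|² ≤ 1/3`. -/
theorem dq_slitPlane {z : ℂ} (hz : z.re ≤ 0) (h0 : z ≠ 0)
    (h : (qz z).re = 0 → 1 / 3 < (qz z).im ^ 2) : dq z ∈ Complex.slitPlane := by
  have hq := qz_ne_zero hz h0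
  rw [Complex.mem_slitPlane_iff]
  by_contra hc
  push Not at hc
  obtain ⟨h1, h2⟩ := hc
  set q := qz z
  have e : q ^ 2 * (3 * (dq z - 1)) = 1 := by
    unfold dq; simp only [add_sub_cancel_left]; field_simp
    exact div_self (pow_ne_zero 2 hq)
  set d := (dq z).re with hd
  have ed : dq z = (d : ℂ) := by apply Complex.ext <;> simp [hd, h2]
  rw [ed] at e
  have e1 := congrArg Complex.re e
  have e2 := congrArg Complex.im e
  simp [pow_two] at e1 e2
  have hne : d - 1 ≠ 0 := by
    intro h; rw [h] at e1; norm_num at e1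
  have e3 : q.re * q.im = 0 := by
    have : q.re * q.im + q.im * q.re = 0 := by
      rcases e2 with h | h
      · exact h
      · exact absurd h hne
    linarith
  have hre : q.re = 0 := by
    rcases mul_eq_zero.1 e3 with h | h
    · exact h
    · rw [h] at e1
      nlinarith [mul_self_nonneg q.re]
  have := h hre
  rw [hre] at e1
  nlinarith

theorem dp_analyticAt {z : ℂ} (hz : z.re < 0) (h : (qz z).re = 0 → 1 / 3 < (qz z).im ^ 2) :
    AnalyticAt ℂ dp z :=
  (csq_analyticAt (dq_slitPlane hz.le (left_ne_zero hz) h)).comp (dq_analyticAt hz)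

theorem dp_re_pos {z : ℂ} (hz : z.re ≤ 0) (h0 : z ≠ 0)
    (h : (qz z).re = 0 → 1 / 3 < (qz z).im ^ 2) : 0 < (dp z).re :=
  csq_re_pos (dq_slitPlane hz h0 h)

/-- The complementary cut: `1 + 3q²` is real and at most `0` exactly when `q` is imaginary with
`|q|² ≥ 1/3`. -/
theorem dt_arg_slitPlane {q : ℂ} (h : q.re = 0 → q.im ^ 2 < 1 / 3) :
    1 + 3 * q ^ 2 ∈ Complex.slitPlane := by
  rw [Complex.mem_slitPlane_iff]
  by_contra hc
  push Not at hc
  obtain ⟨h1, h2⟩ := hc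
  simp [pow_two] at h1 h2
  have h3 : q.re * q.im = 0 := by linarith
  rcases mul_eq_zero.1 h3 with h4 | h4
  · have := h h4
    rw [h4] at h1; nlinarith
  · rw [h4] at h1; nlinarith [mul_self_nonneg q.re]

theorem dt_analyticAt {z : ℂ} (hz : z.re < 0) (h : (qz z).re = 0 → (qz z).im ^ 2 < 1 / 3) :
    AnalyticAt ℂ dt z := by
  have hq := qz_analyticAt hz
  apply AnalyticAt.neg
  apply AnalyticAt.div
  · exact (csq_analyticAt (dt_arg_slitPlane h)).comp_of_eq
      (analyticAt_const.add (analyticAt_const.mul (hq.pow 2))) rfl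
  · exact analyticAt_const.mul hq
  · apply mul_ne_zero _ (qz_ne_zero hz.le (left_ne_zero hz))
    rw [Complex.ofReal_ne_zero]; positivity

/-- For `s = csq (1 + 3p²)` the imaginary part of `s²` gives `Re s Im s = 3 Re p Im p`, so `Im s`
and `Im p` do not have opposite signs, and both terms of `Re s Re p + Im s Im p` are nonnegative. -/
theorem csq_div_re_pos {p : ℂ} (hp : 0 < p.re) : 0 < (csq (1 + 3 * p ^ 2) / p).re := by
  have hs := csq_re_pos (dt_arg_slitPlane (q := p) (fun h => absurd h hp.ne'))
  have e := congrArg Complex.im (csq_sq (1 + 3 * p ^ 2))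
  set s := csq (1 + 3 * p ^ 2)
  simp [pow_two] at e
  rw [Complex.div_re, ← add_div]
  apply div_pos _ (Complex.normSq_pos.2 (fun h => by simp [h] at hp))
  have : 0 ≤ s.im * p.im := by
    have h1 : s.re * (s.im * p.im) = 3 * p.re * p.im ^ 2 := by linear_combination p.im / 2 * e
    have h2 : 0 ≤ s.re * (s.im * p.im) := by rw [h1]; positivity
    exact nonneg_of_mul_nonneg_right h2 hs
  nlinarith [mul_pos hs hp]

theorem dt_re {z : ℂ} : ((qz z).re < 0 → 0 < (dt z).re) ∧ (0 < (qz z).re → (dt z).re < 0) := by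
  have h3 : (0 : ℝ) < √3 := by positivity
  have e : ∀ q : ℂ, csq (1 + 3 * q ^ 2) / (√3 * q) = ((1 / √3 : ℝ) : ℂ) * (csq (1 + 3 * q ^ 2) / q) := by
    intro q
    push_cast
    rw [div_mul_div_comm, one_mul]
  constructor
  · intro h
    have h1 := csq_div_re_pos (p := -qz z) (by simpa using h)
    rw [neg_sq] at h1
    rw [dt, e, ← mul_neg, ← div_neg, Complex.re_ofReal_mul]
    positivity
  · intro h
    have h1 := csq_div_re_pos (p := qz z) h
    rw [dt, e, Complex.neg_re, Complex.re_ofReal_mul, neg_lt_zero]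
    positivity

theorem dt_eq_dp {z : ℂ} (hz : z.re ≤ 0) (h0 : z ≠ 0) (hq : (qz z).re < 0) : dt z = dp z := by
  rcases sq_eq_dq (dt_sq hz h0) (dp_sq z) with e | e
  · exact e
  · have h1 := dt_re.1 hq
    have h2 := csq_re_nonneg (dq z)
    rw [e, dp, Complex.neg_re] at h1; linarith

theorem dt_eq_neg_dp {z : ℂ} (hz : z.re ≤ 0) (h0 : z ≠ 0) (hq : 0 < (qz z).re) : dt z = -dp z := by
  rcases sq_eq_dq (dt_sq hz h0) (dp_sq z) with e | e
  · have h1 := dt_re.2 hq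
    have h2 := csq_re_nonneg (dq z)
    rw [e, dp] at h1; linarith
  · exact e

/-- The derivative of the difference of potentials along a curve. -/
theorem hasDerivAt_potDiff {δ : ℂ → ℂ} {γ : ℝ → ℂ} {t : ℝ} {γ' : ℂ} (hz : (γ t).re < 0)
    (hδ : AnalyticAt ℂ δ (γ t)) (h : ∀ᶠ z in 𝓝 (γ t), δ z ^ 2 = dq z) (hγ : HasDerivAt γ γ' t) :
    HasDerivAt (fun s => potDiff (γ s) (δ (γ s))) (3 * (δ (γ t) * γ').re) t := by
  have h0 := left_ne_zero hz
  have hs : AnalyticAt ℂ (fun z => 1 / z - rt z) (γ t) :=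
    (analyticAt_const.div analyticAt_id h0).sub (rt_analyticAt hz)
  have hr : ∀ᶠ z in 𝓝 (γ t), Roots z ((1 / z - rt z + δ z) / 2) ((1 / z - rt z - δ z) / 2) (rt z) := by
    filter_upwards [h, left_mem_nhds hz] with z h1 h2
    exact roots_of_sq h2.le (left_ne_zero h2) h1
  have d1 := hasDerivAt_hw_comp (ψ := fun z => (1 / z - rt z + δ z) / 2) (hs.add hδ).div_const
    (hr.mono fun z h => h.rot.eqn) hγ
  have d2 := hasDerivAt_hw_comp (ψ := fun z => (1 / z - rt z - δ z) / 2) (hs.sub hδ).div_const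
    (hr.mono fun z h => h.rot.rot.eqn) hγ
  have d3 := d1.sub d2
  convert! d3 using 1
  rw [← Complex.sub_re]
  have : 3 * ((1 / γ t - rt (γ t) + δ (γ t)) / 2) * γ' - 3 * ((1 / γ t - rt (γ t) - δ (γ t)) / 2) * γ'
      = ((3 : ℝ) : ℂ) * (δ (γ t) * γ') := by push_cast; ring
  rw [this, Complex.re_ofReal_mul]

theorem hasDerivAt_potDiff_left {δ : ℂ → ℂ} {x y : ℝ} (hx : x < 0)
    (hδ : AnalyticAt ℂ δ (pt x y)) (h : ∀ᶠ z in 𝓝 (pt x y), δ z ^ 2 = dq z) :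
    HasDerivAt (fun x => potDiff (pt x y) (δ (pt x y))) (3 * (δ (pt x y)).re) x := by
  have := hasDerivAt_potDiff (γ := fun x => pt x y) (t := x) hx hδ h (hasDerivAt_pt_left x y)
  simpa using this

theorem hasDerivAt_potDiff_right {δ : ℂ → ℂ} {x y : ℝ} (hx : x < 0)
    (hδ : AnalyticAt ℂ δ (pt x y)) (h : ∀ᶠ z in 𝓝 (pt x y), δ z ^ 2 = dq z) :
    HasDerivAt (fun y => potDiff (pt x y) (δ (pt x y))) (-(3 * (δ (pt x y)).im)) y := by
  have := hasDerivAt_potDiff (γ := fun y => pt x y) (t := y) hx hδ h (hasDerivAt_pt_right x y)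
  simpa using this

/-- Continuity of the difference of potentials. -/
theorem continuousWithinAt_potDiff {δ : ℂ → ℂ} {z : ℂ} (hz : z.re ≤ 0) (h0 : z ≠ 0)
    (hδ : ContinuousWithinAt δ {z | z.re ≤ 0} z) (h : δ z ^ 2 = dq z) :
    ContinuousWithinAt (fun z => potDiff z (δ z)) {z | z.re ≤ 0} z := by
  have hR := roots_of_sq hz h0 h
  have hs : ContinuousWithinAt (fun z => 1 / z - rt z) {z | z.re ≤ 0} z :=
    (continuousWithinAt_const.div continuousWithinAt_id h0).sub (rt_continuousWithinAt hz)
  exact ((continuousAt_hw (cube_sub_ne_zero hR.rot.eqn)).comp_continuousWithinAt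
      (f := fun z => (1 / z - rt z + δ z) / 2) ((hs.add hδ).div_const 2)).sub
    ((continuousAt_hw (cube_sub_ne_zero hR.rot.rot.eqn)).comp_continuousWithinAt
      (f := fun z => (1 / z - rt z - δ z) / 2) ((hs.sub hδ).div_const 2))

theorem qz_continuousWithinAt {z : ℂ} (hz : z.re ≤ 0) :
    ContinuousWithinAt qz {z | z.re ≤ 0} z := continuousWithinAt_id.mul (rt_continuousWithinAt hz)

theorem dq_continuousWithinAt {z : ℂ} (hz : z.re ≤ 0) (h0 : z ≠ 0) :
    ContinuousWithinAt dq {z | z.re ≤ 0} z := by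
  unfold dq
  apply continuousWithinAt_const.add
  exact continuousWithinAt_const.div (continuousWithinAt_const.mul ((qz_continuousWithinAt hz).pow 2))
    (mul_ne_zero three_ne_zero (pow_ne_zero _ (qz_ne_zero hz h0)))

theorem dp_continuousWithinAt {z : ℂ} (hz : z.re ≤ 0) (h0 : z ≠ 0)
    (h : dq z ∈ Complex.slitPlane ∨ dq z = 0) : ContinuousWithinAt dp {z | z.re ≤ 0} z := by
  have : ContinuousAt csq (dq z) := by
    rcases h with h | h
    · exact (csq_analyticAt h).continuousAt
    · rw [h]; exact csq_continuousAt_zero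
  exact this.comp_continuousWithinAt (dq_continuousWithinAt hz h0)

theorem tendsto_dp_line (y : ℝ) : Tendsto (fun x => dp (pt x y)) atBot (𝓝 1) := by
  have hq : Tendsto (fun x => qz (pt x y)) atBot (Bornology.cobounded ℂ) := by
    rw [← tendsto_norm_atTop_iff_cobounded]
    apply tendsto_atTop_mono (f := fun x : ℝ => -(qz (pt x y)).re)
    · intro x
      exact (neg_le_abs _).trans (Complex.abs_re_le_norm _)
    · exact tendsto_neg_atBot_atTop.comp (tendsto_qz_re y)
  have h1 : Tendsto (fun x => dq (pt x y)) atBot (𝓝 1) := by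
    have h2 : Tendsto (fun x => (qz (pt x y))⁻¹) atBot (𝓝 0) :=
      tendsto_inv₀_cobounded.comp hq
    have h3 : Tendsto (fun x => 1 + (1 / 3 : ℂ) * ((qz (pt x y))⁻¹) ^ 2) atBot
        (𝓝 (1 + (1 / 3 : ℂ) * 0 ^ 2)) := ((h2.pow 2).const_mul _).const_add _
    have h4 : (1 + (1 / 3 : ℂ) * 0 ^ 2) = 1 := by norm_num
    rw [h4] at h3
    refine h3.congr fun x => ?_
    unfold dq; rw [inv_pow]; simp [mul_comm]
  have h5 : csq 1 = 1 := by unfold csq; simp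
  have h6 := (csq_analyticAt Complex.one_mem_slitPlane).continuousAt.tendsto.comp h1
  rw [h5] at h6
  exact h6

/-- A function on the real line whose derivative tends to `3` at `-∞`. -/
theorem tendsto_atBot_of_deriv {f f' : ℝ → ℝ} {b : ℝ} (h : ∀ x < b, HasDerivAt f (f' x) x)
    (hl : Tendsto f' atBot (𝓝 3)) : Tendsto f atBot atBot := by
  obtain ⟨N, hN⟩ : ∃ N, ∀ x ≤ N, 1 ≤ f' x := by
    have := hl.eventually (le_mem_nhds (by norm_num : (1 : ℝ) < 3))
    exact eventually_atBot.1 this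
  set M := min N (b - 1) with hM
  have key : ∀ x ≤ M, f x ≤ f M - M + x := by
    intro x hx
    have hmono : MonotoneOn (fun x => f x - x) (Iic M) := by
      apply monotoneOn_of_deriv_nonneg (convex_Iic M)
      · intro x hx
        have hxb : x < b := lt_of_le_of_lt (le_trans hx (min_le_right _ _)) (by linarith)
        exact ((h x hxb).sub (hasDerivAt_id x)).continuousAt.continuousWithinAt
      · intro x hx
        rw [interior_Iic] at hx
        have hxb : x < b := lt_of_lt_of_le hx ((min_le_right _ _).trans (by linarith))
        exact ((h x hxb).sub (hasDerivAt_id x)).differentiableAt.differentiableWithinAt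
      · intro x hx
        rw [interior_Iic] at hx
        have hxb : x < b := lt_of_lt_of_le hx ((min_le_right _ _).trans (by linarith))
        have := ((h x hxb).sub (hasDerivAt_id x)).deriv
        have e : deriv (fun x => f x - x) x = f' x - 1 := this
        rw [e]
        have := hN x (hx.le.trans (min_le_left _ _)); linarith
    have := hmono (mem_Iic.2 hx) (mem_Iic.2 le_rfl) hx
    simp only at this; linarith
  refine tendsto_atBot_mono' atBot ?_ (tendsto_atBot_add_const_left _ (f M - M) tendsto_id)
  filter_upwards [eventually_le_atBot M] with x hx using key x hx

theorem dt_continuousWithinAt {z : ℂ} (hz : z.re ≤ 0) (h0 : z ≠ 0)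
    (h : (qz z).re = 0 → (qz z).im ^ 2 < 1 / 3) : ContinuousWithinAt dt {z | z.re ≤ 0} z := by
  have hq := qz_continuousWithinAt hz
  apply ContinuousWithinAt.neg
  apply ContinuousWithinAt.div
  · exact (csq_analyticAt (dt_arg_slitPlane h)).continuousAt.comp_continuousWithinAt
      (f := fun z => 1 + 3 * qz z ^ 2)
      (continuousWithinAt_const.add (continuousWithinAt_const.mul (hq.pow 2)))
  · exact continuousWithinAt_const.mul hq
  · apply mul_ne_zero _ (qz_ne_zero hz h0)
    rw [Complex.ofReal_ne_zero]; positivity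

/-! ### Signs of the real part of `q` on horizontal lines -/

theorem mapsTo_pt_left (y : ℝ) : MapsTo (fun x => pt x y) (Iic 0) {z | z.re ≤ 0} := fun _ hx => hx

theorem qz_line_continuousOn (y : ℝ) : ContinuousOn (fun x => (qz (pt x y)).re) (Iic 0) := by
  intro x hx
  exact Complex.continuous_re.continuousAt.comp_continuousWithinAt
    ((qz_continuousWithinAt (z := pt x y) hx).comp (f := fun x => pt x y) (x := x)
      (continuous_pt_left y).continuousWithinAt (mapsTo_pt_left y))

/-- On the axis `Re q = -Im z Im (rt z)`, and `root_im` makes `Im z` a negative multiple of `Im (rt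
z)`. -/
theorem qz_im_axis {z : ℂ} (hz : z.re = 0) (hy : z.im ≠ 0) : 0 < (qz z).re := by
  obtain ⟨k, hk, e⟩ := root_im (rt_eqn hz.le)
  rw [qz, Complex.mul_re, hz, e]
  have : (rt z).im ≠ 0 := by
    intro h; rw [h] at e; simp at e; exact hy e
  have h2 : 0 < (rt z).im ^ 2 := by positivity
  nlinarith

/-- The sign of the real part of `qz` on a horizontal line. -/
theorem exists_line_sign {y : ℝ} (hy : y ≠ 0) :
    ∃ c < 0, (qz (pt c y)).re = 0 ∧ (∀ x < c, (qz (pt x y)).re < 0) ∧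
      ∀ x, c < x → x ≤ 0 → 0 < (qz (pt x y)).re := by
  have hc := qz_line_continuousOn y
  have h0 : 0 < (qz (pt 0 y)).re := qz_im_axis rfl hy
  have hbot := tendsto_qz_re y
  have hneg : ∀ b, ∃ x < b, (qz (pt x y)).re < 0 := by
    intro b
    obtain ⟨x, h1, h2⟩ := ((eventually_lt_atBot b).and (hbot.eventually (eventually_lt_atBot 0))).exists
    exact ⟨x, h1, h2⟩
  have ivt : ∀ a b, a ≤ b → b ≤ 0 → (qz (pt a y)).re ≤ 0 → 0 ≤ (qz (pt b y)).re →
      ∃ x, a ≤ x ∧ x ≤ b ∧ (qz (pt x y)).re = 0 := by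
    intro a b hab hb h1 h2
    obtain ⟨x, hx, e⟩ := intermediate_value_Icc hab
      (hc.mono fun x hx => mem_Iic.2 (hx.2.trans hb)) ⟨h1, h2⟩
    exact ⟨x, hx.1, hx.2, e⟩
  have nz : ∀ x ≤ 0, (qz (pt x y)).re = 0 → x < 0 := by
    intro x hx h
    refine hx.lt_of_ne ?_
    rintro rfl; exact h0.ne' h
  obtain ⟨a, ha, hqa⟩ := hneg 0
  obtain ⟨c, -, hc0, hqc⟩ := ivt a 0 ha.le le_rfl hqa.le h0.le
  have hc1 := nz c hc0 hqc
  -- With one zero on the line, the signs are those at the two ends: negative at `-∞` and positive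
  -- on the imaginary axis.
  have uniq : ∀ x ≤ 0, (qz (pt x y)).re = 0 → x = c := fun x hx h =>
    qz_curve_inj (z := pt x y) (z' := pt c y) (nz x hx h) hc1 h hqc rfl
  refine ⟨c, hc1, hqc, ?_, ?_⟩
  · intro x hx
    by_contra hcon
    push Not at hcon
    obtain ⟨a, ha, hqa⟩ := hneg x
    obtain ⟨x', -, h2, h3⟩ := ivt a x ha.le (hx.le.trans hc0) hqa.le hcon
    have := uniq x' (h2.trans (hx.le.trans hc0)) h3
    linarith
  · intro x hx hx0
    by_contra hcon
    push Not at hcon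
    obtain ⟨x', h1, h2, h3⟩ := ivt x 0 hx0 le_rfl hcon h0.le
    have := uniq x' h2 h3
    linarith

/-- Below the height of `z₁` the curve `Re q = 0` runs to the right of the vertical line through
`z₁`. -/
theorem qz_re_neg_left {x y : ℝ} (hx : x ≤ z₁.re) (hy : y ^ 2 ≤ z₁.im ^ 2)
    (h : x < z₁.re ∨ y ^ 2 < z₁.im ^ 2) : (qz (pt x y)).re < 0 := by
  have hn := z₁_re_neg
  by_cases hy0 : y = 0
  · exact (qz_real (z := pt x y) (hx.trans_lt hn) hy0).1
  · obtain ⟨c, hc, hq, h1, -⟩ := exists_line_sign hy0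
    apply h1
    obtain ⟨a, b, -⟩ := qz_curve_lt (z := pt c y) hc hq
    rcases hy.lt_or_eq with h2 | h2
    · exact hx.trans_lt (a h2).1
    · rw [← (b h2).1] at h hx
      rcases h with h | h
      · exact h
      · exact absurd h2 h.ne

theorem z₁_eq_pt : z₁ = pt z₁.re z₁.im := rfl

/-- The point of `Re q = 0` at the height of `z₁` has the abscissa of `z₁`, hence is `z₁`, with
`|q|² = 1/3`. The sign comes from `qz_im_pos`. -/
theorem qz_z₁ : qz z₁ = Complex.I * (1 / √3 : ℝ) := by
  obtain ⟨c, hc, hq, h1, h2⟩ := exists_line_sign z₁_im_pos.ne'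
  obtain ⟨-, b, -⟩ := qz_curve_lt (z := pt c z₁.im) hc hq
  obtain ⟨e1, e2⟩ := b rfl
  simp only [pt_re] at e1
  subst e1
  rw [← z₁_eq_pt] at hq e2
  have hpos := qz_im_pos z₁_re_neg z₁_im_pos
  have e3 : (1 / √3) ^ 2 = (1 / 3 : ℝ) := by rw [div_pow, Real.sq_sqrt (by norm_num)]; norm_num
  have e4 : (qz z₁).im = 1 / √3 := by
    rw [← sq_eq_sq₀ hpos.le (by positivity), e2, e3]
  apply Complex.ext
  · simp [hq]
  · simp only [Complex.mul_im, Complex.I_re, Complex.I_im, Complex.ofReal_re, Complex.ofReal_im]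
    rw [e4]; ring

theorem dq_z₁ : dq z₁ = 0 := by
  have e3 : ((1 / √3 : ℝ) : ℂ) ^ 2 = 1 / 3 := by
    rw [← Complex.ofReal_pow, div_pow, Real.sq_sqrt (by norm_num)]; norm_num
  rw [dq, qz_z₁, mul_pow, Complex.I_sq, e3]; norm_num

theorem dp_z₁ : dp z₁ = 0 := by rw [dp, dq_z₁, csq_zero]

theorem dq_conj {z : ℂ} (hz : z.re ≤ 0) : dq (starRingEnd ℂ z) = starRingEnd ℂ (dq z) := by
  have h3 : (starRingEnd ℂ) 3 = 3 := map_ofNat _ 3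
  unfold dq; rw [qz_conj hz]; simp [h3]

theorem potDiff_conj {z : ℂ} (hz : z.re ≤ 0) (δ : ℂ) :
    potDiff (starRingEnd ℂ z) (starRingEnd ℂ δ) = potDiff z δ := by
  have h2 : (starRingEnd ℂ) 2 = 2 := map_ofNat _ 2
  unfold potDiff
  rw [rt_conj hz, ← hw_conj ((1 / z - rt z + δ) / 2), ← hw_conj ((1 / z - rt z - δ) / 2)]
  simp [h2]

theorem dp_conj {z : ℂ} (hz : z.re ≤ 0) (h : dq z ∈ Complex.slitPlane) :
    dp (starRingEnd ℂ z) = starRingEnd ℂ (dp z) := by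
  have h1 : (starRingEnd ℂ (dp z)) ^ 2 = dq (starRingEnd ℂ z) := by
    rw [dq_conj hz, ← map_pow, dp_sq]
  rcases sq_eq_dq (dp_sq (starRingEnd ℂ z)) h1 with e | e
  · exact e
  · have h2 := csq_re_nonneg (dq (starRingEnd ℂ z))
    have h3 := csq_re_pos h
    have h4 := congrArg Complex.re e
    simp only [dp, Complex.neg_re, Complex.conj_re] at h4
    linarith

theorem isLevel_conj {z : ℂ} (hz : z.re ≤ 0) : IsLevel (starRingEnd ℂ z) ↔ IsLevel z := by
  have h1 : (starRingEnd ℂ (dp z)) ^ 2 = dq (starRingEnd ℂ z) := by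
    rw [dq_conj hz, ← map_pow, dp_sq]
  rw [isLevel_iff h1, potDiff_conj hz, IsLevel]

/-! ### Monotonicity on lines -/

/-- The derivative in `x` is `3 Re δ`. This is the source of every uniqueness statement about zeros
on horizontal lines in the left half-plane. -/
theorem potDiff_line_strictMonoOn {a b y : ℝ} {δ : ℂ → ℂ} (hb : b ≤ 0)
    (hc : ContinuousOn (fun x => potDiff (pt x y) (δ (pt x y))) (Icc a b))
    (hδ : ∀ x ∈ Ioo a b, AnalyticAt ℂ δ (pt x y) ∧ (∀ᶠ z in 𝓝 (pt x y), δ z ^ 2 = dq z) ∧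
      0 < (δ (pt x y)).re) :
    StrictMonoOn (fun x => potDiff (pt x y) (δ (pt x y))) (Icc a b) := by
  apply strictMonoOn_of_deriv_pos (convex_Icc a b) hc
  intro x hx
  rw [interior_Icc] at hx
  obtain ⟨h1, h2, h3⟩ := hδ x hx
  rw [(hasDerivAt_potDiff_left (hx.2.trans_le hb) h1 h2).deriv]
  positivity

theorem potDiff_line_continuousOn {s : Set ℝ} {y : ℝ} {δ : ℂ → ℂ} (hs : s ⊆ Iic 0)
    (hne : ∀ x ∈ s, pt x y ≠ 0)
    (hδ : ∀ x ∈ s, ContinuousWithinAt δ {z | z.re ≤ 0} (pt x y) ∧ δ (pt x y) ^ 2 = dq (pt x y)) :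
    ContinuousOn (fun x => potDiff (pt x y) (δ (pt x y))) s := by
  intro x hx
  have := continuousWithinAt_potDiff (z := pt x y) (hs hx) (hne x hx) (hδ x hx).1 (hδ x hx).2
  exact this.comp (f := fun x => pt x y) (x := x) (continuous_pt_left y).continuousWithinAt
    fun x hx => hs hx

theorem dp_sq_eventually (z : ℂ) : ∀ᶠ z in 𝓝 z, dp z ^ 2 = dq z := Eventually.of_forall dp_sq

theorem dt_sq_eventually {z : ℂ} (hz : z.re < 0) : ∀ᶠ z in 𝓝 z, dt z ^ 2 = dq z := by
  filter_upwards [left_mem_nhds hz] with z h using dt_sq h.le (left_ne_zero h)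

theorem tendsto_potDiff_line {y b : ℝ} (hb : b ≤ 0)
    (h : ∀ x < b, (qz (pt x y)).re = 0 → 1 / 3 < (qz (pt x y)).im ^ 2) :
    Tendsto (fun x => potDiff (pt x y) (dp (pt x y))) atBot atBot := by
  apply tendsto_atBot_of_deriv (b := b) (f' := fun x => 3 * (dp (pt x y)).re)
  · intro x hx
    exact hasDerivAt_potDiff_left (hx.trans_le hb) (dp_analyticAt (hx.trans_le hb) (h x hx))
      (dp_sq_eventually _)
  · have := ((Complex.continuous_re.tendsto 1).comp (tendsto_dp_line y)).const_mul 3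
    simpa using this

/-- On the vertical segment below `z₁` the difference of potentials is positive. -/
theorem potDiff_segment_pos {y : ℝ} (h : y ^ 2 < z₁.im ^ 2) :
    0 < potDiff (pt z₁.re y) (dp (pt z₁.re y)) := by
  have hn := z₁_re_neg
  have hY := z₁_im_pos
  have hq : ∀ y : ℝ, y ^ 2 < z₁.im ^ 2 → (qz (pt z₁.re y)).re < 0 := fun y hy =>
    qz_re_neg_left le_rfl hy.le (Or.inr hy)
  have main : ∀ y : ℝ, 0 ≤ y → y < z₁.im → 0 < potDiff (pt z₁.re y) (dp (pt z₁.re y)) := by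
    intro y hy0 hy
    -- The value at the upper end `z₁` is zero and the derivative in `y` is `-3 Im dp`. From `dp² =
    -- 1 + 1/(3q²)`, the product `Re dp Im dp` has the sign of `-Re q Im q`, which is positive here.
    have anti : StrictAntiOn (fun y => potDiff (pt z₁.re y) (dp (pt z₁.re y))) (Icc 0 z₁.im) := by
      apply strictAntiOn_of_deriv_neg (convex_Icc _ _)
      · intro v hv
        have hcw : ContinuousWithinAt dp {z | z.re ≤ 0} (pt z₁.re v) := by
          apply dp_continuousWithinAt (z := pt z₁.re v) hn.le (left_ne_zero hn)
          rcases hv.2.lt_or_eq with h1 | h1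
          · left
            apply dq_slitPlane (z := pt z₁.re v) hn.le (left_ne_zero hn)
            intro h2
            exact absurd h2 (hq v (by nlinarith [hv.1])).ne
          · right; rw [h1]; exact dq_z₁
        exact (continuousWithinAt_potDiff (z := pt z₁.re v) hn.le (left_ne_zero hn) hcw
          (dp_sq _)).comp (continuous_pt_right _).continuousWithinAt fun _ _ => hn.le
      · intro v hv
        rw [interior_Icc] at hv
        have hqv := hq v (by nlinarith [hv.1, hv.2])
        rw [(hasDerivAt_potDiff_right hn (dp_analyticAt (z := pt z₁.re v) hn
          (fun h => absurd h hqv.ne)) (dp_sq_eventually _)).deriv]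
        have hqi := qz_im_pos (z := pt z₁.re v) hn hv.1
        have hre := dp_re_pos (z := pt z₁.re v) hn.le (left_ne_zero hn) (fun h => absurd h hqv.ne)
        have hsq := dp_sq (pt z₁.re v)
        set d := dp (pt z₁.re v)
        set q := qz (pt z₁.re v) with hqdef
        have hq0 : q ≠ 0 := fun h => by rw [h] at hqv; simp at hqv
        have e : q ^ 2 * (3 * (d ^ 2 - 1)) = 1 := by
          rw [hsq, dq, ← hqdef]; field_simp; ring
        have e1 := congrArg Complex.re e
        have e2 := congrArg Complex.im e
        simp [pow_two] at e1 e2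
        have hprod : d.re * d.im * ((q.re ^ 2 - q.im ^ 2) ^ 2 + 4 * (q.re * q.im) ^ 2) * 3
            = -(q.re * q.im) := by
          linear_combination (1 / 2) * (q.re ^ 2 - q.im ^ 2) * e2 - (q.re * q.im) * e1
        have hneg : 0 < -(q.re * q.im) := by nlinarith [mul_pos (neg_pos.2 hqv) hqi]
        have : 0 < d.im := by
          by_contra hcon
          push Not at hcon
          have h1 : d.re * d.im ≤ 0 := mul_nonpos_of_nonneg_of_nonpos hre.le hcon
          have h2 : d.re * d.im * ((q.re ^ 2 - q.im ^ 2) ^ 2 + 4 * (q.re * q.im) ^ 2) ≤ 0 :=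
            mul_nonpos_of_nonpos_of_nonneg h1 (by positivity)
          linarith
        linarith
    have h1 := anti ⟨hy0, hy.le⟩ ⟨hY.le, le_rfl⟩ hy
    simp only at h1
    rw [← z₁_eq_pt, dp_z₁, potDiff_zero] at h1
    exact h1
  rcases le_total 0 y with h0 | h0
  · exact main y h0 (lt_of_pow_lt_pow_left₀ 2 hY.le h)
  · have h1 := main (-y) (by linarith) (lt_of_pow_lt_pow_left₀ 2 hY.le (by rwa [neg_sq]))
    rw [← pt_conj, dp_conj (z := pt z₁.re y) hn.le, potDiff_conj (z := pt z₁.re y) hn.le] at h1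
    · exact h1
    · exact dq_slitPlane (z := pt z₁.re y) hn.le (left_ne_zero hn) fun h2 => absurd h2 (hq y h).ne

theorem isLevel_z₁ : IsLevel z₁ := by rw [IsLevel, dp_z₁, potDiff_zero]

theorem isLevel_corner {y : ℝ} (h : y ^ 2 = z₁.im ^ 2) : IsLevel (pt z₁.re y) ∧ dq (pt z₁.re y) = 0 := by
  rcases sq_eq_sq_iff_eq_or_eq_neg.1 h with e | e
  · rw [e, ← z₁_eq_pt]; exact ⟨isLevel_z₁, dq_z₁⟩
  · rw [e, ← pt_conj, isLevel_conj (z := pt z₁.re z₁.im) z₁_re_neg.le,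
      dq_conj (z := pt z₁.re z₁.im) z₁_re_neg.le, ← z₁_eq_pt, dq_z₁]
    exact ⟨isLevel_z₁, map_zero _⟩

theorem potDiff_left_strictMonoOn {y : ℝ} (hy : y ^ 2 ≤ z₁.im ^ 2) :
    StrictMonoOn (fun x => potDiff (pt x y) (dp (pt x y))) (Iic z₁.re) := by
  have hn := z₁_re_neg
  intro a ha b hb hab
  have := potDiff_line_strictMonoOn (a := a) (b := b) (y := y) (δ := dp) (hb.trans hn.le) ?_ ?_
  · exact this ⟨le_rfl, hab.le⟩ ⟨hab.le, le_rfl⟩ hab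
  · apply potDiff_line_continuousOn
    · exact fun x hx => hx.2.trans (hb.trans hn.le)
    · exact fun x hx => left_ne_zero (z := pt x y) (hx.2.trans_lt (hb.trans_lt hn))
    · intro x hx
      have hx1 : x < 0 := hx.2.trans_lt (hb.trans_lt hn)
      refine ⟨dp_continuousWithinAt (z := pt x y) hx1.le (left_ne_zero (z := pt x y) hx1) ?_, dp_sq _⟩
      by_cases hcor : x = z₁.re ∧ y ^ 2 = z₁.im ^ 2
      · right; rw [hcor.1]; exact (isLevel_corner hcor.2).2
      · left
        apply dq_slitPlane (z := pt x y) hx1.le (left_ne_zero (z := pt x y) hx1)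
        have : (qz (pt x y)).re < 0 := by
          apply qz_re_neg_left (hx.2.trans hb) hy
          by_contra hcon
          push Not at hcon
          exact hcor ⟨le_antisymm (hx.2.trans hb) hcon.1, le_antisymm hy hcon.2⟩
        exact fun h => absurd h this.ne
  · intro x hx
    have hx1 : x < z₁.re := hx.2.trans_le hb
    have hq : (qz (pt x y)).re < 0 := qz_re_neg_left hx1.le hy (Or.inl hx1)
    exact ⟨dp_analyticAt (z := pt x y) (hx1.trans hn) fun h => absurd h hq.ne, dp_sq_eventually _,
      dp_re_pos (z := pt x y) (hx1.trans hn).le (left_ne_zero (z := pt x y) (hx1.trans hn))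
        fun h => absurd h hq.ne⟩

/-! ### The cut in the left half-plane as a graph -/

theorem exists_fP {y : ℝ} (hy : y ^ 2 ≤ z₁.im ^ 2) : ∃ x ≤ z₁.re, IsLevel (pt x y) := by
  have hn := z₁_re_neg
  rcases hy.lt_or_eq with h | h
  -- The difference of potentials is positive on the segment below `z₁` and tends to `-∞` to the
  -- left.
  · have h1 := potDiff_segment_pos h
    have h2 := tendsto_potDiff_line (y := y) hn.le fun x hx h0 =>
      absurd h0 (qz_re_neg_left hx.le hy (Or.inl hx)).ne
    obtain ⟨a, ha, hna⟩ := ((eventually_lt_atBot z₁.re).and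
      (h2.eventually (eventually_lt_atBot 0))).exists
    have hcont : ContinuousOn (fun x => potDiff (pt x y) (dp (pt x y))) (Icc a z₁.re) := by
      apply potDiff_line_continuousOn
      · exact fun x hx => hx.2.trans hn.le
      · exact fun x hx => left_ne_zero (z := pt x y) (hx.2.trans_lt hn)
      · intro x hx
        have hx1 : x < 0 := hx.2.trans_lt hn
        refine ⟨dp_continuousWithinAt (z := pt x y) hx1.le (left_ne_zero (z := pt x y) hx1)
          (Or.inl ?_), dp_sq _⟩
        apply dq_slitPlane (z := pt x y) hx1.le (left_ne_zero (z := pt x y) hx1)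
        exact fun h0 => absurd h0 (qz_re_neg_left hx.2 hy (Or.inr h)).ne
    obtain ⟨x, hx, e⟩ := intermediate_value_Icc ha.le hcont ⟨hna.le, h1.le⟩
    exact ⟨x, hx.2, e⟩
  · exact ⟨z₁.re, le_rfl, (isLevel_corner h).1⟩

/-- The arc `Γ_P` is the graph of this function. -/
def fP (y : ℝ) : ℝ := Classical.epsilon fun x => x ≤ z₁.re ∧ IsLevel (pt x y)

theorem fP_spec {y : ℝ} (hy : y ^ 2 ≤ z₁.im ^ 2) : fP y ≤ z₁.re ∧ IsLevel (pt (fP y) y) := by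
  apply Classical.epsilon_spec (p := fun x => x ≤ z₁.re ∧ IsLevel (pt x y))
  obtain ⟨x, h⟩ := exists_fP hy
  exact ⟨x, h⟩

theorem fP_unique {x y : ℝ} (hy : y ^ 2 ≤ z₁.im ^ 2) (hx : x ≤ z₁.re) (h : IsLevel (pt x y)) :
    x = fP y :=
  (potDiff_left_strictMonoOn hy).injOn hx (fP_spec hy).1 (Eq.trans h (fP_spec hy).2.symm)

theorem fP_corner {y : ℝ} (hy : y ^ 2 = z₁.im ^ 2) : fP y = z₁.re :=
  (fP_unique hy.le le_rfl (isLevel_corner hy).1).symm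

theorem fP_lt {y : ℝ} (hy : y ^ 2 < z₁.im ^ 2) : fP y < z₁.re := by
  obtain ⟨h1, h2⟩ := fP_spec hy.le
  refine h1.lt_of_ne fun h => ?_
  rw [h] at h2
  exact (potDiff_segment_pos hy).ne' h2

theorem fP_neg {y : ℝ} (hy : y ^ 2 ≤ z₁.im ^ 2) : fP y < 0 := (fP_spec hy).1.trans_lt z₁_re_neg

theorem fP_even {y : ℝ} (hy : y ^ 2 ≤ z₁.im ^ 2) : fP (-y) = fP y := by
  obtain ⟨h1, h2⟩ := fP_spec hy
  symm
  apply fP_unique (by rwa [neg_sq]) h1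
  rw [← pt_conj]
  exact (isLevel_conj (z := pt (fP y) y) (h1.trans z₁_re_neg.le)).2 h2

theorem potDiff_neg_of_lt_fP {x y : ℝ} (hy : y ^ 2 ≤ z₁.im ^ 2) (hx : x < fP y) :
    potDiff (pt x y) (dp (pt x y)) < 0 := by
  have := potDiff_left_strictMonoOn hy (hx.le.trans (fP_spec hy).1) (fP_spec hy).1 hx
  exact this.trans_eq (fP_spec hy).2

/-! ### The difference of potentials on the imaginary axis -/

/-- For a preimage, `2/(w²-1) = 3zw - 3`. -/
theorem hw_root {z w : ℂ} (h : z * (w ^ 3 - w) = w ^ 2 - 1 / 3) :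
    hw w = 3 * (z * w).re - 3 - Real.log ‖w ^ 3 - w‖ := by
  have hN := sq_sub_one_ne_zero h
  have e : 2 / (w ^ 2 - 1) = ((3 : ℝ) : ℂ) * (z * w) - (3 : ℝ) := by
    push_cast
    field_simp
    linear_combination (-3 : ℂ) * h
  rw [hw, e, Complex.sub_re, Complex.re_ofReal_mul, Complex.ofReal_re]

/-- The difference of potentials at the point of the imaginary axis with preimage `i t`, `τ = t²`. -/
def axisDiff (τ : ℝ) : ℝ := 3 * τ / (τ + 1) + 1 / 2 * Real.log (4 / (3 * τ + 1) ^ 3)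

/-- The positive imaginary part of the point of the imaginary axis with preimage `- i t`. -/
def axisPoint (t : ℝ) : ℝ := (t ^ 2 + 1 / 3) / (t * (t ^ 2 + 1))

/-- For `z = iy` the preimages are `it` and a pair symmetric in the imaginary axis. The pair has
equal values of `|w³ - w|`, so `prod_cube` expresses the difference of potentials through `t` alone.
-/
theorem imag_axis {y : ℝ} (hy : y ≠ 0) :
    ((1 / pt 0 y - rt (pt 0 y) + dp (pt 0 y)) / 2).re = 0 ∧
    ((1 / pt 0 y - rt (pt 0 y) - dp (pt 0 y)) / 2).re < 0 ∧
    ∃ t : ℝ, 0 < t ∧ |y| = axisPoint t ∧ potDiff (pt 0 y) (dp (pt 0 y)) = axisDiff (t ^ 2) := by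
  obtain ⟨t, ht0, ht⟩ := exists_imag_root hy
  obtain ⟨s, hs, -, hR⟩ := imag_roots hy ht
  have hz : Complex.I * (y : ℂ) = pt 0 y := by rw [pt_eq]; push_cast; ring
  rw [hz] at hR
  set β := 1 / y + t with hβ
  set b := (-Complex.I * (β : ℝ) + s) / 2 with hb
  set a := (-Complex.I * (β : ℝ) - s) / 2 with ha
  have har : a.re = -s / 2 := by simp [ha]
  have hbr : b.re = s / 2 := by simp [hb]
  have hai : a.im = -β / 2 := by simp [ha]
  have hbi : b.im = -β / 2 := by simp [hb]
  have hbrt : b = rt (pt 0 y) := rt_unique (by simp) hR.rot.eqn (by rw [hbr]; positivity)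
  rw [hbrt] at hR
  -- Rotation has order three, so seven rotations act as one; the swap then puts `it` first.
  have hR2 : Roots (pt 0 y) (Complex.I * t) a (rt (pt 0 y)) := hR.rot.rot.rot.rot.rot.rot.rot.swap
  obtain ⟨h1, h2, h3⟩ := hR2.eq_of_rt
  have hre : (Complex.I * t - a).re = s / 2 := by rw [Complex.sub_re, har]; simp; ring
  have hdp : dp (pt 0 y) = Complex.I * t - a := by
    rcases sq_eq_dq (dp_sq (pt 0 y)) h1 with e | e
    · exact e
    · have h4 := csq_re_nonneg (dq (pt 0 y))
      have h5 := congrArg Complex.re e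
      rw [Complex.neg_re, hre, dp] at h5
      linarith
  rw [hdp, ← h2, ← h3]
  refine ⟨by simp, by rw [har]; linarith, |t|, by positivity, ?_, ?_⟩
  · have hk : t ^ 2 + 1 ≠ 0 := by positivity
    have e : y = -((t ^ 2 + 1 / 3) / (t * (t ^ 2 + 1))) := by
      field_simp
      linear_combination 3 * ht
    rw [e, axisPoint, abs_neg, abs_div, abs_mul, abs_of_pos (by positivity : 0 < t ^ 2 + 1 / 3),
      abs_of_pos (by positivity : 0 < t ^ 2 + 1), sq_abs]
  · rw [← hR2.potDiff, hw_root hR2.rot.rot.eqn, hw_root hR2.rot.eqn, sq_abs]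
    have hb2 : b = -starRingEnd ℂ a := by
      apply Complex.ext
      · rw [Complex.neg_re, Complex.conj_re, har, hbr]; ring
      · rw [Complex.neg_im, Complex.conj_im, hai, hbi]; ring
    have hba : ‖b ^ 3 - b‖ = ‖a ^ 3 - a‖ := by
      rw [hb2]
      have : (-starRingEnd ℂ a) ^ 3 - -starRingEnd ℂ a = -starRingEnd ℂ (a ^ 3 - a) := by
        simp; ring
      rw [this, norm_neg, Complex.norm_conj]
    have hprod := congrArg norm hR2.prod_cube
    rw [← hbrt] at hprod
    have hI : ‖(Complex.I * (t : ℂ)) ^ 3 - Complex.I * t‖ = |t| * (t ^ 2 + 1) := by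
      have : (Complex.I * (t : ℂ)) ^ 3 - Complex.I * t = ((-(t * (t ^ 2 + 1)) : ℝ) : ℂ) * Complex.I := by
        push_cast
        linear_combination (t : ℂ) ^ 3 * Complex.I * Complex.I_sq
      rw [this, norm_mul, Complex.norm_I, mul_one, Complex.norm_real, Real.norm_eq_abs, abs_neg,
        abs_mul, abs_of_pos (by positivity : 0 < t ^ 2 + 1)]
    have hny : ‖pt 0 y‖ = |y| := by
      rw [← hz, norm_mul, Complex.norm_I, one_mul, Complex.norm_real, Real.norm_eq_abs]
    simp only [norm_mul, norm_pow, norm_neg] at hprod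
    rw [hba, hny] at hprod
    norm_num at hprod
    have hI' := hI
    rw [mul_pow] at hI'
    have hprod' : 27 * |y| ^ 3 * (|t| * (t ^ 2 + 1) * ‖a ^ 3 - a‖ ^ 2) = 4 := by
      rw [← hI, ← hprod]; ring
    have hyt : |y| * (|t| * (t ^ 2 + 1)) = t ^ 2 + 1 / 3 := by
      rw [← abs_of_pos (by positivity : 0 < t ^ 2 + 1), ← abs_mul, ← abs_mul,
        ← abs_of_pos (by positivity : 0 < t ^ 2 + 1 / 3), ← abs_neg (t ^ 2 + 1 / 3)]
      congr 1
      linear_combination ht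
    have hT : 0 < |t| * (t ^ 2 + 1) := by positivity
    have hMa : 0 < ‖a ^ 3 - a‖ := norm_pos_iff.2 (cube_sub_ne_zero hR2.rot.rot.eqn)
    rw [hI, axisDiff]
    have e1 : 4 / (3 * t ^ 2 + 1) ^ 3 = (‖a ^ 3 - a‖ / (|t| * (t ^ 2 + 1))) ^ 2 := by
      have h27 : (3 * t ^ 2 + 1) ^ 3 = 27 * (|y| * (|t| * (t ^ 2 + 1))) ^ 3 := by rw [hyt]; ring
      rw [h27, ← hprod']
      have : |y| ≠ 0 := abs_ne_zero.2 hy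
      field_simp
    rw [e1, Real.log_pow, Real.log_div hMa.ne' hT.ne']
    have e2 : (pt 0 y * (Complex.I * t)).re = -(y * t) := by simp [Complex.mul_re]
    have e3 : (pt 0 y * a).re = (1 + y * t) / 2 := by
      rw [Complex.mul_re, hai]; simp [hβ]; field_simp; ring
    rw [e2, e3]
    have e4 : 3 * t ^ 2 / (t ^ 2 + 1) = -(3 * (3 * (y * t) + 1)) / 2 := by
      have hk : t ^ 2 + 1 ≠ 0 := by positivity
      rw [div_eq_iff hk]
      linear_combination (9 / 2 : ℝ) * ht
    rw [e4]
    push_cast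
    ring

theorem axisDiff_strictAntiOn : StrictAntiOn axisDiff (Ici 0) := by
  have hd : ∀ τ : ℝ, 0 ≤ τ → HasDerivAt axisDiff
      ((3 * 1 * (τ + 1) - 3 * τ * 1) / (τ + 1) ^ 2 + 1 / 2 *
        (((0 * (3 * τ + 1) ^ 3 - 4 * ((3 : ℕ) * (3 * τ + 1) ^ 2 * (3 * 1))) / ((3 * τ + 1) ^ 3) ^ 2)
          / (4 / (3 * τ + 1) ^ 3))) τ := by
    intro τ h
    unfold axisDiff
    apply HasDerivAt.add
    · apply HasDerivAt.div ((hasDerivAt_id τ).const_mul 3) ((hasDerivAt_id τ).add_const 1)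
      simp only [id]; positivity
    · apply HasDerivAt.const_mul
      apply HasDerivAt.log
      · apply HasDerivAt.div (hasDerivAt_const τ (4 : ℝ))
          ((((hasDerivAt_id τ).const_mul 3).add_const 1).pow 3)
        show (3 * τ + 1) ^ 3 ≠ 0
        positivity
      · positivity
  apply strictAntiOn_of_deriv_neg (convex_Ici 0)
  · exact fun τ h => (hd τ h).continuousAt.continuousWithinAt
  · intro τ h
    rw [interior_Ici] at h
    have h' : 0 < τ := h
    rw [(hd τ h'.le).deriv]
    -- The derivative collapses to a quotient that is visibly negative for `τ > 0`.
    have e : (3 * 1 * (τ + 1) - 3 * τ * 1) / (τ + 1) ^ 2 + 1 / 2 *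
        (((0 * (3 * τ + 1) ^ 3 - 4 * ((3 : ℕ) * (3 * τ + 1) ^ 2 * (3 * 1))) / ((3 * τ + 1) ^ 3) ^ 2)
          / (4 / (3 * τ + 1) ^ 3)) = -((3 * (3 * τ ^ 2 + 1)) / (2 * (τ + 1) ^ 2 * (3 * τ + 1))) := by
      push_cast
      field_simp
      ring
    rw [e, neg_lt_zero]
    positivity

theorem axisPoint_lt {t t' : ℝ} (ht : 0 < t) (h : t < t') : axisPoint t' < axisPoint t := by
  have ht' : 0 < t' := ht.trans h
  unfold axisPoint
  rw [div_lt_div_iff₀ (by positivity) (by positivity)]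
  have hd : 0 < t' - t := sub_pos.2 h
  nlinarith [mul_pos ht ht', mul_pos hd (mul_pos ht ht'), mul_pos hd (mul_pos (mul_pos ht ht') (mul_pos ht ht')),
    mul_pos hd (mul_pos ht ht), mul_pos hd (mul_pos ht' ht')]

theorem axisPoint_pos {t : ℝ} (ht : 0 < t) : 0 < axisPoint t := by unfold axisPoint; positivity

theorem log_one_add_bounds {x : ℝ} (h0 : 0 < x) (h1 : x < 1) :
    |x - x ^ 2 / 2 + x ^ 3 / 3 - x ^ 4 / 4 + x ^ 5 / 5 - x ^ 6 / 6 - Real.log (1 + x)|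
      ≤ x ^ 7 / (1 - x) := by
  have h := Real.abs_log_sub_add_sum_range_le (x := -x) (by rw [abs_neg, abs_of_pos h0]; exact h1) 6
  rw [abs_neg, abs_of_pos h0, ← abs_neg] at h
  convert h using 2
  simp [Finset.sum_range_succ]
  ring

/-- At the zero of `axisDiff (t²)` the number `4/(3t²+1)³` is close to `1.0603/32`. The logarithm is
therefore split into `log (1 + x) - 5 log 2` with small `x`, all decimals being rounded in the safe
direction. The points `1.146341` and `1.1463433` bracket the zero so closely that their images under
`axisPoint` give six decimals of `y*`. -/
theorem axisDiff_pos_of : 0 < axisDiff (1.146341 ^ 2) := by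
  have hA : (1 + 0.06028956 : ℝ) / 32 ≤ 4 / (3 * 1.146341 ^ 2 + 1) ^ 3 := by norm_num
  have hl := Real.log_le_log (by norm_num) hA
  rw [Real.log_div (by norm_num) (by norm_num), show (32 : ℝ) = 2 ^ 5 by norm_num,
    Real.log_pow] at hl
  have hb := (abs_le.1 (log_one_add_bounds (x := 0.06028956) (by norm_num) (by norm_num))).2
  have h2 := Real.log_two_lt_d9
  have e : (1.70359837 : ℝ) ≤ 3 * 1.146341 ^ 2 / (1.146341 ^ 2 + 1) := by norm_num
  unfold axisDiff
  generalize (3 * 1.146341 ^ 2 / (1.146341 ^ 2 + 1) : ℝ) = p at e ⊢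
  generalize Real.log (4 / (3 * 1.146341 ^ 2 + 1) ^ 3) = l at hl ⊢
  generalize Real.log (1 + 0.06028956) = m at hl hb
  norm_num at hl hb h2 e ⊢
  linarith

theorem axisDiff_neg_of : axisDiff (1.1463433 ^ 2) < 0 := by
  have hA : 4 / (3 * 1.1463433 ^ 2 + 1) ^ 3 ≤ (1 + 0.06027939 : ℝ) / 32 := by norm_num
  have hl := Real.log_le_log (by positivity) hA
  rw [Real.log_div (x := 1 + 0.06027939) (by norm_num) (by norm_num), show (32 : ℝ) = 2 ^ 5 by norm_num,
    Real.log_pow] at hl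
  have hb := (abs_le.1 (log_one_add_bounds (x := 0.06027939) (by norm_num) (by norm_num))).1
  have h2 := Real.log_two_gt_d9
  have e : 3 * 1.1463433 ^ 2 / (1.1463433 ^ 2 + 1) ≤ (1.70360134 : ℝ) := by norm_num
  unfold axisDiff
  generalize (3 * 1.1463433 ^ 2 / (1.1463433 ^ 2 + 1) : ℝ) = p at e ⊢
  generalize Real.log (4 / (3 * 1.1463433 ^ 2 + 1) ^ 3) = l at hl ⊢
  generalize Real.log (1 + 0.06027939) = m at hl hb
  norm_num at hl hb h2 e ⊢
  linarith

/-- The zero of the difference of potentials on the positive imaginary axis. -/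
theorem exists_axis_zero : ∃ y : ℝ, (0.621028 ≤ y ∧ y < 0.621029) ∧ y ^ 2 < z₁.im ^ 2 ∧
    ∀ x : ℝ, x ≠ 0 → (potDiff (pt 0 x) (dp (pt 0 x)) = 0 ↔ x ^ 2 = y ^ 2) ∧
      (0 < potDiff (pt 0 x) (dp (pt 0 x)) ↔ y ^ 2 < x ^ 2) := by
  have hc : ContinuousOn (fun t : ℝ => axisDiff (t ^ 2)) (Icc 1.146341 1.1463433) := by
    intro t _
    unfold axisDiff
    have h1 : t ^ 2 + 1 ≠ 0 := by positivity
    have h2 : (3 * t ^ 2 + 1) ^ 3 ≠ 0 := by positivity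
    have h3 : 4 / (3 * t ^ 2 + 1) ^ 3 ≠ 0 := by positivity
    apply ContinuousAt.continuousWithinAt
    fun_prop (disch := assumption)
  obtain ⟨t, ⟨hl, hr⟩, ht⟩ := intermediate_value_Icc' (by norm_num) hc
    ⟨axisDiff_neg_of.le, axisDiff_pos_of.le⟩
  simp only at ht
  have t0 : 0 < t := by linarith
  have hA : StrictAntiOn (fun t : ℝ => axisDiff (t ^ 2)) (Ioi 0) := fun a ha b hb hab =>
    axisDiff_strictAntiOn (sq_nonneg a) (sq_nonneg b) (pow_lt_pow_left₀ hab (le_of_lt ha) two_ne_zero)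
  have hP : StrictAntiOn axisPoint (Ioi 0) := fun a ha b _ hab => axisPoint_lt ha hab
  have b1 : axisPoint t ≤ axisPoint 1.146341 :=
    (hP.le_iff_ge t0 (by norm_num : (1.146341 : ℝ) ∈ Ioi 0)).2 hl
  have b2 : axisPoint 1.1463433 ≤ axisPoint t :=
    (hP.le_iff_ge (by norm_num : (1.1463433 : ℝ) ∈ Ioi 0) t0).2 hr
  have c1 : axisPoint 1.146341 < 0.621029 := by unfold axisPoint; norm_num
  have c2 : 0.621028 ≤ axisPoint 1.1463433 := by unfold axisPoint; norm_num
  refine ⟨axisPoint t, ⟨c2.trans b2, b1.trans_lt c1⟩, ?_, ?_⟩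
  -- `z₁_sq_re` gives `(Im z₁)² ≥ 1/2`, which exceeds `0.621029²`.
  · have h1 : axisPoint t ^ 2 < 0.621029 ^ 2 :=
      pow_lt_pow_left₀ (b1.trans_lt c1) (axisPoint_pos t0).le two_ne_zero
    have h2 := z₁_sq_re
    have h3 : (0.621029 : ℝ) ^ 2 < 1 / 2 := by norm_num
    nlinarith [sq_nonneg z₁.re]
  · intro x hx
    obtain ⟨-, -, s, s0, hs, e⟩ := imag_axis hx
    have k : x ^ 2 = axisPoint s ^ 2 := by rw [← hs, sq_abs]
    rw [e, k, ← ht]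
    rw [sq_eq_sq₀ (axisPoint_pos s0).le (axisPoint_pos t0).le,
      pow_lt_pow_iff_left₀ (axisPoint_pos t0).le (axisPoint_pos s0).le two_ne_zero,
      hP.lt_iff_gt t0 s0, hP.injOn.eq_iff s0 t0]
    -- `axisPoint` and `axisDiff (t²)` both decrease in `t`, so the difference of potentials
    -- increases with the height on the axis.
    exact ⟨hA.injOn.eq_iff s0 t0, hA.lt_iff_gt t0 s0⟩

/-! ### Horizontal lines in the left half-plane -/

theorem qz_curve_upper {x y : ℝ} (hx : x ≤ 0) (hy : z₁.im ^ 2 ≤ y ^ 2)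
    (hc : ¬(x = z₁.re ∧ y ^ 2 = z₁.im ^ 2)) :
    (qz (pt x y)).re = 0 → 1 / 3 < (qz (pt x y)).im ^ 2 := by
  intro hq
  have hy0 : y ≠ 0 := by rintro rfl; nlinarith [z₁_im_pos]
  rcases hx.lt_or_eq with h | h
  · obtain ⟨-, h2, h3⟩ := qz_curve_lt (z := pt x y) h hq
    rcases hy.lt_or_eq with e | e
    · exact h3 e
    · exact absurd ⟨(h2 e.symm).1, e.symm⟩ hc
  · exact absurd hq (qz_im_axis (z := pt x y) h hy0).ne'

theorem pt_ne_zero_of_im {x y : ℝ} (hy : y ≠ 0) : pt x y ≠ 0 := fun h => hy (congrArg Complex.im h)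

theorem upper_line_strictMonoOn {y : ℝ} (hy : z₁.im ^ 2 ≤ y ^ 2) :
    StrictMonoOn (fun x => potDiff (pt x y) (dp (pt x y))) (Iic 0) := by
  have hn := z₁_re_neg
  have hy0 : y ≠ 0 := by rintro rfl; nlinarith [z₁_im_pos]
  have key : ∀ a b : ℝ, b ≤ 0 → (∀ x ∈ Ioo a b, x ≠ z₁.re) →
      StrictMonoOn (fun x => potDiff (pt x y) (dp (pt x y))) (Icc a b) := by
    intro a b hb hab
    apply potDiff_line_strictMonoOn hb
    · apply potDiff_line_continuousOn (fun x hx => hx.2.trans hb) (fun x _ => pt_ne_zero_of_im hy0)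
      intro x hx
      have hx0 := hx.2.trans hb
      refine ⟨dp_continuousWithinAt (z := pt x y) hx0 (pt_ne_zero_of_im hy0) ?_, dp_sq _⟩
      by_cases hcor : x = z₁.re ∧ y ^ 2 = z₁.im ^ 2
      · right; rw [hcor.1]; exact (isLevel_corner hcor.2).2
      · left
        exact dq_slitPlane (z := pt x y) hx0 (pt_ne_zero_of_im hy0) (qz_curve_upper hx0 hy hcor)
    · intro x hx
      have hx1 : x < 0 := hx.2.trans_le hb
      have hq := qz_curve_upper hx1.le hy fun h => hab x hx h.1
      exact ⟨dp_analyticAt (z := pt x y) hx1 hq, dp_sq_eventually _,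
        dp_re_pos (z := pt x y) hx1.le (pt_ne_zero_of_im hy0) hq⟩
  intro a _ b hb hab
  -- At the height of the branch points `dp` is only continuous at the corner, so the line is split
  -- there.
  by_cases h : a < z₁.re ∧ z₁.re < b
  · have h1 := key a z₁.re hn.le (fun x hx => hx.2.ne) ⟨le_rfl, h.1.le⟩ ⟨h.1.le, le_rfl⟩ h.1
    have h2 := key z₁.re b hb (fun x hx => hx.1.ne') ⟨le_rfl, h.2.le⟩ ⟨h.2.le, le_rfl⟩ h.2
    exact h1.trans h2
  · refine key a b hb ?_ ⟨le_rfl, hab.le⟩ ⟨hab.le, le_rfl⟩ hab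
    rintro x hx rfl
    exact h hx

theorem upper_axis_pos {y : ℝ} (hy : z₁.im ^ 2 ≤ y ^ 2) : 0 < potDiff (pt 0 y) (dp (pt 0 y)) := by
  obtain ⟨y₀, -, h1, h2⟩ := exists_axis_zero
  have hy0 : y ≠ 0 := by rintro rfl; nlinarith [z₁_im_pos]
  exact (h2 y hy0).2.2 (h1.trans_le hy)

theorem exists_fE {y : ℝ} (hy : z₁.im ^ 2 ≤ y ^ 2) : ∃ x < 0, IsLevel (pt x y) := by
  have hn := z₁_re_neg
  have hy0 : y ≠ 0 := by rintro rfl; nlinarith [z₁_im_pos]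
  rcases hy.lt_or_eq with h | h
  · have hq : ∀ x ≤ 0, (qz (pt x y)).re = 0 → 1 / 3 < (qz (pt x y)).im ^ 2 := fun x hx =>
      qz_curve_upper hx hy fun hc => h.ne' hc.2
    obtain ⟨a, ha, hna⟩ := ((eventually_lt_atBot 0).and ((tendsto_potDiff_line le_rfl
      fun x hx => hq x (le_of_lt hx)).eventually (eventually_lt_atBot 0))).exists
    have hcont : ContinuousOn (fun x => potDiff (pt x y) (dp (pt x y))) (Icc a 0) := by
      apply potDiff_line_continuousOn (fun x hx => hx.2) (fun x _ => pt_ne_zero_of_im hy0)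
      intro x hx
      exact ⟨dp_continuousWithinAt (z := pt x y) hx.2 (pt_ne_zero_of_im hy0)
        (Or.inl (dq_slitPlane (z := pt x y) hx.2 (pt_ne_zero_of_im hy0) (hq x hx.2))), dp_sq _⟩
    have h0 := upper_axis_pos hy
    obtain ⟨x, hx, e⟩ := intermediate_value_Icc ha.le hcont ⟨hna.le, h0.le⟩
    refine ⟨x, hx.2.lt_of_ne ?_, e⟩
    rintro rfl
    exact h0.ne' e
  · exact ⟨z₁.re, hn, (isLevel_corner h.symm).1⟩

/-- The unbounded curves `Γ_E` in the left half-plane are graphs of this function. -/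
def fE (y : ℝ) : ℝ := Classical.epsilon fun x => x < 0 ∧ IsLevel (pt x y)

theorem fE_spec {y : ℝ} (hy : z₁.im ^ 2 ≤ y ^ 2) : fE y < 0 ∧ IsLevel (pt (fE y) y) := by
  apply Classical.epsilon_spec (p := fun x => x < 0 ∧ IsLevel (pt x y))
  obtain ⟨x, h⟩ := exists_fE hy
  exact ⟨x, h⟩

theorem fE_unique {x y : ℝ} (hy : z₁.im ^ 2 ≤ y ^ 2) (hx : x ≤ 0) (h : IsLevel (pt x y)) :
    x = fE y :=
  (upper_line_strictMonoOn hy).injOn hx (fE_spec hy).1.le (Eq.trans h (fE_spec hy).2.symm)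

theorem fE_corner {y : ℝ} (hy : y ^ 2 = z₁.im ^ 2) : fE y = z₁.re :=
  (fE_unique hy.ge z₁_re_neg.le (isLevel_corner hy).1).symm

theorem fE_even {y : ℝ} (hy : z₁.im ^ 2 ≤ y ^ 2) : fE (-y) = fE y := by
  obtain ⟨h1, h2⟩ := fE_spec hy
  symm
  apply fE_unique (by rwa [neg_sq]) h1.le
  rw [← pt_conj]
  exact (isLevel_conj (z := pt (fE y) y) h1.le).2 h2

theorem qz_curve_middle {x y : ℝ} (hx : x ≤ 0) (h0 : pt x y ≠ 0) (hy : y ^ 2 < z₁.im ^ 2) :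
    (qz (pt x y)).re = 0 → (qz (pt x y)).im ^ 2 < 1 / 3 := by
  intro hq
  rcases hx.lt_or_eq with h | h
  · exact ((qz_curve_lt (z := pt x y) h hq).1 hy).2
  · subst h
    have hy0 : y ≠ 0 := by rintro rfl; exact h0 rfl
    exact absurd hq (qz_im_axis (z := pt 0 y) rfl hy0).ne'

theorem dt_line_continuousOn {s : Set ℝ} {y : ℝ} (hs : s ⊆ Iic 0) (hy : y ^ 2 < z₁.im ^ 2)
    (h0 : ∀ x ∈ s, pt x y ≠ 0) :
    ContinuousOn (fun x => potDiff (pt x y) (dt (pt x y))) s := by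
  apply potDiff_line_continuousOn hs h0
  intro x hx
  exact ⟨dt_continuousWithinAt (z := pt x y) (hs hx) (h0 x hx)
    (qz_curve_middle (hs hx) (h0 x hx) hy), dt_sq (z := pt x y) (hs hx) (h0 x hx)⟩

theorem dt_fP {y : ℝ} (hy : y ^ 2 < z₁.im ^ 2) : potDiff (pt (fP y) y) (dt (pt (fP y) y)) = 0 := by
  have h := fP_spec hy.le
  rw [dt_eq_dp (z := pt (fP y) y) (h.1.trans z₁_re_neg.le) (left_ne_zero (h.1.trans_lt z₁_re_neg))
    (qz_re_neg_left h.1 hy.le (Or.inr hy))]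
  exact h.2

/-- Starting from zero on the cut, the difference formed with `dt` increases, because `Re dt > 0` as
long as `Re q < 0`. Unlike `dp`, the root `dt` stays analytic up to the curve `Re q = 0`. -/
theorem dt_line_pos {c y : ℝ} (hc : c < 0) (hy : y ^ 2 < z₁.im ^ 2)
    (hq : ∀ x < c, (qz (pt x y)).re < 0) (hcP : fP y < c) :
    0 < potDiff (pt c y) (dt (pt c y)) := by
  have hm : StrictMonoOn (fun x => potDiff (pt x y) (dt (pt x y))) (Icc (fP y) c) := by
    apply potDiff_line_strictMonoOn hc.le
    · exact dt_line_continuousOn (fun x hx => hx.2.trans hc.le) hy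
        fun x hx => left_ne_zero (z := pt x y) (hx.2.trans_lt hc)
    · intro x hx
      have hx0 : x < 0 := hx.2.trans hc
      exact ⟨dt_analyticAt (z := pt x y) hx0
        (qz_curve_middle hx0.le (left_ne_zero (z := pt x y) hx0) hy),
        dt_sq_eventually (z := pt x y) hx0, dt_re.1 (hq x hx.2)⟩
  have := hm ⟨le_rfl, hcP.le⟩ ⟨hcP.le, le_rfl⟩ hcP
  simpa [dt_fP hy] using this

/-- On the negative real axis `q` is negative, so the difference formed with `-dt` falls all the way
from the cut to `0`. -/
theorem real_line {x : ℝ} (hx : fP 0 < x) (hx0 : x < 0) : potDiff (pt x 0) (-dt (pt x 0)) < 0 := by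
  rw [potDiff_neg, neg_lt_zero]
  have hY := z₁_im_pos
  exact dt_line_pos hx0 (by rw [zero_pow two_ne_zero]; positivity)
    (fun x' hx' => (qz_real (z := pt x' 0) (hx'.trans hx0) rfl).1) hx

/-- To the right of the cut the branch difference is `-dt`. The potential falls from zero on the cut
until `Re q = 0`, at abscissa `c`, and then rises up to the imaginary axis. This leaves room for at
most one further zero. -/
theorem middle_line {y : ℝ} (hy : y ^ 2 < z₁.im ^ 2) (hy0 : y ≠ 0) :
    ∃ c, fP y < c ∧ c < 0 ∧ (∀ x, fP y < x → x ≤ c → potDiff (pt x y) (-dt (pt x y)) < 0) ∧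
      StrictMonoOn (fun x => potDiff (pt x y) (-dt (pt x y))) (Icc c 0) ∧
      ∀ x, c < x → x ≤ 0 → 0 < (qz (pt x y)).re := by
  obtain ⟨c, hc, hq, h1, h2⟩ := exists_line_sign hy0
  have hcP : fP y < c := (fP_lt hy).trans ((qz_curve_lt (z := pt c y) hc hq).1 hy).1
  refine ⟨c, hcP, hc, ?_, ?_, h2⟩
  · intro x hx hxc
    rw [potDiff_neg, neg_lt_zero]
    exact dt_line_pos (hxc.trans_lt hc) hy (fun x' hx' => h1 x' (hx'.trans_le hxc)) hx
  · apply potDiff_line_strictMonoOn (δ := fun z => -dt z) le_rfl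
    · simp only [potDiff_neg]
      exact (dt_line_continuousOn (fun x hx => hx.2) hy fun x _ => pt_ne_zero_of_im hy0).neg
    · intro x hx
      refine ⟨(dt_analyticAt (z := pt x y) hx.2
        (qz_curve_middle hx.2.le (pt_ne_zero_of_im hy0) hy)).neg, ?_, ?_⟩
      · filter_upwards [dt_sq_eventually (z := pt x y) hx.2] with z h
        rw [neg_sq, h]
      · rw [Complex.neg_re, neg_pos]
        exact dt_re.2 (h2 x hx.1 hx.2.le)

/-! ### Comparison with the third potential -/

theorem hw_real (w : ℝ) : hw w = 2 / (w ^ 2 - 1) - Real.log (w ^ 3 - w) := by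
  have e1 : (2 / ((w : ℂ) ^ 2 - 1)) = ((2 / (w ^ 2 - 1) : ℝ) : ℂ) := by push_cast; ring
  have e2 : (w : ℂ) ^ 3 - w = ((w ^ 3 - w : ℝ) : ℂ) := by push_cast; ring
  rw [hw, e1, e2, Complex.ofReal_re, Complex.norm_real, Real.norm_eq_abs, Real.log_abs]

theorem hw_real_strictAntiOn : StrictAntiOn (fun w : ℝ => hw w) (Ioo 0 1) := by
  have hd : ∀ w ∈ Ioo (0 : ℝ) 1, HasDerivAt (fun w : ℝ => hw w)
      ((0 * (w ^ 2 - 1) - 2 * ((2 : ℕ) * w ^ 1)) / (w ^ 2 - 1) ^ 2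
        - ((3 : ℕ) * w ^ 2 - 1) / (w ^ 3 - w)) w ∧ w ^ 2 - 1 < 0 ∧ w ^ 3 - w < 0 := by
    rintro w ⟨h0, h1⟩
    have a1 : w ^ 2 - 1 < 0 := by nlinarith
    have a2 : w ^ 3 - w < 0 := by nlinarith
    refine ⟨?_, a1, a2⟩
    simp only [hw_real]
    apply HasDerivAt.sub
    · exact (hasDerivAt_const w (2 : ℝ)).div ((hasDerivAt_pow 2 w).sub_const 1) a1.ne
    · exact ((hasDerivAt_pow 3 w).sub (hasDerivAt_id w)).log a2.ne
  apply strictAntiOn_of_deriv_neg (convex_Ioo 0 1)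
  · exact fun w hw => (hd w hw).1.continuousAt.continuousWithinAt
  · intro w hw
    rw [interior_Ioo] at hw
    obtain ⟨h, a1, a2⟩ := hd w hw
    rw [h.deriv]
    have e : (0 * (w ^ 2 - 1) - 2 * ((2 : ℕ) * w ^ 1)) / (w ^ 2 - 1) ^ 2
        - ((3 : ℕ) * w ^ 2 - 1) / (w ^ 3 - w) = -((1 + 3 * w ^ 4) / (w * (w ^ 2 - 1) ^ 2)) := by
      have h0 := hw.1.ne'
      have h1 := a1.ne
      have e3 : w ^ 3 - w = w * (w ^ 2 - 1) := by ring
      rw [e3]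
      push_cast
      field_simp
      ring
    rw [e, neg_lt_zero]
    have h0 := hw.1
    have : 0 < (w ^ 2 - 1) ^ 2 := by positivity [a1.ne]
    positivity

/-- For points of the left upper quadrant, the difference between a left preimage and the right
preimage has negative imaginary part. -/
theorem Roots.sub_rt_im_neg {z u v : ℂ} (h : Roots z u v (rt z)) (hz : z.re < 0) (hy : 0 < z.im) :
    (u - rt z).im < 0 := by
  obtain ⟨hu, hv⟩ := h.left hz
  have hr := rt_re_pos hz.le
  have hvi := root_im_neg h.rot.rot.eqn hy
  have e := h.swap.rot.sq_sub
  have hp := mul_ne_zero h.ne_zero (root_ne_zero h.rot.rot.eqn)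
  -- `(u - rt z)² = 1 + 1/(3(zv)²)`. Here `zv` lies in the open fourth quadrant, so this square has
  -- positive imaginary part. As `Re (u - rt z) < 0`, the claim follows.
  have p1 : 0 < (z * v).re := by rw [Complex.mul_re]; nlinarith
  have p2 : (z * v).im < 0 := by
    have hN := sq_sub_one_ne_zero h.rot.rot.eqn
    have e2 : z * v = 1 + ((2 / 3 : ℝ) : ℂ) * (v ^ 2 - 1)⁻¹ := by
      push_cast
      field_simp
      linear_combination 3 * h.rot.rot.eqn
    rw [e2, Complex.add_im, Complex.im_ofReal_mul, Complex.inv_im, Complex.one_im, zero_add]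
    have hn : 0 < Complex.normSq (v ^ 2 - 1) := Complex.normSq_pos.2 hN
    have : (v ^ 2 - 1).im = 2 * (v.re * v.im) := by simp [pow_two]; ring
    rw [this]
    have h3 : 0 < v.re * v.im := mul_pos_of_neg_of_neg hv hvi
    apply mul_neg_of_pos_of_neg (by norm_num)
    apply div_neg_of_neg_of_pos _ hn
    linarith
  have p3 : 0 < ((u - rt z) ^ 2).im := by
    have e3 : (u - rt z) ^ 2 = 1 + ((1 / 3 : ℝ) : ℂ) * ((z * v) ^ 2)⁻¹ := by
      rw [e]; push_cast; field_simp
    rw [e3, Complex.add_im, Complex.im_ofReal_mul, Complex.inv_im, Complex.one_im, zero_add]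
    have hn : 0 < Complex.normSq ((z * v) ^ 2) := Complex.normSq_pos.2 (pow_ne_zero 2 hp)
    have : ((z * v) ^ 2).im = 2 * ((z * v).re * (z * v).im) := by simp [pow_two]; ring
    rw [this]
    have h3 : (z * v).re * (z * v).im < 0 := mul_neg_of_pos_of_neg p1 p2
    apply mul_pos (by norm_num)
    apply div_pos _ hn
    linarith
  have p4 : ((u - rt z) ^ 2).im = 2 * ((u - rt z).re * (u - rt z).im) := by simp [pow_two]; ring
  have p5 : (u - rt z).re < 0 := by rw [Complex.sub_re]; linarith
  by_contra hcon
  push Not at hcon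
  nlinarith [mul_nonneg (neg_nonneg.2 p5.le) hcon]

/-- All roots are real with `0 < r = rt z < 1`, and the pair relation says `(-u - r)(-v - r) = r² -
1 < 0`. Since `-u < -v`, this gives `0 < -u < r`. Now `hw` is even, and decreasing on `(0, 1)`. -/
theorem Roots.hw_lt_of_real {z u v : ℂ} (h : Roots z u v (rt z)) (hz : z.re < 0) (hy : z.im = 0)
    (huv : 0 < (u - v).re) : hw (rt z) < hw u := by
  obtain ⟨hu, hv⟩ := h.left hz
  have hr := rt_re_pos hz.le
  have ofr : ∀ w : ℂ, w.im = 0 → w = (w.re : ℂ) := fun w h => Complex.ext rfl (by simpa using h)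
  have eu := ofr u (root_im_zero h.rot.eqn hy)
  have ev := ofr v (root_im_zero h.rot.rot.eqn hy)
  have er := ofr (rt z) (root_im_zero h.eqn hy)
  have ez := ofr z hy
  have e2 := h.pair
  have e1 : z.re * ((rt z).re ^ 3 - (rt z).re) = (rt z).re ^ 2 - 1 / 3 := by
    apply Complex.ofReal_injective
    push_cast
    rw [← er, ← ez]
    exact h.eqn
  rw [Complex.sub_re] at huv
  generalize hrr : (rt z).re = r at *
  rw [er, eu]
  rw [er, eu, ev] at e2
  have r1 : r < 1 := by
    by_contra hcon
    push Not at hcon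
    have : 0 ≤ r ^ 3 - r := by nlinarith [mul_nonneg hr.le (by nlinarith : 0 ≤ r ^ 2 - 1)]
    nlinarith [mul_nonneg (neg_nonneg.2 hz.le) this]
  have key : (-u.re - r) * (-v.re - r) = r ^ 2 - 1 := by
    have e2' : u.re * v.re + v.re * r + r * u.re = -1 := by exact_mod_cast e2
    linear_combination e2'
  have hur : -u.re < r := by
    by_contra hcon
    push Not at hcon
    nlinarith [mul_nonneg (by linarith : 0 ≤ -u.re - r) (by linarith : 0 ≤ -v.re - r)]
  rw [← hw_neg (u.re : ℂ), ← Complex.ofReal_neg]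
  exact hw_real_strictAntiOn ⟨by linarith, by linarith⟩ ⟨hr, r1⟩ hur

/-- The inequality holds on the real axis. Going up, the difference has derivative `-3 Im (u - rt
z)`, with `u` the root belonging to `dp`, and this is positive by `sub_rt_im_neg`. Conjugation
covers the lower half. This is what keeps `Γ_P^*` away from `Γ_R`. -/
theorem hw_rt_lt {x y : ℝ} (hx : x ≤ z₁.re) (hy : y ^ 2 < z₁.im ^ 2) :
    hw (rt (pt x y)) < hw ((1 / pt x y - rt (pt x y) + dp (pt x y)) / 2) := by
  have hn := z₁_re_neg
  have hx0 : x < 0 := hx.trans_lt hn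
  have hq : ∀ y : ℝ, y ^ 2 < z₁.im ^ 2 → (qz (pt x y)).re < 0 := fun y hy =>
    qz_re_neg_left hx hy.le (Or.inr hy)
  have hsl : ∀ y : ℝ, y ^ 2 < z₁.im ^ 2 → dq (pt x y) ∈ Complex.slitPlane := fun y hy =>
    dq_slitPlane (z := pt x y) hx0.le (left_ne_zero (z := pt x y) hx0) fun h => absurd h (hq y hy).ne
  have main : ∀ y : ℝ, 0 ≤ y → y < z₁.im →
      hw (rt (pt x y)) < hw ((1 / pt x y - rt (pt x y) + dp (pt x y)) / 2) := by
    intro y hy0 hy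
    set ψ : ℂ → ℂ := fun z => (1 / z - rt z + dp z) / 2 with hψ
    have hR : ∀ v : ℝ, Roots (pt x v) (ψ (pt x v)) ((1 / pt x v - rt (pt x v) - dp (pt x v)) / 2)
        (rt (pt x v)) := fun v =>
      roots_of_sq (z := pt x v) hx0.le (left_ne_zero (z := pt x v) hx0) (dp_sq _)
    have hd : ∀ v : ℝ, v ^ 2 < z₁.im ^ 2 → HasDerivAt
        (fun v => hw (ψ (pt x v)) - hw (rt (pt x v)))
        (-(3 * (ψ (pt x v) - rt (pt x v)).im)) v := by
      intro v hv
      have hl : (pt x v).re < 0 := hx0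
      have hra := rt_analyticAt hl
      have hψa : AnalyticAt ℂ ψ (pt x v) :=
        (((analyticAt_const.div analyticAt_id (left_ne_zero hl)).sub hra).add
          (dp_analyticAt hl fun h => absurd h (hq v hv).ne)).div_const
      have d1 := hasDerivAt_hw_comp (γ := fun v => pt x v) (t := v) hψa (by
        filter_upwards [left_mem_nhds hl] with z hz
        exact (roots_of_sq hz.le (left_ne_zero hz) (dp_sq z)).rot.eqn) (hasDerivAt_pt_right x v)
      have d2 := hasDerivAt_hw_comp (γ := fun v => pt x v) (t := v) hra (by
        filter_upwards [left_mem_nhds hl] with z hz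
        exact rt_eqn hz.le) (hasDerivAt_pt_right x v)
      convert! d1.sub d2 using 1
      simp
      ring
    have hsq : ∀ v ∈ Icc 0 y, v ^ 2 < z₁.im ^ 2 := fun v hv => by nlinarith [hv.1, hv.2]
    have hm : StrictMonoOn (fun v => hw (ψ (pt x v)) - hw (rt (pt x v))) (Icc 0 y) := by
      apply strictMonoOn_of_deriv_pos (convex_Icc 0 y)
      · exact fun v hv => (hd v (hsq v hv)).continuousAt.continuousWithinAt
      · intro v hv
        have hv' := interior_subset hv
        rw [interior_Icc] at hv
        rw [(hd v (hsq v hv')).deriv]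
        have := (hR v).sub_rt_im_neg hx0 hv.1
        linarith
    have h0 : 0 < hw (ψ (pt x 0)) - hw (rt (pt x 0)) := by
      apply sub_pos.2
      apply (hR 0).hw_lt_of_real hx0 rfl
      have := dp_re_pos (z := pt x 0) hx0.le (left_ne_zero (z := pt x 0) hx0)
        fun h => absurd h (hq 0 (hsq 0 ⟨le_rfl, hy0⟩)).ne
      have e : ψ (pt x 0) - (1 / pt x 0 - rt (pt x 0) - dp (pt x 0)) / 2 = dp (pt x 0) := by
        simp only [hψ]; ring
      rwa [e]
    exact sub_pos.1 (h0.trans_le (hm.monotoneOn ⟨le_rfl, hy0⟩ ⟨hy0, le_rfl⟩ hy0))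
  have hY := z₁_im_pos
  rcases le_total 0 y with h0 | h0
  · exact main y h0 (lt_of_pow_lt_pow_left₀ 2 hY.le hy)
  · have h1 := main (-y) (by linarith) (lt_of_pow_lt_pow_left₀ 2 hY.le (by rwa [neg_sq]))
    rw [← pt_conj, dp_conj (z := pt x y) hx0.le (hsl y hy), rt_conj (z := pt x y) hx0.le, hw_conj] at h1
    have e : (1 / starRingEnd ℂ (pt x y) - starRingEnd ℂ (rt (pt x y)) + starRingEnd ℂ (dp (pt x y))) / 2
        = starRingEnd ℂ ((1 / pt x y - rt (pt x y) + dp (pt x y)) / 2) := by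
      simp [map_ofNat]
    rwa [e, hw_conj] at h1

/-! ### Local analytic graphs -/

theorem AnalyticAt.re_comp {c : ℝ → ℂ} {t : ℝ} (h : AnalyticAt ℝ c t) :
    AnalyticAt ℝ (fun t => (c t).re) t := (Complex.reCLM.analyticAt _).comp h

theorem AnalyticAt.im_comp {c : ℝ → ℂ} {t : ℝ} (h : AnalyticAt ℝ c t) :
    AnalyticAt ℝ (fun t => (c t).im) t := (Complex.imCLM.analyticAt _).comp h

/-- A curve with nonhorizontal tangent is locally a graph over the imaginary part. -/
theorem exists_graph_of_curve {c : ℝ → ℂ} {e : ℂ} (hc : AnalyticAt ℝ c 0) (hd : HasDerivAt c e 0)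
    (he : e.im ≠ 0) : ∃ f s : ℝ → ℝ, AnalyticAt ℝ f (c 0).im ∧ f (c 0).im = (c 0).re ∧
      HasDerivAt f (e.re / e.im) (c 0).im ∧ s (c 0).im = 0 ∧ HasDerivAt s (1 / e.im) (c 0).im ∧
      ∀ᶠ y in 𝓝 (c 0).im, c (s y) = pt (f y) y := by
  have hre : HasDerivAt (fun t => (c t).re) e.re 0 := by
    simpa using! Complex.reCLM.hasFDerivAt.comp_hasDerivAt 0 hd
  have him : HasDerivAt (fun t => (c t).im) e.im 0 := by
    simpa using! Complex.imCLM.hasFDerivAt.comp_hasDerivAt 0 hd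
  have ha : AnalyticAt ℝ (fun t => (c t).im) 0 := AnalyticAt.im_comp hc
  have hd' : deriv (fun t => (c t).im) 0 ≠ 0 := by rwa [him.deriv]
  have hg := ha.analyticAt_localInverse hd'
  have hl := ha.hasStrictDerivAt.eventually_left_inverse hd'
  have hr := ha.hasStrictDerivAt.eventually_right_inverse hd'
  have hsd := (ha.hasStrictDerivAt.to_localInverse hd').hasDerivAt
  set s := ha.hasStrictDerivAt.localInverse _ _ _ hd'
  rw [him.deriv, ← one_div] at hsd
  have s0 : s (c 0).im = 0 := hl.self_of_nhds
  have hfa : AnalyticAt ℝ (fun y => (c (s y)).re) (c 0).im :=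
    (AnalyticAt.re_comp hc).comp_of_eq hg s0
  refine ⟨fun y => (c (s y)).re, s, hfa, by simp only [s0], ?_, s0, hsd, ?_⟩
  · have := hre.comp_of_eq (c 0).im hsd s0.symm
    rwa [mul_one_div] at this
  · filter_upwards [hr] with y hy
    exact Complex.ext rfl hy

theorem analyticAt_line {χ : ℂ → ℂ} {a e : ℂ} (h : AnalyticAt ℂ χ a) :
    AnalyticAt ℝ (fun s : ℝ => χ (a + s * e)) 0 := by
  have h1 : AnalyticAt ℝ (fun s : ℝ => a + (s : ℂ) * e) 0 :=
    analyticAt_const.add ((Complex.ofRealCLM.analyticAt 0).mul analyticAt_const)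
  exact (h.restrictScalars (𝕜 := ℝ)).comp_of_eq h1 (by simp)

theorem hasDerivAt_line {χ : ℂ → ℂ} {a e χ' : ℂ} (h : HasDerivAt χ χ' a) :
    HasDerivAt (fun s : ℝ => χ (a + s * e)) (χ' * e) 0 := by
  have h1 : HasDerivAt (fun s : ℝ => a + (s : ℂ) * e) (1 * e) 0 :=
    ((Complex.ofRealCLM.hasDerivAt (x := 0)).mul_const e).const_add a
  rw [one_mul] at h1
  exact h.comp_of_eq (0 : ℝ) h1 (by simp)

/-- The zero set of the real part of an analytic function is locally a graph. -/
theorem exists_zero_graph {F : ℂ → ℂ} {z₀ : ℂ} (hF : AnalyticAt ℂ F z₀) (h0 : (F z₀).re = 0)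
    (hd : (deriv F z₀).re ≠ 0) : ∃ f : ℝ → ℝ, AnalyticAt ℝ f z₀.im ∧ f z₀.im = z₀.re ∧
      ∀ᶠ y in 𝓝 z₀.im, (F (pt (f y) y)).re = 0 := by
  have hd0 : deriv F z₀ ≠ 0 := fun h => hd (by rw [h]; rfl)
  have hg := hF.analyticAt_localInverse hd0
  have hl := hF.hasStrictDerivAt.eventually_left_inverse hd0
  have hr := hF.hasStrictDerivAt.eventually_right_inverse hd0
  have hsd := (hF.hasStrictDerivAt.to_localInverse hd0).hasDerivAt
  set χ := hF.hasStrictDerivAt.localInverse _ _ _ hd0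
  have χ0 : χ (F z₀) = z₀ := hl.self_of_nhds
  have c0 : χ (F z₀ + ((0 : ℝ) : ℂ) * Complex.I) = z₀ := by simpa using χ0
  obtain ⟨f, s, hf, hf0, -, s0, hs, he⟩ := exists_graph_of_curve (analyticAt_line (e := Complex.I) hg)
    (hasDerivAt_line (e := Complex.I) hsd) (by
      rw [Complex.mul_I_im, Complex.inv_re]
      exact div_ne_zero hd (Complex.normSq_pos.2 hd0).ne')
  rw [c0] at hf hf0 s0 hs he
  refine ⟨f, hf, hf0, ?_⟩
  have hcont : Tendsto (fun y => F z₀ + (s y : ℂ) * Complex.I) (𝓝 z₀.im) (𝓝 (F z₀)) := by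
    have : ContinuousAt (fun y => F z₀ + (s y : ℂ) * Complex.I) z₀.im :=
      continuousAt_const.add ((Complex.continuous_ofReal.continuousAt.comp hs.continuousAt).mul
        continuousAt_const)
    simpa [ContinuousAt, s0] using this
  filter_upwards [he, hcont.eventually hr] with y h1 h2
  rw [← h1, h2, Complex.add_re, h0, Complex.re_ofReal_mul]
  simp

/-- Equality of the potentials of two local branches defines a graph. -/
theorem exists_level_graph {ψ φ : ℂ → ℂ} {z₀ : ℂ} (hψ : AnalyticAt ℂ ψ z₀) (hφ : AnalyticAt ℂ φ z₀)
    (eψ : ∀ᶠ z in 𝓝 z₀, z * (ψ z ^ 3 - ψ z) = ψ z ^ 2 - 1 / 3)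
    (eφ : ∀ᶠ z in 𝓝 z₀, z * (φ z ^ 3 - φ z) = φ z ^ 2 - 1 / 3)
    (h0 : hw (ψ z₀) = hw (φ z₀)) (hd : (ψ z₀ - φ z₀).re ≠ 0) :
    ∃ f : ℝ → ℝ, AnalyticAt ℝ f z₀.im ∧ f z₀.im = z₀.re ∧
      ∀ᶠ y in 𝓝 z₀.im, hw (ψ (pt (f y) y)) = hw (φ (pt (f y) y)) := by
  obtain ⟨F, hF, dF, rF⟩ := exists_primitive hψ eψ
  obtain ⟨G, hG, dG, rG⟩ := exists_primitive hφ eφ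
  have hD := dF.self_of_nhds.sub dG.self_of_nhds
  obtain ⟨f, hf, hf0, he⟩ := exists_zero_graph (F := fun z => F z - G z) (hF.sub hG)
    (by rw [Complex.sub_re, rF.self_of_nhds, rG.self_of_nhds, h0, sub_self]) (by
      have e : deriv (fun z => F z - G z) z₀ = ((3 : ℝ) : ℂ) * (ψ z₀ - φ z₀) := by
        exact hD.deriv.trans (by push_cast; ring)
      rw [e, Complex.re_ofReal_mul]
      exact mul_ne_zero three_ne_zero hd)
  refine ⟨f, hf, hf0, ?_⟩
  have hcont : Tendsto (fun y => pt (f y) y) (𝓝 z₀.im) (𝓝 z₀) := by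
    have : ContinuousAt (fun y => pt (f y) y) z₀.im :=
      continuous_pt.continuousAt.comp (f := fun y => (f y, y)) (hf.continuousAt.prodMk continuousAt_id)
    simpa [ContinuousAt, hf0, pt_re_im] using this
  filter_upwards [he, hcont.eventually rF, hcont.eventually rG] with y h1 h2 h3
  rw [← h2, ← h3]
  rwa [Complex.sub_re, sub_eq_zero] at h1

theorem exists_isLevel_graph {δ : ℂ → ℂ} {z₀ : ℂ} (hz : z₀.re < 0) (hδ : AnalyticAt ℂ δ z₀)
    (h : ∀ᶠ z in 𝓝 z₀, δ z ^ 2 = dq z) (h0 : IsLevel z₀) (hd : (δ z₀).re ≠ 0) :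
    ∃ f : ℝ → ℝ, AnalyticAt ℝ f z₀.im ∧ f z₀.im = z₀.re ∧ ∀ᶠ y in 𝓝 z₀.im, IsLevel (pt (f y) y) := by
  have hs : AnalyticAt ℂ (fun z => 1 / z - rt z) z₀ :=
    (analyticAt_const.div analyticAt_id (left_ne_zero hz)).sub (rt_analyticAt hz)
  have hr : ∀ᶠ z in 𝓝 z₀, Roots z ((1 / z - rt z + δ z) / 2) ((1 / z - rt z - δ z) / 2) (rt z) := by
    filter_upwards [h, left_mem_nhds hz] with z h1 h2
    exact roots_of_sq h2.le (left_ne_zero h2) h1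
  obtain ⟨f, hf, hf0, he⟩ := exists_level_graph (ψ := fun z => (1 / z - rt z + δ z) / 2)
    (φ := fun z => (1 / z - rt z - δ z) / 2) (hs.add hδ).div_const (hs.sub hδ).div_const
    (hr.mono fun z h => h.rot.eqn) (hr.mono fun z h => h.rot.rot.eqn)
    (hr.self_of_nhds.isLevel.1 h0) (by
      have e : (1 / z₀ - rt z₀ + δ z₀) / 2 - (1 / z₀ - rt z₀ - δ z₀) / 2 = δ z₀ := by ring
      rwa [e])
  refine ⟨f, hf, hf0, ?_⟩
  have hcont : Tendsto (fun y => pt (f y) y) (𝓝 z₀.im) (𝓝 z₀) := by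
    have : ContinuousAt (fun y => pt (f y) y) z₀.im :=
      continuous_pt.continuousAt.comp (f := fun y => (f y, y)) (hf.continuousAt.prodMk continuousAt_id)
    simpa [ContinuousAt, hf0, pt_re_im] using this
  filter_upwards [he, hcont.eventually hr] with y h1 h2
  exact h2.isLevel.2 h1

/-- `Re dp ≠ 0` makes the level set a local analytic graph, and uniqueness of the zero on each line
identifies that graph with `fP`. -/
theorem fP_analytic_germ {y : ℝ} (hy : y ^ 2 < z₁.im ^ 2) : AnalyticAt ℝ fP y := by
  have hsp := fP_spec hy.le
  have hn := z₁_re_neg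
  have hx : (pt (fP y) y).re < 0 := hsp.1.trans_lt hn
  have hq := qz_re_neg_left hsp.1 hy.le (Or.inr hy)
  have hq' : (qz (pt (fP y) y)).re = 0 → 1 / 3 < (qz (pt (fP y) y)).im ^ 2 := fun h => absurd h hq.ne
  obtain ⟨f, hf, hf0, he⟩ := exists_isLevel_graph hx (dp_analyticAt hx hq') (dp_sq_eventually _)
    hsp.2 (dp_re_pos hx.le (left_ne_zero hx) hq').ne'
  simp only [pt_im, pt_re] at hf hf0 he
  apply hf.congr
  have h1 : ∀ᶠ v in 𝓝 y, f v < z₁.re := by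
    apply hf.continuousAt.eventually_lt continuousAt_const
    rw [hf0]; exact fP_lt hy
  have h2 : ∀ᶠ v in 𝓝 y, v ^ 2 < z₁.im ^ 2 :=
    (continuous_pow 2).continuousAt.eventually_lt continuousAt_const hy
  filter_upwards [he, h1, h2] with v a b c
  exact fP_unique c.le b.le a

theorem fE_analytic_germ {y : ℝ} (hy : z₁.im ^ 2 < y ^ 2) : AnalyticAt ℝ fE y := by
  have hsp := fE_spec hy.le
  have hx : (pt (fE y) y).re < 0 := hsp.1
  have hq' : (qz (pt (fE y) y)).re = 0 → 1 / 3 < (qz (pt (fE y) y)).im ^ 2 :=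
    qz_curve_upper hsp.1.le hy.le fun h => hy.ne' h.2
  obtain ⟨f, hf, hf0, he⟩ := exists_isLevel_graph hx (dp_analyticAt hx hq') (dp_sq_eventually _)
    hsp.2 (dp_re_pos hx.le (left_ne_zero hx) hq').ne'
  simp only [pt_im, pt_re] at hf hf0 he
  apply hf.congr
  have h1 : ∀ᶠ v in 𝓝 y, f v < 0 := by
    apply hf.continuousAt.eventually_lt continuousAt_const
    rw [hf0]; exact hsp.1
  have h2 : ∀ᶠ v in 𝓝 y, z₁.im ^ 2 < v ^ 2 :=
    continuousAt_const.eventually_lt (continuous_pow 2).continuousAt hy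
  filter_upwards [he, h1, h2] with v a b c
  exact fE_unique c.le b.le a

/-! ### The branch point -/

theorem dq_zero_iff {z : ℂ} (hz : z.re < 0) : dq z = 0 ↔ z.re = z₁.re ∧ z.im ^ 2 = z₁.im ^ 2 := by
  constructor
  · intro h
    have h0 := left_ne_zero hz
    have hq := qz_ne_zero hz.le h0
    have e : qz z ^ 2 = ((-1 / 3 : ℝ) : ℂ) := by
      rw [dq] at h
      field_simp at h
      push_cast
      linear_combination h / 3
    have e1 := congrArg Complex.re e
    have e2 := congrArg Complex.im e
    rw [Complex.ofReal_re] at e1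
    rw [Complex.ofReal_im] at e2
    simp [pow_two] at e1 e2
    have h3 : (qz z).re = 0 := by
      have : (qz z).re * (qz z).im = 0 := by linarith
      rcases mul_eq_zero.1 this with h | h
      · exact h
      · rw [h] at e1; nlinarith [mul_self_nonneg (qz z).re]
    rw [h3] at e1
    obtain ⟨a, b, c⟩ := qz_curve_lt hz h3
    rcases lt_trichotomy (z.im ^ 2) (z₁.im ^ 2) with hh | hh | hh
    · have := (a hh).2; nlinarith
    · exact ⟨(b hh).1, hh⟩
    · have := c hh; nlinarith
  · rintro ⟨h1, h2⟩
    rw [← pt_re_im z, h1]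
    exact (isLevel_corner h2).2

theorem dq_ne_zero_near : ∀ᶠ z in 𝓝[≠] z₁, dq z ≠ 0 ∧ z.re < 0 := by
  have h1 : ∀ᶠ z : ℂ in 𝓝 z₁, 0 < z.im :=
    Complex.continuous_im.continuousAt.eventually_mem (isOpen_Ioi.mem_nhds z₁_im_pos)
  filter_upwards [self_mem_nhdsWithin, nhdsWithin_le_nhds h1,
    nhdsWithin_le_nhds (left_mem_nhds z₁_re_neg)] with z hz hi hr
  refine ⟨fun h => hz ?_, hr⟩
  obtain ⟨a, b⟩ := (dq_zero_iff hr).1 h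
  refine Complex.ext a ?_
  rcases sq_eq_sq_iff_eq_or_eq_neg.1 b with h | h
  · exact h
  · have := z₁_im_pos; linarith

theorem qz_eqn {z : ℂ} (hz : z.re ≤ 0) : z ^ 2 * (3 * qz z - 1) = 3 * qz z ^ 2 * (qz z - 1) := by
  have := rt_eqn hz
  unfold qz
  linear_combination (-3 * z ^ 2) * this

/-- Differentiating the relation between `z` and `q` implicitly, and using `3q² = -1`, gives `3z₁q'
= 4q`. Then the derivative of `dq` is `-2q'/(3q³) = 2q'/q = 8/(3z₁)`. -/
theorem hasDerivAt_dq_z₁ : HasDerivAt dq (8 / (3 * z₁)) z₁ := by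
  have hn := z₁_re_neg
  have hz0 := left_ne_zero hn
  have hq0 := qz_ne_zero hn.le hz0
  have hd := (qz_analyticAt hn).differentiableAt.hasDerivAt
  have e := qz_eqn hn.le
  have hqz : 3 * qz z₁ ^ 2 + 1 = 0 := by
    rw [qz_z₁, mul_pow, Complex.I_sq, ← Complex.ofReal_pow, div_pow, Real.sq_sqrt (by norm_num)]
    push_cast; norm_num
  set q := qz z₁ with hq
  set q' := deriv qz z₁
  have e1 : HasDerivAt (fun z => z ^ 2 * (3 * qz z - 1) - 3 * qz z ^ 2 * (qz z - 1))
      (((2 : ℕ) * z₁ ^ 1 * (3 * q - 1) + z₁ ^ 2 * (3 * q'))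
        - ((3 * ((2 : ℕ) * q ^ 1 * q')) * (q - 1) + 3 * q ^ 2 * q')) z₁ :=
    ((hasDerivAt_pow 2 z₁).mul ((hd.const_mul 3).sub_const 1)).sub
      (((hd.pow 2).const_mul 3).mul (hd.sub_const 1))
  have e2 : ((2 : ℕ) * z₁ ^ 1 * (3 * q - 1) + z₁ ^ 2 * (3 * q'))
        - ((3 * ((2 : ℕ) * q ^ 1 * q')) * (q - 1) + 3 * q ^ 2 * q') = 0 := by
    rw [← e1.deriv]
    have : (fun z => z ^ 2 * (3 * qz z - 1) - 3 * qz z ^ 2 * (qz z - 1)) =ᶠ[𝓝 z₁] fun _ => 0 := by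
      filter_upwards [left_mem_nhds hn] with x hx
      rw [qz_eqn hx.le, sub_self]
    rw [this.deriv_eq]; simp
  have h3q : 3 * q - 1 ≠ 0 := by
    intro h
    have : (4 : ℂ) / 3 = 0 := by linear_combination hqz - (q + 1 / 3) * h
    norm_num at this
  have e3 : 3 * z₁ * q' = 4 * q := by
    push_cast at e2
    have h6 : (6 : ℂ) * q' = 2 * z₁ * (3 * q - 1) ^ 2 := by
      linear_combination -(3 * q - 1) * e2 + 3 * q' * e + q' * (6 - 6 * q) * hqz
    have h7 : z₁ ^ 2 * (3 * q - 1) ^ 2 = 4 * q := by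
      linear_combination (3 * q - 1) * e + (3 * q ^ 2 - 4 * q) * hqz
    linear_combination z₁ / 2 * h6 + h7
  have hdq : HasDerivAt dq (0 + (0 * (3 * q ^ 2) - 1 * (3 * ((2 : ℕ) * q ^ 1 * q'))) / (3 * q ^ 2) ^ 2) z₁ :=
    (hasDerivAt_const z₁ (1 : ℂ)).add ((hasDerivAt_const z₁ (1 : ℂ)).div ((hd.pow 2).const_mul 3)
      (mul_ne_zero three_ne_zero (pow_ne_zero 2 hq0)))
  convert! hdq using 1
  push_cast
  field_simp
  linear_combination (8 * q / 3) * hqz + 2 / 3 * e3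

theorem csq_one : csq 1 = 1 := by simp [csq]

/-- A local analytic square root of `dq` off the branch points. -/
theorem exists_local_sqrt {z₀ d : ℂ} (hz : z₀.re < 0) (h0 : dq z₀ ≠ 0) (hd : d ^ 2 = dq z₀) :
    ∃ δ : ℂ → ℂ, AnalyticAt ℂ δ z₀ ∧ (∀ z, δ z ^ 2 = dq z) ∧ δ z₀ = d := by
  refine ⟨fun z => d * csq (dq z / dq z₀), ?_, ?_, ?_⟩
  · apply analyticAt_const.mul
    apply (csq_analyticAt (w := dq z₀ / dq z₀) ?_).comp_of_eq (dq_analyticAt hz).div_const rfl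
    rw [div_self h0]
    exact Complex.one_mem_slitPlane
  · intro z
    rw [mul_pow, csq_sq, hd]
    field_simp
  · simp only [div_self h0, csq_one, mul_one]

/-- The square of the complex difference of potentials near the branch point. -/
def branchSq (z : ℂ) : ℂ :=
  (prim (((1 / z₁ - rt z₁) / 2) ^ 3 - (1 / z₁ - rt z₁) / 2) ((1 / z - rt z + dp z) / 2)
    - prim (((1 / z₁ - rt z₁) / 2) ^ 3 - (1 / z₁ - rt z₁) / 2) ((1 / z - rt z - dp z) / 2)) ^ 2

theorem branch_const_ne_zero : ((1 / z₁ - rt z₁) / 2) ^ 3 - (1 / z₁ - rt z₁) / 2 ≠ 0 := by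
  have := roots_of_sq z₁_re_neg.le (left_ne_zero z₁_re_neg) (dp_sq z₁)
  rw [dp_z₁, add_zero, sub_zero] at this
  exact cube_sub_ne_zero this.rot.eqn

theorem branch_continuousAt :
    ContinuousAt (fun z => (1 / z - rt z + dp z) / 2) z₁ ∧
    ContinuousAt (fun z => (1 / z - rt z - dp z) / 2) z₁ := by
  have hn := z₁_re_neg
  have h1 : ContinuousAt dp z₁ :=
    (dp_continuousWithinAt hn.le (left_ne_zero hn) (Or.inr dq_z₁)).continuousAt
      ((left_mem_nhds hn).mono fun z h => le_of_lt h)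
  have hs : ContinuousAt (fun z => 1 / z - rt z) z₁ :=
    (continuousAt_const.div continuousAt_id (left_ne_zero hn)).sub (rt_analyticAt hn).continuousAt
  exact ⟨(hs.add h1).div_const 2, (hs.sub h1).div_const 2⟩

theorem branch_slitPlane : ∀ᶠ z in 𝓝 z₁,
    (((1 / z - rt z + dp z) / 2) ^ 3 - (1 / z - rt z + dp z) / 2)
      / (((1 / z₁ - rt z₁) / 2) ^ 3 - (1 / z₁ - rt z₁) / 2) ∈ Complex.slitPlane ∧
    (((1 / z - rt z - dp z) / 2) ^ 3 - (1 / z - rt z - dp z) / 2)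
      / (((1 / z₁ - rt z₁) / 2) ^ 3 - (1 / z₁ - rt z₁) / 2) ∈ Complex.slitPlane := by
  obtain ⟨h1, h2⟩ := branch_continuousAt
  have hc := branch_const_ne_zero
  apply Eventually.and
  · apply (((h1.pow 3).sub h1).div_const _).eventually_mem
    apply Complex.isOpen_slitPlane.mem_nhds
    simp only [Pi.sub_apply, Pi.pow_apply]
    rw [dp_z₁, add_zero, div_self hc]
    exact Complex.one_mem_slitPlane
  · apply (((h2.pow 3).sub h2).div_const _).eventually_mem
    apply Complex.isOpen_slitPlane.mem_nhds
    simp only [Pi.sub_apply, Pi.pow_apply]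
    rw [dp_z₁, sub_zero, div_self hc]
    exact Complex.one_mem_slitPlane

theorem branchSq_z₁ : branchSq z₁ = 0 := by simp [branchSq, dp_z₁]

/-- If `D` is the complex difference of potentials, then `D' = 3δ`, so `((D²)')² = 4D²·9δ²`.
Replacing `δ` by `-δ` only changes the sign of `D`, so an analytic local root may stand in for `dp`.
-/
theorem branchSq_hasDerivAt : ∀ᶠ z in 𝓝[≠] z₁, ∃ d, HasDerivAt branchSq d z ∧
    d ^ 2 = 36 * branchSq z * dq z := by
  have hc := branch_const_ne_zero
  filter_upwards [dq_ne_zero_near, nhdsWithin_le_nhds branch_slitPlane] with z ⟨h0, hz⟩ ⟨s1, s2⟩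
  obtain ⟨δ, hδ, hsq, hδz⟩ := exists_local_sqrt hz h0 (dp_sq z)
  set c := ((1 / z₁ - rt z₁) / 2) ^ 3 - (1 / z₁ - rt z₁) / 2
  have hs : AnalyticAt ℂ (fun z => 1 / z - rt z) z :=
    (analyticAt_const.div analyticAt_id (left_ne_zero hz)).sub (rt_analyticAt hz)
  have hr : ∀ᶠ w in 𝓝 z, Roots w ((1 / w - rt w + δ w) / 2) ((1 / w - rt w - δ w) / 2) (rt w) := by
    filter_upwards [left_mem_nhds hz] with w h2
    exact roots_of_sq h2.le (left_ne_zero h2) (hsq w)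
  have d1 := hasDerivAt_prim_comp (ψ := fun w => (1 / w - rt w + δ w) / 2) (c := c)
    (hs.add hδ).div_const (hr.mono fun w h => h.rot.eqn) hc (by rw [hδz]; exact s1)
  have d2 := hasDerivAt_prim_comp (ψ := fun w => (1 / w - rt w - δ w) / 2) (c := c)
    (hs.sub hδ).div_const (hr.mono fun w h => h.rot.rot.eqn) hc (by rw [hδz]; exact s2)
  have d3 := (d1.sub d2).pow 2
  have e : branchSq = fun w => (prim c ((1 / w - rt w + δ w) / 2)
      - prim c ((1 / w - rt w - δ w) / 2)) ^ 2 := by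
    funext w
    rcases sq_eq_dq (dp_sq w) (hsq w) with e | e
    · rw [branchSq, e]
    · rw [branchSq, e, ← sub_eq_add_neg, sub_neg_eq_add, ← neg_sub, neg_sq]
  rw [e]
  refine ⟨_, d3, ?_⟩
  rw [← hsq z]
  simp only [Pi.sub_apply]
  push_cast
  ring

/-- Squaring removes the sign ambiguity, so the function is differentiable around `z₁` and
continuous at it: a removable singularity. -/
theorem branchSq_analyticAt : AnalyticAt ℂ branchSq z₁ := by
  apply Complex.analyticAt_of_differentiable_on_punctured_nhds_of_continuousAt
  · filter_upwards [branchSq_hasDerivAt] with z ⟨d, h, _⟩ using h.differentiableAt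
  · obtain ⟨h1, h2⟩ := branch_continuousAt
    obtain ⟨s1, s2⟩ := branch_slitPlane.self_of_nhds
    have hR := roots_of_sq z₁_re_neg.le (left_ne_zero z₁_re_neg) (dp_sq z₁)
    have c1 := (prim_continuousAt (cube_sub_ne_zero hR.rot.eqn) s1).comp_of_eq
      (f := fun z => (1 / z - rt z + dp z) / 2) h1 rfl
    have c2 := (prim_continuousAt (cube_sub_ne_zero hR.rot.rot.eqn) s2).comp_of_eq
      (f := fun z => (1 / z - rt z - dp z) / 2) h2 rfl
    exact (c1.sub c2).pow 2

theorem branchSq_deriv : ∀ᶠ z in 𝓝 z₁, deriv branchSq z ^ 2 = 36 * (branchSq z * dq z) := by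
  have hd := dq_analyticAt z₁_re_neg
  apply (ContinuousAt.eventuallyEq_nhds_iff_eventuallyEq_nhdsNE ?_ ?_).1
  · filter_upwards [branchSq_hasDerivAt] with z ⟨d, h, e⟩
    rw [h.deriv, e, mul_assoc]
  · exact (branchSq_analyticAt.deriv.pow 2).continuousAt
  · exact (analyticAt_const.mul (branchSq_analyticAt.mul hd)).continuousAt

theorem branchSq_re {z : ℂ} (hz : z.re < 0) : ∃ F : ℂ, F ^ 2 = branchSq z ∧ F.re = potDiff z (dp z) := by
  have hR := roots_of_sq hz.le (left_ne_zero hz) (dp_sq z)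
  refine ⟨_, rfl, ?_⟩
  rw [Complex.sub_re, prim_re branch_const_ne_zero (cube_sub_ne_zero hR.rot.eqn),
    prim_re branch_const_ne_zero (cube_sub_ne_zero hR.rot.rot.eqn), potDiff]
  ring

/-- As `dq` has a simple zero, comparing orders in `branchSq_deriv` gives `2(n - 1) = n + 1`. The
order is finite because the potential does not vanish on the segment below `z₁`. -/
theorem branchSq_order : analyticOrderAt branchSq z₁ = (3 : ℕ) := by
  have ha := branchSq_analyticAt
  have hd := dq_analyticAt z₁_re_neg
  have o1 : analyticOrderAt dq z₁ = 1 := by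
    apply hd.analyticOrderAt_eq_one_of_zero_deriv_ne_zero dq_z₁
    rw [hasDerivAt_dq_z₁.deriv]
    exact div_ne_zero (by norm_num) (mul_ne_zero three_ne_zero (left_ne_zero z₁_re_neg))
  have o2 := ha.analyticOrderAt_deriv_add_one
  simp only [branchSq_z₁, sub_zero] at o2
  have o3 := analyticOrderAt_congr branchSq_deriv
  have o4 : analyticOrderAt (fun z => deriv branchSq z ^ 2) z₁ = 2 • analyticOrderAt (deriv branchSq) z₁ :=
    analyticOrderAt_pow ha.deriv 2
  have o5 : analyticOrderAt (fun z => 36 * (branchSq z * dq z)) z₁ = analyticOrderAt branchSq z₁ + 1 := by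
    have e1 := analyticOrderAt_mul (f := fun _ => (36 : ℂ)) (g := branchSq * dq) (z₀ := z₁)
      analyticAt_const (ha.mul hd)
    rw [analyticOrderAt_mul ha hd, o1] at e1
    have e2 : analyticOrderAt (fun _ : ℂ => (36 : ℂ)) z₁ = 0 := by
      rw [analyticAt_const.analyticOrderAt_eq_zero]; norm_num
    rw [e2, zero_add] at e1
    exact e1
  rw [o4, o5] at o3
  have fin : analyticOrderAt branchSq z₁ ≠ ⊤ := by
    intro h
    rw [analyticOrderAt_eq_top] at h
    have hcont : Tendsto (fun y => pt z₁.re y) (𝓝 z₁.im) (𝓝 z₁) :=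
      (continuous_pt_right z₁.re).continuousAt
    have h1 : ∀ᶠ y in 𝓝[<] z₁.im, branchSq (pt z₁.re y) = 0 :=
      nhdsWithin_le_nhds (hcont.eventually h)
    have h2 : ∀ᶠ y in 𝓝[<] z₁.im, 0 < y :=
      nhdsWithin_le_nhds (isOpen_Ioi.mem_nhds z₁_im_pos)
    obtain ⟨y, e, hy, hy'⟩ := (h1.and (h2.and self_mem_nhdsWithin)).exists
    obtain ⟨F, e1, e2⟩ := branchSq_re (z := pt z₁.re y) z₁_re_neg
    rw [e, sq_eq_zero_iff] at e1
    rw [e1] at e2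
    have hy'' : y < z₁.im := hy'
    exact (potDiff_segment_pos (by nlinarith : y ^ 2 < z₁.im ^ 2)).ne e2
  generalize analyticOrderAt branchSq z₁ = n at *
  generalize analyticOrderAt (deriv branchSq) z₁ = m at *
  lift n to ℕ using fin
  have hm : m ≠ ⊤ := by rintro rfl; simp at o2
  lift m to ℕ using hm
  norm_cast at *
  simp at o3
  norm_cast at *
  omega

/-- The leading terms of `branchSq_deriv` give `9g² = 36g·8/(3z₁)`. -/
theorem exists_branch_factor : ∃ g : ℂ → ℂ, AnalyticAt ℂ g z₁ ∧ g z₁ = 32 / (3 * z₁) ∧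
    ∀ᶠ z in 𝓝 z₁, branchSq z = (z - z₁) ^ 3 * g z := by
  have hz0 := left_ne_zero z₁_re_neg
  obtain ⟨g, hg, hg0, he⟩ := (branchSq_analyticAt.analyticOrderAt_eq_natCast).1 branchSq_order
  simp only [smul_eq_mul] at he
  refine ⟨g, hg, ?_, he⟩
  obtain ⟨k, hk, hk0, hke⟩ : ∃ k : ℂ → ℂ, ContinuousAt k z₁ ∧ k z₁ = 8 / (3 * z₁) ∧
      ∀ z, dq z = (z - z₁) * k z := by
    have hd := hasDerivAt_dq_z₁
    refine ⟨dslope dq z₁, continuousAt_dslope_same.2 hd.differentiableAt, ?_, ?_⟩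
    · rw [dslope_same, hd.deriv]
    · intro z
      have := sub_smul_dslope dq z₁ z
      rw [dq_z₁, sub_zero, smul_eq_mul] at this
      exact this.symm
  have hder : ∀ᶠ z in 𝓝 z₁, deriv branchSq z = (z - z₁) ^ 2 * (3 * g z + (z - z₁) * deriv g z) := by
    filter_upwards [he.eventually_nhds, hg.eventually_analyticAt] with z h1 h2
    rw [EventuallyEq.deriv_eq h1]
    have d1 := (((hasDerivAt_id z).sub_const z₁).pow 3).mul h2.differentiableAt.hasDerivAt
    refine d1.deriv.trans ?_
    simp
    ring
  have hlim : ∀ᶠ z in 𝓝 z₁, (3 * g z + (z - z₁) * deriv g z) ^ 2 = 36 * (g z * k z) := by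
    have hsub : ContinuousAt (fun z : ℂ => z - z₁) z₁ := by fun_prop
    apply (ContinuousAt.eventuallyEq_nhds_iff_eventuallyEq_nhdsNE ?_ ?_).1
    · filter_upwards [nhdsWithin_le_nhds hder, nhdsWithin_le_nhds he,
        nhdsWithin_le_nhds branchSq_deriv, self_mem_nhdsWithin] with z h1 h2 h3 h4
      have hne : (z - z₁) ^ 4 ≠ 0 := pow_ne_zero _ (sub_ne_zero.2 h4)
      rw [h1, h2, hke z] at h3
      apply mul_left_cancel₀ hne
      linear_combination h3
    · exact ((continuousAt_const.mul hg.continuousAt).add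
        (hsub.mul hg.deriv.continuousAt)).pow 2
    · exact continuousAt_const.mul (hg.continuousAt.mul hk)
  have h := hlim.self_of_nhds
  rw [sub_self, zero_mul, add_zero, hk0] at h
  have : g z₁ * (9 * g z₁ - 36 * (8 / (3 * z₁))) = 0 := by linear_combination h
  have h2 := (mul_eq_zero.1 this).resolve_left hg0
  field_simp at h2 ⊢
  linear_combination h2 / 9

/-- Level curves emanating from the branch point. -/
theorem exists_branch_curve {e : ℂ} {t : ℝ} (ht : 0 < t) (he : e ^ 3 = -(t * z₁)) :
    ∃ c : ℝ → ℂ, AnalyticAt ℝ c 0 ∧ c 0 = z₁ ∧ HasDerivAt c e 0 ∧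
      ∀ᶠ s in 𝓝 (0 : ℝ), 0 < s → IsLevel (c s) := by
  have hz0 := left_ne_zero z₁_re_neg
  obtain ⟨g, hg, hg0, hge⟩ := exists_branch_factor
  set A : ℂ := 32 / (3 * z₁) with hA
  have hA0 : A ≠ 0 := div_ne_zero (by norm_num) (mul_ne_zero three_ne_zero hz0)
  -- In the coordinate `φ` the square of the difference is exactly `A φ³`. The level curve is the
  -- preimage of a ray on which this is negative, so that its square roots are purely imaginary.
  set φ : ℂ → ℂ := fun z => (z - z₁) * (g z / A) ^ (((3 : ℕ) : ℂ)⁻¹) with hφ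
  have hpow : AnalyticAt ℂ (fun z => (g z / A) ^ (((3 : ℕ) : ℂ)⁻¹)) z₁ := by
    apply hg.div_const.cpow analyticAt_const
    rw [hg0, div_self hA0]
    exact Complex.one_mem_slitPlane
  have hφa : AnalyticAt ℂ φ z₁ := (analyticAt_id.sub analyticAt_const).mul hpow
  have hφ0 : φ z₁ = 0 := by simp [hφ]
  have hφd : HasDerivAt φ 1 z₁ := by
    have := ((hasDerivAt_id z₁).sub_const z₁).mul hpow.differentiableAt.hasDerivAt
    simpa [hg0, div_self hA0] using! this
  have hd0 : deriv φ z₁ ≠ 0 := by rw [hφd.deriv]; exact one_ne_zero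
  have hχ := hφa.analyticAt_localInverse hd0
  have hl := hφa.hasStrictDerivAt.eventually_left_inverse hd0
  have hr := hφa.hasStrictDerivAt.eventually_right_inverse hd0
  have hsd := (hφa.hasStrictDerivAt.to_localInverse hd0).hasDerivAt
  set χ := hφa.hasStrictDerivAt.localInverse _ _ _ hd0
  rw [hφd.deriv, inv_one] at hsd
  have χ0 : χ (φ z₁) = z₁ := hl.self_of_nhds
  have ha := analyticAt_line (e := e) hχ
  have hd := hasDerivAt_line (e := e) hsd
  rw [one_mul] at hd
  refine ⟨_, ha, by simpa using χ0, hd, ?_⟩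
  have hc := ha.continuousAt
  have h1 : Tendsto (fun s : ℝ => φ z₁ + s * e) (𝓝 0) (𝓝 (φ z₁)) := by
    have : ContinuousAt (fun s : ℝ => φ z₁ + s * e) 0 := by fun_prop
    simpa [ContinuousAt] using this
  have h2 : Tendsto (fun s : ℝ => χ (φ z₁ + s * e)) (𝓝 0) (𝓝 z₁) := by
    have := hc.tendsto
    simpa [χ0] using this
  filter_upwards [h1.eventually hr, h2.eventually hge, h2.eventually (left_mem_nhds z₁_re_neg)]
    with s e1 e2 e3 hs
  set z := χ (φ z₁ + s * e)
  rw [hφ0, zero_add] at e1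
  have key : branchSq z = ((-(32 / 3 * t * s ^ 3) : ℝ) : ℂ) := by
    have e4 : (z - z₁) ^ 3 * (g z / A) = (s * e) ^ 3 := by
      rw [← e1]
      simp only [hφ]
      rw [mul_pow, Complex.cpow_nat_inv_pow _ three_ne_zero]
    have e5 : (z - z₁) ^ 3 * g z = A * (s * e) ^ 3 := by
      rw [← e4]; field_simp
    rw [e2, e5, mul_pow, he, hA]
    push_cast
    field_simp
  obtain ⟨F, f1, f2⟩ := branchSq_re e3
  rw [IsLevel, ← f2]
  rw [key] at f1
  have g1 := congrArg Complex.re f1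
  have g2 := congrArg Complex.im f1
  rw [Complex.ofReal_re] at g1
  rw [Complex.ofReal_im] at g2
  simp [pow_two] at g1 g2
  have : F.re * F.im = 0 := by linarith
  rcases mul_eq_zero.1 this with h | h
  · exact h
  · rw [h] at g1
    have : 0 < 32 / 3 * t * s ^ 3 := by positivity
    nlinarith [mul_self_nonneg F.re]

/-! ### Analytic graphs -/

theorem eventually_lt_of_hasDerivAt {f : ℝ → ℝ} {d a : ℝ} (h : HasDerivAt f d a) :
    ∀ᶠ y in 𝓝 a, 0 < (y - a) * d → f a < f y := by
  by_cases hd : d = 0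
  · exact Eventually.of_forall fun y h => by rw [hd, mul_zero] at h; exact absurd h (lt_irrefl 0)
  · have h1 := (hasDerivAt_iff_tendsto_slope.1 h).mul_const d
    have h2 := eventually_nhdsWithin_iff.1 (h1.eventually (lt_mem_nhds (mul_self_pos.2 hd)))
    filter_upwards [h2] with y h3 h4
    have hy : y - a ≠ 0 := fun h => by rw [h, zero_mul] at h4; exact lt_irrefl 0 h4
    have h5 := h3 (sub_ne_zero.1 hy)
    rw [slope_def_field] at h5
    have h6 : 0 < (f y - f a) * ((y - a) * d) := by
      have e : (f y - f a) * ((y - a) * d) = (f y - f a) / (y - a) * d * (y - a) ^ 2 := by field_simp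
      rw [e]; positivity
    exact sub_pos.1 ((pos_iff_pos_of_mul_pos h6).2 h4)

/-- `f` is prolonged past the endpoints by its germs there; this serves the convention that arcs are
analytic at their endpoints. -/
theorem exists_analytic_extension_Icc {f : ℝ → ℝ} {a b : ℝ} (hab : a < b)
    (h : ∀ y ∈ Ioo a b, AnalyticAt ℝ f y)
    (ha : ∃ F, AnalyticAt ℝ F a ∧ ∀ᶠ y in 𝓝 a, a ≤ y → f y = F y)
    (hb : ∃ F, AnalyticAt ℝ F b ∧ ∀ᶠ y in 𝓝 b, y ≤ b → f y = F y) :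
    ∃ F, AnalyticOnNhd ℝ F (Icc a b) ∧ EqOn F f (Icc a b) := by
  obtain ⟨A, hA, eA⟩ := ha
  obtain ⟨B, hB, eB⟩ := hb
  refine ⟨fun y => if y < a then A y else if b < y then B y else f y, ?_, ?_⟩
  · intro y hy
    rcases hy.1.eq_or_lt with rfl | h1
    · apply hA.congr
      filter_upwards [eA, Iio_mem_nhds hab] with y h1 h2
      by_cases h3 : y < a
      · rw [if_pos h3]
      · rw [if_neg h3, if_neg (not_lt.2 (le_of_lt h2)), h1 (not_lt.1 h3)]
    · rcases hy.2.eq_or_lt with rfl | h2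
      · apply hB.congr
        filter_upwards [eB, Ioi_mem_nhds hab] with y' h1 h2
        rw [if_neg (not_lt.2 (le_of_lt h2))]
        by_cases h3 : y < y'
        · rw [if_pos h3]
        · rw [if_neg h3, h1 (not_lt.1 h3)]
      · apply (h y ⟨h1, h2⟩).congr
        filter_upwards [Ioo_mem_nhds h1 h2] with y' h3
        rw [if_neg (not_lt.2 h3.1.le), if_neg (not_lt.2 h3.2.le)]
  · intro y hy
    simp only
    rw [if_neg (not_lt.2 hy.1), if_neg (not_lt.2 hy.2)]

theorem exists_analytic_extension_Ici {f : ℝ → ℝ} {a : ℝ} (h : ∀ y ∈ Ioi a, AnalyticAt ℝ f y)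
    (ha : ∃ F, AnalyticAt ℝ F a ∧ ∀ᶠ y in 𝓝 a, a ≤ y → f y = F y) :
    ∃ F, AnalyticOnNhd ℝ F (Ici a) ∧ EqOn F f (Ici a) := by
  obtain ⟨A, hA, eA⟩ := ha
  refine ⟨fun y => if y < a then A y else f y, ?_, ?_⟩
  · intro y hy
    rcases (mem_Ici.1 hy).eq_or_lt with rfl | h1
    · apply hA.congr
      filter_upwards [eA] with y h1
      by_cases h3 : y < a
      · rw [if_pos h3]
      · rw [if_neg h3, h1 (not_lt.1 h3)]
    · apply (h y h1).congr
      filter_upwards [Ioi_mem_nhds h1] with y' h3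
      rw [if_neg (not_lt.2 (le_of_lt h3))]
  · intro y hy
    exact if_neg (not_lt.2 hy)

theorem analyticAt_pt {f g : ℝ → ℝ} {t : ℝ} (hf : AnalyticAt ℝ f t) (hg : AnalyticAt ℝ g t) :
    AnalyticAt ℝ (fun t => pt (f t) (g t)) t := by
  simp only [pt_eq]
  exact ((Complex.ofRealCLM.analyticAt _).comp hf).add
    (((Complex.ofRealCLM.analyticAt _).comp hg).mul analyticAt_const)

theorem hasDerivAt_pt {f g : ℝ → ℝ} {f' g' t : ℝ} (hf : HasDerivAt f f' t) (hg : HasDerivAt g g' t) :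
    HasDerivAt (fun t => pt (f t) (g t)) (pt f' g') t := by
  simp only [pt_eq]
  exact hf.ofReal_comp.add (hg.ofReal_comp.mul_const _)

/-- The graph `x = F y`, parametrized by `y = p + t (q - p)`. -/
def graphArc (F : ℝ → ℝ) (p q : ℝ) (t : ℝ) : ℂ := pt (F (p + t * (q - p))) (p + t * (q - p))

theorem segment_mem {p q t : ℝ} (ht : t ∈ Icc (0 : ℝ) 1) : p + t * (q - p) ∈ uIcc p q := by
  rw [← segment_eq_uIcc]
  exact ⟨1 - t, t, by linarith [ht.2], ht.1, by ring, by simp; ring⟩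

theorem arcSet_graphArc (F : ℝ → ℝ) (p q : ℝ) :
    arcSet (graphArc F p q) = (fun y => pt (F y) y) '' uIcc p q := by
  ext z
  constructor
  · rintro ⟨t, ht, rfl⟩
    exact ⟨_, segment_mem ht, rfl⟩
  · rintro ⟨y, hy, rfl⟩
    rw [← segment_eq_uIcc] at hy
    obtain ⟨a, b, ha, hb, hab, rfl⟩ := hy
    refine ⟨b, ⟨hb, by linarith⟩, ?_⟩
    have e : p + b * (q - p) = a • p + b • q := by
      rw [← eq_sub_iff_add_eq] at hab
      rw [hab]; simp; ring
    simp only [graphArc, e]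

theorem hasDerivAt_graphArc {F : ℝ → ℝ} {p q t : ℝ} (hF : DifferentiableAt ℝ F (p + t * (q - p))) :
    HasDerivAt (graphArc F p q) (pt (deriv F (p + t * (q - p)) * (q - p)) (q - p)) t := by
  have h1 : HasDerivAt (fun t => p + t * (q - p)) (q - p) t := by
    simpa using ((hasDerivAt_id t).mul_const (q - p)).const_add p
  exact hasDerivAt_pt (hF.hasDerivAt.comp t h1) h1

theorem isAnalyticArc_graphArc {F : ℝ → ℝ} {p q : ℝ} (hpq : p ≠ q)
    (hF : AnalyticOnNhd ℝ F (uIcc p q)) :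
    IsAnalyticArc (graphArc F p q) (pt (F p) p) (pt (F q) q) := by
  have hd : q - p ≠ 0 := sub_ne_zero.2 hpq.symm
  refine ⟨?_, ?_, ?_, by simp [graphArc], by simp [graphArc]⟩
  · intro t ht
    have h1 : AnalyticAt ℝ (fun t : ℝ => p + t * (q - p)) t := by fun_prop
    exact analyticAt_pt ((hF _ (segment_mem ht)).comp_of_eq h1 rfl) h1
  · intro t ht h
    rw [(hasDerivAt_graphArc (hF _ (segment_mem ht)).differentiableAt).deriv] at h
    exact hd (congrArg Complex.im h)
  · intro s _ t _ h
    have h1 : p + s * (q - p) = p + t * (q - p) := congrArg Complex.im h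
    exact mul_right_cancel₀ hd (add_left_cancel h1)

/-- The unbounded graph `x = F y`, parametrized by `y = p + t`, and its mirror image. -/
def graphRay (F : ℝ → ℝ) (p σ : ℝ) (t : ℝ) : ℂ := pt (F (p + t)) (σ * (p + t))

theorem raySet_graphRay (F : ℝ → ℝ) (p σ : ℝ) :
    raySet (graphRay F p σ) = (fun y => pt (F y) (σ * y)) '' Ici p := by
  ext z
  constructor
  · rintro ⟨t, ht, rfl⟩
    exact ⟨p + t, by rw [mem_Ici] at ht ⊢; linarith, rfl⟩
  · rintro ⟨y, hy, rfl⟩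
    refine ⟨y - p, by rw [mem_Ici] at hy ⊢; linarith, ?_⟩
    simp [graphRay]

theorem isAnalyticRay_graphRay {F : ℝ → ℝ} {p σ : ℝ} (hσ : σ ≠ 0)
    (hF : AnalyticOnNhd ℝ F (Ici p)) :
    IsAnalyticRay (graphRay F p σ) (pt (F p) (σ * p)) := by
  have hmem : ∀ t ∈ Ici (0 : ℝ), p + t ∈ Ici p := fun t ht => by
    rw [mem_Ici] at ht ⊢; linarith
  refine ⟨?_, ?_, ?_, by simp [graphRay], ?_⟩
  · intro t ht
    have h1 : AnalyticAt ℝ (fun t : ℝ => p + t) t := by fun_prop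
    exact analyticAt_pt ((hF _ (hmem t ht)).comp_of_eq h1 rfl) (analyticAt_const.mul h1)
  · intro t ht h
    have h1 : HasDerivAt (fun t => p + t) 1 t := (hasDerivAt_id t).const_add p
    have h2 := hasDerivAt_pt ((hF _ (hmem t ht)).differentiableAt.hasDerivAt.comp t h1)
      (h1.const_mul σ)
    have h3 := h2.deriv.symm.trans h
    have h4 : σ * 1 = 0 := congrArg Complex.im h3
    rw [mul_one] at h4
    exact hσ h4
  · intro s _ t _ h
    have h1 : σ * (p + s) = σ * (p + t) := congrArg Complex.im h
    exact add_left_cancel (mul_left_cancel₀ hσ h1)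
  · rw [← tendsto_norm_atTop_iff_cobounded]
    have h1 : Tendsto (fun t : ℝ => |σ| * |p + t|) atTop atTop :=
      (tendsto_abs_atTop_atTop.comp (tendsto_atTop_add_const_left _ p tendsto_id)).const_mul_atTop
        (abs_pos.2 hσ)
    apply tendsto_atTop_mono _ h1
    intro t
    rw [← abs_mul]
    exact Complex.abs_im_le_norm (graphRay F p σ t)

/-! ### The graphs at the branch point -/

/-- The condition on `θ` says that `exp (iθ)³` is a positive multiple of `-z₁`, as `19π/12 = arg z₁
+ π`. The slope of the graph over the height is `cot θ`, and the half with positive curve parameter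
lies where `y - Im z₁` has the sign of `sin θ`. -/
theorem exists_branch_germ {θ : ℝ} (hθ : ∃ k : ℤ, 3 * θ = 19 * Real.pi / 12 + k * (2 * Real.pi))
    (hs : Real.sin θ ≠ 0) : ∃ F : ℝ → ℝ, AnalyticAt ℝ F z₁.im ∧ F z₁.im = z₁.re ∧
      (∀ᶠ y in 𝓝 z₁.im, 0 < (y - z₁.im) * (Real.cos θ / Real.sin θ) → z₁.re < F y) ∧
      (∀ᶠ y in 𝓝 z₁.im, (y - z₁.im) * (Real.cos θ / Real.sin θ) < 0 → F y < z₁.re) ∧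
      ∀ᶠ y in 𝓝 z₁.im, 0 < (y - z₁.im) * Real.sin θ → IsLevel (pt (F y) y) := by
  set e : ℂ := Complex.exp ((θ : ℝ) * Complex.I) with he
  have ρ0 := third_root_pos
  have e3 : e ^ 3 = -(((1 / (3 : ℝ) ^ (-(1 / 4) : ℝ) : ℝ) : ℂ) * z₁) := by
    rw [z₁_eq, ← mul_assoc, ← Complex.ofReal_mul, one_div_mul_cancel ρ0.ne', Complex.ofReal_one,
      one_mul, he, ← Complex.exp_nat_mul, ← neg_one_mul (Complex.exp _), ← Complex.exp_pi_mul_I,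
      ← Complex.exp_add, Complex.exp_eq_exp_iff_exists_int]
    obtain ⟨k, hk⟩ := hθ
    refine ⟨k, ?_⟩
    have hk' : (3 : ℂ) * θ = 19 * Real.pi / 12 + k * (2 * Real.pi) := by exact_mod_cast hk
    push_cast
    linear_combination Complex.I * hk'
  obtain ⟨c, hc, c0, hd, hl⟩ := exists_branch_curve (by positivity) e3
  have er : e.re = Real.cos θ := Complex.exp_ofReal_mul_I_re θ
  have ei : e.im = Real.sin θ := Complex.exp_ofReal_mul_I_im θ
  obtain ⟨F, s, hF, hF0, hFd, s0, hsd, hce⟩ := exists_graph_of_curve hc hd (by rwa [ei])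
  rw [c0, er, ei] at *
  refine ⟨F, hF, hF0, ?_, ?_, ?_⟩
  · have := eventually_lt_of_hasDerivAt hFd
    rwa [hF0] at this
  · have := eventually_lt_of_hasDerivAt hFd.neg
    filter_upwards [this] with y h1 h2
    simp only [Pi.neg_apply, hF0] at h1
    have := h1 (by linarith)
    linarith
  · have hsc : Tendsto s (𝓝 z₁.im) (𝓝 0) := by
      have := hsd.continuousAt.tendsto
      rwa [s0] at this
    filter_upwards [eventually_lt_of_hasDerivAt hsd, hce, hsc.eventually hl] with y h1 h2 h3 h4
    rw [s0] at h1
    rw [← h2]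
    apply h3 (h1 ?_)
    have e : (y - z₁.im) * (1 / Real.sin θ) = (y - z₁.im) * Real.sin θ * (1 / Real.sin θ) ^ 2 := by
      field_simp
    rw [e]
    positivity

theorem near_im_sq : ∀ᶠ y in 𝓝 z₁.im, 0 < y :=
  isOpen_Ioi.mem_nhds z₁_im_pos

/-- The three directions are `19π/36`, `43π/36` and `-5π/36`. Only `43π/36` points down and to the
left, where `fP` is the unique zero. -/
theorem fP_germ : ∃ F, AnalyticAt ℝ F z₁.im ∧ ∀ᶠ y in 𝓝 z₁.im, y ≤ z₁.im → fP y = F y := by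
  have hpi := Real.pi_pos
  have e : 43 * Real.pi / 36 = 7 * Real.pi / 36 + Real.pi := by ring
  have c0 : 0 < Real.cos (7 * Real.pi / 36) := Real.cos_pos_of_mem_Ioo ⟨by linarith, by linarith⟩
  have s0 : 0 < Real.sin (7 * Real.pi / 36) := Real.sin_pos_of_pos_of_lt_pi (by linarith) (by linarith)
  have hs : Real.sin (43 * Real.pi / 36) < 0 := by rw [e, Real.sin_add_pi]; linarith
  have hc : Real.cos (43 * Real.pi / 36) < 0 := by rw [e, Real.cos_add_pi]; linarith
  obtain ⟨F, hF, F0, -, h2, h3⟩ := exists_branch_germ (θ := 43 * Real.pi / 36)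
    ⟨1, by push_cast; ring⟩ hs.ne
  refine ⟨F, hF, ?_⟩
  filter_upwards [h2, h3, near_im_sq] with y a b hy hle
  rcases hle.eq_or_lt with rfl | h
  · rw [F0, fP_corner rfl]
  · have hsq : y ^ 2 < z₁.im ^ 2 := by nlinarith
    have hF := a (mul_neg_of_neg_of_pos (sub_neg.2 h) (div_pos_of_neg_of_neg hc hs))
    exact (fP_unique hsq.le hF.le (b (mul_pos_of_neg_of_neg (sub_neg.2 h) hs))).symm

/-- Of the three directions only `19π/36` points upwards. -/
theorem fE_germ : ∃ F, AnalyticAt ℝ F z₁.im ∧ ∀ᶠ y in 𝓝 z₁.im, z₁.im ≤ y → fE y = F y := by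
  have hpi := Real.pi_pos
  have hs : 0 < Real.sin (19 * Real.pi / 36) :=
    Real.sin_pos_of_pos_of_lt_pi (by linarith) (by linarith)
  obtain ⟨F, hF, F0, -, -, h3⟩ := exists_branch_germ (θ := 19 * Real.pi / 36)
    ⟨0, by push_cast; ring⟩ hs.ne'
  refine ⟨F, hF, ?_⟩
  have hneg : ∀ᶠ y in 𝓝 z₁.im, F y < 0 := by
    apply hF.continuousAt.eventually_lt continuousAt_const
    rw [F0]; exact z₁_re_neg
  filter_upwards [hneg, h3, near_im_sq] with y a b hy hle
  rcases hle.eq_or_lt with rfl | h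
  · rw [F0, fE_corner rfl]
  · have hY := z₁_im_pos
    have hsq : z₁.im ^ 2 < y ^ 2 := by nlinarith
    exact (fE_unique hsq.le a.le (b (mul_pos (sub_pos.2 h) hs))).symm

/-- The third level curve at the branch point. -/
theorem star_germ : ∃ F, AnalyticAt ℝ F z₁.im ∧ F z₁.im = z₁.re ∧
    ∀ᶠ y in 𝓝 z₁.im, y < z₁.im → z₁.re < F y ∧ IsLevel (pt (F y) y) := by
  have hpi := Real.pi_pos
  have c0 : 0 < Real.cos (5 * Real.pi / 36) := Real.cos_pos_of_mem_Ioo ⟨by linarith, by linarith⟩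
  have s0 : 0 < Real.sin (5 * Real.pi / 36) := Real.sin_pos_of_pos_of_lt_pi (by linarith) (by linarith)
  have hs : Real.sin (-(5 * Real.pi / 36)) < 0 := by rw [Real.sin_neg]; linarith
  have hc : 0 < Real.cos (-(5 * Real.pi / 36)) := by rw [Real.cos_neg]; linarith
  obtain ⟨F, hF, F0, h1, -, h3⟩ := exists_branch_germ (θ := -(5 * Real.pi / 36))
    ⟨-1, by push_cast; ring⟩ hs.ne
  refine ⟨F, hF, F0, ?_⟩
  filter_upwards [h1, h3] with y a b h
  exact ⟨a (mul_pos_of_neg_of_neg (sub_neg.2 h) (div_neg_of_pos_of_neg hc hs)),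
    b (mul_pos_of_neg_of_neg (sub_neg.2 h) hs)⟩

/-- A germ at the lower endpoint, by symmetry. -/
theorem germ_neg {f : ℝ → ℝ} {Y : ℝ} (hf : ∀ᶠ y in 𝓝 Y, y ≤ Y → f (-y) = f y)
    (h : ∃ F, AnalyticAt ℝ F Y ∧ ∀ᶠ y in 𝓝 Y, y ≤ Y → f y = F y) :
    ∃ F, AnalyticAt ℝ F (-Y) ∧ ∀ᶠ y in 𝓝 (-Y), -Y ≤ y → f y = F y := by
  obtain ⟨F, hF, he⟩ := h
  refine ⟨fun y => F (-y), ?_, ?_⟩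
  · exact hF.comp_of_eq analyticAt_id.neg (by simp)
  · have hc : Tendsto (fun y : ℝ => -y) (𝓝 (-Y)) (𝓝 Y) := by
      have : ContinuousAt (fun y : ℝ => -y) (-Y) := by fun_prop
      simpa [ContinuousAt] using this
    filter_upwards [hc.eventually he, hc.eventually hf] with y h1 h2 h3
    have h4 : -y ≤ Y := by linarith
    rw [← h1 h4, ← h2 h4, neg_neg]

theorem exists_fP_extension : ∃ F, AnalyticOnNhd ℝ F (Icc (-z₁.im) z₁.im) ∧
    EqOn F fP (Icc (-z₁.im) z₁.im) := by
  have hY := z₁_im_pos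
  apply exists_analytic_extension_Icc (by linarith)
  · intro y hy
    exact fP_analytic_germ (sq_lt_sq' hy.1 hy.2)
  · apply germ_neg _ fP_germ
    filter_upwards [near_im_sq] with y h1 h2
    exact fP_even (by nlinarith)
  · exact fP_germ

theorem exists_fE_extension : ∃ F, AnalyticOnNhd ℝ F (Ici z₁.im) ∧ EqOn F fE (Ici z₁.im) := by
  have hY := z₁_im_pos
  apply exists_analytic_extension_Ici _ fE_germ
  intro y hy
  have hy' : z₁.im < y := hy
  exact fE_analytic_germ (by nlinarith)

theorem fP_continuousOn : ContinuousOn fP (Icc (-z₁.im) z₁.im) := by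
  obtain ⟨F, hF, he⟩ := exists_fP_extension
  exact hF.continuousOn.congr he.symm

/-! ### The standard branches in the left half-plane -/

/-- The standard cut in the left half-plane. -/
def stdCut : Set ℂ := {z | z.im ^ 2 ≤ z₁.im ^ 2 ∧ z.re = fP z.im}

/-- The region of the strip to the right of the standard cut. -/
def stdRegion : Set ℂ := {z | z.im ^ 2 < z₁.im ^ 2 ∧ fP z.im < z.re}

theorem stdCut_left {z : ℂ} (h : z ∈ stdCut) : z.re < 0 := h.2 ▸ fP_neg h.1

open Classical in
/-- The difference of the two standard left branches. -/
def ds (z : ℂ) : ℂ := if z ∈ stdRegion then -dt z else dp z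

theorem ds_of_mem {z : ℂ} (h : z ∈ stdRegion) : ds z = -dt z := if_pos h

theorem ds_of_not_mem {z : ℂ} (h : z ∉ stdRegion) : ds z = dp z := if_neg h

theorem ds_sq {z : ℂ} (hz : z.re ≤ 0) (h0 : z ≠ 0) : ds z ^ 2 = dq z := by
  by_cases h : z ∈ stdRegion
  · rw [ds_of_mem h, neg_sq, dt_sq hz h0]
  · rw [ds_of_not_mem h, dp_sq]

theorem fP_continuousAt {y : ℝ} (hy : y ^ 2 < z₁.im ^ 2) : ContinuousAt fP y :=
  (fP_analytic_germ hy).continuousAt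

theorem im_sq_lt_near {z : ℂ} (hy : z.im ^ 2 < z₁.im ^ 2) : ∀ᶠ w : ℂ in 𝓝 z, w.im ^ 2 < z₁.im ^ 2 :=
  (Complex.continuous_im.pow 2).continuousAt.eventually_lt continuousAt_const hy

theorem stdRegion_mem_nhds {z : ℂ} (h : z ∈ stdRegion) : ∀ᶠ w in 𝓝 z, w ∈ stdRegion := by
  have h1 : ContinuousAt (fun w : ℂ => fP w.im) z :=
    (fP_continuousAt h.1).comp (f := Complex.im) Complex.continuous_im.continuousAt
  exact (im_sq_lt_near h.1).and
    (h1.eventually_lt Complex.continuous_re.continuousAt h.2)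

theorem mem_Icc_of_sq_le {y : ℝ} (h : y ^ 2 ≤ z₁.im ^ 2) : y ∈ Icc (-z₁.im) z₁.im :=
  abs_le.1 (abs_le_of_sq_le_sq h z₁_im_pos.le)

theorem sq_le_of_mem_Icc {y : ℝ} (h : y ∈ Icc (-z₁.im) z₁.im) : y ^ 2 ≤ z₁.im ^ 2 :=
  sq_le_sq' h.1 h.2

theorem left_of_fP_near {z : ℂ} (hy : z.im ^ 2 ≤ z₁.im ^ 2) (h : z.re < fP z.im) :
    ∀ᶠ w in 𝓝 z, w ∉ stdRegion := by
  have h1 : ContinuousWithinAt (fun w : ℂ => fP w.im) {w | w.im ∈ Icc (-z₁.im) z₁.im} z :=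
    (fP_continuousOn z.im (mem_Icc_of_sq_le hy)).comp
      Complex.continuous_im.continuousWithinAt fun w hw => hw
  have h2 : ∀ᶠ w in 𝓝[{w | w.im ∈ Icc (-z₁.im) z₁.im}] z, w.re < fP w.im :=
    (Complex.continuous_re.continuousWithinAt).eventually_lt h1 h
  rw [eventually_nhdsWithin_iff] at h2
  filter_upwards [h2] with w hw hA
  exact (hw (mem_Icc_of_sq_le hA.1.le)).not_gt hA.2

/-- The difference of the standard branches is locally one of the two analytic square roots. -/
theorem ds_cases {z : ℂ} (hz : z.re ≤ 0) (h0 : z ≠ 0) (hc : z ∉ stdCut) :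
    ((∀ᶠ w in 𝓝 z, w.re ≤ 0 → ds w = -dt w) ∧ ((qz z).re = 0 → (qz z).im ^ 2 < 1 / 3)) ∨
    ((∀ᶠ w in 𝓝 z, w.re ≤ 0 → ds w = dp w) ∧ ((qz z).re = 0 → 1 / 3 < (qz z).im ^ 2)) := by
  -- In the strip `dp` jumps on the curve `Re q = 0`, where `dt` is analytic, and `-dt = dp` to the
  -- right of that curve. Using `-dt` in `stdRegion` thus moves the jump to the standard cut.
  by_cases hA : z ∈ stdRegion
  · left
    refine ⟨?_, qz_curve_middle (x := z.re) (y := z.im) hz h0 hA.1⟩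
    filter_upwards [stdRegion_mem_nhds hA] with w hw _ using ds_of_mem hw
  · right
    rcases lt_or_ge (z₁.im ^ 2) (z.im ^ 2) with hy | hy
    · refine ⟨?_, qz_curve_upper (x := z.re) (y := z.im) hz hy.le fun h => hy.ne' h.2⟩
      have : ∀ᶠ w : ℂ in 𝓝 z, z₁.im ^ 2 < w.im ^ 2 :=
        continuousAt_const.eventually_lt (Complex.continuous_im.pow 2).continuousAt hy
      filter_upwards [this] with w hw _
      exact ds_of_not_mem fun h => h.1.not_gt hw
    · rcases lt_trichotomy z.re (fP z.im) with h | h | h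
      · constructor
        · filter_upwards [left_of_fP_near hy h] with w hw _ using ds_of_not_mem hw
        · have : (qz (pt z.re z.im)).re < 0 := by
            have h1 := fP_spec hy
            apply qz_re_neg_left (h.le.trans h1.1) hy
            exact Or.inl (h.trans_le h1.1)
          exact fun h => absurd h this.ne
      · exact absurd ⟨hy, h⟩ hc
      -- The remaining points lie on the horizontal edges of the region, to the right of the
      -- corners. There `Re q > 0`, so both formulas agree.
      · have hy' : z.im ^ 2 = z₁.im ^ 2 := by
          refine le_antisymm hy (not_lt.1 fun h' => hA ⟨h', h⟩)
        have hY := z₁_im_pos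
        have hy0 : z.im ≠ 0 := by intro h; rw [h] at hy'; nlinarith
        have hq : 0 < (qz z).re := by
          obtain ⟨c, hc, h1, -, h2⟩ := exists_line_sign hy0
          have := ((qz_curve_lt (z := pt c z.im) hc h1).2.1 hy').1
          rw [fP_corner hy'] at h
          exact h2 z.re (this.trans_lt h) hz
        refine ⟨?_, fun h => absurd h hq.ne'⟩
        have h1 : ∀ᶠ w in 𝓝[{w | w.re ≤ 0}] z, 0 < (qz w).re :=
          (Complex.continuous_re.continuousAt.comp_continuousWithinAt
            (qz_continuousWithinAt hz)).eventually_mem (isOpen_Ioi.mem_nhds hq)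
        rw [eventually_nhdsWithin_iff] at h1
        filter_upwards [h1, isOpen_ne.mem_nhds h0] with w hw hw0 hwr
        by_cases hwA : w ∈ stdRegion
        · rw [ds_of_mem hwA, dt_eq_neg_dp hwr hw0 (hw hwr), neg_neg]
        · exact ds_of_not_mem hwA

theorem ds_continuousWithinAt {z : ℂ} (hz : z.re ≤ 0) (h0 : z ≠ 0) (hc : z ∉ stdCut) :
    ContinuousWithinAt ds {z | z.re ≤ 0} z := by
  rcases ds_cases hz h0 hc with ⟨h, hq⟩ | ⟨h, hq⟩
  · exact (dt_continuousWithinAt hz h0 hq).neg.congr_of_eventuallyEq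
      (eventually_nhdsWithin_iff.2 h) (h.self_of_nhds hz)
  · exact (dp_continuousWithinAt hz h0 (Or.inl (dq_slitPlane hz h0 hq))).congr_of_eventuallyEq
      (eventually_nhdsWithin_iff.2 h) (h.self_of_nhds hz)

theorem ds_analyticAt {z : ℂ} (hz : z.re < 0) (hc : z ∉ stdCut) : AnalyticAt ℂ ds z := by
  rcases ds_cases hz.le (left_ne_zero hz) hc with ⟨h, hq⟩ | ⟨h, hq⟩
  · apply (dt_analyticAt hz hq).neg.congr
    filter_upwards [h, left_mem_nhds hz] with w h1 h2 using (h1 h2.le).symm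
  · apply (dp_analyticAt hz hq).congr
    filter_upwards [h, left_mem_nhds hz] with w h1 h2 using (h1 h2.le).symm

/-- The standard branch `ψ_P` in the left half-plane. -/
def sP (z : ℂ) : ℂ := (1 / z - rt z - ds z) / 2

/-- The standard branch `ψ_Q` in the left half-plane. -/
def sQ (z : ℂ) : ℂ := (1 / z - rt z + ds z) / 2

theorem std_roots {z : ℂ} (hz : z.re ≤ 0) (h0 : z ≠ 0) : Roots z (sQ z) (sP z) (rt z) :=
  roots_of_sq hz h0 (ds_sq hz h0)

theorem sQ_sub_sP (z : ℂ) : sQ z - sP z = ds z := by unfold sQ sP; ring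

theorem sP_analyticAt {z : ℂ} (hz : z.re < 0) (hc : z ∉ stdCut) : AnalyticAt ℂ sP z :=
  (((analyticAt_const.div analyticAt_id (left_ne_zero hz)).sub (rt_analyticAt hz)).sub
    (ds_analyticAt hz hc)).div_const

theorem sP_continuousWithinAt {z : ℂ} (hz : z.re ≤ 0) (h0 : z ≠ 0) (hc : z ∉ stdCut) :
    ContinuousWithinAt sP {z | z.re ≤ 0} z :=
  (((continuousWithinAt_const.div continuousWithinAt_id h0).sub (rt_continuousWithinAt hz)).sub
    (ds_continuousWithinAt hz h0 hc)).div_const 2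

theorem neg_eqn {z w : ℂ} (h : z * (w ^ 3 - w) = w ^ 2 - 1 / 3) :
    -z * ((-w) ^ 3 - -w) = (-w) ^ 2 - 1 / 3 := by linear_combination h

theorem ds_imag_axis {z : ℂ} (hz : z.re = 0) (h0 : z ≠ 0) : ds z = dp z := by
  have hy : z.im ≠ 0 := fun h => h0 (Complex.ext hz h)
  by_cases hA : z ∈ stdRegion
  · rw [ds_of_mem hA, dt_eq_neg_dp hz.le h0 (qz_im_axis hz hy), neg_neg]
  · exact ds_of_not_mem hA

/-- On the axis `sP z` has negative real part, so its negative is the right preimage of `-z`. This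
is the matching condition for gluing along the axis. -/
theorem sP_imag_axis {z : ℂ} (hz : z.re = 0) (h0 : z ≠ 0) : sP z = -rt (-z) := by
  have hy : z.im ≠ 0 := fun h => h0 (Complex.ext hz h)
  have h1 := (imag_axis hy).2.1
  have e : pt 0 z.im = z := by rw [← hz]; rfl
  rw [e, ← ds_imag_axis hz h0] at h1
  rw [← neg_eq_iff_eq_neg]
  apply rt_unique (by simp [hz])
  · exact neg_eqn (std_roots hz.le h0).rot.rot.eqn
  · rw [Complex.neg_re]; exact neg_pos.2 h1

theorem sQ_imag_axis {z : ℂ} (hz : z.re = 0) (h0 : z ≠ 0) : (sQ z).re = 0 := by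
  have hy : z.im ≠ 0 := fun h => h0 (Complex.ext hz h)
  have h1 := (imag_axis hy).1
  have e : pt 0 z.im = z := by rw [← hz]; rfl
  rwa [e, ← ds_imag_axis hz h0] at h1

theorem not_mem_stdCut {z : ℂ} (hz : 0 ≤ z.re) : z ∉ stdCut := fun h => (stdCut_left h).not_ge hz

/-! ### The standard branches -/

open Classical in
/-- The standard branch `ψ_P`. -/
def stdP (z : ℂ) : ℂ := if z.re < 0 then sP z else -rt (-z)

/-- The standard branch `ψ_R`. -/
def stdR (z : ℂ) : ℂ := -stdP (-z)

/-- The standard branch `ψ_Q`. -/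
def stdQ (z : ℂ) : ℂ := 1 / z - stdP z - stdR z

theorem stdP_left {z : ℂ} (hz : z.re < 0) : stdP z = sP z := if_pos hz

theorem stdP_right {z : ℂ} (hz : 0 ≤ z.re) : stdP z = -rt (-z) := if_neg (not_lt.2 hz)

theorem stdP_closed_left {z : ℂ} (hz : z.re ≤ 0) (h0 : z ≠ 0) : stdP z = sP z := by
  rcases hz.lt_or_eq with h | h
  · exact stdP_left h
  · rw [stdP_right h.ge, sP_imag_axis h h0]

theorem stdR_left {z : ℂ} (hz : z.re ≤ 0) : stdR z = rt z := by
  rw [stdR, stdP_right (by simpa using hz), neg_neg, neg_neg]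

theorem stdR_neg (z : ℂ) : stdR (-z) = -stdP z := by rw [stdR, neg_neg]

theorem stdP_neg (z : ℂ) : stdP (-z) = -stdR z := by rw [stdR, neg_neg]

theorem stdQ_neg (z : ℂ) : stdQ (-z) = -stdQ z := by
  rw [stdQ, stdQ, stdR_neg, stdP_neg, div_neg]; ring

theorem stdQ_left {z : ℂ} (hz : z.re ≤ 0) (h0 : z ≠ 0) : stdQ z = sQ z := by
  rw [stdQ, stdP_closed_left hz h0, stdR_left hz, sP, sQ]; ring

theorem std_roots_left {z : ℂ} (hz : z.re ≤ 0) (h0 : z ≠ 0) :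
    Roots z (stdQ z) (stdP z) (stdR z) := by
  rw [stdQ_left hz h0, stdP_closed_left hz h0, stdR_left hz]
  exact std_roots hz h0

theorem std_roots_all {z : ℂ} (h0 : z ≠ 0) : Roots z (stdQ z) (stdP z) (stdR z) := by
  rcases le_total z.re 0 with hz | hz
  · exact std_roots_left hz h0
  · have := (std_roots_left (z := -z) (by simpa using hz) (neg_ne_zero.2 h0)).neg
    rw [stdQ_neg, stdP_neg, stdR_neg] at this
    simp only [neg_neg] at this
    exact this.rot.swap.rot.rot

/-- The two one-sided definitions are continuous and agree on the axis, and a continuous choice of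
simple preimages is analytic. -/
theorem stdP_local_imag {z₀ : ℂ} (hz : z₀.re = 0) (h0 : z₀ ≠ 0) : AnalyticAt ℂ stdP z₀ := by
  have h4 : (-rt (-z₀)) ^ 4 ≠ -1 / 3 := by
    rw [Even.neg_pow (by decide)]; exact rt_pow_four_ne (by simp [hz])
  apply analyticAt_of_continuousAt
  · have h1 : ContinuousWithinAt stdP {z | z.re ≤ 0} z₀ := by
      apply (sP_continuousWithinAt hz.le h0 (not_mem_stdCut hz.ge)).congr_of_eventuallyEq _
        (stdP_closed_left hz.le h0)
      rw [EventuallyEq, eventually_nhdsWithin_iff]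
      filter_upwards [isOpen_ne.mem_nhds h0] with w hw hwr
      exact stdP_closed_left hwr hw
    have h2 : ContinuousWithinAt stdP {z | 0 ≤ z.re} z₀ := by
      have h3 : ContinuousWithinAt (fun z => -rt (-z)) {z | 0 ≤ z.re} z₀ := by
        apply ContinuousWithinAt.neg
        apply (rt_continuousWithinAt (z := -z₀) (by simp [hz])).comp (f := fun z => -z)
          continuousWithinAt_id.neg
        intro z hz
        simpa using hz
      exact h3.congr (fun z hz => stdP_right hz) (stdP_right hz.ge)
    have h3 := h1.union h2
    have e : {z : ℂ | z.re ≤ 0} ∪ {z | 0 ≤ z.re} = univ := by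
      ext z; simpa using le_total z.re 0
    rwa [e, continuousWithinAt_univ] at h3
  · filter_upwards [isOpen_ne.mem_nhds h0] with w hw
    exact (std_roots_all hw).rot.rot.eqn
  · rw [stdP_right hz.ge]; exact h4

theorem fP_zero_lt : fP 0 < 0 := fP_neg (by rw [zero_pow two_ne_zero]; exact sq_nonneg _)

theorem zero_mem_stdRegion : (0 : ℂ) ∈ stdRegion := by
  have := z₁_im_pos
  refine ⟨?_, fP_zero_lt⟩
  rw [Complex.zero_im, zero_pow two_ne_zero]; positivity

/-- Near `0` the difference is `-dt`, and `-z dt` tends to `1/(√3 rt 0) = 1`. So `sQ` carries the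
whole pole. -/
theorem tendsto_sQ_mul : Tendsto (fun z => z * sQ z) (𝓝[{z | z.re ≤ 0 ∧ z ≠ 0}] 0) (𝓝 1) := by
  have hr : Tendsto rt (𝓝[{z | z.re ≤ 0 ∧ z ≠ 0}] 0) (𝓝 (rt 0)) :=
    (rt_continuousWithinAt (z := 0) (by simp)).mono fun z hz => hz.1
  have hid : Tendsto (fun z : ℂ => z) (𝓝[{z | z.re ≤ 0 ∧ z ≠ 0}] 0) (𝓝 0) := nhdsWithin_le_nhds
  have hq : Tendsto (fun z => csq (1 + 3 * qz z ^ 2)) (𝓝[{z | z.re ≤ 0 ∧ z ≠ 0}] 0) (𝓝 (csq 1)) := by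
    apply (csq_analyticAt Complex.one_mem_slitPlane).continuousAt.tendsto.comp
    have := ((hid.mul hr).pow 2).const_mul 3 |>.const_add 1
    simpa [qz] using this
  have hr0 : rt 0 ≠ 0 := rt_ne_zero (by simp)
  have h3 : ((√3 : ℝ) : ℂ) ≠ 0 := by rw [Complex.ofReal_ne_zero]; positivity
  have hl := ((((hid.mul hr).const_sub 1).add
    (hq.div (hr.const_mul ((√3 : ℝ) : ℂ)) (mul_ne_zero h3 hr0))).div_const 2)
  have e : (1 - 0 * rt 0 + csq 1 / (((√3 : ℝ) : ℂ) * rt 0)) / 2 = 1 := by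
    rw [csq_one, rt_zero, ← Complex.ofReal_mul, mul_one_div_cancel (by positivity)]
    norm_num
  rw [e] at hl
  apply hl.congr'
  rw [EventuallyEq, eventually_nhdsWithin_iff]
  filter_upwards [stdRegion_mem_nhds zero_mem_stdRegion] with z hA ⟨hz, h0⟩
  have hrz : rt z ≠ 0 := rt_ne_zero hz
  rw [sQ, ds_of_mem hA, dt, neg_neg]
  simp only [Pi.div_apply, qz]
  field_simp

theorem tendsto_sQ_zero : Tendsto sQ (𝓝[{z | z.re ≤ 0 ∧ z ≠ 0}] 0) (Bornology.cobounded ℂ) := by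
  have h1 := tendsto_sQ_mul
  have h2 : Tendsto (fun z : ℂ => z⁻¹) (𝓝[{z | z.re ≤ 0 ∧ z ≠ 0}] 0) (Bornology.cobounded ℂ) :=
    tendsto_inv₀_nhdsNE_zero.mono_left (nhdsWithin_mono _ fun z hz => hz.2)
  rw [← tendsto_norm_atTop_iff_cobounded] at h2 ⊢
  have h3 := h1.norm
  rw [norm_one] at h3
  apply (h3.pos_mul_atTop one_pos h2).congr'
  filter_upwards [self_mem_nhdsWithin] with z hz
  rw [← norm_mul, mul_comm z, mul_assoc, mul_inv_cancel₀ hz.2, mul_one]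

/-- Compare with the local inverse `g` through `-1/√3`. On the left, `g` cannot be `sQ`, which is
unbounded, nor `rt`, which has the wrong sign. On the right, `-g z` must be `rt (-z)`. -/
theorem stdP_analyticAt_zero : AnalyticAt ℂ stdP 0 := by
  have he := neg_eqn (rt_eqn (z := -0) (by simp))
  rw [neg_neg] at he
  have h4 : (-rt (-0)) ^ 4 ≠ -1 / 3 := by
    rw [Even.neg_pow (by decide)]; exact rt_pow_four_ne (by simp)
  obtain ⟨g, hg, g0, hge, -⟩ := exists_local_inverse he h4
  have hr : ∀ᶠ z in 𝓝 (0 : ℂ), (g z).re < 0 := by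
    apply (Complex.continuous_re.continuousAt.comp hg.continuousAt).eventually_lt continuousAt_const
    have := rt_re_pos (z := -0) (by simp)
    simp [g0] at this ⊢
    exact this
  apply hg.congr
  have hb : ∀ᶠ z in 𝓝 (0 : ℂ), ‖g z‖ < ‖g 0‖ + 1 :=
    hg.continuousAt.norm.eventually_lt continuousAt_const (by linarith)
  have hQ : ∀ᶠ z in 𝓝 (0 : ℂ), z.re ≤ 0 ∧ z ≠ 0 → ‖g 0‖ + 1 ≤ ‖sQ z‖ := by
    apply eventually_nhdsWithin_iff.1
    exact (tendsto_norm_atTop_iff_cobounded.2 tendsto_sQ_zero).eventually_ge_atTop _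
  filter_upwards [hge, hr, hb, hQ] with z e1 e2 e3 e4
  rcases lt_or_ge z.re 0 with h | h
  · have h0 := left_ne_zero h
    rw [stdP_left h]
    rcases (std_roots h.le h0).mem e1 with e | e | e
    · have := e4 ⟨h.le, h0⟩
      rw [← e] at this; linarith
    · exact e
    · rw [e] at e2
      exact absurd (rt_re_pos h.le) (not_lt.2 e2.le)
  · rw [stdP_right h, ← neg_eq_iff_eq_neg]
    apply rt_unique (by simpa using h) (neg_eqn e1)
    simpa using e2

theorem stdP_analyticAt {z : ℂ} (hc : z ∉ stdCut) : AnalyticAt ℂ stdP z := by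
  rcases lt_trichotomy z.re 0 with h | h | h
  · apply (sP_analyticAt h hc).congr
    filter_upwards [left_mem_nhds h] with w hw using (stdP_left hw).symm
  · by_cases h0 : z = 0
    · rw [h0]; exact stdP_analyticAt_zero
    · exact stdP_local_imag h h0
  · have h1 : AnalyticAt ℂ (fun z => -rt (-z)) z :=
      ((rt_analyticAt (z := -z) (by simpa using h)).comp_of_eq analyticAt_id.neg rfl).neg
    apply h1.congr
    have : ∀ᶠ w : ℂ in 𝓝 z, 0 < w.re :=
      Complex.continuous_re.continuousAt.eventually_mem (isOpen_Ioi.mem_nhds h)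
    filter_upwards [this] with w hw using (stdP_right hw.le).symm

theorem stdP_eqn (z : ℂ) : z * (stdP z ^ 3 - stdP z) = stdP z ^ 2 - 1 / 3 := by
  by_cases h0 : z = 0
  · have := neg_eqn (rt_eqn (z := -0) (by simp))
    rw [h0, stdP_right (by simp)]
    rwa [neg_neg] at this
  · exact (std_roots_all h0).rot.rot.eqn

theorem stdR_analyticAt {z : ℂ} (hc : -z ∉ stdCut) : AnalyticAt ℂ stdR z :=
  ((stdP_analyticAt hc).comp_of_eq analyticAt_id.neg rfl).neg

theorem stdQ_analyticAt {z : ℂ} (h0 : z ≠ 0) (hP : z ∉ stdCut) (hR : -z ∉ stdCut) :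
    AnalyticAt ℂ stdQ z :=
  ((analyticAt_const.div analyticAt_id h0).sub (stdP_analyticAt hP)).sub (stdR_analyticAt hR)

/-! ### Existence of the sheet structure -/

/-- The prefactor is a positive multiple of `-i`, so reality of the integral becomes vanishing of a
real part. -/
theorem isReal_iff (c : ℂ) : IsReal (3 / (2 * Real.pi * Complex.I) * c) ↔ c.re = 0 := by
  have hpi := Real.pi_ne_zero
  have e : 3 / (2 * Real.pi * Complex.I) * c = ((3 / (2 * Real.pi) : ℝ) : ℂ) * (-(Complex.I * c)) := by
    have hpi' : (Real.pi : ℂ) ≠ 0 := Complex.ofReal_ne_zero.2 hpi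
    push_cast
    field_simp
    linear_combination c * Complex.I_sq
  rw [IsReal, e, Complex.im_ofReal_mul, Complex.neg_im, Complex.I_mul_im]
  simp [hpi]

theorem RealPlusIntegrals.rotate {γ : ℝ → ℂ} {g g' : ℂ → ℂ} (h : RealPlusIntegrals γ g)
    (hg : ∀ z, g' (-z) = -g z) : RealPlusIntegrals (fun t => -γ t) g' := by
  obtain ⟨gp, h1, h2, h3⟩ := h
  have hd : ∀ t, deriv (fun t => -γ t) t = -deriv γ t := fun t => deriv.fun_neg
  have e : ∀ t, -gp t * deriv (fun t => -γ t) t = gp t * deriv γ t := fun t => by rw [hd]; ring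
  refine ⟨fun t => -gp t, ?_, ?_, ?_⟩
  · intro t ht
    apply ((h1 t ht).neg).congr
    intro ε
    rw [← hg, hd]
    congr 1
    ring
  · simpa only [e] using h2
  · simpa only [e] using h3

theorem IsAnalyticArc.neg {γ : ℝ → ℂ} {a b : ℂ} (h : IsAnalyticArc γ a b) :
    IsAnalyticArc (fun t => -γ t) (-a) (-b) := by
  refine ⟨h.analytic.neg, ?_, fun s hs t ht e => h.injOn hs ht (neg_injective e), ?_, ?_⟩
  · intro t ht
    rw [deriv.fun_neg]
    exact neg_ne_zero.2 (h.regular t ht)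
  · simp only [h.source]
  · simp only [h.target]

theorem IsAnalyticRay.neg {γ : ℝ → ℂ} {a : ℂ} (h : IsAnalyticRay γ a) :
    IsAnalyticRay (fun t => -γ t) (-a) := by
  refine ⟨h.analytic.neg, ?_, fun s hs t ht e => h.injOn hs ht (neg_injective e), ?_, ?_⟩
  · intro t ht
    rw [deriv.fun_neg]
    exact neg_ne_zero.2 (h.regular t ht)
  · simp only [h.source]
  · rw [← tendsto_norm_atTop_iff_cobounded]
    simpa only [norm_neg] using tendsto_norm_atTop_iff_cobounded.2 h.target

theorem mem_arcSet_neg {γ : ℝ → ℂ} {z : ℂ} : z ∈ arcSet (fun t => -γ t) ↔ -z ∈ arcSet γ := by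
  constructor
  · rintro ⟨t, ht, rfl⟩; exact ⟨t, ht, (neg_neg _).symm⟩
  · rintro ⟨t, ht, e⟩; exact ⟨t, ht, by simp only [e, neg_neg]⟩

theorem mem_raySet_neg {γ : ℝ → ℂ} {z : ℂ} : z ∈ raySet (fun t => -γ t) ↔ -z ∈ raySet γ := by
  constructor
  · rintro ⟨t, ht, rfl⟩; exact ⟨t, ht, (neg_neg _).symm⟩
  · rintro ⟨t, ht, e⟩; exact ⟨t, ht, by simp only [e, neg_neg]⟩

theorem isPreimage_neg {w z : ℂ} (h : IsPreimage w (-z)) : IsPreimage (-w) z := by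
  have := neg_eqn (isPreimage_iff.1 h)
  rw [neg_neg] at this
  exact isPreimage_iff.2 this

theorem tendsto_neg_infty : Tendsto (fun z : ℂ => -z) (Bornology.cobounded ℂ)
    (Bornology.cobounded ℂ) := by
  rw [← tendsto_norm_atTop_iff_cobounded]
  simpa only [norm_neg] using tendsto_norm_cobounded_atTop

/-- The symmetry `z ↦ -z` of sheet structures. -/
theorem IsSheetStructure.rotate {γP γR : ℝ → ℂ} {ψP ψQ ψR : ℂ → ℂ}
    (S : IsSheetStructure γP γR ψP ψQ ψR) :
    IsSheetStructure (fun t => -γR t) (fun t => -γP t) (fun z => -ψR (-z)) (fun z => -ψQ (-z))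
      (fun z => -ψP (-z)) := by
  have hsub : ∀ {γ : ℝ → ℂ} {ψ : ℂ → ℂ}, DifferentiableOn ℂ ψ (arcSet γ)ᶜ →
      DifferentiableOn ℂ (fun z => -ψ (-z)) (arcSet fun t => -γ t)ᶜ := by
    intro γ ψ h
    apply DifferentiableOn.neg
    exact h.comp differentiableOn_id.neg fun z hz hz' => hz (mem_arcSet_neg.2 hz')
  have hmem : ∀ z, z ∉ (arcSet fun t => -γR t) ∪ (arcSet fun t => -γP t) ∪ {0} →
      -z ∉ arcSet γP ∪ arcSet γR ∪ {0} := by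
    rintro z hz ((h | h) | h)
    · exact hz (Or.inl (Or.inr (mem_arcSet_neg.2 h)))
    · exact hz (Or.inl (Or.inl (mem_arcSet_neg.2 h)))
    · exact hz (Or.inr (neg_eq_zero.1 h))
  refine
    { arcP := ?_
      arcP_left := ?_
      arcR := ?_
      arcR_right := ?_
      invP := fun z hz => isPreimage_neg (S.invR _ fun h => hz (mem_arcSet_neg.2 h))
      invQ := fun z hz => isPreimage_neg (S.invQ _ (hmem z hz))
      invR := fun z hz => isPreimage_neg (S.invP _ fun h => hz (mem_arcSet_neg.2 h))
      analyticP := hsub S.analyticR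
      analyticQ := ?_
      poleQ := ?_
      analyticR := hsub S.analyticP
      inftyP := (S.inftyR.comp tendsto_neg_infty).neg
      inftyQ := ?_
      inftyR := ?_
      realP := S.realR.rotate fun z => by simp only [neg_neg]; ring
      realR := S.realP.rotate fun z => by simp only [neg_neg]; ring }
  · have := S.arcR.neg
    rwa [z₃_eq, z₄_eq, neg_neg, neg_neg] at this
  · intro z hz
    have := S.arcR_right _ (mem_arcSet_neg.1 hz)
    simpa using this
  · have := S.arcP.neg
    rwa [← z₃_eq, ← z₄_eq] at this
  · intro z hz
    have := S.arcP_left _ (mem_arcSet_neg.1 hz)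
    simpa using this
  · apply DifferentiableOn.neg
    exact S.analyticQ.comp differentiableOn_id.neg fun z hz => hmem z hz
  · apply tendsto_neg_infty.comp
    apply S.poleQ.comp
    apply tendsto_nhdsWithin_of_tendsto_nhds_of_eventually_within
    · have : Tendsto (fun z : ℂ => -z) (𝓝 0) (𝓝 (-0)) := continuous_neg.tendsto 0
      rw [neg_zero] at this
      exact this.mono_left nhdsWithin_le_nhds
    · filter_upwards [self_mem_nhdsWithin] with z hz using neg_ne_zero.2 hz
  · simpa using (S.inftyQ.comp tendsto_neg_infty).neg
  · simpa using (S.inftyP.comp tendsto_neg_infty).neg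

theorem not_mem_stdRegion_infty :
    ∀ᶠ z in Bornology.cobounded ℂ ⊓ 𝓟 {z | z.re ≤ 0}, z ∉ stdRegion := by
  obtain ⟨m, hm⟩ := (isCompact_Icc.image_of_continuousOn fP_continuousOn).bddBelow
  rw [eventually_inf_principal]
  filter_upwards [tendsto_norm_cobounded_atTop.eventually_gt_atTop (|m| + z₁.im)] with z hz hr hA
  have hmem := abs_le.2 (mem_Icc_of_sq_le hA.1.le)
  have h1 := hm ⟨z.im, mem_Icc_of_sq_le hA.1.le, rfl⟩
  have h2 : |z.re| ≤ |m| := by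
    have hz0 : z.re ≤ 0 := hr
    have : m ≤ z.re := h1.trans hA.2.le
    rw [abs_of_nonpos hz0, abs_of_nonpos (this.trans hz0)]
    linarith
  have := Complex.norm_le_abs_re_add_abs_im z
  linarith

theorem tendsto_dp_infty :
    Tendsto dp (Bornology.cobounded ℂ ⊓ 𝓟 {z | z.re ≤ 0}) (𝓝 1) := by
  have hn : Tendsto (fun z : ℂ => ‖z‖) (Bornology.cobounded ℂ ⊓ 𝓟 {z | z.re ≤ 0}) atTop :=
    tendsto_norm_cobounded_atTop.mono_left inf_le_left
  have hq : Tendsto qz (Bornology.cobounded ℂ ⊓ 𝓟 {z | z.re ≤ 0}) (Bornology.cobounded ℂ) := by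
    rw [← tendsto_norm_atTop_iff_cobounded]
    have h1 := tendsto_rt.norm
    rw [norm_one] at h1
    apply (hn.atTop_mul_pos one_pos h1).congr
    intro z
    rw [qz, norm_mul]
  have hi := tendsto_inv₀_cobounded.comp hq
  have hdq : Tendsto dq (Bornology.cobounded ℂ ⊓ 𝓟 {z | z.re ≤ 0}) (𝓝 1) := by
    have := ((hi.pow 2).const_mul (1 / 3)).const_add 1
    have e : (1 : ℂ) + 1 / 3 * 0 ^ 2 = 1 := by norm_num
    rw [e] at this
    apply this.congr
    intro z
    simp only [dq, Function.comp_apply]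
    rw [inv_pow, div_mul_eq_mul_div, one_mul, div_eq_mul_inv, div_eq_mul_inv, mul_inv]
    ring
  have := (csq_analyticAt Complex.one_mem_slitPlane).continuousAt.tendsto.comp hdq
  rwa [csq_one] at this

theorem tendsto_ds_infty :
    Tendsto ds (Bornology.cobounded ℂ ⊓ 𝓟 {z | z.re ≤ 0}) (𝓝 1) := by
  apply tendsto_dp_infty.congr'
  filter_upwards [not_mem_stdRegion_infty] with z hz using (ds_of_not_mem hz).symm

theorem tendsto_stdP : Tendsto stdP (Bornology.cobounded ℂ) (𝓝 (-1)) := by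
  have e : Bornology.cobounded ℂ = (Bornology.cobounded ℂ ⊓ 𝓟 {z | z.re < 0})
      ⊔ (Bornology.cobounded ℂ ⊓ 𝓟 {z | 0 ≤ z.re}) := by
    rw [← inf_sup_left, sup_principal]
    have : {z : ℂ | z.re < 0} ∪ {z | 0 ≤ z.re} = univ := by
      ext z; simpa using lt_or_ge z.re 0
    rw [this, principal_univ, inf_top_eq]
  rw [e, tendsto_sup]
  constructor
  · have hle : Bornology.cobounded ℂ ⊓ 𝓟 {z | z.re < 0} ≤ Bornology.cobounded ℂ ⊓ 𝓟 {z | z.re ≤ 0} :=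
      inf_le_inf_left _ (principal_mono.2 fun z (h : z.re < 0) => h.le)
    have h1 : Tendsto (fun z : ℂ => z⁻¹) (Bornology.cobounded ℂ ⊓ 𝓟 {z | z.re < 0}) (𝓝 0) :=
      tendsto_inv₀_cobounded.mono_left inf_le_left
    have h2 := ((h1.sub (tendsto_rt.mono_left hle)).sub (tendsto_ds_infty.mono_left hle)).div_const 2
    have e2 : ((0 : ℂ) - 1 - 1) / 2 = -1 := by norm_num
    rw [e2] at h2
    apply h2.congr'
    rw [EventuallyEq, eventually_inf_principal]
    refine Eventually.of_forall fun z hz => ?_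
    rw [stdP_left hz, sP, one_div]
  · have h1 : Tendsto (fun z : ℂ => -z) (Bornology.cobounded ℂ ⊓ 𝓟 {z | 0 ≤ z.re})
        (Bornology.cobounded ℂ ⊓ 𝓟 {z | z.re ≤ 0}) := by
      apply tendsto_inf.2 ⟨tendsto_neg_infty.mono_left inf_le_left, ?_⟩
      rw [tendsto_principal, eventually_inf_principal]
      refine Eventually.of_forall fun z hz => ?_
      have : 0 ≤ z.re := hz
      simpa using this
    apply (tendsto_rt.comp h1).neg.congr'
    rw [EventuallyEq, eventually_inf_principal]
    exact Eventually.of_forall fun z hz => (stdP_right hz).symm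

theorem tendsto_stdR : Tendsto stdR (Bornology.cobounded ℂ) (𝓝 1) := by
  have := (tendsto_stdP.comp tendsto_neg_infty).neg
  rwa [neg_neg] at this

theorem tendsto_stdQ : Tendsto stdQ (Bornology.cobounded ℂ) (𝓝 0) := by
  have := (tendsto_inv₀_cobounded (α := ℂ)).sub tendsto_stdP |>.sub tendsto_stdR
  have e : (0 : ℂ) - -1 - 1 = 0 := by norm_num
  rw [e] at this
  apply this.congr
  intro z
  rw [stdQ, one_div]

theorem stdQ_pole : Tendsto stdQ (𝓝[≠] 0) (Bornology.cobounded ℂ) := by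
  have h1 : Tendsto (fun z : ℂ => z⁻¹) (𝓝[≠] 0) (Bornology.cobounded ℂ) := tendsto_inv₀_nhdsNE_zero
  have hc : ContinuousAt (fun z => stdP z + stdR z) 0 :=
    (stdP_analyticAt (not_mem_stdCut le_rfl)).continuousAt.add
      (stdR_analyticAt (not_mem_stdCut (by simp))).continuousAt
  rw [← tendsto_norm_atTop_iff_cobounded] at h1 ⊢
  have h2 := (h1.atTop_add (hc.norm.tendsto.mono_left nhdsWithin_le_nhds).neg)
  apply tendsto_atTop_mono _ h2
  intro z
  have e : stdQ z = z⁻¹ - (stdP z + stdR z) := by rw [stdQ, one_div]; ring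
  rw [e]
  have := norm_sub_norm_le z⁻¹ (stdP z + stdR z)
  linarith

theorem z₂_eq_pt : z₂ = pt z₁.re (-z₁.im) := by rw [z₂_eq]; rfl

/-- A parametrization of the standard cut. -/
theorem exists_stdArc : ∃ F : ℝ → ℝ, AnalyticOnNhd ℝ F (Icc (-z₁.im) z₁.im) ∧
    EqOn F fP (Icc (-z₁.im) z₁.im) ∧ IsAnalyticArc (graphArc F z₁.im (-z₁.im)) z₁ z₂ ∧
    arcSet (graphArc F z₁.im (-z₁.im)) = stdCut := by
  have hY := z₁_im_pos
  obtain ⟨F, hF, he⟩ := exists_fP_extension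
  have hu : uIcc z₁.im (-z₁.im) = Icc (-z₁.im) z₁.im := by rw [uIcc_comm, uIcc_of_le (by linarith)]
  refine ⟨F, hF, he, ?_, ?_⟩
  · have := isAnalyticArc_graphArc (p := z₁.im) (q := -z₁.im) (F := F) (by linarith) (by rwa [hu])
    rw [he ⟨by linarith, le_rfl⟩, he ⟨le_rfl, by linarith⟩, fP_corner rfl, fP_corner (neg_sq _)] at this
    rwa [← z₁_eq_pt, ← z₂_eq_pt] at this
  · rw [arcSet_graphArc, hu]
    ext z
    constructor
    · rintro ⟨y, hy, rfl⟩
      exact ⟨sq_le_of_mem_Icc hy, he hy⟩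
    · rintro ⟨h1, h2⟩
      refine ⟨z.im, mem_Icc_of_sq_le h1, ?_⟩
      simp only
      rw [he (mem_Icc_of_sq_le h1), ← h2, pt_re_im]

theorem dp_curve_zero {γ : ℝ → ℂ} {t : ℝ} {γ' : ℂ} (hγ : HasDerivAt γ γ' t) (hz : (γ t).re < 0)
    (hq : (qz (γ t)).re = 0 → 1 / 3 < (qz (γ t)).im ^ 2) (h : ∀ᶠ s in 𝓝 t, IsLevel (γ s)) :
    (dp (γ t) * γ').re = 0 := by
  have h1 := hasDerivAt_potDiff hz (dp_analyticAt hz hq) (dp_sq_eventually _) hγ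
  have h2 : (fun s => potDiff (γ s) (dp (γ s))) =ᶠ[𝓝 t] fun _ => 0 := h
  have h3 := h1.deriv
  rw [h2.deriv_eq] at h3
  simp only [deriv_const] at h3
  linarith

/-- The arc is traversed downwards, so its left side is the region to the right of the cut, where
the boundary value is `-dp`. Since the potential is constant along the arc, `Re (dp γ') = 0`. -/
theorem std_realP {F : ℝ → ℝ} (hF : AnalyticOnNhd ℝ F (Icc (-z₁.im) z₁.im))
    (he : EqOn F fP (Icc (-z₁.im) z₁.im)) (hγ : IsAnalyticArc (graphArc F z₁.im (-z₁.im)) z₁ z₂)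
    (hc : arcSet (graphArc F z₁.im (-z₁.im)) = stdCut) :
    RealPlusIntegrals (graphArc F z₁.im (-z₁.im)) (fun z => stdQ z - stdP z) := by
  have hY := z₁_im_pos
  set γ := graphArc F z₁.im (-z₁.im) with hγdef
  have hmem : ∀ t ∈ Icc (0 : ℝ) 1, γ t ∈ stdCut := fun t ht => hc ▸ ⟨t, ht, rfl⟩
  have him : ∀ t, (γ t).im = z₁.im + t * (-z₁.im - z₁.im) := fun t => rfl
  have hlt : ∀ t ∈ Ioo (0 : ℝ) 1, (γ t).im ^ 2 < z₁.im ^ 2 := fun t ht => by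
    apply sq_lt_sq'
    · rw [him]; nlinarith [ht.2]
    · rw [him]; nlinarith [ht.1]
  have hq : ∀ t ∈ Ioo (0 : ℝ) 1, (qz (γ t)).re < 0 := fun t ht => by
    have h1 := hmem t (Ioo_subset_Icc_self ht)
    have h2 := fP_spec h1.1
    rw [← h1.2] at h2
    exact qz_re_neg_left (x := (γ t).re) (y := (γ t).im) h2.1 h1.1 (Or.inr (hlt t ht))
  have hleft : ∀ t ∈ Icc (0 : ℝ) 1, (γ t).re < 0 := fun t ht => stdCut_left (hmem t ht)
  have hder : ∀ t ∈ Icc (0 : ℝ) 1, HasDerivAt γ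
      (pt (deriv F (z₁.im + t * (-z₁.im - z₁.im)) * (-z₁.im - z₁.im)) (-z₁.im - z₁.im)) t := by
    intro t ht
    apply hasDerivAt_graphArc
    have h1 := segment_mem (p := z₁.im) (q := -z₁.im) ht
    rw [uIcc_comm, uIcc_of_le (by linarith)] at h1
    exact (hF _ h1).differentiableAt
  have hdp0 : ∀ t ∈ Icc (0 : ℝ) 1, t ∉ Ioo (0 : ℝ) 1 → dp (γ t) = 0 := by
    intro t ht h
    rcases (mem_Icc.1 ht).1.eq_or_lt with h0 | h0
    · rw [← h0, hγ.source, dp_z₁]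
    · rcases (mem_Icc.1 ht).2.eq_or_lt with h1 | h1
      · rw [h1, hγ.target, z₂_eq_pt, dp, (isLevel_corner (neg_sq _)).2, csq_zero]
      · exact absurd ⟨h0, h1⟩ h
  have hzero : ∀ t ∈ Icc (0 : ℝ) 1, (-dp (γ t) * deriv γ t).re = 0 := by
    intro t ht
    by_cases h : t ∈ Ioo (0 : ℝ) 1
    · rw [neg_mul, Complex.neg_re, neg_eq_zero]
      apply dp_curve_zero (hder t ht).differentiableAt.hasDerivAt (hleft t ht)
        fun h0 => absurd h0 (hq t h).ne
      filter_upwards [Ioo_mem_nhds h.1 h.2] with s hs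
      have h1 := hmem s (Ioo_subset_Icc_self hs)
      have h2 := (fP_spec h1.1).2
      rwa [← h1.2] at h2
    · rw [hdp0 t ht h]; simp
  have hcont : ContinuousOn (fun t => -dp (γ t) * deriv γ t) (Icc 0 1) := by
    intro t ht
    apply ContinuousWithinAt.mul
    · apply ContinuousWithinAt.neg
      apply (dp_continuousWithinAt (hleft t ht).le (left_ne_zero (hleft t ht)) ?_).comp
        (hder t ht).continuousAt.continuousWithinAt fun s hs => (hleft s hs).le
      by_cases h : t ∈ Ioo (0 : ℝ) 1
      · left
        exact dq_slitPlane (hleft t ht).le (left_ne_zero (hleft t ht))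
          fun h0 => absurd h0 (hq t h).ne
      · right
        rw [← dp_sq, hdp0 t ht h]; norm_num
    · exact (hγ.analytic t ht).deriv.continuousAt.continuousWithinAt
  have hint : ∀ t ∈ Icc (0 : ℝ) 1, IntervalIntegrable (fun t => -dp (γ t) * deriv γ t) volume 0 t := by
    intro t ht
    apply ContinuousOn.intervalIntegrable
    rw [uIcc_of_le ht.1]
    exact hcont.mono (Icc_subset_Icc_right ht.2)
  refine ⟨fun t => -dp (γ t), ?_, hint 1 ⟨zero_le_one, le_rfl⟩, ?_⟩
  · intro t ht
    have ht' := Ioo_subset_Icc_self ht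
    set a := deriv F (z₁.im + t * (-z₁.im - z₁.im)) * (-z₁.im - z₁.im) with ha
    have hdγ : deriv γ t = pt a (-z₁.im - z₁.im) := (hder t ht').deriv
    rw [hdγ]
    have hI : ∀ ε : ℝ, γ t + ε * (Complex.I * pt a (-z₁.im - z₁.im))
        = pt ((γ t).re + ε * (z₁.im + z₁.im)) ((γ t).im + ε * a) := by
      intro ε
      apply Complex.ext
      · simp
      · simp
    simp only [hI]
    set w : ℝ → ℂ := fun ε => pt ((γ t).re + ε * (z₁.im + z₁.im)) ((γ t).im + ε * a) with hw
    have hw0 : w 0 = γ t := by simp [hw, pt_re_im]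
    have hwc : Tendsto w (𝓝[>] 0) (𝓝 (γ t)) := by
      have : ContinuousAt w 0 := by
        simp only [hw, pt_eq]
        fun_prop
      rw [ContinuousAt, hw0] at this
      exact this.mono_left nhdsWithin_le_nhds
    have hreg : ∀ᶠ ε in 𝓝[>] (0 : ℝ), w ε ∈ stdRegion := by
      have hmemt := mem_Icc_of_sq_le (hmem t ht').1
      have hdim : HasDerivAt (fun ε : ℝ => (γ t).im + ε * a) a 0 := by
        simpa using ((hasDerivAt_id (0 : ℝ)).mul_const a).const_add (γ t).im
      have hdF : HasDerivAt (fun ε : ℝ => F ((γ t).im + ε * a)) (deriv F (γ t).im * a) 0 :=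
        (hF _ hmemt).differentiableAt.hasDerivAt.comp_of_eq 0 hdim (by simp)
      have hdre : HasDerivAt (fun ε : ℝ => (γ t).re + ε * (z₁.im + z₁.im)) (z₁.im + z₁.im) 0 := by
        simpa using ((hasDerivAt_id (0 : ℝ)).mul_const (z₁.im + z₁.im)).const_add (γ t).re
      have hd := hdre.sub hdF
      -- Derivative at `0` of the horizontal distance of the displaced point from the cut. The
      -- displacement is normal to the arc, which produces the factor `1 + F'²`.
      have hpos : 0 < z₁.im + z₁.im - deriv F (γ t).im * a := by
        have e : z₁.im + z₁.im - deriv F (γ t).im * a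
            = (z₁.im + z₁.im) * (1 + (deriv F (γ t).im) ^ 2) := by rw [ha, ← him]; ring
        rw [e]; positivity
      have h1 := eventually_lt_of_hasDerivAt hd
      simp only [Pi.sub_apply, zero_mul, add_zero, he hmemt, ← (hmem t ht').2, sub_self] at h1
      filter_upwards [nhdsWithin_le_nhds h1, self_mem_nhdsWithin,
        hwc.eventually (im_sq_lt_near (hlt t ht))] with ε h2 h3 h4
      refine ⟨h4, ?_⟩
      have h5 := h2 (mul_pos (by simpa using h3) hpos)
      have h6 := he (mem_Icc_of_sq_le h4.le)
      simp only [hw, pt_im, pt_re] at h6 ⊢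
      linarith
    have hlim : Tendsto (fun ε => -dt (w ε)) (𝓝[>] 0) (𝓝 (-dp (γ t))) := by
      rw [← dt_eq_dp (hleft t ht').le (left_ne_zero (hleft t ht')) (hq t ht)]
      exact ((dt_analyticAt (hleft t ht') (qz_curve_middle (x := (γ t).re) (y := (γ t).im)
        (hleft t ht').le (left_ne_zero (hleft t ht')) (hlt t ht))).continuousAt.tendsto.comp hwc).neg
    apply hlim.congr'
    filter_upwards [hreg, hwc.eventually (left_mem_nhds (hleft t ht'))] with ε h1 h2
    rw [stdQ_left h2.le (left_ne_zero h2), stdP_left h2, sQ_sub_sP, ds_of_mem h1]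
  · intro t ht
    rw [isReal_iff]
    have h1 := Complex.reCLM.intervalIntegral_comp_comm (hint t ht)
    simp only [Complex.reCLM_apply] at h1
    rw [← h1]
    apply intervalIntegral.integral_zero_ae
    refine Eventually.of_forall fun s hs => ?_
    rw [uIoc_of_le ht.1] at hs
    exact hzero s ⟨hs.1.le, hs.2.trans ht.2⟩

theorem exists_sheetStructure :
    ∃ (γP γR : ℝ → ℂ) (ψP ψQ ψR : ℂ → ℂ), IsSheetStructure γP γR ψP ψQ ψR := by
  obtain ⟨F, hF, he, hγ, hc⟩ := exists_stdArc
  set γ := graphArc F z₁.im (-z₁.im)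
  have hR : ∀ z, z ∈ arcSet (fun t => -γ t) ↔ -z ∈ stdCut := fun z => by rw [mem_arcSet_neg, hc]
  refine ⟨γ, fun t => -γ t, stdP, stdQ, stdR,
    { arcP := hγ
      arcP_left := fun z hz => stdCut_left (hc ▸ hz)
      arcR := ?_
      arcR_right := ?_
      invP := fun z _ => isPreimage_iff.2 (stdP_eqn z)
      invQ := ?_
      invR := ?_
      analyticP := fun z hz => (stdP_analyticAt (hc ▸ hz)).differentiableAt.differentiableWithinAt
      analyticQ := ?_
      poleQ := stdQ_pole
      analyticR := ?_
      inftyP := tendsto_stdP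
      inftyQ := tendsto_stdQ
      inftyR := tendsto_stdR
      realP := std_realP hF he hγ hc
      realR := (std_realP hF he hγ hc).rotate fun z => by rw [stdQ_neg, stdR_neg]; ring }⟩
  · rw [z₃_eq, z₄_eq]; exact hγ.neg
  · intro z hz
    simpa using stdCut_left ((hR z).1 hz)
  · intro z hz
    have h0 : z ≠ 0 := fun h => hz (Or.inr h)
    exact isPreimage_iff.2 (std_roots_all h0).rot.eqn
  · intro z _
    have := neg_eqn (stdP_eqn (-z))
    rw [neg_neg] at this
    exact isPreimage_iff.2 this
  · intro z hz
    have h0 : z ≠ 0 := fun h => hz (Or.inr h)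
    refine (stdQ_analyticAt h0 ?_ ?_).differentiableAt.differentiableWithinAt
    · exact fun h => hz (Or.inl (Or.inl (hc ▸ h)))
    · exact fun h => hz (Or.inl (Or.inr ((hR z).2 h)))
  · intro z hz
    exact (stdR_analyticAt fun h => hz ((hR z).2 h)).differentiableAt.differentiableWithinAt

/-! ### Complements of analytic arcs -/

theorem eq_of_locally_eq {X Y : Type*} [TopologicalSpace X] {s : Set X} (hs : IsPreconnected s)
    {f : X → Y} (h : ∀ x ∈ s, ∀ᶠ y in 𝓝[s] x, f y = f x) {x y : X} (hx : x ∈ s) (hy : y ∈ s) :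
    f x = f y := by
  let : TopologicalSpace Y := ⊥
  have : DiscreteTopology Y := ⟨rfl⟩
  refine hs.constant (fun x hx => ?_) hx hy
  exact tendsto_const_nhds.congr' ((h x hx).mono fun y hy => hy.symm)

theorem IsAnalyticArc.continuousOn {γ : ℝ → ℂ} {a b : ℂ} (h : IsAnalyticArc γ a b) :
    ContinuousOn γ (Icc 0 1) := h.analytic.continuousOn

theorem IsAnalyticArc.isCompact {γ : ℝ → ℂ} {a b : ℂ} (h : IsAnalyticArc γ a b) :
    IsCompact (arcSet γ) := isCompact_Icc.image_of_continuousOn h.continuousOn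

theorem IsAnalyticArc.isClosed {γ : ℝ → ℂ} {a b : ℂ} (h : IsAnalyticArc γ a b) :
    IsClosed (arcSet γ) := h.isCompact.isClosed

/-- Local straightening of an analytic arc. -/
theorem IsAnalyticArc.exists_box {γ : ℝ → ℂ} {a b : ℂ} (h : IsAnalyticArc γ a b) {t₀ : ℝ}
    (ht : t₀ ∈ Icc (0 : ℝ) 1) : ∃ (Φ : ℂ → ℂ) (r : ℝ), 0 < r ∧
      (∀ s : ℝ, Φ s = γ s) ∧
      (∀ ε : ℝ, Φ (t₀ + ε * Complex.I) = γ t₀ + ε * (Complex.I * deriv γ t₀)) ∧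
      (∀ ζ ∈ Metric.ball (t₀ : ℂ) r, map Φ (𝓝 ζ) = 𝓝 (Φ ζ)) ∧
      ∀ ζ ∈ Metric.ball (t₀ : ℂ) r, Φ ζ ∈ arcSet γ → ζ.im = 0 ∧ ζ.re ∈ Icc (0 : ℝ) 1 := by
  set v := deriv γ t₀ with hv
  have hv0 : v ≠ 0 := h.regular t₀ ht
  -- A thickening of the arc in the fixed direction `iv`. At the real point `t₀` its real derivative
  -- is multiplication by `v`, hence invertible.
  set Φ : ℂ → ℂ := fun ζ => γ ζ.re + (ζ.im : ℂ) * (Complex.I * v) with hΦ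
  set L : ℂ ≃L[ℝ] ℂ := (ContinuousLinearEquiv.unitsEquivAut ℂ (Units.mk0 v hv0)).restrictScalars ℝ
  have hd : HasStrictFDerivAt Φ (L : ℂ →L[ℝ] ℂ) (t₀ : ℂ) := by
    have h1 : HasStrictDerivAt γ v t₀ := (h.analytic t₀ ht).hasStrictDerivAt
    have h2 : HasStrictFDerivAt (fun ζ : ℂ => γ ζ.re)
        ((ContinuousLinearMap.toSpanSingleton ℝ v).comp Complex.reCLM) (t₀ : ℂ) :=
      HasStrictFDerivAt.comp (t₀ : ℂ) (f := fun ζ : ℂ => ζ.re) (by simpa using h1.hasStrictFDerivAt)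
        Complex.reCLM.hasStrictFDerivAt
    have h3 : HasStrictFDerivAt (fun ζ : ℂ => (ζ.im : ℂ) * (Complex.I * v))
        ((ContinuousLinearMap.toSpanSingleton ℝ (Complex.I * v)).comp Complex.imCLM) (t₀ : ℂ) := by
      have := ((ContinuousLinearMap.toSpanSingleton ℝ (Complex.I * v)).comp
        Complex.imCLM).hasStrictFDerivAt (x := (t₀ : ℂ))
      convert! this using 1
    convert! h2.add h3 using 1
    ext ζ
    simp only [L]
    simp
    conv_lhs => rw [← Complex.re_add_im ζ]
    ring
  set R := hd.toOpenPartialHomeomorph Φ with hR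
  have hRc : (R : ℂ → ℂ) = Φ := rfl
  have hsrc : (t₀ : ℂ) ∈ R.source := hd.mem_toOpenPartialHomeomorph_source
  obtain ⟨ρ, hρ, hρs⟩ := Metric.isOpen_iff.1 R.open_source _ hsrc
  have hΦr : ∀ s : ℝ, Φ s = γ s := fun s => by simp [hΦ]
  -- The far part of the arc is compact and, by injectivity, misses `γ t₀`. Near `γ t₀` only the
  -- straightened piece remains.
  set K := γ '' (Icc 0 1 \ Metric.ball t₀ ρ) with hK
  have hKc : IsClosed K := by
    apply IsCompact.isClosed
    apply IsCompact.image_of_continuousOn (isCompact_Icc.diff Metric.isOpen_ball)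
    exact h.continuousOn.mono Set.sdiff_subset
  have hK0 : Φ t₀ ∉ K := by
    rintro ⟨s, ⟨hs, hs'⟩, e⟩
    rw [hΦr] at e
    rw [h.injOn hs ht e] at hs'
    exact hs' (Metric.mem_ball_self hρ)
  have hnear : ∀ᶠ ζ in 𝓝 (t₀ : ℂ), Φ ζ ∉ K :=
    hd.continuousAt.eventually_mem (hKc.isOpen_compl.mem_nhds hK0)
  obtain ⟨r, hr, hrs⟩ := Metric.eventually_nhds_iff_ball.1 hnear
  refine ⟨Φ, min r ρ, lt_min hr hρ, hΦr, fun ε => by simp [hΦ, hv], ?_, ?_⟩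
  · intro ζ hζ
    exact R.map_nhds_eq (hρs (Metric.ball_subset_ball (min_le_right _ _) hζ))
  · rintro ζ hζ ⟨s, hs, e⟩
    have h1 := hrs ζ (Metric.ball_subset_ball (min_le_left _ _) hζ)
    have h2 : s ∈ Metric.ball t₀ ρ := by
      by_contra hcon
      exact h1 ⟨s, ⟨hs, hcon⟩, e⟩
    have h3 : (s : ℂ) ∈ R.source := by
      apply hρs
      rw [Metric.mem_ball, Complex.dist_eq, ← Complex.ofReal_sub, Complex.norm_real]
      exact h2
    have h4 : (s : ℂ) = ζ := by
      apply R.injOn h3 (hρs (Metric.ball_subset_ball (min_le_right _ _) hζ))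
      rw [hRc, hΦr, e]
    rw [← h4]
    exact ⟨by simp, by simpa using hs⟩

theorem IsAnalyticArc.transversal {γ : ℝ → ℂ} {a b : ℂ} (h : IsAnalyticArc γ a b) {t : ℝ}
    (ht : t ∈ Icc (0 : ℝ) 1) :
    Tendsto (fun ε : ℝ => γ t + ε * (Complex.I * deriv γ t)) (𝓝[>] 0) (𝓝 (γ t)) ∧
      ∀ᶠ ε : ℝ in 𝓝[>] 0, γ t + ε * (Complex.I * deriv γ t) ∉ arcSet γ := by
  obtain ⟨Φ, r, hr, -, h1, -, h3⟩ := h.exists_box ht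
  have hlim : ∀ v w : ℂ, Tendsto (fun ε : ℝ => w + ε * v) (𝓝[>] 0) (𝓝 w) := by
    intro v w
    have : ContinuousAt (fun ε : ℝ => w + ε * v) 0 := by fun_prop
    have := this.tendsto
    simp only [Complex.ofReal_zero, zero_mul, add_zero] at this
    exact this.mono_left nhdsWithin_le_nhds
  refine ⟨hlim _ _, ?_⟩
  filter_upwards [(hlim Complex.I t).eventually (Metric.ball_mem_nhds _ hr),
    self_mem_nhdsWithin] with ε h4 h5 h6
  rw [← h1] at h6
  have := (h3 _ h4 h6).1
  simp at this
  exact (ne_of_gt h5) this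

theorem IsAnalyticArc.compl_frequently {γ : ℝ → ℂ} {a b : ℂ} (h : IsAnalyticArc γ a b) (z : ℂ) :
    ∃ᶠ w in 𝓝 z, w ∉ arcSet γ := by
  by_cases hz : z ∈ arcSet γ
  · obtain ⟨t, ht, rfl⟩ := hz
    obtain ⟨Φ, r, hr, h1, -, h2, h3⟩ := h.exists_box ht
    have hm := h2 t (Metric.mem_ball_self hr)
    rw [h1] at hm
    rw [← hm, frequently_map]
    have hc : Tendsto (fun ε : ℝ => (t : ℂ) + ε * Complex.I) (𝓝[>] 0) (𝓝 t) := by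
      have : ContinuousAt (fun ε : ℝ => (t : ℂ) + ε * Complex.I) 0 := by fun_prop
      have := this.tendsto
      simp only [Complex.ofReal_zero, zero_mul, add_zero] at this
      exact this.mono_left nhdsWithin_le_nhds
    apply hc.frequently
    apply Eventually.frequently
    filter_upwards [hc.eventually (Metric.ball_mem_nhds _ hr), self_mem_nhdsWithin] with ε h4 h5 h6
    have := (h3 _ h4 h6).1
    simp at this
    exact (ne_of_gt h5) this
  · intro hcon
    exact hcon.self_of_nhds hz

theorem halfBall_const {f : ℂ → Prop} {c : ℂ} {r σ : ℝ}
    (h : ∀ ζ ∈ Metric.ball c r, 0 < σ * ζ.im → ∀ᶠ w in 𝓝 ζ, f w = f ζ) {ζ ζ' : ℂ}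
    (h1 : ζ ∈ Metric.ball c r) (h2 : 0 < σ * ζ.im) (h3 : ζ' ∈ Metric.ball c r)
    (h4 : 0 < σ * ζ'.im) : f ζ = f ζ' := by
  have hconv : Convex ℝ (Metric.ball c r ∩ {ζ | 0 < σ * ζ.im}) := by
    apply (convex_ball c r).inter
    have := (convex_Ioi (0 : ℝ)).linear_preimage (σ • Complex.imLm)
    simpa [preimage, Complex.imLm] using! this
  exact eq_of_locally_eq hconv.isPreconnected
    (fun x hx => nhdsWithin_le_nhds (h x hx.1 hx.2)) ⟨h1, h2⟩ ⟨h3, h4⟩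

/-- Removing an analytic arc from a connected open set leaves it connected. -/
theorem IsAnalyticArc.const_of_locally_const {γ : ℝ → ℂ} {a b : ℂ} (h : IsAnalyticArc γ a b)
    {U : Set ℂ} (hU : IsPreconnected U) (hγU : arcSet γ ⊆ U) (hUo : IsOpen U) {f : ℂ → Prop}
    (hf : ∀ z ∈ U, z ∉ arcSet γ → ∀ᶠ w in 𝓝 z, f w = f z) {z w : ℂ}
    (hz : z ∈ U) (hz' : z ∉ arcSet γ) (hw : w ∈ U) (hw' : w ∉ arcSet γ) : f z = f w := by
  -- The parameters at which the two sides of the arc carry the same value of `f`.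
  set T : Set ℝ := {t | ∃ p : Prop, ∀ᶠ w in 𝓝 (γ t), w ∉ arcSet γ → f w = p} with hT
  -- Agreement at one parameter spreads along a straightened box, because each half of the box is
  -- connected. A parameter outside `[0, 1]` counts as agreement: there the arc is absent.
  have box : ∀ t₀ ∈ Icc (0 : ℝ) 1, ∃ r > 0, (∀ s, |s - t₀| < r → (s ∈ Icc (0 : ℝ) 1 → s ∈ T) →
      ∀ s', |s' - t₀| < r → s' ∈ Icc (0 : ℝ) 1 → s' ∈ T) := by
    intro t₀ ht₀
    obtain ⟨Φ, r₁, hr₁, h1, -, h2, h3⟩ := h.exists_box ht₀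
    have hUn : ∀ᶠ ζ in 𝓝 (t₀ : ℂ), Φ ζ ∈ U := by
      have := h2 t₀ (Metric.mem_ball_self hr₁)
      have h4 : ∀ᶠ w in 𝓝 (Φ t₀), w ∈ U := hUo.mem_nhds (hγU (by rw [h1]; exact ⟨t₀, ht₀, rfl⟩))
      rw [← this] at h4
      exact h4
    obtain ⟨r₂, hr₂, hU₂⟩ := Metric.eventually_nhds_iff_ball.1 hUn
    obtain ⟨r, hr, hb1, hb2⟩ : ∃ r > 0, Metric.ball (t₀ : ℂ) r ⊆ Metric.ball (t₀ : ℂ) r₁ ∧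
        Metric.ball (t₀ : ℂ) r ⊆ Metric.ball (t₀ : ℂ) r₂ :=
      ⟨min r₁ r₂, lt_min hr₁ hr₂, Metric.ball_subset_ball (min_le_left _ _),
        Metric.ball_subset_ball (min_le_right _ _)⟩
    have hloc : ∀ ζ ∈ Metric.ball (t₀ : ℂ) r, Φ ζ ∉ arcSet γ →
        ∀ᶠ w in 𝓝 ζ, f (Φ w) = f (Φ ζ) := by
      intro ζ hζ hζ'
      have h4 := hf (Φ ζ) (hU₂ ζ (hb2 hζ)) hζ'
      rw [← h2 ζ (hb1 hζ)] at h4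
      exact h4
    have hoff : ∀ ζ ∈ Metric.ball (t₀ : ℂ) r, ζ.im ≠ 0 → Φ ζ ∉ arcSet γ :=
      fun ζ hζ hi hm => hi (h3 ζ (hb1 hζ) hm).1
    have hU : ∀ ζ ζ', ζ ∈ Metric.ball (t₀ : ℂ) r → 0 < ζ.im → ζ' ∈ Metric.ball (t₀ : ℂ) r →
        0 < ζ'.im → f (Φ ζ) = f (Φ ζ') := fun ζ ζ' a1 a2 a3 a4 =>
      halfBall_const (f := fun ζ => f (Φ ζ)) (σ := 1)
        (fun ζ hζ hi => hloc ζ hζ (hoff ζ hζ (by simpa using hi.ne'))) a1 (by simpa using a2) a3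
        (by simpa using a4)
    have hL : ∀ ζ ζ', ζ ∈ Metric.ball (t₀ : ℂ) r → ζ.im < 0 → ζ' ∈ Metric.ball (t₀ : ℂ) r →
        ζ'.im < 0 → f (Φ ζ) = f (Φ ζ') := fun ζ ζ' a1 a2 a3 a4 =>
      halfBall_const (f := fun ζ => f (Φ ζ)) (σ := -1)
        (fun ζ hζ hi => hloc ζ hζ (hoff ζ hζ fun h => by rw [h] at hi; simp at hi))
        a1 (by simpa using a2) a3 (by simpa using a4)
    have hball : ∀ s : ℝ, |s - t₀| < r → (s : ℂ) ∈ Metric.ball (t₀ : ℂ) r := fun s hs => by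
      rw [Metric.mem_ball, Complex.dist_eq, ← Complex.ofReal_sub, Complex.norm_real]
      exact hs
    have happ : ∀ (s σ : ℝ), Tendsto (fun ε : ℝ => (s : ℂ) + (σ * ε : ℝ) * Complex.I) (𝓝[>] 0)
        (𝓝 (s : ℂ)) := fun s σ => by
      have : ContinuousAt (fun ε : ℝ => (s : ℂ) + (σ * ε : ℝ) * Complex.I) 0 := by fun_prop
      have := this.tendsto
      simp only [mul_zero, Complex.ofReal_zero, zero_mul, add_zero] at this
      exact this.mono_left nhdsWithin_le_nhds
    refine ⟨r, hr, ?_⟩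
    intro s hs hsT s' hs' hs'I
    obtain ⟨p, hp⟩ : ∃ p : Prop, ∀ᶠ ζ in 𝓝 (s : ℂ), Φ ζ ∉ arcSet γ → f (Φ ζ) = p := by
      by_cases hsI : s ∈ Icc (0 : ℝ) 1
      · obtain ⟨p, hp⟩ := hsT hsI
        rw [← h1, ← h2 _ (hb1 (hball s hs))] at hp
        exact ⟨p, hp⟩
      · have : Φ s ∉ arcSet γ := fun hm => hsI (by simpa using (h3 s (hb1 (hball s hs)) hm).2)
        exact ⟨_, (hloc s (hball s hs) this).mono fun ζ h _ => h⟩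
    have side : ∀ σ : ℝ, σ ≠ 0 → ∃ ζ ∈ Metric.ball (t₀ : ℂ) r, 0 < σ * ζ.im ∧ f (Φ ζ) = p := by
      intro σ hσ
      obtain ⟨ε, e1, e2, e3⟩ := (((happ s σ).eventually hp).and (((happ s σ).eventually
        (Metric.isOpen_ball.mem_nhds (hball s hs))).and self_mem_nhdsWithin)).exists
      have hε : (0 : ℝ) < ε := e3
      refine ⟨_, e2, ?_, e1 (hoff _ e2 ?_)⟩
      · simp
        have := mul_pos (sq_pos_of_ne_zero hσ) hε
        nlinarith
      · simp; exact ⟨hσ, hε.ne'⟩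
    obtain ⟨ζ₁, b1, i1, p1⟩ := side 1 one_ne_zero
    obtain ⟨ζ₂, b2, i2, p2⟩ := side (-1) (by norm_num)
    refine ⟨p, ?_⟩
    rw [← h1, ← h2 _ (hb1 (hball s' hs')), eventually_map]
    filter_upwards [Metric.isOpen_ball.mem_nhds (hball s' hs')] with ζ hζ hζ'
    rcases lt_trichotomy ζ.im 0 with hi | hi | hi
    · rw [← p2]; exact hL _ _ hζ hi b2 (by linarith)
    · have hζr : ζ = (ζ.re : ℂ) := Complex.ext rfl (by simpa using hi)
      have h4 := happ ζ.re 1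
      rw [← hζr] at h4
      obtain ⟨ε, e1, e2, e3⟩ := ((h4.eventually (hloc ζ hζ hζ')).and ((h4.eventually
        (Metric.isOpen_ball.mem_nhds hζ)).and self_mem_nhdsWithin)).exists
      have hε : (0 : ℝ) < ε := e3
      rw [← e1, ← p1]
      exact hU _ _ e2 (by simpa [hi] using hε) b1 (by linarith)
    · rw [← p1]; exact hU _ _ hζ hi b1 (by linarith)
  have hTall : ∀ t ∈ Icc (0 : ℝ) 1, t ∈ T := by
    have hloc : ∀ t ∈ Icc (0 : ℝ) 1, ∀ᶠ s in 𝓝[Icc 0 1] t, (s ∈ T) = (t ∈ T) := by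
      intro t ht
      obtain ⟨r, hr, hb⟩ := box t ht
      filter_upwards [self_mem_nhdsWithin, nhdsWithin_le_nhds (Metric.ball_mem_nhds t hr)] with s hs hs'
      apply propext
      exact ⟨fun h => hb s hs' (fun _ => h) t (by simpa using hr) ht,
        fun h => hb t (by simpa using hr) (fun _ => h) s hs' hs⟩
    have h0 : (0 : ℝ) ∈ T := by
      obtain ⟨r, hr, hb⟩ := box 0 ⟨le_rfl, zero_le_one⟩
      -- A slightly negative parameter lies beyond the end of the arc, so the two sides communicate
      -- around the endpoint.
      refine hb (-(r / 2)) ?_ ?_ 0 (by simpa using hr) ⟨le_rfl, zero_le_one⟩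
      · rw [sub_zero, abs_neg, abs_of_pos (by positivity)]; linarith
      · intro hcon; linarith [hcon.1]
    intro t ht
    have := eq_of_locally_eq (f := fun t => t ∈ T) isPreconnected_Icc hloc ht ⟨le_rfl, zero_le_one⟩
    rw [this]; exact h0
  have hall : ∀ z ∈ U, ∃ p : Prop, ∀ᶠ w in 𝓝 z, w ∉ arcSet γ → f w = p := by
    intro z hz
    by_cases hzγ : z ∈ arcSet γ
    · obtain ⟨t, ht, rfl⟩ := hzγ
      exact hTall t ht
    · exact ⟨f z, (hf z hz hzγ).mono fun w h _ => h⟩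
  choose! p hp using hall
  have hpl : ∀ z ∈ U, ∀ᶠ w in 𝓝[U] z, p w = p z := by
    intro z hz
    filter_upwards [self_mem_nhdsWithin, nhdsWithin_le_nhds (hp z hz).eventually_nhds] with w hw h1
    obtain ⟨v, ⟨h2, h3⟩, h4⟩ := ((h.compl_frequently w).and_eventually h1 |>.and_eventually (hp w hw)).exists
    rw [← h4 h2, h3 h2]
  have hpf : ∀ z ∈ U, z ∉ arcSet γ → f z = p z := fun z hz hz' => (hp z hz).self_of_nhds hz'
  rw [hpf z hz hz', hpf w hw hw']
  exact eq_of_locally_eq hU hpl hz hw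

/-! ### Uniqueness of the sheet structure -/

theorem eq_of_eqOn_left {f g : ℂ → ℂ} {z : ℂ} (hz : z.re = 0) (hf : ContinuousAt f z)
    (hg : ContinuousWithinAt g {z | z.re ≤ 0} z) (h : ∀ᶠ w in 𝓝 z, w.re < 0 → f w = g w) :
    f z = g z := by
  have hne : (𝓝[{w : ℂ | w.re < 0}] z).NeBot := by
    rw [← mem_closure_iff_nhdsWithin_neBot, Complex.closure_setOfPred_re_lt]
    exact hz.le
  refine tendsto_nhds_unique (hf.tendsto.mono_left (nhdsWithin_le_nhds (s := {w : ℂ | w.re < 0})))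
    ((hg.tendsto.mono_left (nhdsWithin_mono _ fun w (hw : w.re < 0) => hw.le)).congr' ?_)
  filter_upwards [self_mem_nhdsWithin, nhdsWithin_le_nhds h] with w h1 h2
  exact (h2 h1).symm

theorem isPreconnected_left : IsPreconnected {z : ℂ | z.re < 0} := by
  apply Convex.isPreconnected
  have := (convex_Iio (0 : ℝ)).linear_preimage Complex.reLm
  simpa [preimage, Complex.reLm] using! this

theorem eventually_pos_eq {f : ℂ → ℂ} {z : ℂ} (hf : ContinuousAt f z) (h0 : (f z).re ≠ 0) :
    ∀ᶠ w in 𝓝 z, (0 < (f w).re) = (0 < (f z).re) := by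
  have hc : ContinuousAt (fun w => (f w).re) z := Complex.continuous_re.continuousAt.comp hf
  rcases h0.lt_or_gt with h | h
  · filter_upwards [hc.eventually_lt continuousAt_const h] with w hw
    exact propext ⟨fun h' => absurd h' hw.not_gt, fun h' => absurd h' h.not_gt⟩
  · filter_upwards [continuousAt_const.eventually_lt hc h] with w hw
    exact propext ⟨fun _ => h, fun _ => hw⟩

namespace IsSheetStructure

variable {γP γR : ℝ → ℂ} {ψP ψQ ψR : ℂ → ℂ}

theorem not_mem_R (S : IsSheetStructure γP γR ψP ψQ ψR) {z : ℂ} (hz : z.re ≤ 0) :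
    z ∉ arcSet γR := fun h => absurd (S.arcR_right z h) hz.not_gt

theorem continuousAt_P (S : IsSheetStructure γP γR ψP ψQ ψR) {z : ℂ} (hz : z ∉ arcSet γP) :
    ContinuousAt ψP z :=
  (S.analyticP.differentiableAt (S.arcP.isClosed.isOpen_compl.mem_nhds hz)).continuousAt

theorem continuousAt_R (S : IsSheetStructure γP γR ψP ψQ ψR) {z : ℂ} (hz : z ∉ arcSet γR) :
    ContinuousAt ψR z :=
  (S.analyticR.differentiableAt (S.arcR.isClosed.isOpen_compl.mem_nhds hz)).continuousAt

theorem isOpen_compl (S : IsSheetStructure γP γR ψP ψQ ψR) :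
    IsOpen (arcSet γP ∪ arcSet γR ∪ {0})ᶜ :=
  ((S.arcP.isClosed.union S.arcR.isClosed).union isClosed_singleton).isOpen_compl

theorem continuousAt_Q (S : IsSheetStructure γP γR ψP ψQ ψR) {z : ℂ}
    (hz : z ∉ arcSet γP ∪ arcSet γR ∪ {0}) : ContinuousAt ψQ z :=
  (S.analyticQ.differentiableAt (S.isOpen_compl.mem_nhds hz)).continuousAt

theorem left_mem_compl (S : IsSheetStructure γP γR ψP ψQ ψR) {z : ℂ} (hz : z.re ≤ 0)
    (h0 : z ≠ 0) (hP : z ∉ arcSet γP) : z ∉ arcSet γP ∪ arcSet γR ∪ {0} := by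
  rintro ((h | h) | h)
  · exact hP h
  · exact S.not_mem_R hz h
  · exact h0 h

/-- The real part of `ψ_R` has no zero in the left half-plane and is positive near infinity, where
`ψ_R → 1`; so `ψ_R` is the right preimage. -/
theorem R_eq_rt_left (S : IsSheetStructure γP γR ψP ψQ ψR) {z : ℂ} (hz : z.re < 0) :
    ψR z = rt z := by
  apply rt_unique hz.le (isPreimage_iff.1 (S.invR z (S.not_mem_R hz.le)))
  have hloc : ∀ w ∈ {w : ℂ | w.re < 0}, ∀ᶠ v in 𝓝[{w : ℂ | w.re < 0}] w,
      (0 < (ψR v).re) = (0 < (ψR w).re) := fun w hw =>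
    nhdsWithin_le_nhds (eventually_pos_eq (S.continuousAt_R (S.not_mem_R (le_of_lt hw)))
      (root_re_ne_zero (isPreimage_iff.1 (S.invR w (S.not_mem_R (le_of_lt hw)))) (ne_of_lt hw)))
  have h1 := S.inftyR.comp (tendsto_pt_atBot 0)
  have h2 := ((Complex.continuous_re.tendsto _).comp h1).eventually (lt_mem_nhds
    (show (0 : ℝ) < (1 : ℂ).re by simp))
  obtain ⟨x, hx, hx0⟩ := (h2.and (eventually_lt_atBot 0)).exists
  rw [eq_of_locally_eq (f := fun w => 0 < (ψR w).re) isPreconnected_left hloc hz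
    (show pt x 0 ∈ {w : ℂ | w.re < 0} from hx0)]
  exact hx

theorem R_eq_rt (S : IsSheetStructure γP γR ψP ψQ ψR) {z : ℂ} (hz : z.re ≤ 0) : ψR z = rt z := by
  rcases hz.lt_or_eq with h | h
  · exact S.R_eq_rt_left h
  · exact eq_of_eqOn_left h (S.continuousAt_R (S.not_mem_R hz)) (rt_continuousWithinAt hz)
      (Eventually.of_forall fun w hw => S.R_eq_rt_left hw)

theorem dq_ne_zero (S : IsSheetStructure γP γR ψP ψQ ψR) {z : ℂ} (hz : z.re < 0)
    (h : z ∉ arcSet γP) : dq z ≠ 0 := by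
  intro h0
  obtain ⟨h1, h2⟩ := (dq_zero_iff hz).1 h0
  apply h
  rcases sq_eq_sq_iff_eq_or_eq_neg.1 h2 with h3 | h3
  · exact ⟨0, ⟨le_rfl, zero_le_one⟩, by rw [S.arcP.source]; exact (Complex.ext h1 h3).symm⟩
  · refine ⟨1, ⟨zero_le_one, le_rfl⟩, ?_⟩
    rw [S.arcP.target, z₂_eq_pt]
    apply Complex.ext
    · exact h1.symm
    · exact h3.symm

/-- A locally constant property off the cut needs checking only far out on the negative real axis,
as an arc does not separate the half-plane. -/
theorem left_const (S : IsSheetStructure γP γR ψP ψQ ψR) {f : ℂ → Prop}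
    (hf : ∀ z : ℂ, z.re < 0 → z ∉ arcSet γP → ∀ᶠ w in 𝓝 z, f w = f z)
    (h : ∀ᶠ x in atBot, f (pt x 0)) {z : ℂ} (hz : z.re < 0) (hz' : z ∉ arcSet γP) : f z := by
  have h1 : ∀ᶠ x in atBot, pt x 0 ∉ arcSet γP :=
    (tendsto_pt_atBot 0).eventually (Bornology.isBounded_def.1 S.arcP.isCompact.isBounded)
  obtain ⟨x, ⟨hx, hx1⟩, hx0⟩ := ((h.and h1).and (eventually_lt_atBot 0)).exists
  rw [S.arcP.const_of_locally_const isPreconnected_left S.arcP_left isOpen_left hf hz hz'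
    (show pt x 0 ∈ {w : ℂ | w.re < 0} from hx0) hx1]
  exact hx

theorem P_re_neg (S : IsSheetStructure γP γR ψP ψQ ψR) {z : ℂ} (hz : z.re < 0)
    (hz' : z ∉ arcSet γP) : (ψP z).re < 0 := by
  have h1 := ((Complex.continuous_re.tendsto _).comp (S.inftyP.comp (tendsto_pt_atBot 0))).eventually
    (gt_mem_nhds (show ((-1 : ℂ)).re < (0 : ℝ) by simp))
  have hne : ∀ z : ℂ, z.re < 0 → z ∉ arcSet γP → (ψP z).re ≠ 0 := fun z hz hz' =>
    root_re_ne_zero (isPreimage_iff.1 (S.invP z hz')) hz.ne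
  have := S.left_const (f := fun w => ¬ 0 < (ψP w).re) (fun z hz hz' =>
    (eventually_pos_eq (S.continuousAt_P hz') (hne z hz hz')).mono fun w hw => by rw [hw])
    (h1.mono fun x hx => not_lt.2 (le_of_lt hx)) hz hz'
  exact lt_of_le_of_ne (not_lt.1 this) (hne z hz hz')

/-- If the real part were positive far out, `ψ_Q` would equal `rt`, but these tend to `0` and `1`.
-/
theorem Q_re_neg (S : IsSheetStructure γP γR ψP ψQ ψR) {z : ℂ} (hz : z.re < 0)
    (hz' : z ∉ arcSet γP) : (ψQ z).re < 0 := by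
  have hm : ∀ z : ℂ, z.re < 0 → z ∉ arcSet γP → z ∉ arcSet γP ∪ arcSet γR ∪ {0} :=
    fun z hz hz' => S.left_mem_compl hz.le (left_ne_zero hz) hz'
  have hne : ∀ z : ℂ, z.re < 0 → z ∉ arcSet γP → (ψQ z).re ≠ 0 := fun z hz hz' =>
    root_re_ne_zero (isPreimage_iff.1 (S.invQ z (hm z hz hz'))) hz.ne
  have h1 := ((continuous_norm.tendsto _).comp
    (S.inftyQ.comp (tendsto_pt_atBot 0))).eventually
    (gt_mem_nhds (show ‖(0 : ℂ)‖ < (1 / 2 : ℝ) by simp))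
  have h2 := ((continuous_norm.tendsto _).comp (tendsto_rt_line 0)).eventually
    (lt_mem_nhds (show (1 / 2 : ℝ) < ‖(1 : ℂ)‖ by norm_num))
  have h3 : ∀ᶠ x in atBot, pt x 0 ∉ arcSet γP :=
    (tendsto_pt_atBot 0).eventually (Bornology.isBounded_def.1 S.arcP.isCompact.isBounded)
  have := S.left_const (f := fun w => ¬ 0 < (ψQ w).re) (fun z hz hz' =>
    (eventually_pos_eq (S.continuousAt_Q (hm z hz hz')) (hne z hz hz')).mono
      fun w hw => by rw [hw])
    (by
      filter_upwards [h1, h2, h3, eventually_lt_atBot 0] with x a1 a2 a3 a4 a5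
      have := rt_unique (z := pt x 0) a4.le (isPreimage_iff.1 (S.invQ _ (hm _ a4 a3))) a5
      simp only [Function.comp] at a1 a2
      rw [this] at a1
      linarith) hz hz'
  exact lt_of_le_of_ne (not_lt.1 this) (hne z hz hz')

/-- Off the cut there are no multiple preimages, so a coincidence of the two branches would spread
by the local inverse and reach infinity, where the limits `0` and `-1` differ. -/
theorem Q_ne_P (S : IsSheetStructure γP γR ψP ψQ ψR) {z : ℂ} (hz : z.re < 0)
    (hz' : z ∉ arcSet γP) : ψQ z ≠ ψP z := by
  have hm : ∀ z : ℂ, z.re < 0 → z ∉ arcSet γP → z ∉ arcSet γP ∪ arcSet γR ∪ {0} :=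
    fun z hz hz' => S.left_mem_compl hz.le (left_ne_zero hz) hz'
  refine S.left_const (f := fun w => ψQ w ≠ ψP w) (fun z hz hz' => ?_) ?_ hz hz'
  · by_cases h : ψQ z = ψP z
    · have hdiff : sQ z - sP z ≠ 0 := by
        intro h0
        have := ds_sq hz.le (left_ne_zero hz)
        rw [← sQ_sub_sP, h0] at this
        exact S.dq_ne_zero hz hz' (by rw [← this]; ring)
      have hr := std_roots hz.le (left_ne_zero hz)
      have hneg := hr.left hz
      have hrt := rt_re_pos hz.le
      have e := isPreimage_iff.1 (S.invP z hz')
      have h4 : ψP z ^ 4 ≠ -1 / 3 := by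
        rcases hr.mem e with e | e | e
        · rw [e]
          exact hr.rot.pow_four_ne (fun h => hdiff (by rw [h, sub_self]))
            (fun h => by rw [h] at hneg; linarith [hneg.1])
        · rw [e]
          exact hr.swap.rot.pow_four_ne (fun h => hdiff (by rw [h, sub_self]))
            (fun h => by rw [h] at hneg; linarith [hneg.2])
        · rw [e]; exact rt_pow_four_ne hz.le
      obtain ⟨g, -, -, -, hg⟩ := exists_local_inverse e h4
      filter_upwards [(S.continuousAt_P hz').eventually hg,
        (S.continuousAt_Q (hm z hz hz')).eventually (h ▸ hg), left_mem_nhds hz,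
        S.arcP.isClosed.isOpen_compl.mem_nhds hz'] with w h1 h2 h3 h5
      have a1 := h1 w (isPreimage_iff.1 (S.invP w h5))
      have a2 := h2 w (isPreimage_iff.1 (S.invQ w (hm w h3 h5)))
      simp [h, ← a1, ← a2]
    · filter_upwards [((S.continuousAt_Q (hm z hz hz')).sub (S.continuousAt_P hz')).eventually_ne
        (sub_ne_zero.2 h)] with w hw
      simp [h, sub_ne_zero.1 hw]
  · have h1 := (S.inftyQ.sub S.inftyP).comp (tendsto_pt_atBot 0)
    filter_upwards [h1.eventually_ne (show (0 : ℂ) - -1 ≠ 0 by norm_num)] with x hx h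
    exact hx (sub_eq_zero.2 h)

theorem roots_left (S : IsSheetStructure γP γR ψP ψQ ψR) {z : ℂ} (hz : z.re < 0)
    (hz' : z ∉ arcSet γP) : Roots z (ψQ z) (ψP z) (rt z) := by
  have hr := std_roots hz.le (left_ne_zero hz)
  have hrt := rt_re_pos hz.le
  have hp := S.P_re_neg hz hz'
  have hq := S.Q_re_neg hz hz'
  have hne := S.Q_ne_P hz hz'
  rcases hr.mem (isPreimage_iff.1 (S.invQ z (S.left_mem_compl hz.le (left_ne_zero hz) hz')))
    with e | e | e <;>
  rcases hr.mem (isPreimage_iff.1 (S.invP z hz')) with e' | e' | e'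
  · exact absurd (e.trans e'.symm) hne
  · rw [e, e']; exact hr
  · rw [e'] at hp; linarith
  · rw [e, e']; exact hr.swap
  · exact absurd (e.trans e'.symm) hne
  · rw [e'] at hp; linarith
  all_goals rw [e] at hq; linarith

theorem sub_sq (S : IsSheetStructure γP γR ψP ψQ ψR) {z : ℂ} (hz : z.re < 0)
    (hz' : z ∉ arcSet γP) : (ψQ z - ψP z) ^ 2 = dq z := (S.roots_left hz hz').eq_of_rt.1

/-- The values of the quadratic differential along the cut are nonpositive. -/
theorem quadratic_nonpos (S : IsSheetStructure γP γR ψP ψQ ψR) {t : ℝ} (ht : t ∈ Ioo (0 : ℝ) 1) :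
    (dq (γP t) * deriv γP t ^ 2).re ≤ 0 ∧ (dq (γP t) * deriv γP t ^ 2).im = 0 := by
  obtain ⟨gp, hlim, hint, hreal⟩ := S.realP
  have hleft : ∀ t ∈ Icc (0 : ℝ) 1, (γP t).re < 0 := fun t ht => S.arcP_left _ ⟨t, ht, rfl⟩
  -- Squaring the boundary value removes the choice of branch, so `dq`, which is analytic across the
  -- cut, determines it.
  have hsq : ∀ t ∈ Ioo (0 : ℝ) 1, gp t ^ 2 = dq (γP t) := by
    intro t ht
    have ht' := Ioo_subset_Icc_self ht
    obtain ⟨h1, h2⟩ := S.arcP.transversal ht'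
    refine tendsto_nhds_unique ((hlim t ht).pow 2)
      (((dq_analyticAt (hleft t ht')).continuousAt.tendsto.comp h1).congr' ?_)
    filter_upwards [h2, h1.eventually (left_mem_nhds (hleft t ht'))] with ε h3 h4
    exact (S.sub_sq h4 h3).symm
  -- The boundary value is merely integrable, so the reality condition is differentiated only almost
  -- everywhere. Continuity of `dq γ'²` then gives every point of the arc.
  have hae : ∀ᵐ t : ℝ, t ∈ Ioo (0 : ℝ) 1 → (gp t * deriv γP t).re = 0 := by
    have h1 := hint.ae_hasDerivAt_integral
    filter_upwards [h1] with t h2 ht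
    have h3 := h2 (by rw [uIcc_of_le zero_le_one]; exact Ioo_subset_Icc_self ht) 0 left_mem_uIcc
    have h4 : HasDerivAt (fun x => (∫ s in (0 : ℝ)..x, gp s * deriv γP s).re)
        (gp t * deriv γP t).re t := by
      exact Complex.reCLM.hasFDerivAt.comp_hasDerivAt t h3
    have h5 : (fun x => (∫ s in (0 : ℝ)..x, gp s * deriv γP s).re) =ᶠ[𝓝 t] fun _ => 0 := by
      filter_upwards [Ioo_mem_nhds ht.1 ht.2] with x hx
      exact (isReal_iff _).1 (hreal x (Ioo_subset_Icc_self hx))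
    have h6 := h4.deriv
    rw [h5.deriv_eq, deriv_const] at h6
    exact h6.symm
  have hcont : ContinuousOn (fun t => dq (γP t) * deriv γP t ^ 2) (Ioo 0 1) := by
    intro s hs
    have hs' := Ioo_subset_Icc_self hs
    have h1 : ContinuousAt (fun t => dq (γP t)) s :=
      (dq_analyticAt (hleft s hs')).continuousAt.comp (S.arcP.analytic s hs').continuousAt
    have h2 : ContinuousAt (deriv γP) s := (S.arcP.analytic s hs').deriv.continuousAt
    exact (h1.mul (h2.pow 2)).continuousWithinAt
  set C : Set ℂ := {w | w.re ≤ 0 ∧ w.im = 0} with hC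
  have hCc : IsClosed C := (isClosed_le Complex.continuous_re continuous_const).inter
    (isClosed_eq Complex.continuous_im continuous_const)
  have haeC : ∀ᵐ t : ℝ, t ∈ Ioo (0 : ℝ) 1 → dq (γP t) * deriv γP t ^ 2 ∈ C := by
    filter_upwards [hae] with t h1 ht
    have h2 := h1 ht
    rw [← hsq t ht, ← mul_pow]
    have h3 : gp t * deriv γP t = (gp t * deriv γP t).im * Complex.I := by
      apply Complex.ext <;> simp [h2]
    generalize (gp t * deriv γP t).im = u at h3
    rw [h3, mul_pow, Complex.I_sq, ← Complex.ofReal_pow]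
    refine ⟨?_, ?_⟩
    · simp only [mul_neg, mul_one, Complex.neg_re, Complex.ofReal_re]
      nlinarith [sq_nonneg u]
    · simp only [mul_neg, mul_one, Complex.neg_im, Complex.ofReal_im, neg_zero]
  by_contra hcon
  have hopen : ∀ᶠ s in 𝓝 t, s ∈ Ioo (0 : ℝ) 1 ∧ dq (γP s) * deriv γP s ^ 2 ∉ C := by
    have h1 := (hcont t ht).continuousAt (Ioo_mem_nhds ht.1 ht.2)
    exact Filter.Eventually.and (Ioo_mem_nhds ht.1 ht.2) (h1.eventually (hCc.isOpen_compl.mem_nhds hcon))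
  obtain ⟨U, hU, hUo, htU⟩ := eventually_nhds_iff.1 hopen
  have hpos := hUo.measure_pos (volume : Measure ℝ) ⟨t, htU⟩
  apply hpos.ne'
  refine measure_mono_null (fun s hs => ?_) (ae_iff.1 haeC)
  have := hU s hs
  simp only [mem_ofPred_eq, Classical.not_imp]
  exact this

/-- The nonpositive quadratic differential makes the square of the difference of potentials constant
inside the arc. It is continuous up to the ends and vanishes at `z₁`. -/
theorem arcP_isLevel (S : IsSheetStructure γP γR ψP ψQ ψR) {t : ℝ} (ht : t ∈ Icc (0 : ℝ) 1) :
    IsLevel (γP t) := by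
  have hleft : ∀ t ∈ Icc (0 : ℝ) 1, (γP t).re < 0 := fun t ht => S.arcP_left _ ⟨t, ht, rfl⟩
  have hne : ∀ t ∈ Ioo (0 : ℝ) 1, dq (γP t) ≠ 0 := by
    intro t ht h0
    have ht' := Ioo_subset_Icc_self ht
    obtain ⟨h1, h2⟩ := (dq_zero_iff (hleft t ht')).1 h0
    rcases sq_eq_sq_iff_eq_or_eq_neg.1 h2 with h3 | h3
    · have e : γP t = γP 0 := by
        rw [S.arcP.source]
        exact Complex.ext h1 h3
      exact ht.1.ne' (S.arcP.injOn ht' ⟨le_rfl, zero_le_one⟩ e)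
    · have e : γP t = γP 1 := by
        rw [S.arcP.target, z₂_eq_pt]
        exact Complex.ext h1 h3
      exact ht.2.ne (S.arcP.injOn ht' ⟨zero_le_one, le_rfl⟩ e)
  set N : ℝ → ℝ := fun t => potDiff (γP t) (dp (γP t)) ^ 2 with hN
  have hd : ∀ t ∈ Ioo (0 : ℝ) 1, HasDerivAt N 0 t := by
    intro t ht
    have ht' := Ioo_subset_Icc_self ht
    obtain ⟨δ, h1, h2, -⟩ := exists_local_sqrt (hleft t ht') (hne t ht) (dp_sq _)
    have h3 := hasDerivAt_potDiff (hleft t ht') h1 (Eventually.of_forall h2)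
      (S.arcP.analytic t ht').differentiableAt.hasDerivAt
    have h4 : (δ (γP t) * deriv γP t).re = 0 := by
      obtain ⟨a1, a2⟩ := S.quadratic_nonpos ht
      rw [← h2, ← mul_pow] at a1 a2
      set w := δ (γP t) * deriv γP t
      rw [sq, Complex.mul_re] at a1
      rw [sq, Complex.mul_im] at a2
      by_contra h5
      have h6 : w.im = 0 := by
        have : w.re * w.im = 0 := by linarith
        exact (mul_eq_zero.1 this).resolve_left h5
      rw [h6] at a1
      have := mul_self_pos.2 h5
      linarith
    have h5 := h3.pow 2
    rw [h4] at h5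
    convert! h5 using 1
    · funext s
      exact potDiff_sq (dp_sq _) (h2 _)
    · simp
  have hend : ∀ t ∈ Icc (0 : ℝ) 1, dq (γP t) = 0 → ContinuousWithinAt N (Icc 0 1) t := by
    intro t ht h0
    have h1 := continuousWithinAt_potDiff (hleft t ht).le (left_ne_zero (hleft t ht))
      (dp_continuousWithinAt (hleft t ht).le (left_ne_zero (hleft t ht)) (Or.inr h0)) (dp_sq _)
    have h2 : ContinuousWithinAt (fun t => potDiff (γP t) (dp (γP t))) (Icc 0 1) t :=
      h1.comp (f := γP) (S.arcP.continuousOn t ht) fun s hs => (hleft s hs).le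
    exact h2.pow 2
  have hc : ContinuousOn N (Icc 0 1) := by
    intro t ht
    rcases eq_endpoints_or_mem_Ioo_of_mem_Icc ht with h | h | h
    · apply hend t ht
      rw [h, S.arcP.source, dq_z₁]
    · apply hend t ht
      rw [h, S.arcP.target, z₂_eq_pt]
      exact (isLevel_corner (neg_sq _)).2
    · exact (hd t h).continuousAt.continuousWithinAt
  have h0 : N 0 = 0 := by
    have := isLevel_z₁
    simp only [hN, S.arcP.source]
    rw [IsLevel] at this
    rw [this]; norm_num
  have ht0 : N t = 0 := by
    rcases ht.1.eq_or_lt with h | h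
    · rw [← h, h0]
    · obtain ⟨c, hc1, hc2⟩ := exists_hasDerivAt_eq_slope N (fun _ => 0) h
        (hc.mono (Icc_subset_Icc_right ht.2)) fun s hs => hd s ⟨hs.1, hs.2.trans_le ht.2⟩
      have := (div_eq_zero_iff.1 hc2.symm).resolve_right (by linarith)
      linarith
  exact pow_eq_zero_iff two_ne_zero |>.1 ht0

/-- The arc stays in the zero set. At heights `± Im z₁` this contains only the branch points, which
are the ends of the arc, so the interior stays in the open strip. There it cannot meet the vertical
segment through the branch points, and it must cross the real axis to the left of it, as `real_line`
allows no zero between `fP 0` and `0`. Hence it stays on the left, where `fP` is the only zero, and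
it takes all heights by continuity. -/
theorem arcSet_P (S : IsSheetStructure γP γR ψP ψQ ψR) : arcSet γP = stdCut := by
  have hY := z₁_im_pos
  have hleft : ∀ t ∈ Icc (0 : ℝ) 1, (γP t).re < 0 := fun t ht => S.arcP_left _ ⟨t, ht, rfl⟩
  have h0m : (0 : ℝ) ∈ Icc (0 : ℝ) 1 := ⟨le_rfl, zero_le_one⟩
  have h1m : (1 : ℝ) ∈ Icc (0 : ℝ) 1 := ⟨zero_le_one, le_rfl⟩
  have hcim : ContinuousOn (fun t => (γP t).im) (Icc 0 1) :=
    Complex.continuous_im.comp_continuousOn S.arcP.continuousOn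
  have hcre : ContinuousOn (fun t => (γP t).re) (Icc 0 1) :=
    Complex.continuous_re.comp_continuousOn S.arcP.continuousOn
  have him0 : (γP 0).im = z₁.im := by rw [S.arcP.source]
  have him1 : (γP 1).im = -z₁.im := by rw [S.arcP.target, z₂_eq_pt, pt_im]
  have corner : ∀ t ∈ Ioo (0 : ℝ) 1, (γP t).im ^ 2 ≠ z₁.im ^ 2 := by
    intro t ht h
    have ht' := Ioo_subset_Icc_self ht
    have hre : (γP t).re = z₁.re := by
      rw [← fE_corner h]
      exact fE_unique h.ge (hleft t ht').le (S.arcP_isLevel ht')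
    rcases sq_eq_sq_iff_eq_or_eq_neg.1 h with h3 | h3
    · have e : γP t = γP 0 := by rw [S.arcP.source]; exact Complex.ext hre h3
      exact ht.1.ne' (S.arcP.injOn ht' h0m e)
    · have e : γP t = γP 1 := by rw [S.arcP.target, z₂_eq_pt]; exact Complex.ext hre h3
      exact ht.2.ne (S.arcP.injOn ht' h1m e)
  have hlt : ∀ t ∈ Ioo (0 : ℝ) 1, (γP t).im ^ 2 < z₁.im ^ 2 := by
    intro t ht
    have ht' := Ioo_subset_Icc_self ht
    by_contra hcon
    have habs : z₁.im ≤ |(γP t).im| := by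
      rw [← abs_of_pos hY]
      exact sq_le_sq.1 (not_lt.1 hcon)
    rcases le_abs.1 habs with h | h
    · obtain ⟨s, hs, hs'⟩ := intermediate_value_Icc' ht.2.le
        (hcim.mono (Icc_subset_Icc_left ht.1.le)) (show z₁.im ∈ Icc _ _ from
          ⟨by simp only [him1]; linarith, h⟩)
      rcases hs.2.eq_or_lt with h2 | h2
      · rw [h2] at hs'; simp only [him1] at hs'; linarith
      · exact corner s ⟨ht.1.trans_le hs.1, h2⟩ (by simp only at hs'; rw [hs'])
    · obtain ⟨s, hs, hs'⟩ := intermediate_value_Icc' ht.1.le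
        (hcim.mono (Icc_subset_Icc_right ht.2.le)) (show -z₁.im ∈ Icc _ _ from
          ⟨by linarith, by simp only [him0]; linarith⟩)
      rcases hs.1.eq_or_lt with h2 | h2
      · rw [← h2] at hs'; simp only [him0] at hs'; linarith
      · exact corner s ⟨h2, hs.2.trans_lt ht.2⟩ (by simp only at hs'; rw [hs', neg_sq])
  have hne : ∀ t ∈ Ioo (0 : ℝ) 1, (γP t).re ≠ z₁.re := by
    intro t ht h
    have h1 := potDiff_segment_pos (hlt t ht)
    have h2 := S.arcP_isLevel (Ioo_subset_Icc_self ht)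
    rw [IsLevel, ← pt_re_im (γP t), h] at h2
    exact h1.ne' h2
  obtain ⟨t₀, ht₀, him⟩ := intermediate_value_Icc' zero_le_one hcim
    (show (0 : ℝ) ∈ Icc _ _ from ⟨by simp only [him1]; linarith, by simp only [him0]; linarith⟩)
  have ht₀' : t₀ ∈ Ioo (0 : ℝ) 1 := by
    rcases eq_endpoints_or_mem_Ioo_of_mem_Icc ht₀ with h | h | h
    · rw [h] at him; simp only [him0] at him; linarith
    · rw [h] at him; simp only [him1] at him; linarith
    · exact h
  have hlt₀ : (γP t₀).re < z₁.re := by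
    apply lt_of_le_of_ne _ (hne t₀ ht₀')
    by_contra hcon
    have h3 : pt (γP t₀).re 0 = γP t₀ := Complex.ext rfl him.symm
    have h1 := real_line (x := (γP t₀).re) ((fP_lt (y := 0) (by have := pow_pos hY 2; linarith)).trans (not_le.1 hcon))
      (hleft t₀ ht₀)
    rw [h3] at h1
    have h2 := S.arcP_isLevel ht₀
    rw [isLevel_iff (δ := -dt (γP t₀))
      (by rw [neg_sq]; exact dt_sq (hleft t₀ ht₀).le (left_ne_zero (hleft t₀ ht₀)))] at h2
    exact h1.ne h2
  have hltx : ∀ t ∈ Ioo (0 : ℝ) 1, (γP t).re < z₁.re := by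
    intro t ht
    have h1 : IsPreconnected ((fun t => (γP t).re) '' Ioo 0 1) :=
      isPreconnected_Ioo.image _ (hcre.mono Ioo_subset_Icc_self)
    by_contra hcon
    have := h1.ordConnected.out (mem_image_of_mem _ ht₀') (mem_image_of_mem _ ht)
      ⟨hlt₀.le, not_lt.1 hcon⟩
    obtain ⟨s, hs, e⟩ := this
    exact hne s hs e
  have hmem : ∀ t ∈ Icc (0 : ℝ) 1, γP t ∈ stdCut := by
    intro t ht
    rcases eq_endpoints_or_mem_Ioo_of_mem_Icc ht with h | h | h
    · rw [h, S.arcP.source]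
      exact ⟨le_rfl, (fP_corner rfl).symm⟩
    · rw [h, S.arcP.target, z₂_eq_pt]
      exact ⟨(neg_sq _).le, (fP_corner (neg_sq _)).symm⟩
    · exact ⟨(hlt t h).le, fP_unique (hlt t h).le (hltx t h).le (S.arcP_isLevel ht)⟩
  apply Subset.antisymm
  · rintro _ ⟨t, ht, rfl⟩
    exact hmem t ht
  · intro z hz
    have hz1 := mem_Icc_of_sq_le hz.1
    obtain ⟨t, ht, e⟩ := intermediate_value_Icc' zero_le_one hcim
      (show z.im ∈ Icc _ _ from ⟨by simp only [him1]; exact hz1.1, by simp only [him0]; exact hz1.2⟩)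
    refine ⟨t, ht, Complex.ext ?_ e⟩
    rw [(hmem t ht).2, hz.2]
    simp only at e
    rw [e]

theorem mem_arcSet_R (S : IsSheetStructure γP γR ψP ψQ ψR) {z : ℂ} :
    z ∈ arcSet γR ↔ -z ∈ stdCut := by
  rw [← S.rotate.arcSet_P, mem_arcSet_neg, neg_neg]

/-- Both sides are continuous nonvanishing square roots of `dq` off the cut, and both tend to `1`
along the negative real axis. -/
theorem sub_eq_ds (S : IsSheetStructure γP γR ψP ψQ ψR) {z : ℂ} (hz : z.re < 0)
    (hz' : z ∉ stdCut) : ψQ z - ψP z = ds z := by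
  rw [← S.arcSet_P] at hz'
  refine S.left_const (f := fun w => ψQ w - ψP w = ds w) (fun z hz hz' => ?_) ?_ hz hz'
  · have h1 := (S.continuousAt_Q (S.left_mem_compl hz.le (left_ne_zero hz) hz')).sub
      (S.continuousAt_P hz')
    have h2 := (ds_analyticAt hz (S.arcSet_P ▸ hz')).continuousAt
    have h3 : ∀ w : ℂ, w.re < 0 → w ∉ arcSet γP →
        ψQ w - ψP w = ds w ∨ ψQ w - ψP w = -ds w := fun w hw hw' =>
      sq_eq_dq (S.sub_sq hw hw') (ds_sq hw.le (left_ne_zero hw))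
    by_cases h : ψQ z - ψP z = ds z
    · have h4 : ψQ z - ψP z + ds z ≠ 0 := by
        rw [h]
        intro h0
        apply S.dq_ne_zero hz hz'
        rw [← ds_sq hz.le (left_ne_zero hz)]
        have : ds z = 0 := by linear_combination h0 / 2
        rw [this]; ring
      filter_upwards [(h1.add h2).eventually_ne h4, left_mem_nhds hz,
        S.arcP.isClosed.isOpen_compl.mem_nhds hz'] with w a1 a2 a3
      have := (h3 w a2 a3).resolve_right fun e => a1 (by simp only [Pi.add_apply, Pi.sub_apply]; rw [e]; ring)
      simp [h, this]
    · filter_upwards [(h1.sub h2).eventually_ne (sub_ne_zero.2 h)] with w a1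
      have := sub_ne_zero.1 a1
      simp only [Pi.sub_apply] at this
      simp [h, this]
  · have h1 := (S.inftyQ.sub S.inftyP).comp (tendsto_pt_atBot 0)
    have h2 : Tendsto (fun x => ds (pt x 0)) atBot (𝓝 1) :=
      tendsto_ds_infty.comp (tendsto_inf.2 ⟨tendsto_pt_atBot 0, tendsto_principal.2
        ((eventually_le_atBot 0).mono fun x hx => hx)⟩)
    have h3 := (h1.add h2).eventually_ne (show (0 : ℂ) - -1 + 1 ≠ 0 by norm_num)
    have h4 : ∀ᶠ x in atBot, pt x 0 ∉ arcSet γP :=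
      (tendsto_pt_atBot 0).eventually (Bornology.isBounded_def.1 S.arcP.isCompact.isBounded)
    filter_upwards [h3, h4, eventually_lt_atBot 0] with x a1 a2 a3
    refine (sq_eq_dq (S.sub_sq (z := pt x 0) a3 a2)
      (ds_sq (z := pt x 0) a3.le (left_ne_zero a3))).resolve_right fun e => a1 ?_
    simp only [Function.comp]
    rw [e]; ring

theorem eq_std_left (S : IsSheetStructure γP γR ψP ψQ ψR) {z : ℂ} (hz : z.re < 0)
    (hz' : z ∉ stdCut) : ψP z = stdP z ∧ ψQ z = stdQ z := by
  have h0 := left_ne_zero hz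
  have h1 := (S.roots_left hz (S.arcSet_P ▸ hz')).eq_of_rt.2
  rw [S.sub_eq_ds hz hz'] at h1
  rw [stdP_left hz, stdQ_left hz.le h0]
  exact ⟨h1.2, h1.1⟩

theorem eq_std_closed_left (S : IsSheetStructure γP γR ψP ψQ ψR) {z : ℂ} (hz : z.re ≤ 0)
    (hz' : z ∉ stdCut) (h0 : z ≠ 0) : ψP z = stdP z ∧ ψQ z = stdQ z ∧ ψR z = stdR z := by
  refine ⟨?_, ?_, (S.R_eq_rt hz).trans (stdR_left hz).symm⟩ <;>
  rcases hz.lt_or_eq with h | h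
  · exact (S.eq_std_left h hz').1
  · refine eq_of_eqOn_left h (S.continuousAt_P (S.arcSet_P ▸ hz'))
      (stdP_analyticAt hz').continuousAt.continuousWithinAt ?_
    filter_upwards [(S.arcP.isClosed.isOpen_compl.mem_nhds (S.arcSet_P ▸ hz'))] with w h1 h2
    exact (S.eq_std_left h2 (S.arcSet_P ▸ h1)).1
  · exact (S.eq_std_left h hz').2
  · refine eq_of_eqOn_left h (S.continuousAt_Q (S.left_mem_compl hz h0 (S.arcSet_P ▸ hz')))
      (stdQ_analyticAt h0 hz' (not_mem_stdCut (by simp [h]))).continuousAt.continuousWithinAt ?_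
    filter_upwards [(S.arcP.isClosed.isOpen_compl.mem_nhds (S.arcSet_P ▸ hz'))] with w h1 h2
    exact (S.eq_std_left h2 (S.arcSet_P ▸ h1)).2

theorem eq_std (S : IsSheetStructure γP γR ψP ψQ ψR) {z : ℂ} (h0 : z ≠ 0) (hP : z ∉ stdCut)
    (hR : -z ∉ stdCut) : ψP z = stdP z ∧ ψQ z = stdQ z ∧ ψR z = stdR z := by
  rcases le_total z.re 0 with h | h
  · exact S.eq_std_closed_left h hP h0
  · obtain ⟨h1, h2, h3⟩ := S.rotate.eq_std_closed_left (z := -z) (by simpa using h) hR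
      (neg_ne_zero.2 h0)
    simp only [neg_neg, stdP_neg, stdQ_neg, stdR_neg, neg_inj] at h1 h2 h3
    exact ⟨h3, h2, h1⟩

end IsSheetStructure

/-! ### The potential of the standard sheet structure -/

theorem stdCut_ne_zero {z : ℂ} (h : z ∈ stdCut) : z ≠ 0 := left_ne_zero (stdCut_left h)

theorem stdCut_not_mem_stdRegion {z : ℂ} (h : z ∈ stdCut) : z ∉ stdRegion :=
  fun h' => h'.2.ne h.2.symm

theorem stdCut_isLevel {z : ℂ} (h : z ∈ stdCut) : IsLevel z := by
  have := (fP_spec h.1).2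
  rwa [← h.2, pt_re_im] at this

/-- The branches may exchange at the cut, but the two possible values of `hw` agree there. At a
branch point even the branches coincide, and a root continuous at `0` suffices. -/
theorem hw_continuousAt_of_cut {z : ℂ} (h : z ∈ stdCut) :
    ContinuousAt (fun w => hw (sQ w)) z ∧ ContinuousAt (fun w => hw (sP w)) z := by
  have hz := stdCut_left h
  have h0 := left_ne_zero hz
  obtain ⟨s, hs, hs2⟩ := exists_continuous_sqrt (dq z)
  have hδ : ContinuousAt (fun w => s (dq w)) z :=
    ContinuousAt.comp (g := s) hs (dq_analyticAt hz).continuousAt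
  have hR := roots_of_sq hz.le h0 (hs2 (dq z))
  have hc : ContinuousAt (fun z => 1 / z - rt z) z :=
    (continuousAt_const.div continuousAt_id h0).sub (rt_analyticAt hz).continuousAt
  have hA : ContinuousAt (fun w => hw ((1 / w - rt w + s (dq w)) / 2)) z :=
    ContinuousAt.comp (g := hw) (continuousAt_hw (cube_sub_ne_zero hR.rot.eqn))
      ((hc.add hδ).div_const 2)
  have hB : ContinuousAt (fun w => hw ((1 / w - rt w - s (dq w)) / 2)) z :=
    ContinuousAt.comp (g := hw) (continuousAt_hw (cube_sub_ne_zero hR.rot.rot.eqn))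
      ((hc.sub hδ).div_const 2)
  have hAB := hR.isLevel.1 (stdCut_isLevel h)
  have key : ∀ f : ℂ → ℝ, (∀ w : ℂ, w.re < 0 → f w = hw ((1 / w - rt w + s (dq w)) / 2) ∨
      f w = hw ((1 / w - rt w - s (dq w)) / 2)) → ContinuousAt f z := by
    intro f hf
    have hfz : f z = hw ((1 / z - rt z + s (dq z)) / 2) :=
      (hf z hz).elim id fun e => e.trans hAB.symm
    rw [ContinuousAt, Metric.tendsto_nhds]
    intro ε hε
    filter_upwards [Metric.tendsto_nhds.1 hA.tendsto ε hε, Metric.tendsto_nhds.1 hB.tendsto ε hε,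
      left_mem_nhds hz] with w h1 h2 h3
    rcases hf w h3 with e | e
    · rw [e, hfz]; exact h1
    · rw [e, hfz, hAB]; exact h2
  have hcase : ∀ w : ℂ, w.re < 0 → ds w = s (dq w) ∨ ds w = -s (dq w) := fun w hw =>
    sq_eq_dq (ds_sq hw.le (left_ne_zero hw)) (hs2 _)
  constructor <;> refine key _ fun w hw => ?_
  · rcases hcase w hw with e | e
    · left; rw [sQ, e]
    · right; rw [sQ, e, ← sub_eq_add_neg]
  · rcases hcase w hw with e | e
    · right; rw [sP, e]
    · left; rw [sP, e, sub_neg_eq_add]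

/-- The real part of `3 ∫ (ψ_Q - ψ_P) dz` for the standard sheet structure. -/
def pot (z : ℂ) : ℝ := hw (stdQ z) - hw (stdP z)

theorem pot_left {z : ℂ} (hz : z.re ≤ 0) (h0 : z ≠ 0) : pot z = potDiff z (ds z) := by
  rw [pot, stdQ_left hz h0, stdP_closed_left hz h0, (std_roots hz h0).potDiff, sQ_sub_sP]

theorem pot_right {z : ℂ} (hz : 0 ≤ z.re) (h0 : z ≠ 0) : pot z = hw (sQ (-z)) - hw (rt (-z)) := by
  have h1 := stdQ_neg (-z)
  rw [neg_neg, stdQ_left (z := -z) (by simpa using hz) (neg_ne_zero.2 h0)] at h1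
  rw [pot, h1, stdP_right hz, hw_neg, hw_neg]

theorem stdQ_eqn {z : ℂ} (h0 : z ≠ 0) : z * (stdQ z ^ 3 - stdQ z) = stdQ z ^ 2 - 1 / 3 :=
  (std_roots_all h0).rot.eqn

theorem pot_continuousAt {z : ℂ} (h0 : z ≠ 0) : ContinuousAt pot z := by
  by_cases hP : z ∈ stdCut
  · obtain ⟨h1, h2⟩ := hw_continuousAt_of_cut hP
    refine (h1.sub h2).congr ?_
    filter_upwards [left_mem_nhds (stdCut_left hP)] with w hw
    simp only [Pi.sub_apply]
    rw [pot, stdQ_left hw.le (left_ne_zero hw), stdP_left hw]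
  by_cases hR : -z ∈ stdCut
  · obtain ⟨h1, -⟩ := hw_continuousAt_of_cut hR
    have hz := stdCut_left hR
    have h2 : ContinuousAt (fun w => hw (rt w)) (-z) :=
      ContinuousAt.comp (g := hw) (continuousAt_hw (cube_sub_ne_zero (rt_eqn hz.le)))
        (rt_analyticAt hz).continuousAt
    have h3 : ContinuousAt (fun w : ℂ => hw (sQ (-w)) - hw (rt (-w))) z :=
      ContinuousAt.comp (g := fun w => hw (sQ w) - hw (rt w)) (h1.sub h2) continuousAt_neg
    refine h3.congr ?_
    filter_upwards [continuousAt_neg.eventually (left_mem_nhds hz)] with w hw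
    have hw' : 0 < w.re := by simpa using hw
    exact (pot_right hw'.le (by rintro rfl; simp at hw')).symm
  · have h1 : ContinuousAt (fun w => hw (stdQ w)) z :=
      ContinuousAt.comp (g := hw) (continuousAt_hw (cube_sub_ne_zero (stdQ_eqn h0)))
        (stdQ_analyticAt h0 hP hR).continuousAt
    have h2 : ContinuousAt (fun w => hw (stdP w)) z :=
      ContinuousAt.comp (g := hw) (continuousAt_hw (cube_sub_ne_zero (stdP_eqn z)))
        (stdP_analyticAt hP).continuousAt
    exact h1.sub h2

theorem hasDerivAt_pot {γ : ℝ → ℂ} {t : ℝ} {γ' : ℂ} (h0 : γ t ≠ 0) (hP : γ t ∉ stdCut)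
    (hR : -γ t ∉ stdCut) (hγ : HasDerivAt γ γ' t) :
    HasDerivAt (fun s => pot (γ s)) (3 * ((stdQ (γ t) - stdP (γ t)) * γ').re) t := by
  have h1 := hasDerivAt_hw_comp (stdQ_analyticAt h0 hP hR)
    ((eventually_ne_nhds h0).mono fun w hw => stdQ_eqn hw) hγ
  have h2 := hasDerivAt_hw_comp (stdP_analyticAt hP) (Eventually.of_forall stdP_eqn) hγ
  convert! h1.sub h2 using 1
  rw [← Complex.sub_re]
  have : (3 * stdQ (γ t) * γ' - 3 * stdP (γ t) * γ') = ((3 : ℝ) : ℂ) *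
    ((stdQ (γ t) - stdP (γ t)) * γ') := by push_cast; ring
  rw [this, Complex.re_ofReal_mul]

theorem hasDerivAt_pot_line {x y : ℝ} (h0 : pt x y ≠ 0) (hP : pt x y ∉ stdCut)
    (hR : -pt x y ∉ stdCut) :
    HasDerivAt (fun s => pot (pt s y)) (3 * (stdQ (pt x y) - stdP (pt x y)).re) x := by
  have := hasDerivAt_pot (γ := fun s => pt s y) h0 hP hR (hasDerivAt_pt_left x y)
  rwa [mul_one] at this

/-- Here `ψ_Q` has nonnegative and `ψ_P` negative real part. So `pot` increases to the right on
horizontal lines in the closed right half-plane. -/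
theorem std_re_pos_right {z : ℂ} (hz : 0 ≤ z.re) (h0 : z ≠ 0) : 0 < (stdQ z - stdP z).re := by
  have hz' : (-z).re ≤ 0 := by simpa using hz
  have h1 := stdQ_neg (-z)
  rw [neg_neg, stdQ_left hz' (neg_ne_zero.2 h0)] at h1
  have h2 : (sQ (-z)).re ≤ 0 := by
    rcases hz'.lt_or_eq with h | h
    · exact ((std_roots hz' (neg_ne_zero.2 h0)).left h).1.le
    · exact (sQ_imag_axis h (neg_ne_zero.2 h0)).le
  have h3 := rt_re_pos hz'
  rw [h1, stdP_right hz]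
  simp only [Complex.sub_re, Complex.neg_re]
  linarith

theorem strictMonoOn_of_deriv_pos_except {f f' : ℝ → ℝ} {s : Set ℝ} (hs : Convex ℝ s) {a : ℝ}
    (hf : ContinuousOn f s) (h : ∀ x ∈ interior s, x ≠ a → HasDerivAt f (f' x) x ∧ 0 < f' x) :
    StrictMonoOn f s := by
  have key : ∀ t ⊆ s, Convex ℝ t → a ∉ interior t → StrictMonoOn f t := fun t hts ht ha =>
    strictMonoOn_of_deriv_pos ht (hf.mono hts) fun x hx => by
      obtain ⟨h1, h2⟩ := h x (interior_mono hts hx) (fun e => ha (e ▸ hx))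
      rw [h1.deriv]; exact h2
  by_cases ha : a ∈ s
  · have h1 := key (s ∩ Iic a) inter_subset_left (hs.inter (convex_Iic a)) (by simp)
    have h2 := key (s ∩ Ici a) inter_subset_left (hs.inter (convex_Ici a)) (by simp)
    have h3 := h1.union h2 ⟨⟨ha, self_mem_Iic⟩, fun x hx => hx.2⟩ ⟨⟨ha, self_mem_Ici⟩, fun x hx => hx.2⟩
    rwa [← inter_union_distrib_left, Iic_union_Ici, inter_univ] at h3
  · exact key s subset_rfl hs fun h => ha (interior_subset h)

theorem pot_line_continuousOn {s : Set ℝ} {y : ℝ} (h : ∀ x ∈ s, pt x y ≠ 0) :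
    ContinuousOn (fun x => pot (pt x y)) s := fun x hx =>
  (ContinuousAt.comp (g := pot) (f := fun x => pt x y) (pot_continuousAt (h x hx))
    (continuous_pt_left y).continuousAt).continuousWithinAt

theorem pot_right_strictMonoOn {s : Set ℝ} {y : ℝ} (hs : Convex ℝ s) (hs0 : s ⊆ Ici 0)
    (h0 : ∀ x ∈ s, pt x y ≠ 0) : StrictMonoOn (fun x => pot (pt x y)) s := by
  refine strictMonoOn_of_deriv_pos_except
    -- The exceptional abscissa `-fP (-y)` is the only place where the line can cross `Γ_R`, and
    -- continuity carries monotonicity across it.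
    (f' := fun x => 3 * (stdQ (pt x y) - stdP (pt x y)).re) (a := -fP (-y)) hs (pot_line_continuousOn h0)
    fun x hx hxa => ?_
  have hxs := interior_subset hx
  have hx0 : 0 ≤ x := hs0 hxs
  refine ⟨hasDerivAt_pot_line (h0 x hxs) (not_mem_stdCut hx0) fun h => hxa ?_,
    mul_pos three_pos (std_re_pos_right hx0 (h0 x hxs))⟩
  have := h.2
  simp only [Complex.neg_re, Complex.neg_im, pt_re, pt_im] at this
  linarith

theorem tendsto_pot_right (y : ℝ) : Tendsto (fun x => pot (pt x y)) atTop atTop := by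
  have hb : ∀ᶠ z in Bornology.cobounded ℂ, z ∉ stdCut := by
    obtain ⟨F, -, -, h1, h2⟩ := exists_stdArc
    rw [← h2]
    exact Bornology.isBounded_def.1 h1.isCompact.isBounded
  have hb' := tendsto_neg_infty.eventually hb
  have hline : Tendsto (fun x : ℝ => pt (-x) y) atBot (Bornology.cobounded ℂ) :=
    (tendsto_pt_atTop y).comp tendsto_neg_atBot_atTop
  obtain ⟨b, hb1⟩ := eventually_atBot.1 (((hline.eventually hb).and (hline.eventually hb')).and
    (eventually_lt_atBot 0))
  have h1 : Tendsto (fun x : ℝ => -pot (pt (-x) y)) atBot atBot := by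
    apply tendsto_atBot_of_deriv (f' := fun x => 3 * (stdQ (pt (-x) y) - stdP (pt (-x) y)).re) (b := b)
    · intro x hx
      obtain ⟨⟨a1, a2⟩, a3⟩ := hb1 x hx.le
      have a0 : pt (-x) y ≠ 0 := fun h => by
        have := congrArg Complex.re h
        simp at this; linarith
      have a4 := (hasDerivAt_pot_line a0 a1 a2).comp x (hasDerivAt_neg x)
      convert! a4.neg using 1
      ring
    · have h2 := ((Complex.continuous_re.tendsto _).comp
        ((tendsto_stdQ.sub tendsto_stdP).comp hline)).const_mul 3
      norm_num at h2
      exact h2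
  have h2 := tendsto_neg_atBot_atTop.comp (h1.comp tendsto_neg_atTop_atBot)
  simpa [Function.comp_def] using h2

theorem tendsto_hw_infty : Tendsto hw (Bornology.cobounded ℂ) atBot := by
  have h1 : Tendsto (fun w : ℂ => 2 / 3 - Real.log (3 * ‖w‖)) (Bornology.cobounded ℂ) atBot := by
    apply tendsto_const_nhds.add_atBot
    apply tendsto_neg_atTop_atBot.comp
    exact Real.tendsto_log_atTop.comp (tendsto_norm_cobounded_atTop.const_mul_atTop three_pos)
  refine tendsto_atBot_mono' _ ?_ h1
  filter_upwards [tendsto_norm_cobounded_atTop.eventually (eventually_ge_atTop 2)] with w hw2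
  have h3 : 3 ≤ ‖w ^ 2 - 1‖ := by
    have := norm_sub_norm_le (w ^ 2) 1
    rw [norm_pow, norm_one] at this
    nlinarith
  have h4 : (2 / (w ^ 2 - 1)).re ≤ 2 / 3 := by
    refine (Complex.re_le_norm _).trans ?_
    rw [norm_div, Complex.norm_two]
    exact div_le_div_of_nonneg_left two_pos.le three_pos h3
  have h5 : 3 * ‖w‖ ≤ ‖w ^ 3 - w‖ := by
    have : w ^ 3 - w = (w ^ 2 - 1) * w := by ring
    rw [this, norm_mul]
    exact mul_le_mul_of_nonneg_right h3 (norm_nonneg _)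
  have h6 := Real.log_le_log (by linarith) h5
  unfold hw
  linarith

/-- At `0` the branch `ψ_Q` has its pole, where `hw` tends to `-∞`, while `ψ_P` stays analytic. -/
theorem tendsto_pot_zero : Tendsto pot (𝓝[≠] 0) atBot := by
  have h1 : Tendsto (fun z => hw (stdQ z)) (𝓝[≠] 0) atBot := tendsto_hw_infty.comp stdQ_pole
  have h2 : ContinuousAt (fun z => hw (stdP z)) 0 :=
    ContinuousAt.comp (g := hw) (continuousAt_hw (cube_sub_ne_zero (stdP_eqn 0)))
      stdP_analyticAt_zero.continuousAt
  exact h1.atBot_add (h2.tendsto.mono_left nhdsWithin_le_nhds).neg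

/-! ### The zeros of the potential -/

theorem pot_upper_strictMonoOn {y : ℝ} (hy : z₁.im ^ 2 ≤ y ^ 2) :
    StrictMonoOn (fun x => pot (pt x y)) univ := by
  have hy0 : y ≠ 0 := fun h => by
    have := pow_pos z₁_im_pos 2
    rw [h] at hy; linarith
  have h1 : StrictMonoOn (fun x => pot (pt x y)) (Iic 0) := by
    refine (upper_line_strictMonoOn hy).congr fun x hx => ?_
    have : pt x y ∉ stdRegion := fun h => absurd h.1 hy.not_gt
    simp only
    rw [pot_left (z := pt x y) hx (pt_ne_zero_of_im hy0), ds_of_not_mem this]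
  have h2 := pot_right_strictMonoOn (y := y) (convex_Ici 0) subset_rfl
    fun x _ => pt_ne_zero_of_im hy0
  have := h1.union h2 isGreatest_Iic isLeast_Ici
  rwa [Iic_union_Ici] at this

theorem pot_left_eq_zero_iff {z : ℂ} (hz : z.re ≤ 0) (h0 : z ≠ 0) : pot z = 0 ↔ IsLevel z := by
  rw [pot_left hz h0, isLevel_iff (ds_sq hz h0)]

theorem pot_upper_zero_iff {x y : ℝ} (hy : z₁.im ^ 2 ≤ y ^ 2) : pot (pt x y) = 0 ↔ x = fE y := by
  have hy0 : y ≠ 0 := fun h => by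
    have := pow_pos z₁_im_pos 2
    rw [h] at hy; linarith
  have h1 : pot (pt (fE y) y) = 0 :=
    (pot_left_eq_zero_iff (z := pt (fE y) y) (fE_spec hy).1.le (pt_ne_zero_of_im hy0)).2 (fE_spec hy).2
  constructor
  · intro h
    exact (pot_upper_strictMonoOn hy).injOn (mem_univ _) (mem_univ _) (h.trans h1.symm)
  · rintro rfl
    exact h1

/-- The part of a horizontal line to the right of the standard cut contains one zero. -/
theorem exists_star {y : ℝ} (hy : y ^ 2 < z₁.im ^ 2) : ∃ s, fP y < s ∧ pt s y ≠ 0 ∧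
    pot (pt s y) = 0 ∧ (s < 0 → 0 < (qz (pt s y)).re) ∧ ∀ x, fP y < x → pt x y ≠ 0 →
      (x < s → pot (pt x y) < 0) ∧ (s < x → 0 < pot (pt x y)) := by
  have hmemR : ∀ x, fP y < x → pt x y ∈ stdRegion := fun x hx => ⟨hy, hx⟩
  -- The real line passes through the pole at `0`: the potential is negative to the left of it, and
  -- to the right it rises from `-∞`. Hence this zero is positive.
  by_cases hy0 : y = 0
  · subst hy0
    have hne : ∀ x : ℝ, x ≠ 0 → pt x 0 ≠ 0 := fun x hx h => hx (congrArg Complex.re h)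
    have hmono := pot_right_strictMonoOn (s := Ioi 0) (y := 0) (convex_Ioi 0) Ioi_subset_Ici_self
      fun x hx => hne x (ne_of_gt hx)
    obtain ⟨b, hb, hb0⟩ := (((tendsto_pot_right 0).eventually (eventually_gt_atTop 0)).and
      (eventually_gt_atTop 0)).exists
    have hlim : Tendsto (fun x => pot (pt x 0)) (𝓝[>] 0) atBot := by
      apply tendsto_pot_zero.comp
      apply tendsto_nhdsWithin_of_tendsto_nhds_of_eventually_within
      · exact ((continuous_pt_left 0).tendsto' 0 0 rfl).mono_left nhdsWithin_le_nhds
      · filter_upwards [self_mem_nhdsWithin] with x hx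
        exact hne x (ne_of_gt hx)
    obtain ⟨a, ha, ha0, hab⟩ := ((hlim.eventually (eventually_lt_atBot 0)).and
      (Ioo_mem_nhdsGT hb0)).exists
    obtain ⟨s, hs, hs0⟩ := intermediate_value_Icc hab.le
      (pot_line_continuousOn (y := 0) (s := Icc a b) fun x hx => hne x (ha0.trans_le hx.1).ne')
      (show (0 : ℝ) ∈ Icc _ _ from ⟨ha.le, hb.le⟩)
    have hs1 : 0 < s := ha0.trans_le hs.1
    refine ⟨s, fP_zero_lt.trans hs1, hne s hs1.ne', hs0, fun h => absurd h hs1.not_gt,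
      fun x hx hx0 => ⟨fun h => ?_, fun h => ?_⟩⟩
    · rcases lt_trichotomy x 0 with h1 | h1 | h1
      · rw [pot_left (z := pt x 0) h1.le hx0, ds_of_mem (hmemR x hx)]
        exact real_line hx h1
      · exact absurd (by rw [h1]; rfl) hx0
      · exact (hmono h1 hs1 h).trans_eq hs0
    · exact hs0.symm.trans_lt (hmono hs1 (hs1.trans h) h)
  · have hne : ∀ x : ℝ, pt x y ≠ 0 := fun x => pt_ne_zero_of_im hy0
    obtain ⟨c, hc1, hc2, hc3, hc4, hc5⟩ := middle_line hy hy0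
    have heq : ∀ x, fP y < x → x ≤ 0 → pot (pt x y) = potDiff (pt x y) (-dt (pt x y)) :=
      fun x hx hx0 => by rw [pot_left (z := pt x y) hx0 (hne x), ds_of_mem (hmemR x hx)]
    have hmono : StrictMonoOn (fun x => pot (pt x y)) (Ici c) := by
      have h1 : StrictMonoOn (fun x => pot (pt x y)) (Icc c 0) :=
        hc4.congr fun x hx => (heq x (hc1.trans_le hx.1) hx.2).symm
      have h2 := pot_right_strictMonoOn (y := y) (convex_Ici 0) subset_rfl fun x _ => hne x
      have := h1.union h2 (isGreatest_Icc hc2.le) isLeast_Ici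
      rwa [Icc_union_Ici_eq_Ici hc2.le] at this
    have hcneg : pot (pt c y) < 0 := by
      rw [heq c hc1 hc2.le]; exact hc3 c hc1 le_rfl
    obtain ⟨b, hb, hb0⟩ := (((tendsto_pot_right y).eventually (eventually_gt_atTop 0)).and
      (eventually_gt_atTop c)).exists
    obtain ⟨s, hs, hs0⟩ := intermediate_value_Icc hb0.le
      (pot_line_continuousOn (y := y) (s := Icc c b) fun x hx => hne x)
      (show (0 : ℝ) ∈ Icc _ _ from ⟨hcneg.le, hb.le⟩)
    have hcs : c < s := by
      refine lt_of_le_of_ne hs.1 fun h => ?_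
      rw [← h] at hs0
      exact hcneg.ne hs0
    refine ⟨s, hc1.trans hcs, hne s, hs0, fun h => hc5 s hcs h.le, fun x hx hx0 =>
      ⟨fun h => ?_, fun h => ?_⟩⟩
    · rcases le_or_gt x c with h1 | h1
      · rw [heq x hx (h1.trans hc2.le)]
        exact hc3 x hx h1
      · exact (hmono h1.le hs.1 h).trans_eq hs0
    · exact hs0.symm.trans_lt (hmono hs.1 (hs.1.trans h.le) h)

/-! ### The curve through the imaginary axis -/

open Classical in
/-- The curve `Γ_P^*` as a graph over the imaginary axis. -/
def fS (y : ℝ) : ℝ := if h : y ^ 2 < z₁.im ^ 2 then (exists_star h).choose else z₁.re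

theorem fS_spec {y : ℝ} (hy : y ^ 2 < z₁.im ^ 2) : fP y < fS y ∧ pt (fS y) y ≠ 0 ∧
    pot (pt (fS y) y) = 0 ∧ (fS y < 0 → 0 < (qz (pt (fS y) y)).re) ∧
    ∀ x, fP y < x → pt x y ≠ 0 →
      (x < fS y → pot (pt x y) < 0) ∧ (fS y < x → 0 < pot (pt x y)) := by
  have : fS y = (exists_star hy).choose := dif_pos hy
  rw [this]
  exact (exists_star hy).choose_spec

theorem fS_corner {y : ℝ} (hy : y ^ 2 = z₁.im ^ 2) : fS y = z₁.re := dif_neg hy.not_lt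

theorem fS_unique {x y : ℝ} (hy : y ^ 2 < z₁.im ^ 2) (hx : fP y < x) (h0 : pt x y ≠ 0)
    (h : pot (pt x y) = 0) : x = fS y := by
  have h1 := (fS_spec hy).2.2.2.2 x hx h0
  rcases lt_trichotomy x (fS y) with h2 | h2 | h2
  · exact absurd h (h1.1 h2).ne
  · exact h2
  · exact absurd h (h1.2 h2).ne'

theorem fS_zero_pos : 0 < fS 0 := by
  have h0 : (0 : ℝ) ^ 2 < z₁.im ^ 2 := by have := pow_pos z₁_im_pos 2; linarith
  obtain ⟨-, h2, -, h4, -⟩ := fS_spec h0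
  rcases lt_trichotomy (fS 0) 0 with h | h | h
  · exact absurd (h4 h) (qz_real (z := pt (fS 0) 0) h rfl).1.not_gt
  · exact absurd (by rw [h]; rfl) h2
  · exact h

/-- To the right of the cut the potential changes from negative to positive at `fS y`, so its sign
on the imaginary axis tells on which side the zero lies. -/
theorem fS_sign {y : ℝ} (hy : y ^ 2 < z₁.im ^ 2) (hy0 : y ≠ 0) :
    (fS y < 0 ↔ 0 < potDiff (pt 0 y) (dp (pt 0 y))) ∧
      (fS y = 0 ↔ potDiff (pt 0 y) (dp (pt 0 y)) = 0) := by
  have hne := pt_ne_zero_of_im (x := 0) hy0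
  have e : pot (pt 0 y) = potDiff (pt 0 y) (dp (pt 0 y)) := by
    rw [pot_left (z := pt 0 y) le_rfl hne, ds_imag_axis rfl hne]
  obtain ⟨-, -, h3, -, h5⟩ := fS_spec hy
  obtain ⟨h6, h7⟩ := h5 0 (fP_neg hy.le) hne
  rw [← e]
  rcases lt_trichotomy (fS y) 0 with h | h | h
  · have := h7 h
    exact ⟨⟨fun _ => this, fun _ => h⟩, ⟨fun h' => absurd h' h.ne, fun h' => absurd h' this.ne'⟩⟩
  · rw [h] at h3
    exact ⟨⟨fun h' => absurd h h'.ne, fun h' => absurd h3 h'.ne'⟩, ⟨fun _ => h3, fun _ => h⟩⟩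
  · have := h6 h
    exact ⟨⟨fun h' => absurd h h'.not_gt, fun h' => absurd this h'.not_gt⟩,
      ⟨fun h' => absurd h' h.ne', fun h' => absurd h' this.ne⟩⟩

/-- The set `Γ_P^*`. -/
def starSet : Set ℂ := {z | z.im ^ 2 ≤ z₁.im ^ 2 ∧ z.re = fS z.im}

theorem corner_cases {z : ℂ} (h1 : z.im ^ 2 = z₁.im ^ 2) (h2 : z.re = z₁.re) : z = z₁ ∨ z = z₂ := by
  rcases sq_eq_sq_iff_eq_or_eq_neg.1 h1 with h3 | h3
  · exact Or.inl (Complex.ext h2 h3)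
  · right
    rw [z₂_eq_pt]
    exact Complex.ext h2 h3

theorem starSet_cases {z : ℂ} (h : z ∈ starSet) :
    (z = z₁ ∨ z = z₂) ∨ z.im ^ 2 < z₁.im ^ 2 ∧ z.re = fS z.im := by
  rcases h.1.lt_or_eq with h1 | h1
  · exact Or.inr ⟨h1, h.2⟩
  · exact Or.inl (corner_cases h1 (h.2.trans (fS_corner h1)))

theorem z₂_re : z₂.re = z₁.re := by rw [z₂_eq_pt, pt_re]

theorem z₂_im : z₂.im = -z₁.im := by rw [z₂_eq_pt, pt_im]

theorem starSet_ne_zero {z : ℂ} (h : z ∈ starSet) : z ≠ 0 := by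
  rcases starSet_cases h with (h1 | h1) | h1
  · rw [h1]; exact left_ne_zero z₁_re_neg
  · rw [h1]; exact left_ne_zero (z₂_re ▸ z₁_re_neg)
  · have := (fS_spec h1.1).2.1
    rwa [← h1.2, pt_re_im] at this

theorem starSet_pot {z : ℂ} (h : z ∈ starSet) (h1 : z.im ^ 2 < z₁.im ^ 2) : pot z = 0 := by
  have := (fS_spec h1).2.2.1
  rwa [← h.2, pt_re_im] at this

/-- On `Γ_R` the potential is the difference of `hw` at `sQ (-z)` and at the right preimage of `-z`,
to which `hw_rt_lt` applies. -/
theorem pot_pos_of_neg_mem_stdCut {z : ℂ} (h : -z ∈ stdCut) (h1 : z.im ^ 2 < z₁.im ^ 2) :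
    0 < pot z := by
  have hz := stdCut_left h
  have h0 : z ≠ 0 := neg_ne_zero.1 (left_ne_zero hz)
  have hz' : 0 ≤ z.re := by simp only [Complex.neg_re] at hz; linarith
  have hx : (-z).re ≤ z₁.re := by rw [h.2]; exact (fP_spec h.1).1
  have h2 := hw_rt_lt (x := (-z).re) (y := (-z).im) hx (by simpa using h1)
  rw [pt_re_im] at h2
  rw [pot_right hz' h0, sQ, ds_of_not_mem (stdCut_not_mem_stdRegion h)]
  linarith

/-- `Γ_P^*` does not meet `Γ_R`. -/
theorem starSet_not_mem_R {z : ℂ} (h : z ∈ starSet) : -z ∉ stdCut := by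
  intro hc
  have hz := stdCut_left hc
  rw [Complex.neg_re] at hz
  rcases starSet_cases h with (h1 | h1) | h1
  · rw [h1] at hz; linarith [z₁_re_neg]
  · rw [h1, z₂_re] at hz; linarith [z₁_re_neg]
  · exact (pot_pos_of_neg_mem_stdCut hc h1.1).ne' (starSet_pot h h1.1)

/-- The branches are analytic at the zero, as `starSet` avoids `Γ_R`. Their difference has nonzero
real part: on the left because `Re q > 0`, on the right by `std_re_pos_right`. -/
theorem fS_analytic_germ {y : ℝ} (hy : y ^ 2 < z₁.im ^ 2) : AnalyticAt ℝ fS y := by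
  obtain ⟨h1, h2, h3, h4, -⟩ := fS_spec hy
  set z₀ := pt (fS y) y with hz₀
  have hmem : z₀ ∈ starSet := ⟨hy.le, rfl⟩
  have hP : z₀ ∉ stdCut := fun h => h1.ne h.2.symm
  have hreg : z₀ ∈ stdRegion := by
    refine ⟨?_, ?_⟩
    · rw [hz₀, pt_im]; exact hy
    · rw [hz₀, pt_im, pt_re]; exact h1
  have hR := starSet_not_mem_R hmem
  have hre : (stdQ z₀ - stdP z₀).re ≠ 0 := by
    rcases lt_or_ge (fS y) 0 with h | h
    · have h5 : z₀.re < 0 := h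
      rw [stdQ_left h5.le h2, stdP_left h5, sQ_sub_sP, ds_of_mem hreg, Complex.neg_re]
      exact (neg_pos.2 (dt_re.2 (h4 h))).ne'
    · exact (std_re_pos_right (z := z₀) h h2).ne'
  obtain ⟨f, hf, hf0, he⟩ := exists_level_graph (stdQ_analyticAt h2 hP hR) (stdP_analyticAt hP)
    ((eventually_ne_nhds h2).mono fun w hw => stdQ_eqn hw) (Eventually.of_forall stdP_eqn)
    (sub_eq_zero.1 h3) hre
  change AnalyticAt ℝ f y at hf
  change f y = fS y at hf0
  change ∀ᶠ y in 𝓝 y, _ at he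
  refine hf.congr ?_
  have hc : ContinuousAt (fun y => pt (f y) y) y :=
    (analyticAt_pt hf analyticAt_id).continuousAt
  have hlt : ∀ᶠ y' in 𝓝 y, fP y' < f y' :=
    (fP_continuousAt hy).eventually_lt hf.continuousAt (by rw [hf0]; exact h1)
  have hsq : ∀ᶠ y' in 𝓝 y, y' ^ 2 < z₁.im ^ 2 :=
    (continuous_pow 2).continuousAt.eventually_lt continuousAt_const hy
  have hne : ∀ᶠ y' in 𝓝 y, pt (f y') y' ≠ 0 := hc.eventually_ne (by rw [hf0]; exact h2)
  filter_upwards [he, hlt, hsq, hne] with y' a1 a2 a3 a4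
  exact fS_unique a3 a2 a4 (sub_eq_zero.2 a1)

theorem fS_eq_of_isLevel {x y : ℝ} (hy : y ^ 2 < z₁.im ^ 2) (hx : z₁.re < x) (hx0 : x < 0)
    (h : IsLevel (pt x y)) : fS y = x := by
  have h0 : pt x y ≠ 0 := left_ne_zero (z := pt x y) hx0
  exact (fS_unique hy ((fP_spec hy.le).1.trans_lt hx) h0
    ((pot_left_eq_zero_iff (z := pt x y) hx0.le h0).2 h)).symm

/-- Symmetry of `fS` is needed only near the corner, where the curve is still in the left half-plane
and conjugation acts on the level set. -/
theorem fS_germ : (∃ F, AnalyticAt ℝ F z₁.im ∧ ∀ᶠ y in 𝓝 z₁.im, y ≤ z₁.im → fS y = F y) ∧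
    ∀ᶠ y in 𝓝 z₁.im, y ≤ z₁.im → fS (-y) = fS y := by
  obtain ⟨F, hF, hF0, he⟩ := star_germ
  have hneg : ∀ᶠ y in 𝓝 z₁.im, F y < 0 :=
    hF.continuousAt.eventually_lt continuousAt_const (by rw [hF0]; exact z₁_re_neg)
  have hkey : ∀ᶠ y in 𝓝 z₁.im, y ≤ z₁.im → fS y = F y ∧ fS (-y) = F y := by
    filter_upwards [he, hneg, near_im_sq] with y h1 h2 h3 h4
    rcases h4.eq_or_lt with h5 | h5
    · rw [h5, hF0]
      exact ⟨fS_corner rfl, fS_corner (neg_sq _)⟩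
    · obtain ⟨h6, h7⟩ := h1 h5
      have hy : y ^ 2 < z₁.im ^ 2 := by nlinarith
      refine ⟨fS_eq_of_isLevel hy h6 h2 h7, fS_eq_of_isLevel (by rwa [neg_sq]) h6 h2 ?_⟩
      rw [← pt_conj]
      exact (isLevel_conj (z := pt (F y) y) h2.le).2 h7
  exact ⟨⟨F, hF, hkey.mono fun y h h' => (h h').1⟩, hkey.mono fun y h h' => by
    rw [(h h').1, (h h').2]⟩

theorem exists_starArc : ∃ γ, IsAnalyticArc γ z₂ z₁ ∧ arcSet γ = starSet := by
  have hY := z₁_im_pos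
  obtain ⟨h1, h2⟩ := fS_germ
  obtain ⟨F, hF, he⟩ := exists_analytic_extension_Icc (f := fS) (a := -z₁.im) (b := z₁.im)
    (by linarith) (fun y hy => fS_analytic_germ (sq_lt_sq' hy.1 hy.2)) (germ_neg h2 h1) h1
  have hu : uIcc (-z₁.im) z₁.im = Icc (-z₁.im) z₁.im := uIcc_of_le (by linarith)
  have hγ := isAnalyticArc_graphArc (F := F) (p := -z₁.im) (q := z₁.im) (by linarith)
    (by rw [hu]; exact hF)
  refine ⟨graphArc F (-z₁.im) z₁.im, ?_, ?_⟩
  · rw [he ⟨le_rfl, by linarith⟩, he ⟨by linarith, le_rfl⟩, fS_corner (neg_sq _), fS_corner rfl,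
      ← z₁_eq_pt, ← z₂_eq_pt] at hγ
    exact hγ
  · rw [arcSet_graphArc, hu]
    ext z
    constructor
    · rintro ⟨y, hy, rfl⟩
      exact ⟨sq_le_of_mem_Icc hy, he hy⟩
    · rintro ⟨h3, h4⟩
      have h5 := mem_Icc_of_sq_le h3
      exact ⟨z.im, h5, Complex.ext (by simp only [pt_re]; rw [he h5, h4]) rfl⟩

/-! ### The unbounded curves -/

/-- The set `Γ_{E,1}`. -/
def upperRay : Set ℂ := {z | z₁.im ≤ z.im ∧ z.re = fE z.im}

/-- The set `Γ_{E,2}`. -/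
def lowerRay : Set ℂ := {z | z.im ≤ -z₁.im ∧ z.re = fE z.im}

theorem upperRay_sq {z : ℂ} (h : z ∈ upperRay) : z₁.im ^ 2 ≤ z.im ^ 2 :=
  pow_le_pow_left₀ z₁_im_pos.le h.1 2

theorem lowerRay_sq {z : ℂ} (h : z ∈ lowerRay) : z₁.im ^ 2 ≤ z.im ^ 2 := by
  have := pow_le_pow_left₀ z₁_im_pos.le (le_neg_of_le_neg h.1) 2
  rwa [neg_sq] at this

theorem upperRay_left {z : ℂ} (h : z ∈ upperRay) : z.re < 0 := by
  rw [h.2]; exact (fE_spec (upperRay_sq h)).1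

theorem lowerRay_left {z : ℂ} (h : z ∈ lowerRay) : z.re < 0 := by
  rw [h.2]; exact (fE_spec (lowerRay_sq h)).1

theorem exists_rays : ∃ γ₁ γ₂, IsAnalyticRay γ₁ z₁ ∧ raySet γ₁ = upperRay ∧
    IsAnalyticRay γ₂ z₂ ∧ raySet γ₂ = lowerRay := by
  have hY := z₁_im_pos
  obtain ⟨F, hF, he⟩ := exists_fE_extension
  have hsq : ∀ y ∈ Ici z₁.im, z₁.im ^ 2 ≤ y ^ 2 := fun y hy => pow_le_pow_left₀ hY.le hy 2
  have hF0 : F z₁.im = z₁.re := (he self_mem_Ici).trans (fE_corner rfl)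
  have h1 := isAnalyticRay_graphRay (F := F) (p := z₁.im) (one_ne_zero) hF
  have h2 := isAnalyticRay_graphRay (F := F) (p := z₁.im) (neg_ne_zero.2 one_ne_zero) hF
  rw [hF0, one_mul, ← z₁_eq_pt] at h1
  rw [hF0, neg_one_mul, ← z₂_eq_pt] at h2
  refine ⟨_, _, h1, ?_, h2, ?_⟩
  · rw [raySet_graphRay]
    ext z
    constructor
    · rintro ⟨y, hy, rfl⟩
      exact ⟨by simpa using hy, by simp only [pt_re, pt_im, one_mul]; exact he hy⟩
    · rintro ⟨h3, h4⟩
      exact ⟨z.im, h3, Complex.ext (by simp only [pt_re]; rw [he h3, h4]) (by simp)⟩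
  · rw [raySet_graphRay]
    ext z
    constructor
    · rintro ⟨y, hy, rfl⟩
      refine ⟨by simpa using hy, ?_⟩
      simp only [pt_re, pt_im, neg_one_mul]
      rw [fE_even (hsq y hy)]
      exact he hy
    · rintro ⟨h3, h4⟩
      have h5 : -z.im ∈ Ici z₁.im := le_neg_of_le_neg h3
      refine ⟨-z.im, h5, Complex.ext ?_ (by simp)⟩
      simp only [pt_re]
      rw [he h5, h4, ← fE_even (hsq _ h5), neg_neg]

/-! ### The configuration of the curves -/

/-- The zeros of the potential. -/
theorem pot_eq_zero_iff {z : ℂ} (h0 : z ≠ 0) :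
    pot z = 0 ↔ z ∈ stdCut ∪ starSet ∪ upperRay ∪ lowerRay := by
  rcases lt_or_ge (z.im ^ 2) (z₁.im ^ 2) with hy | hy
  · have hu : z ∉ upperRay := fun h => absurd (upperRay_sq h) hy.not_ge
    have hl : z ∉ lowerRay := fun h => absurd (lowerRay_sq h) hy.not_ge
    constructor
    · intro h
      left; left
      rcases lt_trichotomy z.re (fP z.im) with h1 | h1 | h1
      · have h2 := h1.trans (fP_neg hy.le)
        rw [pot_left h2.le h0, ds_of_not_mem fun h => absurd h.2 h1.not_gt] at h
        exact absurd h (potDiff_neg_of_lt_fP hy.le h1).ne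
      · exact Or.inl ⟨hy.le, h1⟩
      · exact Or.inr ⟨hy.le, fS_unique hy h1 h0 h⟩
    · rintro (((h | h) | h) | h)
      · exact (pot_left_eq_zero_iff (stdCut_left h).le h0).2 (stdCut_isLevel h)
      · exact starSet_pot h hy
      · exact absurd h hu
      · exact absurd h hl
  · have h1 : pot z = 0 ↔ z.re = fE z.im := pot_upper_zero_iff (x := z.re) hy
    rw [h1]
    constructor
    · intro h
      rcases le_abs.1 (abs_of_pos z₁_im_pos ▸ sq_le_sq.1 hy) with h2 | h2
      · exact Or.inl (Or.inr ⟨h2, h⟩)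
      · exact Or.inr ⟨by linarith, h⟩
    · rintro (((h | h) | h) | h)
      · have e := le_antisymm h.1 hy
        rw [fE_corner e, h.2, fP_corner e]
      · have e := le_antisymm h.1 hy
        rw [fE_corner e, h.2, fS_corner e]
      · exact h.2
      · exact h.2

theorem z₁_mem_stdCut : z₁ ∈ stdCut := ⟨le_rfl, (fP_corner rfl).symm⟩

theorem z₂_mem_stdCut : z₂ ∈ stdCut := by
  rw [z₂_eq_pt]
  exact ⟨(neg_sq _).le, (fP_corner (neg_sq _)).symm⟩

theorem pot_z₁ : pot z₁ = 0 :=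
  (pot_eq_zero_iff (stdCut_ne_zero z₁_mem_stdCut)).2 (Or.inl (Or.inl (Or.inl z₁_mem_stdCut)))

theorem stdCut_inter_starSet : stdCut ∩ starSet = {z₁, z₂} := by
  ext z
  constructor
  · rintro ⟨h1, h2⟩
    rcases starSet_cases h2 with h | h
    · exact h
    · exact absurd (h1.2.symm.trans h.2) (fS_spec h.1).1.ne
  · rintro (h | h)
    · rw [h]
      exact ⟨z₁_mem_stdCut, ⟨le_rfl, (fS_corner rfl).symm⟩⟩
    · rw [mem_singleton_iff.1 h]
      refine ⟨z₂_mem_stdCut, ?_⟩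
      rw [z₂_eq_pt]
      exact ⟨(neg_sq _).le, (fS_corner (neg_sq _)).symm⟩

theorem inter_upperRay : (stdCut ∪ starSet) ∩ upperRay = {z₁} := by
  ext z
  constructor
  · rintro ⟨h1, h2⟩
    have h3 : z.im ^ 2 ≤ z₁.im ^ 2 := h1.elim (fun h => h.1) fun h => h.1
    have e := le_antisymm h3 (upperRay_sq h2)
    rcases corner_cases e (h2.2.trans (fE_corner e)) with h | h
    · exact h
    · have := h2.1
      rw [h, z₂_im] at this
      linarith [z₁_im_pos]
  · intro h
    rw [mem_singleton_iff.1 h]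
    exact ⟨Or.inl z₁_mem_stdCut, ⟨le_rfl, (fE_corner rfl).symm⟩⟩

theorem inter_lowerRay : (stdCut ∪ starSet) ∩ lowerRay = {z₂} := by
  ext z
  constructor
  · rintro ⟨h1, h2⟩
    have h3 : z.im ^ 2 ≤ z₁.im ^ 2 := h1.elim (fun h => h.1) fun h => h.1
    have e := le_antisymm h3 (lowerRay_sq h2)
    rcases corner_cases e (h2.2.trans (fE_corner e)) with h | h
    · have := h2.1
      rw [h] at this
      linarith [z₁_im_pos]
    · exact h
  · intro h
    rw [mem_singleton_iff.1 h]
    refine ⟨Or.inl z₂_mem_stdCut, ?_⟩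
    rw [z₂_eq_pt]
    exact ⟨le_rfl, (fE_corner (neg_sq _)).symm⟩

theorem disjoint_rays : Disjoint upperRay lowerRay := by
  rw [disjoint_left]
  intro z h1 h2
  linarith [h1.1, h2.1, z₁_im_pos]

/-- The sign of the potential on the axis depends only on the square of the height, so `fS y` and
`fS (-y)` have the same sign. If `z` and `-z` both lie on the curve these values are opposite, hence
zero. Real points are excluded by `fS_zero_pos`. -/
theorem starSet_inter_neg {y : ℝ} (hy : y ^ 2 < z₁.im ^ 2) (hy0 : 0 < y)
    (h : ∀ x : ℝ, x ≠ 0 → (potDiff (pt 0 x) (dp (pt 0 x)) = 0 ↔ x ^ 2 = y ^ 2) ∧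
      (0 < potDiff (pt 0 x) (dp (pt 0 x)) ↔ y ^ 2 < x ^ 2)) (z : ℂ) :
    z ∈ starSet ∧ -z ∈ starSet ↔ z = Complex.I * y ∨ z = -(Complex.I * y) := by
  have hI : ∀ σ : ℝ, σ ^ 2 = y ^ 2 → pt 0 σ ∈ starSet := by
    intro σ hσ
    have hσ0 : σ ≠ 0 := fun e => by rw [e] at hσ; nlinarith
    have hσ1 : σ ^ 2 < z₁.im ^ 2 := by rw [hσ]; exact hy
    exact ⟨hσ1.le, ((fS_sign hσ1 hσ0).2.2 ((h σ hσ0).1.2 hσ)).symm⟩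
  have e1 : pt 0 y = Complex.I * y := by apply Complex.ext <;> simp
  have e2 : pt 0 (-y) = -(Complex.I * y) := by apply Complex.ext <;> simp
  constructor
  · rintro ⟨h1, h2⟩
    have hlt : z.im ^ 2 < z₁.im ^ 2 ∧ z.re = fS z.im := by
      rcases starSet_cases h1 with (e | e) | e
      · exfalso
        rw [e] at h2
        have := h2.2.trans (fS_corner (by simp))
        rw [Complex.neg_re] at this
        linarith [z₁_re_neg]
      · exfalso
        rw [e] at h2
        have := h2.2.trans (fS_corner (by simp [z₂_im]))
        rw [Complex.neg_re, z₂_re] at this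
        linarith [z₁_re_neg]
      · exact e
    have h3 : -z.re = fS (-z.im) := h2.2
    have hz0 : z.im ≠ 0 := by
      intro e
      have h4 := hlt.2
      rw [e] at h3 h4
      rw [neg_zero] at h3
      linarith [fS_zero_pos]
    have hneg : (-z.im) ^ 2 < z₁.im ^ 2 := by rw [neg_sq]; exact hlt.1
    obtain ⟨a1, a2⟩ := fS_sign hlt.1 hz0
    obtain ⟨b1, -⟩ := fS_sign hneg (neg_ne_zero.2 hz0)
    rw [(h _ hz0).2, ← hlt.2] at a1
    rw [(h _ (neg_ne_zero.2 hz0)).2, neg_sq, ← h3, ← a1] at b1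
    rw [(h _ hz0).1, ← hlt.2] at a2
    have hre : z.re = 0 := by
      rcases lt_trichotomy z.re 0 with c | c | c
      · linarith [b1.2 c]
      · exact c
      · linarith [b1.1 (by linarith)]
    rw [← e2, ← e1]
    rcases sq_eq_sq_iff_eq_or_eq_neg.1 (a2.1 hre) with c | c
    · exact Or.inl (Complex.ext hre c)
    · exact Or.inr (Complex.ext hre c)
  · rintro (rfl | rfl)
    · rw [← e2, ← e1]
      exact ⟨hI y rfl, hI (-y) (neg_sq y)⟩
    · rw [neg_neg, ← e2, ← e1]
      exact ⟨hI (-y) (neg_sq y), hI y rfl⟩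

theorem exists_real_mem_starSet : ∃ x : ℝ, 0 < x ∧ (x : ℂ) ∈ starSet := by
  refine ⟨fS 0, fS_zero_pos, ?_, by simp⟩
  have := pow_pos z₁_im_pos 2
  simp only [Complex.ofReal_im]
  linarith

/-! ### Paths of integration -/

theorem isPathIn_segment {Ω : Set ℂ} {a b : ℂ} (h : ∀ t ∈ Ioo (0 : ℝ) 1, a + t * (b - a) ∈ Ω) :
    IsPathIn Ω a b fun t => a + t * (b - a) := by
  refine ⟨?_, by simp, by simp, h⟩
  have : ContDiff ℝ 1 fun t : ℝ => a + t * (b - a) :=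
    contDiff_const.add (Complex.ofRealCLM.contDiff.mul contDiff_const)
  exact this.contDiffOn

/-- Reparametrizing by a smooth step makes both pieces rest at the junction, so the concatenation is
`C¹`. At each time one of the two summands equals `b`, which is subtracted once. -/
theorem IsPathIn.trans {Ω : Set ℂ} {a b c : ℂ} {γ₁ γ₂ : ℝ → ℂ} (h₁ : IsPathIn Ω a b γ₁)
    (h₂ : IsPathIn Ω b c γ₂) (hb : b ∈ Ω) : ∃ γ, IsPathIn Ω a c γ := by
  set S : ℝ → ℝ := Real.smoothTransition
  have hS : ∀ x, S x ∈ Icc (0 : ℝ) 1 := fun x =>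
    ⟨Real.smoothTransition.nonneg x, Real.smoothTransition.le_one x⟩
  have hSc : ContDiff ℝ 1 S := Real.smoothTransition.contDiff (n := 1)
  have c1 : ContDiff ℝ 1 fun t : ℝ => γ₁ (S (2 * t)) :=
    h₁.contDiffOn.comp_contDiff (hSc.comp (contDiff_const.mul contDiff_id)) fun t => hS _
  have c2 : ContDiff ℝ 1 fun t : ℝ => γ₂ (S (2 * t - 1)) :=
    h₂.contDiffOn.comp_contDiff (hSc.comp ((contDiff_const.mul contDiff_id).sub contDiff_const))
      fun t => hS _
  refine ⟨fun t => γ₁ (S (2 * t)) + γ₂ (S (2 * t - 1)) - b,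
    ((c1.add c2).sub contDiff_const).contDiffOn, ?_, ?_, ?_⟩
  · have e1 : S (2 * 0) = 0 := Real.smoothTransition.zero_of_nonpos (by norm_num)
    have e2 : S (2 * 0 - 1) = 0 := Real.smoothTransition.zero_of_nonpos (by norm_num)
    simp only [e1, e2, h₁.source, h₂.source]; ring
  · have e1 : S (2 * 1) = 1 := Real.smoothTransition.one_of_one_le (by norm_num)
    have e2 : S (2 * 1 - 1) = 1 := Real.smoothTransition.one_of_one_le (by norm_num)
    simp only [e1, e2, h₁.target, h₂.target]; ring
  · intro t ht
    rcases lt_trichotomy t (1 / 2) with h | h | h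
    · have e2 : S (2 * t - 1) = 0 := Real.smoothTransition.zero_of_nonpos (by linarith)
      rw [e2, h₂.source, add_sub_cancel_right]
      exact h₁.mem _ ⟨Real.smoothTransition.pos_of_pos (by linarith [ht.1]),
        Real.smoothTransition.lt_one_of_lt_one (by linarith)⟩
    · have e1 : S (2 * t) = 1 := Real.smoothTransition.one_of_one_le (by linarith)
      have e2 : S (2 * t - 1) = 0 := Real.smoothTransition.zero_of_nonpos (by linarith)
      rw [e1, e2, h₁.target, h₂.source, add_sub_cancel_right]
      exact hb
    · have e1 : S (2 * t) = 1 := Real.smoothTransition.one_of_one_le (by linarith)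
      rw [e1, h₁.target, add_sub_cancel_left]
      exact h₂.mem _ ⟨Real.smoothTransition.pos_of_pos (by linarith),
        Real.smoothTransition.lt_one_of_lt_one (by linarith [ht.2])⟩

theorem ball_segment {z b : ℂ} {r : ℝ} (hb : b ∈ Metric.ball z r) {t : ℝ}
    (ht : t ∈ Icc (0 : ℝ) 1) : z + t * (b - z) ∈ Metric.ball z r := by
  rw [Metric.mem_ball, dist_eq_norm] at hb ⊢
  rw [add_sub_cancel_left, norm_mul, Complex.norm_real, Real.norm_eq_abs, abs_of_nonneg ht.1]
  exact (mul_le_of_le_one_left (norm_nonneg _) ht.2).trans_lt hb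

theorem exists_path_of_isPreconnected {Ω : Set ℂ} (hΩ : IsPreconnected Ω) (ho : IsOpen Ω) {b c : ℂ}
    (hb : b ∈ Ω) (hc : c ∈ Ω) : ∃ γ, IsPathIn Ω b c γ := by
  have hloc : ∀ x ∈ Ω, ∀ᶠ y in 𝓝[Ω] x, (∃ γ, IsPathIn Ω b y γ) = ∃ γ, IsPathIn Ω b x γ := by
    intro x hx
    obtain ⟨r, hr, hrs⟩ := Metric.isOpen_iff.1 ho x hx
    filter_upwards [self_mem_nhdsWithin, nhdsWithin_le_nhds (Metric.ball_mem_nhds x hr)] with y hy hyr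
    apply propext
    constructor
    · rintro ⟨γ, h⟩
      refine h.trans (isPathIn_segment fun t ht => hrs ?_) hy
      have := ball_segment hyr (t := 1 - t) ⟨by linarith [ht.2], by linarith [ht.1]⟩
      convert! this using 1
      push_cast
      ring
    · rintro ⟨γ, h⟩
      exact h.trans (isPathIn_segment fun t ht => hrs (ball_segment hyr (Ioo_subset_Icc_self ht))) hx
  rw [eq_of_locally_eq (f := fun y => ∃ γ, IsPathIn Ω b y γ) hΩ hloc hc hb]
  exact ⟨_, isPathIn_segment fun t _ => by simpa using hb⟩

theorem IsAnalyticArc.isPreconnected_diff {γ : ℝ → ℂ} {a b : ℂ} (h : IsAnalyticArc γ a b)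
    {U : Set ℂ} (hU : IsPreconnected U) (hγU : arcSet γ ⊆ U) (hUo : IsOpen U) :
    IsPreconnected (U \ arcSet γ) := by
  apply isPreconnected_of_forall_constant
  intro f hf x hx y hy
  have hopen : IsOpen (U \ arcSet γ) := hUo.sdiff h.isClosed
  have hloc : ∀ z ∈ U, z ∉ arcSet γ → ∀ᶠ w in 𝓝 z, (f w = true) = (f z = true) := by
    intro z hz hz'
    have h1 : ContinuousAt f z := hf.continuousAt (hopen.mem_nhds ⟨hz, hz'⟩)
    have h2 : ∀ᶠ w in 𝓝 z, f w ∈ ({f z} : Set Bool) :=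
      h1.eventually_mem ((isOpen_discrete _).mem_nhds rfl)
    exact h2.mono fun w hw => by rw [mem_singleton_iff.1 hw]
  have := h.const_of_locally_const hU hγU hUo hloc hx.1 hx.2 hy.1 hy.2
  exact Bool.eq_iff_iff.2 (iff_of_eq this)

/-- The points of an analytic arc can be reached from one side by segments. -/
theorem IsAnalyticArc.exists_access {γ : ℝ → ℂ} {a b : ℂ} (h : IsAnalyticArc γ a b) {C : Set ℂ}
    (hC : IsClosed C) {z : ℂ} (hz : z ∈ arcSet γ) (hzC : z ∉ C) :
    ∃ w, ∀ t ∈ Ioc (0 : ℝ) 1, z + t * (w - z) ∈ (arcSet γ ∪ C)ᶜ := by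
  obtain ⟨t₀, ht₀, rfl⟩ := hz
  obtain ⟨h1, h2⟩ := h.transversal ht₀
  obtain ⟨ε, hε, hε'⟩ := mem_nhdsGT_iff_exists_Ioc_subset.1
    (h2.and (h1.eventually (hC.isOpen_compl.mem_nhds hzC)))
  refine ⟨γ t₀ + ε * (Complex.I * deriv γ t₀), fun t ht => ?_⟩
  have h3 : t * ε ∈ Ioc 0 ε := ⟨mul_pos ht.1 hε, mul_le_of_le_one_left (le_of_lt hε) ht.2⟩
  obtain ⟨h4, h5⟩ := hε' h3
  have e : γ t₀ + t * (γ t₀ + ε * (Complex.I * deriv γ t₀) - γ t₀)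
      = γ t₀ + (t * ε : ℝ) * (Complex.I * deriv γ t₀) := by push_cast; ring
  rw [e]
  rintro (h6 | h6)
  · exact h4 h6
  · exact h5 h6

theorem exists_path_of_access {Ω : Set ℂ} (hΩ : IsPreconnected Ω) (ho : IsOpen Ω) {a z b c : ℂ}
    (ha : ∀ t ∈ Ioc (0 : ℝ) 1, a + t * (b - a) ∈ Ω) (hz : ∀ t ∈ Ioc (0 : ℝ) 1, z + t * (c - z) ∈ Ω) :
    ∃ γ, IsPathIn Ω a z γ := by
  have hb : b ∈ Ω := by simpa using ha 1 ⟨zero_lt_one, le_rfl⟩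
  have hc : c ∈ Ω := by simpa using hz 1 ⟨zero_lt_one, le_rfl⟩
  obtain ⟨γ, hγ⟩ := exists_path_of_isPreconnected hΩ ho hb hc
  have h1 : IsPathIn Ω a b _ := isPathIn_segment fun t ht => ha t ⟨ht.1, ht.2.le⟩
  have h2 : IsPathIn Ω c z _ := isPathIn_segment fun t ht => by
    have := hz (1 - t) ⟨by linarith [ht.2], by linarith [ht.1]⟩
    convert! this using 1
    push_cast
    ring
  obtain ⟨γ', h3⟩ := h1.trans hγ hb
  exact h3.trans h2 hc

/-- This bounds all branches along a path that stays away from `0`, including near the cuts, which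
gives integrability. -/
theorem root_norm_le {z w : ℂ} (h : z * (w ^ 3 - w) = w ^ 2 - 1 / 3) :
    ‖w‖ ≤ 2 ∨ ‖z‖ * ‖w‖ ≤ 2 := by
  by_contra! hcon
  obtain ⟨h1, h2⟩ := hcon
  have h3 : 3 ≤ ‖w ^ 2 - 1‖ := by
    have := norm_sub_norm_le (w ^ 2) 1
    rw [norm_pow, norm_one] at this
    nlinarith
  have h4 : ‖w ^ 2 - 1 / 3‖ ≤ ‖w ^ 2 - 1‖ + 2 / 3 := by
    have e : w ^ 2 - 1 / 3 = (w ^ 2 - 1) + ((2 / 3 : ℝ) : ℂ) := by push_cast; ring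
    rw [e]
    refine (norm_add_le _ _).trans_eq ?_
    rw [Complex.norm_real]; norm_num
  have e : z * (w ^ 3 - w) = z * w * (w ^ 2 - 1) := by ring
  rw [← h, e, norm_mul, norm_mul] at h4
  nlinarith

namespace IsSheetStructure

variable {γP γR : ℝ → ℂ} {ψP ψQ ψR : ℂ → ℂ}

theorem isPreconnected_compl (S : IsSheetStructure γP γR ψP ψQ ψR) :
    IsPreconnected (arcSet γP ∪ arcSet γR ∪ {0})ᶜ := by
  have h0 : IsPreconnected ({0}ᶜ : Set ℂ) :=
    (isConnected_compl_singleton_of_one_lt_rank (by simp) 0).isPreconnected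
  have hP : arcSet γP ⊆ ({0}ᶜ : Set ℂ) := fun z hz h => by
    have := S.arcP_left z hz
    rw [mem_singleton_iff.1 h] at this
    simp at this
  have hR : arcSet γR ⊆ ({0}ᶜ : Set ℂ) \ arcSet γP := fun z hz => by
    have := S.arcR_right z hz
    refine ⟨fun h => ?_, fun h => absurd (S.arcP_left z h) this.not_gt⟩
    rw [mem_singleton_iff.1 h] at this
    simp at this
  have h1 := S.arcP.isPreconnected_diff h0 hP isOpen_compl_singleton
  have h2 := S.arcR.isPreconnected_diff h1 hR (isOpen_compl_singleton.sdiff S.arcP.isClosed)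
  convert! h2 using 1
  ext z
  simp only [mem_compl_iff, mem_union, mem_singleton_iff, Set.mem_sdiff]
  tauto

theorem exists_access (S : IsSheetStructure γP γR ψP ψQ ψR) {z : ℂ} (h0 : z ≠ 0) :
    ∃ w, ∀ t ∈ Ioc (0 : ℝ) 1, z + t * (w - z) ∈ (arcSet γP ∪ arcSet γR ∪ {0})ᶜ := by
  by_cases hP : z ∈ arcSet γP
  · rw [union_assoc]
    refine S.arcP.exists_access (S.arcR.isClosed.union isClosed_singleton) hP ?_
    rintro (h | h)
    · exact S.not_mem_R (S.arcP_left z hP).le h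
    · exact h0 h
  by_cases hR : z ∈ arcSet γR
  · rw [union_comm (arcSet γP), union_assoc]
    refine S.arcR.exists_access (S.arcP.isClosed.union isClosed_singleton) hR ?_
    rintro (h | h)
    · exact hP h
    · exact h0 h
  · refine ⟨z, fun t _ => ?_⟩
    rw [sub_self, mul_zero, add_zero]
    rintro ((h | h) | h)
    · exact hP h
    · exact hR h
    · exact h0 h

theorem exists_path (S : IsSheetStructure γP γR ψP ψQ ψR) {a z : ℂ} (ha : a ≠ 0) (hz : z ≠ 0) :
    ∃ γ, IsPathIn (arcSet γP ∪ arcSet γR ∪ {0})ᶜ a z γ := by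
  obtain ⟨b, hb⟩ := S.exists_access ha
  obtain ⟨c, hc⟩ := S.exists_access hz
  exact exists_path_of_access S.isPreconnected_compl S.isOpen_compl hb hc

theorem intervalIntegrable (S : IsSheetStructure γP γR ψP ψQ ψR) {a z : ℂ} {γ : ℝ → ℂ}
    (hγ : IsPathIn (arcSet γP ∪ arcSet γR ∪ {0})ᶜ a z γ) (ha : a ≠ 0) (hz : z ≠ 0) :
    IntervalIntegrable (fun t => (ψQ (γ t) - ψP (γ t)) * deriv γ t) volume 0 1 := by
  have hc := hγ.contDiffOn.continuousOn
  have hne : ∀ t ∈ Icc (0 : ℝ) 1, γ t ≠ 0 := by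
    intro t ht
    rcases eq_endpoints_or_mem_Ioo_of_mem_Icc ht with h | h | h
    · rw [h, hγ.source]; exact ha
    · rw [h, hγ.target]; exact hz
    · exact fun e => hγ.mem t h (Or.inr e)
  obtain ⟨m, hm, hmle⟩ : ∃ m > 0, ∀ t ∈ Icc (0 : ℝ) 1, m ≤ ‖γ t‖ := by
    obtain ⟨t, ht, h⟩ := isCompact_Icc.exists_isMinOn (nonempty_Icc.2 zero_le_one) hc.norm
    exact ⟨‖γ t‖, norm_pos_iff.2 (hne t ht), fun s hs => h hs⟩
  obtain ⟨D, hD⟩ := isCompact_Icc.exists_bound_of_continuousOn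
    (hγ.contDiffOn.continuousOn_derivWithin (uniqueDiffOn_Icc zero_lt_one) le_rfl)
  have hroot : ∀ t ∈ Ioo (0 : ℝ) 1, ∀ w, IsPreimage w (γ t) → ‖w‖ ≤ 2 + 2 / m := by
    intro t ht w hw
    have hm2 : 0 < 2 / m := by positivity
    rcases root_norm_le (isPreimage_iff.1 hw) with h | h
    · linarith
    · have h1 : m * ‖w‖ ≤ 2 :=
        (mul_le_mul_of_nonneg_right (hmle t (Ioo_subset_Icc_self ht)) (norm_nonneg w)).trans h
      have h2 : ‖w‖ ≤ 2 / m := by rw [le_div_iff₀ hm]; linarith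
      linarith
  rw [intervalIntegrable_iff_integrableOn_Ioo_of_le zero_le_one]
  refine IntegrableOn.of_bound (by simp) ?_ ((2 + 2 / m + (2 + 2 / m)) * D) ?_
  · apply ContinuousOn.aestronglyMeasurable _ measurableSet_Ioo
    refine ContinuousOn.mul (fun t ht => ?_) ((hγ.contDiffOn.mono
      Ioo_subset_Icc_self).continuousOn_deriv_of_isOpen isOpen_Ioo le_rfl)
    have h1 := hγ.mem t ht
    have h2 : ContinuousAt (fun w => ψQ w - ψP w) (γ t) :=
      (S.continuousAt_Q h1).sub (S.continuousAt_P fun h => h1 (Or.inl (Or.inl h)))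
    exact ContinuousAt.comp_continuousWithinAt (g := fun w => ψQ w - ψP w) h2
      (hc.mono Ioo_subset_Icc_self t ht)
  · filter_upwards [ae_restrict_mem measurableSet_Ioo] with t ht
    have h1 := hγ.mem t ht
    rw [norm_mul]
    have h2 : ‖deriv γ t‖ ≤ D := by
      rw [← derivWithin_of_mem_nhds (Icc_mem_nhds ht.1 ht.2)]
      exact hD t (Ioo_subset_Icc_self ht)
    refine mul_le_mul ((norm_sub_le _ _).trans (add_le_add ?_ ?_)) h2 (norm_nonneg _) (by positivity)
    · exact hroot t ht _ (S.invQ _ h1)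
    · exact hroot t ht _ (S.invP _ fun h => h1 (Or.inl (Or.inl h)))

/-- `pot` is continuous along the whole path, even when an endpoint lies on a cut, and is
differentiable in the interior, so the fundamental theorem of calculus applies. -/
theorem integral_re (S : IsSheetStructure γP γR ψP ψQ ψR) {a z : ℂ} {γ : ℝ → ℂ}
    (hγ : IsPathIn (arcSet γP ∪ arcSet γR ∪ {0})ᶜ a z γ) (ha : a ≠ 0) (hz : z ≠ 0) :
    3 * (∫ t in (0 : ℝ)..1, (ψQ (γ t) - ψP (γ t)) * deriv γ t).re = pot z - pot a := by
  have hint := S.intervalIntegrable hγ ha hz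
  have hc := hγ.contDiffOn.continuousOn
  have hne : ∀ t ∈ Icc (0 : ℝ) 1, γ t ≠ 0 := by
    intro t ht
    rcases eq_endpoints_or_mem_Ioo_of_mem_Icc ht with h | h | h
    · rw [h, hγ.source]; exact ha
    · rw [h, hγ.target]; exact hz
    · exact fun e => hγ.mem t h (Or.inr e)
  have hcont : ContinuousOn (fun t => pot (γ t)) (Icc 0 1) := fun t ht =>
    ContinuousAt.comp_continuousWithinAt (g := pot) (pot_continuousAt (hne t ht)) (hc t ht)
  have hder : ∀ t ∈ Ioo (0 : ℝ) 1, HasDerivAt (fun t => pot (γ t))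
      (3 * ((ψQ (γ t) - ψP (γ t)) * deriv γ t).re) t := by
    intro t ht
    have h1 := hγ.mem t ht
    have h0 := hne t (Ioo_subset_Icc_self ht)
    have hP : γ t ∉ stdCut := fun h => h1 (Or.inl (Or.inl (S.arcSet_P ▸ h)))
    have hR : -γ t ∉ stdCut := fun h => h1 (Or.inl (Or.inr (S.mem_arcSet_R.2 h)))
    obtain ⟨e1, e2, -⟩ := S.eq_std h0 hP hR
    rw [e1, e2]
    refine hasDerivAt_pot h0 hP hR ?_
    exact ((hγ.contDiffOn.contDiffAt (Icc_mem_nhds ht.1 ht.2)).differentiableAt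
      one_ne_zero).hasDerivAt
  have hre : IntervalIntegrable (fun t => ((ψQ (γ t) - ψP (γ t)) * deriv γ t).re) volume 0 1 :=
    ⟨hint.1.re, hint.2.re⟩
  have h1 := intervalIntegral.integral_eq_sub_of_hasDerivAt_of_le zero_le_one hcont hder
    (hre.const_mul 3)
  have h2 := Complex.reCLM.intervalIntegral_comp_comm hint
  simp only [Complex.reCLM_apply] at h2
  rw [intervalIntegral.integral_const_mul, h2, hγ.source, hγ.target] at h1
  exact h1

theorem realIntegralExactlyOn (S : IsSheetStructure γP γR ψP ψQ ψR) :
    RealIntegralExactlyOn (arcSet γP ∪ arcSet γR ∪ {0})ᶜ (fun z => ψQ z - ψP z) z₁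
      (stdCut ∪ starSet ∪ upperRay ∪ lowerRay) := by
  have h1 := stdCut_ne_zero z₁_mem_stdCut
  refine ⟨?_, fun z hz => ⟨S.exists_path h1 hz, fun γ hγ => ⟨S.intervalIntegrable hγ h1 hz, ?_⟩⟩⟩
  · rintro (((h | h) | h) | h)
    · exact stdCut_ne_zero h rfl
    · exact starSet_ne_zero h rfl
    · exact left_ne_zero (upperRay_left h) rfl
    · exact left_ne_zero (lowerRay_left h) rfl
  · rw [isReal_iff, ← pot_eq_zero_iff hz]
    have h2 := S.integral_re hγ h1 hz
    rw [pot_z₁, sub_zero] at h2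
    rw [← h2]
    simp

end IsSheetStructure

/-! ### The half-turn -/

theorem IsPathIn.neg {Ω Ω' : Set ℂ} {a z : ℂ} {γ : ℝ → ℂ} (h : IsPathIn Ω a z γ)
    (hΩ : ∀ w ∈ Ω, -w ∈ Ω') : IsPathIn Ω' (-a) (-z) fun t => -γ t :=
  ⟨h.contDiffOn.neg, by simp only [h.source], by simp only [h.target], fun t ht => hΩ _ (h.mem t ht)⟩

theorem RealIntegralExactlyOn.rotate {Ω Ω' C C' : Set ℂ} {g g' : ℂ → ℂ} {a : ℂ}
    (h : RealIntegralExactlyOn Ω g a C) (hΩ : ∀ w, w ∈ Ω' ↔ -w ∈ Ω) (hC : ∀ w, w ∈ C' ↔ -w ∈ C)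
    (hg : ∀ z, g (-z) = -g' z) : RealIntegralExactlyOn Ω' g' (-a) C' := by
  obtain ⟨h0, h1⟩ := h
  refine ⟨fun h => h0 (by simpa using (hC 0).1 h), fun z hz => ?_⟩
  obtain ⟨⟨γ, hγ⟩, h2⟩ := h1 (-z) (neg_ne_zero.2 hz)
  refine ⟨⟨fun t => -γ t, ?_⟩, fun γ hγ => ?_⟩
  · have := hγ.neg (Ω' := Ω') fun w hw => (hΩ _).2 (by rwa [neg_neg])
    rwa [neg_neg] at this
  · have hγ' := hγ.neg (Ω' := Ω) fun w hw => (hΩ _).1 hw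
    rw [neg_neg] at hγ'
    have h3 := h2 _ hγ'
    have e : ∀ t, g (-γ t) * deriv (fun t => -γ t) t = g' (γ t) * deriv γ t := fun t => by
      rw [hg, deriv.fun_neg]; ring
    simp only [e] at h3
    rw [hC]
    exact h3

end HermitePade

end

open HermitePade in
theorem mainTheorem10 :
    -- the sheet structure exists
    (∃ (γP γR : ℝ → ℂ) (ψP ψQ ψR : ℂ → ℂ), IsSheetStructure γP γR ψP ψQ ψR) ∧
    ∃ y : ℝ, (0.621028 ≤ y ∧ y < 0.621029) ∧
    ∀ (γP γR : ℝ → ℂ) (ψP ψQ ψR : ℂ → ℂ), IsSheetStructure γP γR ψP ψQ ψR →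
    -- the curves `Γ_P^*`, `Γ_R^*`, `Γ_{E,1}`, `Γ_{E,2}`, `Γ_{E,3}`, `Γ_{E,4}`
    ∃ γPs γRs γE1 γE2 γE3 γE4 : ℝ → ℂ,
      -- (a) the four curves of `ψ_Q - ψ_P`
      (IsAnalyticArc γPs z₂ z₁ ∧ (∃ x : ℝ, 0 < x ∧ (x : ℂ) ∈ arcSet γPs) ∧
        IsAnalyticRay γE1 z₁ ∧ (∀ z ∈ raySet γE1, z.re < 0) ∧
        IsAnalyticRay γE2 z₂ ∧ (∀ z ∈ raySet γE2, z.re < 0) ∧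
        arcSet γP ∩ arcSet γPs = {z₁, z₂} ∧
        (arcSet γP ∪ arcSet γPs) ∩ raySet γE1 = {z₁} ∧
        (arcSet γP ∪ arcSet γPs) ∩ raySet γE2 = {z₂} ∧
        Disjoint (raySet γE1) (raySet γE2) ∧
        RealIntegralExactlyOn (arcSet γP ∪ arcSet γR ∪ {0})ᶜ (fun z => ψQ z - ψP z) z₁
          (arcSet γP ∪ arcSet γPs ∪ raySet γE1 ∪ raySet γE2)) ∧
      -- (b) the four curves of `ψ_Q - ψ_R`
      (IsAnalyticArc γRs z₄ z₃ ∧ (∃ x : ℝ, x < 0 ∧ (x : ℂ) ∈ arcSet γRs) ∧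
        IsAnalyticRay γE3 z₃ ∧ (∀ z ∈ raySet γE3, 0 < z.re) ∧
        IsAnalyticRay γE4 z₄ ∧ (∀ z ∈ raySet γE4, 0 < z.re) ∧
        arcSet γR ∩ arcSet γRs = {z₃, z₄} ∧
        (arcSet γR ∪ arcSet γRs) ∩ raySet γE3 = {z₃} ∧
        (arcSet γR ∪ arcSet γRs) ∩ raySet γE4 = {z₄} ∧
        Disjoint (raySet γE3) (raySet γE4) ∧
        RealIntegralExactlyOn (arcSet γP ∪ arcSet γR ∪ {0})ᶜ (fun z => ψQ z - ψR z) z₃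
          (arcSet γR ∪ arcSet γRs ∪ raySet γE3 ∪ raySet γE4)) ∧
      -- (c)
      Disjoint (arcSet γPs) (arcSet γR) ∧
      -- (d)
      Disjoint (arcSet γRs) (arcSet γP) ∧
      -- (e)
      arcSet γPs ∩ arcSet γRs = {Complex.I * y, -(Complex.I * y)} := by
  refine ⟨exists_sheetStructure, ?_⟩
  obtain ⟨y, hy, hyY, hy0⟩ := exists_axis_zero
  refine ⟨y, hy, fun γP γR ψP ψQ ψR S => ?_⟩
  obtain ⟨γs, hγs, hs⟩ := exists_starArc
  obtain ⟨γ₁, γ₂, hγ₁, h₁, hγ₂, h₂⟩ := exists_rays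
  have hP := S.arcSet_P
  have hR : ∀ z, z ∈ arcSet γR ↔ -z ∈ stdCut := fun z => S.mem_arcSet_R
  have hs' : ∀ z, z ∈ arcSet (fun t => -γs t) ↔ -z ∈ starSet := fun z => by rw [mem_arcSet_neg, hs]
  have h₁' : ∀ z, z ∈ raySet (fun t => -γ₂ t) ↔ -z ∈ lowerRay := fun z => by rw [mem_raySet_neg, h₂]
  have h₂' : ∀ z, z ∈ raySet (fun t => -γ₁ t) ↔ -z ∈ upperRay := fun z => by rw [mem_raySet_neg, h₁]
  have hneg : ∀ z w : ℂ, -z = w ↔ z = -w := fun z w => neg_eq_iff_eq_neg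
  have hI := S.realIntegralExactlyOn
  have hI' := S.rotate.realIntegralExactlyOn
  obtain ⟨x, hx, hxs⟩ := exists_real_mem_starSet
  -- The curves of (b) are the negatives of those of (a). As `z₃ = -z₁`, the third ray is minus the
  -- upper one.
  refine ⟨γs, fun t => -γs t, γ₁, γ₂, fun t => -γ₁ t, fun t => -γ₂ t,
    ⟨hγs, ⟨x, hx, hs ▸ hxs⟩, hγ₁, fun z hz => upperRay_left (h₁ ▸ hz), hγ₂,
      fun z hz => lowerRay_left (h₂ ▸ hz), ?_, ?_, ?_, ?_, ?_⟩,
    ⟨?_, ⟨-x, by linarith, ?_⟩, ?_, fun z hz => ?_, ?_, fun z hz => ?_, ?_, ?_, ?_, ?_, ?_⟩,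
    ?_, ?_, ?_⟩
  · rw [hP, hs]; exact stdCut_inter_starSet
  · rw [hP, hs, h₁]; exact inter_upperRay
  · rw [hP, hs, h₂]; exact inter_lowerRay
  · rw [h₁, h₂]; exact disjoint_rays
  · rw [hs, h₁, h₂]
    nth_rw 2 [hP]
    exact hI
  · rw [z₃_eq, z₄_eq]; exact hγs.neg
  · rw [hs']; simpa using hxs
  · rw [z₃_eq]; exact hγ₁.neg
  · simpa using upperRay_left ((h₂' z).1 hz)
  · rw [z₄_eq]; exact hγ₂.neg
  · simpa using lowerRay_left ((h₁' z).1 hz)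
  · ext z
    have := Set.ext_iff.1 stdCut_inter_starSet (-z)
    simp only [mem_inter_iff, mem_insert_iff, mem_singleton_iff, hneg] at this ⊢
    rw [hR, hs', z₃_eq, z₄_eq]
    exact this
  · ext z
    have := Set.ext_iff.1 inter_upperRay (-z)
    simp only [mem_inter_iff, mem_union, mem_singleton_iff, hneg] at this ⊢
    rw [hR, hs', h₂', z₃_eq]
    exact this
  · ext z
    have := Set.ext_iff.1 inter_lowerRay (-z)
    simp only [mem_inter_iff, mem_union, mem_singleton_iff, hneg] at this ⊢
    rw [hR, hs', h₁', z₄_eq]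
    exact this
  · rw [disjoint_left]
    exact fun z a b => disjoint_left.1 disjoint_rays ((h₂' z).1 a) ((h₁' z).1 b)
  · rw [z₃_eq]
    -- The result of (a) for the rotated sheet structure is carried back by the half-turn.
    refine hI'.rotate (fun w => ?_) (fun w => ?_) fun z => ?_
    · simp only [mem_compl_iff, mem_union, mem_singleton_iff, mem_arcSet_neg, neg_neg, neg_eq_zero]
      tauto
    · simp only [mem_union, hR, hs', h₁', h₂']
    · simp only [neg_neg]
      ring
  · rw [hs, disjoint_left]
    exact fun z a b => starSet_not_mem_R a ((hR z).1 b)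
  · rw [hP, disjoint_left]
    exact fun z a b => starSet_not_mem_R ((hs' z).1 a) (by rwa [neg_neg])
  · ext z
    rw [mem_inter_iff, hs, hs', mem_insert_iff, mem_singleton_iff]
    exact starSet_inter_neg hyY (by linarith [hy.1]) hy0 z
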